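/- **Setting.** All 2-categories, 2-functors, double and triple categories are strict unless said otherwise; composites of functions and functors are written right to left. Let $\mathbf{C}=\mathrm{Gph}\mathbf{Cat}$ be the 2-category of graphs of small categories $A=(\partial^-,\partial^+\colon A_1\rightrightarrows A_0)$, with pairs of functors consistent with the faces as morphisms, and pairs of natural transformations $\varphi_i\colon F_i\to G_i$ ($i=0,1$) with $\partial^\alpha\varphi_1=\varphi_0\partial^\alpha$ as 2-cells. (Think of $A_0$ as objects and horizontal arrows, and of $A_1$ as vertical arrows and cells.) Let $(T,h,m)$ be the 2-monad on $\mathbf{C}$ of the free double category: $(TA)_0=A_0$; the objects (resp. morphisms) of $(TA)_1$ are the finite paths of vertical arrows (resp. of cells), including the empty path on each object (resp. morphism) of $A_0$, with termwise composition and with the faces given by the two ends of a path; $h$ embeds $A$ as the paths of length one and $m$ concatenates paths of paths. **Pseudo algebras.** A *normal pseudo $T$-algebra* $(A,c,\kappa)$ is an object $A$ of $\mathbf{C}$ with a morphism $c\colon TA\to A$ such that $c\cdot hA=1$, and an invertible 2-cell $\kappa\colon c\cdot Tc\to c\cdot mA$ such that $\kappa\cdot ThA=1$, $\kappa\cdot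 hTA=1$ and $(\kappa\cdot mTA)(\kappa\cdot T^2c)=(\kappa\cdot TmA)(c\cdot T\kappa)$. A *lax morphism* $(f,\varphi)\colon (A,a,\kappa)\to(B,b,\lambda)$ is a morphism $f\colon A\to B$ of $\mathbf{C}$ with a 2-cell $\varphi\colon b\cdot Tf\to f\cdot a$ such that $\varphi\cdot hA=1$ and $(\varphi\cdot mA)(\lambda\cdot T^2f)=(f\cdot\kappa)(\varphi\cdot Ta)(b\cdot T\varphi)$. A *colax morphism* $(r,\rho)$ has $\rho\colon r\cdot a\to b\cdot Tr$, with the dual conditions $\rho\cdot hA=1$ and $(\rho\cdot mA)(r\cdot\kappa)=(\lambda\cdot T^2r)(b\cdot T\rho)(\rho\cdot Ta)$. A *pseudo morphism* is a lax morphism with $\varphi$ invertible. The triple category $\mathrm{Ps}(\mathrm{NPsa}_2(T))$ has the normal pseudo $T$-algebras as objects, and the pseudo, lax and colax morphisms as arrows in the directions $0$ (transversal), $1$ and $2$. For $0\le i<j\le 2$ an $ij$-cell is a square with two $i$-arrows $f\colon A\to B$ (top) and $g\colon A'\to B'$ (bottom), two $j$-arrows $r\colon A\to A'$ (left) and $s\colon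 B\to B'$ (right), and a 2-cell $\pi\colon sf\to gr$ of $\mathbf{C}$ satisfying the following coherence condition, where $a,a',b,b'$ are the structures of $A,A',B,B'$, the comparisons of $f,g,r,s$ are $\varphi,\gamma,\rho,\sigma$, and pseudo morphisms are viewed as lax morphisms: - for $ij=12$ and $ij=02$ ($r,s$ colax): $(g\cdot\rho)(\pi\cdot a)(s\cdot\varphi)=(\gamma\cdot Tr)(b'\cdot T\pi)(\sigma\cdot Tf)\colon s\cdot b\cdot Tf\to g\cdot a'\cdot Tr$; - for $ij=01$ ($r,s$ lax): $(\pi\cdot a)(s\cdot\varphi)(\sigma\cdot Tf)=(g\cdot\rho)(\gamma\cdot Tr)(b'\cdot T\pi)\colon b'\cdot Ts\cdot Tf\to g\cdot r\cdot a$. Three-dimensional cells are the commutative cubes of such cells, determined by their six faces. Compositions are given by pasting. **Weak double categories.** A *weak double category* $\mathbb{D}$ on a graph of categories $A$ has a functor $x\mapsto e_x\colon A_0\to A_1$ that is a section of both faces, a functorial composition $u\otimes v$ of consecutive vertical arrows and of consecutive cells, with $\partial^-(u\otimes v)=\partial^-u$ and $\partial^+(u\otimes v)=\partial^+v$, and invertible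 natural comparisons $e_x\otimes u\to u$, $u\otimes e_y\to u$ and $u\otimes(v\otimes w)\to(u\otimes v)\otimes w$ that are special (their images by $\partial^\pm$ are identities) and satisfy the triangle and pentagon conditions. A *lax double functor* $F$ is a morphism of graphs with special natural comparisons $e_{F(x)}\to F(e_x)$ and $F(u)\otimes F(v)\to F(u\otimes v)$ coherent with unitors and associators; a *colax double functor* is defined dually; a *pseudo double functor* is a lax double functor with invertible comparisons. The triple category $\mathrm{PsDbl}$ has the weak double categories as objects, and pseudo, lax and colax double functors as arrows in the directions $0,1,2$. Its $ij$-cells are squares inhabited by a 2-cell $\pi\colon sf\to gr$ of $\mathbf{C}$, as above, satisfying the analogous coherence conditions with the comparisons for $e_x$ and for $u\otimes v$; its three-dimensional cells are the commutative cubes. **Theorem 5.8 (Weak double categories as normal pseudo algebras).** There is an adjoint equivalence of triple categories: there are triple functors $$V\colon \mathrm{Ps}(\mathrm{NPsa}_2(T))\to\mathrm{PsDbl},\qquad J\colon\mathrm{PsDbl}\to\mathrm{Ps}(\mathrm{NPsa}_2(T)),\qquad VJ=1,$$ and a transversal transformation $\varepsilon\colon JV\to 1$, all of whose components (on objects, $1$-arrows,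 $2$-arrows and $12$-cells) are invertible in the transversal direction, such that $$V\varepsilon=1,\qquad \varepsilon J=1.$$ Both $V$ and $J$ commute with the forgetful triple functors to the triple category of objects, morphisms (in the three directions), quintets (squares inhabited by an arbitrary 2-cell) and commutative cubes of $\mathbf{C}$. Moreover: 1. $V$ extracts the biased structure: $V(A,c,\kappa)$ is the weak double category on $A$ with $e_x=c(\text{empty path at }x)$, $u\otimes v=c(u,v)$ (on vertical arrows and on cells), with the unitors $\kappa((\,),(u))\colon e_x\otimes u\to u$ and $\kappa((u),(\,))\colon u\otimes e_y\to u$, and with the associator $\kappa((u,v),(w))^{-1}\,\kappa((u),(v,w))\colon u\otimes(v\otimes w)\to(u\otimes v)\otimes w$. The comparisons of the image under $V$ of a lax, colax or pseudo morphism are those of the morphism on the paths of length $0$ and $2$. 2. $J$ chooses a left bracketing: $J(\mathbb{D})=(A,c,\kappa)$ has the same graph $A$ as $\mathbb{D}$, $c$ of the empty path at $x$ is $e_x$, and $$c(x_1,\dots,x_n)=(\dots((x_1\otimes x_2)\otimes x_3)\dots\otimes x_n)$$ for vertical arrows and for cells; moreover $\kappa((u_1,\dots,u_n),(v))$ is an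 identity for every consecutive $u_1,\dots,u_n,v$ with $n\ge 1$. -/

import Mathlib

open CategoryTheory

universe u v w

namespace TripleCat

/-- A category structure with set of objects `O` and set of arrows `M`: domain, codomain,
identities, and a composition (in diagrammatic order) of consecutive arrows. -/
structure CatStr (O M : Type*) where
  dom : M → O
  cod : M → O
  ide : O → M
  comp : ∀ f g : M, cod f = dom g → M
  dom_ide : ∀ x, dom (ide x) = x
  cod_ide : ∀ x, cod (ide x) = x
  dom_comp : ∀ f g h, dom (comp f g h) = dom f
  cod_comp : ∀ f g h, cod (comp f g h) = cod g
  ide_comp : ∀ f, comp (ide (dom f)) f (cod_ide _) = f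
  comp_ide : ∀ f, comp f (ide (cod f)) (dom_ide _).symm = f
  assoc : ∀ f g k (h : cod f = dom g) (h' : cod g = dom k),
    comp (comp f g h) k ((cod_comp f g h).trans h') =
      comp f (comp g k h') (h.trans (dom_comp g k h').symm)

/-- `f` is invertible for the composition `c`. -/
def CatStr.IsIso {O M : Type*} (c : CatStr O M) (f : M) : Prop :=
  ∃ (g : M) (h : c.cod f = c.dom g) (h' : c.cod g = c.dom f),
    c.comp f g h = c.ide (c.dom f) ∧ c.comp g f h' = c.ide (c.cod f)

/-- The maps `F₀` (on objects) and `F₁` (on arrows) form a functor. -/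
structure IsFun {O M O' M' : Type*} (c : CatStr O M) (c' : CatStr O' M')
    (F₀ : O → O') (F₁ : M → M') : Prop where
  dom : ∀ f, c'.dom (F₁ f) = F₀ (c.dom f)
  cod : ∀ f, c'.cod (F₁ f) = F₀ (c.cod f)
  ide : ∀ x, F₁ (c.ide x) = c'.ide (F₀ x)
  comp : ∀ f g h, F₁ (c.comp f g h) =
    c'.comp (F₁ f) (F₁ g) ((cod f).trans ((congrArg F₀ h).trans (dom g).symm))

lemma IsFun.id {O M : Type*} (c : CatStr O M) : IsFun c c id id :=
  ⟨fun _ => rfl, fun _ => rfl, fun _ => rfl, fun _ _ _ => rfl⟩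

lemma IsFun.trans {O M O' M' O'' M'' : Type*} {c : CatStr O M} {c' : CatStr O' M'}
    {c'' : CatStr O'' M''} {F₀ : O → O'} {F₁ : M → M'} {G₀ : O' → O''} {G₁ : M' → M''}
    (hF : IsFun c c' F₀ F₁) (hG : IsFun c' c'' G₀ G₁) :
    IsFun c c'' (G₀ ∘ F₀) (G₁ ∘ F₁) where
  dom f := (hG.dom _).trans (congrArg G₀ (hF.dom f))
  cod f := (hG.cod _).trans (congrArg G₀ (hF.cod f))
  ide x := (congrArg G₁ (hF.ide x)).trans (hG.ide _)
  comp f g h := (congrArg G₁ (hF.comp f g h)).trans (hG.comp _ _ _)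

/-- Four category structures form a (strict) double category: `O` are the objects, `H` and `V`
the arrows in the two directions, `S` the double cells.  `ch` and `cv` compose the arrows, `sh`
and `sv` compose the double cells in the direction of `H` and of `V`, respectively. -/
structure IsDouble {O H V S : Type*} (ch : CatStr O H) (cv : CatStr O V)
    (sh : CatStr V S) (sv : CatStr H S) : Prop where
  dom_h : IsFun sv cv ch.dom sh.dom
  cod_h : IsFun sv cv ch.cod sh.cod
  ide_h : IsFun cv sv ch.ide sh.ide
  dom_v : IsFun sh ch cv.dom sv.dom
  cod_v : IsFun sh ch cv.cod sv.cod
  ide_v : IsFun ch sh cv.ide sv.ide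
  interchange : ∀ (x y z t : S) (hxy : sh.cod x = sh.dom y) (hzt : sh.cod z = sh.dom t)
    (vxz : sv.cod x = sv.dom z) (vyt : sv.cod y = sv.dom t)
    (p : sv.cod (sh.comp x y hxy) = sv.dom (sh.comp z t hzt))
    (q : sh.cod (sv.comp x z vxz) = sh.dom (sv.comp y t vyt)),
    sv.comp (sh.comp x y hxy) (sh.comp z t hzt) p =
      sh.comp (sv.comp x z vxz) (sv.comp y t vyt) q

end TripleCat

/-- A (strict) triple category, with directions `0` (transversal), `1`, `2`: objects, arrows in
each direction, double cells in each pair of directions and three-dimensional cells.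
For instance `c01_0` is the composition of `01`-cells in direction `0`; its `dom` and `cod` are
the `0`-directed faces of the `01`-cells. -/
structure TripleCategory where
  Ob : Type u
  A0 : Type u
  A1 : Type u
  A2 : Type u
  S01 : Type u
  S02 : Type u
  S12 : Type u
  Cube : Type u
  c0 : TripleCat.CatStr Ob A0
  c1 : TripleCat.CatStr Ob A1
  c2 : TripleCat.CatStr Ob A2
  c01_0 : TripleCat.CatStr A1 S01
  c01_1 : TripleCat.CatStr A0 S01
  c02_0 : TripleCat.CatStr A2 S02
  c02_2 : TripleCat.CatStr A0 S02
  c12_1 : TripleCat.CatStr A2 S12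
  c12_2 : TripleCat.CatStr A1 S12
  q0 : TripleCat.CatStr S12 Cube
  q1 : TripleCat.CatStr S02 Cube
  q2 : TripleCat.CatStr S01 Cube
  dbl01 : TripleCat.IsDouble c0 c1 c01_0 c01_1
  dbl02 : TripleCat.IsDouble c0 c2 c02_0 c02_2
  dbl12 : TripleCat.IsDouble c1 c2 c12_1 c12_2
  dbl01_2 : TripleCat.IsDouble c02_0 c12_1 q0 q1
  dbl02_1 : TripleCat.IsDouble c01_0 c12_2 q0 q2
  dbl12_0 : TripleCat.IsDouble c01_1 c02_2 q1 q2

/-- A (strict) triple functor. -/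
@[ext]
structure TripleFunctor (X Y : TripleCategory.{u}) where
  ob : X.Ob → Y.Ob
  a0 : X.A0 → Y.A0
  a1 : X.A1 → Y.A1
  a2 : X.A2 → Y.A2
  s01 : X.S01 → Y.S01
  s02 : X.S02 → Y.S02
  s12 : X.S12 → Y.S12
  cube : X.Cube → Y.Cube
  f0 : TripleCat.IsFun X.c0 Y.c0 ob a0
  f1 : TripleCat.IsFun X.c1 Y.c1 ob a1
  f2 : TripleCat.IsFun X.c2 Y.c2 ob a2
  f01_0 : TripleCat.IsFun X.c01_0 Y.c01_0 a1 s01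
  f01_1 : TripleCat.IsFun X.c01_1 Y.c01_1 a0 s01
  f02_0 : TripleCat.IsFun X.c02_0 Y.c02_0 a2 s02
  f02_2 : TripleCat.IsFun X.c02_2 Y.c02_2 a0 s02
  f12_1 : TripleCat.IsFun X.c12_1 Y.c12_1 a2 s12
  f12_2 : TripleCat.IsFun X.c12_2 Y.c12_2 a1 s12
  fq0 : TripleCat.IsFun X.q0 Y.q0 s12 cube
  fq1 : TripleCat.IsFun X.q1 Y.q1 s02 cube
  fq2 : TripleCat.IsFun X.q2 Y.q2 s01 cube

namespace TripleFunctor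

/-- The identity triple functor. -/
def id (X : TripleCategory.{v}) : TripleFunctor X X where
  ob := _root_.id
  a0 := _root_.id
  a1 := _root_.id
  a2 := _root_.id
  s01 := _root_.id
  s02 := _root_.id
  s12 := _root_.id
  cube := _root_.id
  f0 := .id _
  f1 := .id _
  f2 := .id _
  f01_0 := .id _
  f01_1 := .id _
  f02_0 := .id _
  f02_2 := .id _
  f12_1 := .id _
  f12_2 := .id _
  fq0 := .id _
  fq1 := .id _
  fq2 := .id _

/-- The composite of triple functors, in diagrammatic order. -/
def comp {X Y Z : TripleCategory.{v}} (F : TripleFunctor X Y) (G : TripleFunctor Y Z) :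
    TripleFunctor X Z where
  ob := G.ob ∘ F.ob
  a0 := G.a0 ∘ F.a0
  a1 := G.a1 ∘ F.a1
  a2 := G.a2 ∘ F.a2
  s01 := G.s01 ∘ F.s01
  s02 := G.s02 ∘ F.s02
  s12 := G.s12 ∘ F.s12
  cube := G.cube ∘ F.cube
  f0 := F.f0.trans G.f0
  f1 := F.f1.trans G.f1
  f2 := F.f2.trans G.f2
  f01_0 := F.f01_0.trans G.f01_0
  f01_1 := F.f01_1.trans G.f01_1
  f02_0 := F.f02_0.trans G.f02_0
  f02_2 := F.f02_2.trans G.f02_2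
  f12_1 := F.f12_1.trans G.f12_1
  f12_2 := F.f12_2.trans G.f12_2
  fq0 := F.fq0.trans G.fq0
  fq1 := F.fq1.trans G.fq1
  fq2 := F.fq2.trans G.fq2

end TripleFunctor

/-- A transversal transformation `F → G` of triple functors: every cell of `X` that has no
transversal direction gets a component, a cell of `Y` with one more, transversal, direction,
whose transversal faces are the values of `F` and `G`.  The components are consistent with the
faces, identities and compositions in directions `1` and `2`, and natural with respect to the
transversal direction. -/
structure TransversalTransformation {X Y : TripleCategory.{u}} (F G : TripleFunctor X Y) where
  ob : X.Ob → Y.A0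
  a1 : X.A1 → Y.S01
  a2 : X.A2 → Y.S02
  s12 : X.S12 → Y.Cube
  dom_ob : ∀ x, Y.c0.dom (ob x) = F.ob x
  cod_ob : ∀ x, Y.c0.cod (ob x) = G.ob x
  dom_a1 : ∀ x, Y.c01_0.dom (a1 x) = F.a1 x
  cod_a1 : ∀ x, Y.c01_0.cod (a1 x) = G.a1 x
  dom_a2 : ∀ x, Y.c02_0.dom (a2 x) = F.a2 x
  cod_a2 : ∀ x, Y.c02_0.cod (a2 x) = G.a2 x
  dom_s12 : ∀ x, Y.q0.dom (s12 x) = F.s12 x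
  cod_s12 : ∀ x, Y.q0.cod (s12 x) = G.s12 x
  f1 : TripleCat.IsFun X.c1 Y.c01_1 ob a1
  f2 : TripleCat.IsFun X.c2 Y.c02_2 ob a2
  f12_1 : TripleCat.IsFun X.c12_1 Y.q1 a2 s12
  f12_2 : TripleCat.IsFun X.c12_2 Y.q2 a1 s12
  nat_a0 : ∀ f : X.A0,
    Y.c0.comp (ob (X.c0.dom f)) (G.a0 f) ((cod_ob _).trans (G.f0.dom f).symm) =
      Y.c0.comp (F.a0 f) (ob (X.c0.cod f)) ((F.f0.cod f).trans (dom_ob _).symm)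
  nat_s01 : ∀ f : X.S01,
    Y.c01_0.comp (a1 (X.c01_0.dom f)) (G.s01 f) ((cod_a1 _).trans (G.f01_0.dom f).symm) =
      Y.c01_0.comp (F.s01 f) (a1 (X.c01_0.cod f)) ((F.f01_0.cod f).trans (dom_a1 _).symm)
  nat_s02 : ∀ f : X.S02,
    Y.c02_0.comp (a2 (X.c02_0.dom f)) (G.s02 f) ((cod_a2 _).trans (G.f02_0.dom f).symm) =
      Y.c02_0.comp (F.s02 f) (a2 (X.c02_0.cod f)) ((F.f02_0.cod f).trans (dom_a2 _).symm)
  nat_cube : ∀ f : X.Cube,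
    Y.q0.comp (s12 (X.q0.dom f)) (G.cube f) ((cod_s12 _).trans (G.fq0.dom f).symm) =
      Y.q0.comp (F.cube f) (s12 (X.q0.cod f)) ((F.fq0.cod f).trans (dom_s12 _).symm)

/-- All the components are invertible in the transversal direction. -/
structure TransversalTransformation.IsInvertible {X Y : TripleCategory.{u}}
    {F G : TripleFunctor X Y} (t : TransversalTransformation F G) : Prop where
  ob : ∀ x, Y.c0.IsIso (t.ob x)
  a1 : ∀ x, Y.c01_0.IsIso (t.a1 x)
  a2 : ∀ x, Y.c02_0.IsIso (t.a2 x)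
  s12 : ∀ x, Y.q0.IsIso (t.s12 x)

namespace TripleCat

section Arrows
variable {K : Type*} [Category K]

/-- Composition of consecutive arrows of a category, for arrows whose ends agree propositionally. -/
def vcomp (a b : Arrow K) (h : a.right = b.left) : Arrow K :=
  Arrow.mk (a.hom ≫ eqToHom h ≫ b.hom)

@[simp] lemma vcomp_left (a b : Arrow K) (h) : (vcomp a b h).left = a.left := rfl
@[simp] lemma vcomp_right (a b : Arrow K) (h) : (vcomp a b h).right = b.right := rfl

lemma vcomp_mk {X Y Z : K} (f : X ⟶ Y) (g : Y ⟶ Z) :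
    vcomp (Arrow.mk f) (Arrow.mk g) rfl = Arrow.mk (f ≫ g) := by simp [vcomp]

lemma id_vcomp {X : K} (b : Arrow K) (h : X = b.left) :
    vcomp (Arrow.mk (𝟙 X)) b h = b := by subst h; cases b; simp [vcomp]; rfl

lemma vcomp_id {X : K} (a : Arrow K) (h : a.right = X) :
    vcomp a (Arrow.mk (𝟙 X)) h = a := by subst h; cases a; simp [vcomp]; rfl

lemma vcomp_assoc (a b c : Arrow K) (h : a.right = b.left)
    (h' : (vcomp a b h).right = c.left) :
    vcomp (vcomp a b h) c h' = vcomp a (vcomp b c h') h := by simp [vcomp]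

/-- An arrow with prescribed ends. -/
def homOf (a : Arrow K) {X Y : K} (hl : a.left = X) (hr : a.right = Y) : X ⟶ Y :=
  eqToHom hl.symm ≫ a.hom ≫ eqToHom hr

@[simp] lemma mk_homOf (a : Arrow K) {X Y : K} (hl : a.left = X) (hr : a.right = Y) :
    Arrow.mk (homOf a hl hr) = a := by subst hl hr; cases a; simp [homOf]; rfl

lemma homOf_mk {X Y : K} (f : X ⟶ Y) : homOf (Arrow.mk f) rfl rfl = f := by simp [homOf]

/-- Auxiliary: composition of arrows with an absorbing value for non-consecutive arrows. -/
noncomputable def pcomp (a b : Option (Arrow K)) : Option (Arrow K) :=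
  open Classical in
  match a, b with
  | some a, some b => if h : a.right = b.left then some (vcomp a b h) else none
  | _, _ => none

lemma pcomp_assoc (a b c : Option (Arrow K)) : pcomp (pcomp a b) c = pcomp a (pcomp b c) := by
  rcases a with _ | a <;> rcases b with _ | b <;> rcases c with _ | c <;> simp [pcomp]
  by_cases h : a.right = b.left <;> by_cases h' : b.right = c.left <;>
    simp [h, h', vcomp_assoc]

lemma some_vcomp (a b : Arrow K) (h) : some (vcomp a b h) = pcomp (some a) (some b) := by
  simp [pcomp, h]

lemma pcomp_idc (a : Arrow K) {X : K} (h : a.right = X) :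
    pcomp (some a) (some (Arrow.mk (𝟙 X))) = some a := by
  rw [← some_vcomp _ _ h, vcomp_id]

lemma idc_pcomp (a : Arrow K) {X : K} (h : X = a.left) :
    pcomp (some (Arrow.mk (𝟙 X))) (some a) = some a := by
  rw [← some_vcomp _ _ h, id_vcomp]

lemma mk_eqToHom {X Y : K} (h : X = Y) :
    Arrow.mk (eqToHom h) = Arrow.mk (𝟙 X) := by subst h; rfl

lemma pcomp_reassoc2 {a b c d : Option (Arrow K)} (E : pcomp a b = pcomp c d) (z) :
    pcomp a (pcomp b z) = pcomp c (pcomp d z) := by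
  rw [← pcomp_assoc, E, pcomp_assoc]

lemma pcomp_reassoc3 {a b c d e f : Option (Arrow K)}
    (E : pcomp a (pcomp b c) = pcomp d (pcomp e f)) (z) :
    pcomp a (pcomp b (pcomp c z)) = pcomp d (pcomp e (pcomp f z)) := by
  rw [← pcomp_assoc b, ← pcomp_assoc a, E, pcomp_assoc, pcomp_assoc]

end Arrows

section Bicat
open Bicategory
variable {C : Type*} [Bicategory C] {W X Y Z : C}

/-- Left whiskering of a 2-cell. -/
def whL (f : X ⟶ Y) (a : Arrow (Y ⟶ Z)) : Arrow (X ⟶ Z) := Arrow.mk (f ◁ a.hom)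

/-- Right whiskering of a 2-cell. -/
def whR (a : Arrow (X ⟶ Y)) (g : Y ⟶ Z) : Arrow (X ⟶ Z) := Arrow.mk (a.hom ▷ g)

@[simp] lemma whL_left (f : X ⟶ Y) (a : Arrow (Y ⟶ Z)) : (whL f a).left = f ≫ a.left := rfl
@[simp] lemma whL_right (f : X ⟶ Y) (a : Arrow (Y ⟶ Z)) : (whL f a).right = f ≫ a.right := rfl
@[simp] lemma whR_left (a : Arrow (X ⟶ Y)) (g : Y ⟶ Z) : (whR a g).left = a.left ≫ g := rfl
@[simp] lemma whR_right (a : Arrow (X ⟶ Y)) (g : Y ⟶ Z) : (whR a g).right = a.right ≫ g := rfl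

lemma whL_vcomp (f : X ⟶ Y) (a b : Arrow (Y ⟶ Z)) (h) :
    whL f (vcomp a b h) = vcomp (whL f a) (whL f b) (by simp [h]) := by
  simp [whL, vcomp]

lemma whR_vcomp (a b : Arrow (X ⟶ Y)) (g : Y ⟶ Z) (h) :
    whR (vcomp a b h) g = vcomp (whR a g) (whR b g) (by simp [h]) := by
  simp [whR, vcomp]

lemma whL_idc (f : X ⟶ Y) (g : Y ⟶ Z) : whL f (Arrow.mk (𝟙 g)) = Arrow.mk (𝟙 (f ≫ g)) := by
  simp [whL]

lemma whR_idc (f : X ⟶ Y) (g : Y ⟶ Z) : whR (Arrow.mk (𝟙 f)) g = Arrow.mk (𝟙 (f ≫ g)) := by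
  simp [whR]

lemma exchange (a : Arrow (X ⟶ Y)) (b : Arrow (Y ⟶ Z)) :
    vcomp (whL a.left b) (whR a b.right) rfl = vcomp (whR a b.left) (whL a.right b) rfl := by
  simp [whL, whR, vcomp, whisker_exchange]

lemma exchange' (a : Arrow (X ⟶ Y)) (b : Arrow (Y ⟶ Z)) {f f' : X ⟶ Y} {g g' : Y ⟶ Z}
    (hf : a.left = f) (hf' : a.right = f') (hg : b.left = g) (hg' : b.right = g') :
    pcomp (some (whL f b)) (some (whR a g')) = pcomp (some (whR a g)) (some (whL f' b)) := by
  subst hf hf' hg hg'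
  rw [← some_vcomp _ _ rfl, ← some_vcomp _ _ rfl, exchange]

variable [Strict C]

lemma whL_comp (f : W ⟶ X) (g : X ⟶ Y) (a : Arrow (Y ⟶ Z)) :
    whL (f ≫ g) a = whL f (whL g a) := by
  simp [whL, Strict.associator_eqToIso]

lemma whR_comp (a : Arrow (W ⟶ X)) (f : X ⟶ Y) (g : Y ⟶ Z) :
    whR a (f ≫ g) = whR (whR a f) g := by
  simp [whR, Strict.associator_eqToIso]

lemma whR_whL (f : W ⟶ X) (a : Arrow (X ⟶ Y)) (g : Y ⟶ Z) :
    whR (whL f a) g = whL f (whR a g) := by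
  simp [whR, whL, Strict.associator_eqToIso]

lemma whL_id (a : Arrow (X ⟶ Y)) : whL (𝟙 X) a = a := by
  simp [whL, Strict.leftUnitor_eqToIso]

lemma whR_id (a : Arrow (X ⟶ Y)) : whR a (𝟙 Y) = a := by
  simp [whR, Strict.rightUnitor_eqToIso]

end Bicat
end TripleCat

namespace TripleCat
open Bicategory

/-- A category with objects `Ob`, together with a functor `toC` to (the underlying category of)
the 2-category `C` that is given on objects by `und`. -/
structure ArrowKind {C : Type u} [Bicategory.{w, v} C] {Ob : Type u} (und : Ob → C) where
  Hom : Ob → Ob → Type v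
  id : ∀ X, Hom X X
  comp : ∀ {X Y Z}, Hom X Y → Hom Y Z → Hom X Z
  id_comp : ∀ {X Y} (f : Hom X Y), comp (id X) f = f
  comp_id : ∀ {X Y} (f : Hom X Y), comp f (id Y) = f
  assoc : ∀ {X Y Z W} (f : Hom X Y) (g : Hom Y Z) (h : Hom Z W),
    comp (comp f g) h = comp f (comp g h)
  toC : ∀ {X Y}, Hom X Y → (und X ⟶ und Y)
  toC_id : ∀ X, toC (id X) = 𝟙 (und X)
  toC_comp : ∀ {X Y Z} (f : Hom X Y) (g : Hom Y Z), toC (comp f g) = toC f ≫ toC g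

/-- An arrow, with its ends. -/
structure KArr {C : Type u} [Bicategory.{w, v} C] {Ob : Type u} {und : Ob → C}
    (K : ArrowKind und) where
  {src : Ob}
  {tgt : Ob}
  hom : K.Hom src tgt

section
variable {C : Type u} [Bicategory.{w, v} C] {Ob : Type u} {und : Ob → C}

/-- The category structure of a kind of arrows. -/
abbrev KArr.cat (K : ArrowKind und) : CatStr Ob (KArr K) where
  dom f := f.src
  cod f := f.tgt
  ide x := ⟨K.id x⟩
  comp f g h := ⟨K.comp f.hom (cast (by rw [h]) g.hom)⟩
  dom_ide _ := rfl
  cod_ide _ := rfl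
  dom_comp _ _ _ := rfl
  cod_comp _ _ _ := rfl
  ide_comp := by rintro ⟨f⟩; simp [K.id_comp]
  comp_ide := by rintro ⟨f⟩; simp [K.comp_id]
  assoc := by
    rintro ⟨f⟩ ⟨g⟩ ⟨k⟩ h h'
    dsimp only at h h'
    subst h h'
    simp [K.assoc]

variable [Strict C]

/-- The 2-cell obtained by pasting two quintets side by side. -/
def pasteH {A B E A' D F : C} {r : A ⟶ B} {r' : B ⟶ E} {s : A' ⟶ D} {s' : D ⟶ F}
    {u : A ⟶ A'} {v : B ⟶ D} {w : E ⟶ F} (π : r ≫ v ⟶ u ≫ s) (θ : r' ≫ w ⟶ v ≫ s') :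
    Arrow (A ⟶ F) :=
  vcomp (whL r (Arrow.mk θ)) (whR (Arrow.mk π) s') (by simp)

lemma pasteH_left {A B E A' D F : C} {r : A ⟶ B} {r' : B ⟶ E} {s : A' ⟶ D} {s' : D ⟶ F}
    {u : A ⟶ A'} {v : B ⟶ D} {w : E ⟶ F} (π : r ≫ v ⟶ u ≫ s) (θ : r' ≫ w ⟶ v ≫ s') :
    (pasteH π θ).left = (r ≫ r') ≫ w := (Strict.assoc _ _ _).symm

lemma pasteH_right {A B E A' D F : C} {r : A ⟶ B} {r' : B ⟶ E} {s : A' ⟶ D} {s' : D ⟶ F}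
    {u : A ⟶ A'} {v : B ⟶ D} {w : E ⟶ F} (π : r ≫ v ⟶ u ≫ s) (θ : r' ≫ w ⟶ v ≫ s') :
    (pasteH π θ).right = u ≫ (s ≫ s') := Strict.assoc _ _ _

/-- The 2-cell obtained by pasting two quintets one above the other. -/
def pasteV {A B A' D A'' F : C} {r : A ⟶ B} {s : A' ⟶ D} {t : A'' ⟶ F}
    {u : A ⟶ A'} {u' : A' ⟶ A''} {v : B ⟶ D} {v' : D ⟶ F}
    (π : r ≫ v ⟶ u ≫ s) (ζ : s ≫ v' ⟶ u' ≫ t) : Arrow (A ⟶ F) :=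
  vcomp (whR (Arrow.mk π) v') (whL u (Arrow.mk ζ)) (by simp)

lemma pasteV_left {A B A' D A'' F : C} {r : A ⟶ B} {s : A' ⟶ D} {t : A'' ⟶ F}
    {u : A ⟶ A'} {u' : A' ⟶ A''} {v : B ⟶ D} {v' : D ⟶ F}
    (π : r ≫ v ⟶ u ≫ s) (ζ : s ≫ v' ⟶ u' ≫ t) :
    (pasteV π ζ).left = r ≫ (v ≫ v') := Strict.assoc _ _ _

lemma pasteV_right {A B A' D A'' F : C} {r : A ⟶ B} {s : A' ⟶ D} {t : A'' ⟶ F}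
    {u : A ⟶ A'} {u' : A' ⟶ A''} {v : B ⟶ D} {v' : D ⟶ F}
    (π : r ≫ v ⟶ u ≫ s) (ζ : s ≫ v' ⟶ u' ≫ t) :
    (pasteV π ζ).right = (u ≫ u') ≫ t := (Strict.assoc _ _ _).symm

/-- Which 2-cells of `C` are admitted as quintets with horizontal arrows in `K` and vertical
arrows in `L`; the identity cells are admitted, and admitted cells can be pasted. -/
structure QuintetKind (K L : ArrowKind und) where
  Coh : ∀ {A B A' B' : Ob} (r : K.Hom A B) (s : K.Hom A' B') (u : L.Hom A A') (v : L.Hom B B'),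
    (K.toC r ≫ L.toC v ⟶ L.toC u ≫ K.toC s) → Prop
  idH : ∀ {A A' : Ob} (u : L.Hom A A'), Coh (K.id A) (K.id A') u u
    (eqToHom (by simp only [K.toC_id, Strict.id_comp, Strict.comp_id]))
  idV : ∀ {A B : Ob} (r : K.Hom A B), Coh r r (L.id A) (L.id B)
    (eqToHom (by simp only [L.toC_id, Strict.id_comp, Strict.comp_id]))
  compH : ∀ {A B E A' D F : Ob} {r : K.Hom A B} {r' : K.Hom B E} {s : K.Hom A' D}
    {s' : K.Hom D F} {u : L.Hom A A'} {v : L.Hom B D} {w : L.Hom E F}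
    {π : K.toC r ≫ L.toC v ⟶ L.toC u ≫ K.toC s} {θ : K.toC r' ≫ L.toC w ⟶ L.toC v ≫ K.toC s'},
    Coh r s u v π → Coh r' s' v w θ → Coh (K.comp r r') (K.comp s s') u w
      (homOf (pasteH π θ) (by rw [pasteH_left, K.toC_comp]) (by rw [pasteH_right, K.toC_comp]))
  compV : ∀ {A B A' D A'' F : Ob} {r : K.Hom A B} {s : K.Hom A' D} {t : K.Hom A'' F}
    {u : L.Hom A A'} {u' : L.Hom A' A''} {v : L.Hom B D} {v' : L.Hom D F}
    {π : K.toC r ≫ L.toC v ⟶ L.toC u ≫ K.toC s} {ζ : K.toC s ≫ L.toC v' ⟶ L.toC u' ≫ K.toC t},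
    Coh r s u v π → Coh s t u' v' ζ → Coh r t (L.comp u u') (L.comp v v')
      (homOf (pasteV π ζ) (by rw [pasteV_left, L.toC_comp]) (by rw [pasteV_right, L.toC_comp]))

/-- A quintet: four arrows, forming a square, and an admitted 2-cell of `C` inhabiting it. -/
structure Quintet {K L : ArrowKind und} (Q : QuintetKind K L) where
  {A : Ob}
  {B : Ob}
  {A' : Ob}
  {B' : Ob}
  top : K.Hom A B
  bot : K.Hom A' B'
  left : L.Hom A A'
  right : L.Hom B B'
  cell : K.toC top ≫ L.toC right ⟶ L.toC left ≫ K.toC bot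
  coh : Q.Coh top bot left right cell

namespace Quintet
variable {K L : ArrowKind und} {Q : QuintetKind K L}

abbrev topArr (x : Quintet Q) : KArr K := ⟨x.top⟩
abbrev botArr (x : Quintet Q) : KArr K := ⟨x.bot⟩
abbrev leftArr (x : Quintet Q) : KArr L := ⟨x.left⟩
abbrev rightArr (x : Quintet Q) : KArr L := ⟨x.right⟩

lemma mk_congr {A B A' B' : Ob} {r r₁ : K.Hom A B} {s s₁ : K.Hom A' B'} {u u₁ : L.Hom A A'}
    {v v₁ : L.Hom B B'} {π π₁ c c₁} (hr : r = r₁) (hs : s = s₁) (hu : u = u₁) (hv : v = v₁)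
    (hπ : Arrow.mk π = Arrow.mk π₁) :
    (⟨r, s, u, v, π, c⟩ : Quintet Q) = ⟨r₁, s₁, u₁, v₁, π₁, c₁⟩ := by
  subst hr hs hu hv
  obtain rfl := Arrow.mk_injective _ _ hπ
  rfl

/-- Horizontal composition of quintets. -/
def hcomp : ∀ (x y : Quintet Q), x.rightArr = y.leftArr → Quintet Q
  | ⟨r, s, u, _, _, c⟩, ⟨r', s', _, w, _, c'⟩, rfl =>
    ⟨K.comp r r', K.comp s s', u, w, _, Q.compH c c'⟩

/-- Vertical composition of quintets. -/
def vertComp : ∀ (x y : Quintet Q), x.botArr = y.topArr → Quintet Q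
  | ⟨r, _, u, v, _, c⟩, ⟨_, t, u', v', _, c'⟩, rfl =>
    ⟨r, t, L.comp u u', L.comp v v', _, Q.compV c c'⟩

lemma some_pasteH {A B E A' D F : C} {r : A ⟶ B} {r' : B ⟶ E} {s : A' ⟶ D} {s' : D ⟶ F}
    {u : A ⟶ A'} {v : B ⟶ D} {w : E ⟶ F} (π : r ≫ v ⟶ u ≫ s) (θ : r' ≫ w ⟶ v ≫ s') :
    some (pasteH π θ) =
      pcomp (some (whL r (Arrow.mk θ))) (some (whR (Arrow.mk π) s')) := some_vcomp _ _ _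

lemma some_pasteV {A B A' D A'' F : C} {r : A ⟶ B} {s : A' ⟶ D} {t : A'' ⟶ F}
    {u : A ⟶ A'} {u' : A' ⟶ A''} {v : B ⟶ D} {v' : D ⟶ F}
    (π : r ≫ v ⟶ u ≫ s) (ζ : s ≫ v' ⟶ u' ≫ t) :
    some (pasteV π ζ) =
      pcomp (some (whR (Arrow.mk π) v')) (some (whL u (Arrow.mk ζ))) := some_vcomp _ _ _

lemma whL_pasteH {Z A B E A' D F : C} {r : A ⟶ B} {r' : B ⟶ E} {s : A' ⟶ D} {s' : D ⟶ F}
    {u : A ⟶ A'} {v : B ⟶ D} {w : E ⟶ F} (π : r ≫ v ⟶ u ≫ s) (θ : r' ≫ w ⟶ v ≫ s')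
    (f : Z ⟶ A) : some (whL f (pasteH π θ)) =
      pcomp (some (whL f (whL r (Arrow.mk θ)))) (some (whL f (whR (Arrow.mk π) s'))) := by
  exact (congrArg some (whL_vcomp f _ _ _)).trans (some_vcomp _ _ _)

lemma whR_pasteH {Z A B E A' D F : C} {r : A ⟶ B} {r' : B ⟶ E} {s : A' ⟶ D} {s' : D ⟶ F}
    {u : A ⟶ A'} {v : B ⟶ D} {w : E ⟶ F} (π : r ≫ v ⟶ u ≫ s) (θ : r' ≫ w ⟶ v ≫ s')
    (f : F ⟶ Z) : some (whR (pasteH π θ) f) =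
      pcomp (some (whL r (whR (Arrow.mk θ) f))) (some (whR (Arrow.mk π) (s' ≫ f))) := by
  rw [← whR_whL, whR_comp]
  exact (congrArg some (whR_vcomp _ _ f _)).trans (some_vcomp _ _ _)

lemma whL_pasteV {Z A B A' D A'' F : C} {r : A ⟶ B} {s : A' ⟶ D} {t : A'' ⟶ F}
    {u : A ⟶ A'} {u' : A' ⟶ A''} {v : B ⟶ D} {v' : D ⟶ F}
    (π : r ≫ v ⟶ u ≫ s) (ζ : s ≫ v' ⟶ u' ≫ t) (f : Z ⟶ A) :
    some (whL f (pasteV π ζ)) =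
      pcomp (some (whL f (whR (Arrow.mk π) v'))) (some (whL (f ≫ u) (Arrow.mk ζ))) := by
  rw [whL_comp]
  exact (congrArg some (whL_vcomp f _ _ _)).trans (some_vcomp _ _ _)

lemma whR_pasteV {Z A B A' D A'' F : C} {r : A ⟶ B} {s : A' ⟶ D} {t : A'' ⟶ F}
    {u : A ⟶ A'} {u' : A' ⟶ A''} {v : B ⟶ D} {v' : D ⟶ F}
    (π : r ≫ v ⟶ u ≫ s) (ζ : s ≫ v' ⟶ u' ≫ t) (f : F ⟶ Z) :
    some (whR (pasteV π ζ) f) =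
      pcomp (some (whR (Arrow.mk π) (v' ≫ f))) (some (whL u (whR (Arrow.mk ζ) f))) := by
  rw [← whR_whL, whR_comp]
  exact (congrArg some (whR_vcomp _ _ f _)).trans (some_vcomp _ _ _)

/-- The category structure given by the horizontal composition. -/
abbrev catH (Q : QuintetKind K L) : CatStr (KArr L) (Quintet Q) where
  dom := leftArr
  cod := rightArr
  ide u := ⟨_, _, u.hom, u.hom, _, Q.idH u.hom⟩
  comp := hcomp
  dom_ide _ := rfl
  cod_ide _ := rfl
  dom_comp := by rintro ⟨r, s, u, v, π, c⟩ ⟨r', s', v', w, θ, c'⟩ ⟨⟩; rfl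
  cod_comp := by rintro ⟨r, s, u, v, π, c⟩ ⟨r', s', v', w, θ, c'⟩ ⟨⟩; rfl
  ide_comp := by
    rintro ⟨r, s, u, v, π, c⟩
    refine mk_congr (K.id_comp _) (K.id_comp _) rfl rfl (Option.some_injective _ ?_)
    rw [mk_homOf, some_pasteH, mk_eqToHom, whR_idc, K.toC_id, whL_id]
    exact pcomp_idc _ (by rw [Strict.id_comp]; rfl)
  comp_ide := by
    rintro ⟨r, s, u, v, π, c⟩
    refine mk_congr (K.comp_id _) (K.comp_id _) rfl rfl (Option.some_injective _ ?_)
    rw [mk_homOf, some_pasteH, mk_eqToHom, whL_idc, K.toC_id, K.toC_id, whR_id]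
    exact idc_pcomp _ (by rw [Strict.id_comp]; rfl)
  assoc := by
    rintro ⟨r, s, u, v, π, c⟩ ⟨r', s', v', w, θ, c'⟩ ⟨r'', s'', w', z, η, c''⟩ ⟨⟩ ⟨⟩
    refine mk_congr (K.assoc _ _ _) (K.assoc _ _ _) rfl rfl (Option.some_injective _ ?_)
    rw [mk_homOf, mk_homOf, some_pasteH, some_pasteH, mk_homOf, mk_homOf, whL_pasteH,
      whR_pasteH, pcomp_assoc, K.toC_comp, K.toC_comp, whL_comp]

/-- The category structure given by the vertical composition. -/
abbrev catV (Q : QuintetKind K L) : CatStr (KArr K) (Quintet Q) where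
  dom := topArr
  cod := botArr
  ide r := ⟨r.hom, r.hom, _, _, _, Q.idV r.hom⟩
  comp := vertComp
  dom_ide _ := rfl
  cod_ide _ := rfl
  dom_comp := by rintro ⟨r, s, u, v, π, c⟩ ⟨r', s', v', w, θ, c'⟩ ⟨⟩; rfl
  cod_comp := by rintro ⟨r, s, u, v, π, c⟩ ⟨r', s', v', w, θ, c'⟩ ⟨⟩; rfl
  ide_comp := by
    rintro ⟨r, s, u, v, π, c⟩
    refine mk_congr rfl rfl (L.id_comp _) (L.id_comp _) (Option.some_injective _ ?_)
    rw [mk_homOf, some_pasteV, mk_eqToHom, whR_idc, L.toC_id, L.toC_id, whL_id]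
    exact idc_pcomp _ (by rw [Strict.comp_id]; rfl)
  comp_ide := by
    rintro ⟨r, s, u, v, π, c⟩
    refine mk_congr rfl rfl (L.comp_id _) (L.comp_id _) (Option.some_injective _ ?_)
    rw [mk_homOf, some_pasteV, mk_eqToHom, whL_idc, L.toC_id, whR_id]
    exact pcomp_idc _ (by rw [Strict.comp_id]; rfl)
  assoc := by
    rintro ⟨r, s, u, v, π, c⟩ ⟨s', t, u', v', θ, c'⟩ ⟨t', z, u'', v'', η, c''⟩ ⟨⟩ ⟨⟩
    refine mk_congr rfl rfl (L.assoc _ _ _) (L.assoc _ _ _) (Option.some_injective _ ?_)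
    rw [mk_homOf, mk_homOf, some_pasteV, some_pasteV, mk_homOf, mk_homOf, whL_pasteV,
      whR_pasteV, pcomp_assoc, L.toC_comp, L.toC_comp, whL_comp]

lemma isDouble (Q : QuintetKind K L) : IsDouble (KArr.cat K) (KArr.cat L) (catH Q) (catV Q) where
  dom_h := ⟨fun _ => rfl, fun _ => rfl, fun _ => rfl, by
    rintro ⟨r, s, u, v, π, c⟩ ⟨r', s', v', w, θ, c'⟩ ⟨⟩; rfl⟩
  cod_h := ⟨fun _ => rfl, fun _ => rfl, fun _ => rfl, by
    rintro ⟨r, s, u, v, π, c⟩ ⟨r', s', v', w, θ, c'⟩ ⟨⟩; rfl⟩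
  ide_h := ⟨fun _ => rfl, fun _ => rfl, fun X => by
    refine mk_congr rfl rfl rfl rfl ?_
    rw [mk_eqToHom], by
    rintro ⟨u⟩ ⟨u'⟩ h
    dsimp [KArr.cat] at h
    subst h
    refine mk_congr rfl rfl rfl rfl (Option.some_injective _ ?_)
    rw [mk_homOf, some_pasteV, mk_eqToHom, mk_eqToHom, mk_eqToHom, whL_idc, whR_idc, pcomp_idc]
    · change some (Arrow.mk (𝟙 (_ ≫ L.toC (L.comp u u')))) = _
      rw [L.toC_comp, Strict.assoc]
    · simp [K.toC_id]⟩
  dom_v := ⟨fun _ => rfl, fun _ => rfl, fun _ => rfl, by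
    rintro ⟨r, s, u, v, π, c⟩ ⟨r', s', v', w, θ, c'⟩ ⟨⟩; rfl⟩
  cod_v := ⟨fun _ => rfl, fun _ => rfl, fun _ => rfl, by
    rintro ⟨r, s, u, v, π, c⟩ ⟨r', s', v', w, θ, c'⟩ ⟨⟩; rfl⟩
  ide_v := ⟨fun _ => rfl, fun _ => rfl, fun X => by
    refine mk_congr rfl rfl rfl rfl ?_
    rw [mk_eqToHom], by
    rintro ⟨u⟩ ⟨u'⟩ h
    dsimp [KArr.cat] at h
    subst h
    refine mk_congr rfl rfl rfl rfl (Option.some_injective _ ?_)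
    rw [mk_homOf, some_pasteH, mk_eqToHom, mk_eqToHom, mk_eqToHom, whL_idc, whR_idc, pcomp_idc]
    · change some (Arrow.mk (𝟙 (K.toC (K.comp u u') ≫ _))) = _
      rw [K.toC_comp, Strict.assoc]
    · simp [L.toC_id]⟩
  interchange := by
    rintro ⟨r, s, u, v, π, c⟩ ⟨r', s', v', w, θ, c'⟩ ⟨t, q, x, y, ζ, d⟩ ⟨t', q', y', z, η, d'⟩
    rintro ⟨⟩ ⟨⟩ h h' h₁ h₂
    dsimp [catV, topArr, botArr] at h h'
    cases h
    cases h'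
    refine mk_congr rfl rfl rfl rfl (Option.some_injective _ ?_)
    rw [mk_homOf, mk_homOf, some_pasteH, some_pasteV, mk_homOf, mk_homOf, mk_homOf, mk_homOf,
      whR_pasteH, whL_pasteH, whL_pasteV, whR_pasteV]
    have := exchange' (Arrow.mk π) (Arrow.mk η) rfl rfl rfl rfl
    simp only [Arrow.mk_left, Arrow.mk_right] at this
    simp only [pcomp_assoc, whL_comp] at this ⊢
    rw [pcomp_reassoc2 this.symm]

end Quintet
end
end TripleCat

namespace TripleCat
open Bicategory

/-- Composition of three consecutive arrows. -/
def vcomp₃ {K : Type*} [Category K] (a b c : Arrow K) (h : a.right = b.left)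
    (h' : b.right = c.left) : Arrow K :=
  vcomp a (vcomp b c h') h

lemma some_vcomp₃ {K : Type*} [Category K] (a b c : Arrow K) (h h') :
    some (vcomp₃ a b c h h') = pcomp (some a) (pcomp (some b) (some c)) := by
  rw [← some_vcomp b c h']
  exact some_vcomp _ _ _

lemma three_of {K : Type*} [Category K] {a₁ a₂ a₃ b₁ b₂ b₃ : Arrow K} {p q p' q'}
    (E : pcomp (some a₁) (pcomp (some a₂) (some a₃)) =
      pcomp (some b₁) (pcomp (some b₂) (some b₃))) :
    vcomp₃ a₁ a₂ a₃ p q = vcomp₃ b₁ b₂ b₃ p' q' :=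
  Option.some_injective _ ((some_vcomp₃ _ _ _ _ _).trans (E.trans (some_vcomp₃ _ _ _ _ _).symm))

lemma of_three {K : Type*} [Category K] {a₁ a₂ a₃ b₁ b₂ b₃ : Arrow K} {p q p' q'}
    (E : vcomp₃ a₁ a₂ a₃ p q = vcomp₃ b₁ b₂ b₃ p' q') :
    pcomp (some a₁) (pcomp (some a₂) (some a₃)) =
      pcomp (some b₁) (pcomp (some b₂) (some b₃)) :=
  (some_vcomp₃ _ _ _ _ _).symm.trans ((congrArg some E).trans (some_vcomp₃ _ _ _ _ _))

lemma unit_left {K : Type*} [Category K] (a : Arrow K) {X Y : K} (h : X = a.left)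
    (h' : Y = a.left) :
    pcomp (some (Arrow.mk (𝟙 X))) (pcomp (some (Arrow.mk (𝟙 Y))) (some a)) = some a := by
  rw [idc_pcomp a h', idc_pcomp a h]

lemma unit_mid {K : Type*} [Category K] (a : Arrow K) {X Y : K} (h : X = a.left)
    (h' : a.right = Y) :
    pcomp (some (Arrow.mk (𝟙 X))) (pcomp (some a) (some (Arrow.mk (𝟙 Y)))) = some a := by
  rw [pcomp_idc a h', idc_pcomp a h]

lemma unit_right {K : Type*} [Category K] (a : Arrow K) {X Y : K} (h : a.right = X)
    (h' : a.right = Y) :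
    pcomp (some a) (pcomp (some (Arrow.mk (𝟙 X))) (some (Arrow.mk (𝟙 Y)))) = some a := by
  rw [← pcomp_assoc, pcomp_idc a h, pcomp_idc a h']

section
variable {C : Type u} [Bicategory.{w, v} C]

lemma whL_three {W X Y : C} (f : W ⟶ X) (a b c : Arrow (X ⟶ Y)) (h h') :
    whL f (vcomp₃ a b c h h') = vcomp₃ (whL f a) (whL f b) (whL f c)
      (congrArg (f ≫ ·) h) (congrArg (f ≫ ·) h') := by
  simp [vcomp₃, vcomp, whL]

lemma whR_three {W X Y : C} (f : Y ⟶ W) (a b c : Arrow (X ⟶ Y)) (h h') :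
    whR (vcomp₃ a b c h h') f = vcomp₃ (whR a f) (whR b f) (whR c f)
      (congrArg (· ≫ f) h) (congrArg (· ≫ f) h') := by
  simp [vcomp₃, vcomp, whR]

lemma three_whL {W X Y : C} {a₁ a₂ a₃ b₁ b₂ b₃ : Arrow (X ⟶ Y)} {p q p' q'} (f : W ⟶ X)
    (E : vcomp₃ a₁ a₂ a₃ p q = vcomp₃ b₁ b₂ b₃ p' q') :
    pcomp (some (whL f a₁)) (pcomp (some (whL f a₂)) (some (whL f a₃))) =
      pcomp (some (whL f b₁)) (pcomp (some (whL f b₂)) (some (whL f b₃))) :=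
  of_three ((whL_three _ _ _ _ _ _).symm.trans ((congrArg (whL f) E).trans (whL_three _ _ _ _ _ _)))

lemma three_whR {W X Y : C} {a₁ a₂ a₃ b₁ b₂ b₃ : Arrow (X ⟶ Y)} {p q p' q'} (f : Y ⟶ W)
    (E : vcomp₃ a₁ a₂ a₃ p q = vcomp₃ b₁ b₂ b₃ p' q') :
    pcomp (some (whR a₁ f)) (pcomp (some (whR a₂ f)) (some (whR a₃ f))) =
      pcomp (some (whR b₁ f)) (pcomp (some (whR b₂ f)) (some (whR b₃ f))) :=
  of_three ((whR_three _ _ _ _ _ _).symm.trans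
    ((congrArg (whR · f) E).trans (whR_three _ _ _ _ _ _)))

end

section
variable {C : Type u} [Bicategory.{w, v} C] [Strict C] {Ob : Type u} {und : Ob → C}

/-- The six quintets are the faces of a commutative cube, in the 2-category `C`.
The arrows `r, s, r', s'` have direction `0`, the arrows `u, v, u', v'` have direction `1` and the
arrows `x, x', y, y'` have direction `2`. -/
inductive IsCommCube {K₀ K₁ K₂ : ArrowKind und} {Q01 : QuintetKind K₀ K₁}
    {Q02 : QuintetKind K₀ K₂} {Q12 : QuintetKind K₁ K₂} :
    Quintet Q01 → Quintet Q01 → Quintet Q02 → Quintet Q02 → Quintet Q12 → Quintet Q12 → Prop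
  | mk {A B A' B' D E D' E' : Ob} {r : K₀.Hom A B} {s : K₀.Hom D E} {r' : K₀.Hom A' B'}
      {s' : K₀.Hom D' E'} {u : K₁.Hom A D} {v : K₁.Hom B E} {u' : K₁.Hom A' D'}
      {v' : K₁.Hom B' E'} {x : K₂.Hom A A'} {x' : K₂.Hom B B'} {y : K₂.Hom D D'}
      {y' : K₂.Hom E E'} {φ ψ π ρ ω ζ} {hφ : Q01.Coh r s u v φ} {hψ : Q01.Coh r' s' u' v' ψ}
      {hπ : Q02.Coh r r' x x' π} {hρ : Q02.Coh s s' y y' ρ} {hω : Q12.Coh u u' x y ω}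
      {hζ : Q12.Coh v v' x' y' ζ}
      (comm : vcomp₃ (whR (Arrow.mk φ) (K₂.toC y')) (whL (K₁.toC u) (Arrow.mk ρ))
          (whR (Arrow.mk ω) (K₀.toC s')) (by simp) (by simp) =
        vcomp₃ (whL (K₀.toC r) (Arrow.mk ζ)) (whR (Arrow.mk π) (K₁.toC v'))
          (whL (K₂.toC x) (Arrow.mk ψ)) (by simp) (by simp)) :
      IsCommCube ⟨r, s, u, v, φ, hφ⟩ ⟨r', s', u', v', ψ, hψ⟩ ⟨r, r', x, x', π, hπ⟩
        ⟨s, s', y, y', ρ, hρ⟩ ⟨u, u', x, y, ω, hω⟩ ⟨v, v', x', y', ζ, hζ⟩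

/-- A commutative cube of quintets, given by its six faces. -/
@[ext]
structure QCube {K₀ K₁ K₂ : ArrowKind und} (Q01 : QuintetKind K₀ K₁)
    (Q02 : QuintetKind K₀ K₂) (Q12 : QuintetKind K₁ K₂) where
  φ : Quintet Q01
  ψ : Quintet Q01
  π : Quintet Q02
  ρ : Quintet Q02
  ω : Quintet Q12
  ζ : Quintet Q12
  comm : IsCommCube φ ψ π ρ ω ζ

namespace QCube
variable {K₀ K₁ K₂ : ArrowKind und} {Q01 : QuintetKind K₀ K₁}
  {Q02 : QuintetKind K₀ K₂} {Q12 : QuintetKind K₁ K₂} (X Y : QCube Q01 Q02 Q12)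

lemma e1 : X.φ.topArr = X.π.topArr := by rcases X with ⟨_, _, _, _, _, _, ⟨_⟩⟩; rfl
lemma e2 : X.φ.botArr = X.ρ.topArr := by rcases X with ⟨_, _, _, _, _, _, ⟨_⟩⟩; rfl
lemma e3 : X.ψ.topArr = X.π.botArr := by rcases X with ⟨_, _, _, _, _, _, ⟨_⟩⟩; rfl
lemma e4 : X.ψ.botArr = X.ρ.botArr := by rcases X with ⟨_, _, _, _, _, _, ⟨_⟩⟩; rfl
lemma e5 : X.φ.leftArr = X.ω.topArr := by rcases X with ⟨_, _, _, _, _, _, ⟨_⟩⟩; rfl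
lemma e6 : X.φ.rightArr = X.ζ.topArr := by rcases X with ⟨_, _, _, _, _, _, ⟨_⟩⟩; rfl
lemma e7 : X.ψ.leftArr = X.ω.botArr := by rcases X with ⟨_, _, _, _, _, _, ⟨_⟩⟩; rfl
lemma e8 : X.ψ.rightArr = X.ζ.botArr := by rcases X with ⟨_, _, _, _, _, _, ⟨_⟩⟩; rfl
lemma e9 : X.π.leftArr = X.ω.leftArr := by rcases X with ⟨_, _, _, _, _, _, ⟨_⟩⟩; rfl
lemma e10 : X.π.rightArr = X.ζ.leftArr := by rcases X with ⟨_, _, _, _, _, _, ⟨_⟩⟩; rfl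
lemma e11 : X.ρ.leftArr = X.ω.rightArr := by rcases X with ⟨_, _, _, _, _, _, ⟨_⟩⟩; rfl
lemma e12 : X.ρ.rightArr = X.ζ.rightArr := by rcases X with ⟨_, _, _, _, _, _, ⟨_⟩⟩; rfl

/-- Pasting of cubes in direction `0`. -/
def comp0 (h : X.ζ = Y.ω) : QCube Q01 Q02 Q12 where
  φ := X.φ.hcomp Y.φ (by rw [e6, h, e5])
  ψ := X.ψ.hcomp Y.ψ (by rw [e8, h, e7])
  π := X.π.hcomp Y.π (by rw [e10, h, e9])
  ρ := X.ρ.hcomp Y.ρ (by rw [e12, h, e11])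
  ω := X.ω
  ζ := Y.ζ
  comm := by
    obtain ⟨_, _, _, _, _, _, @⟨_, _, _, _, _, _, _, _, r, s, r', s', u, v, u', v', x, x', y, y',
      φ, ψ, π, ρ, ω, ζ, _, _, _, _, _, _, c⟩⟩ := X
    obtain ⟨_, _, _, _, _, _, @⟨_, _, _, _, _, _, _, _, r₂, s₂, r₂', s₂', _, v₂, _, v₂', _, x₂', _,
      y₂', φ₂, ψ₂, π₂, ρ₂, _, ζ₂, _, _, _, _, _, _, d⟩⟩ := Y
    cases h
    have c' := three_whR (K₀.toC s₂') c
    have d' := three_whL (K₀.toC r) d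
    have e := exchange' (Arrow.mk φ) (Arrow.mk ρ₂) rfl rfl rfl rfl
    have e' := exchange' (Arrow.mk π) (Arrow.mk ψ₂) rfl rfl rfl rfl
    refine .mk (three_of ?_)
    simp only [mk_homOf]
    rw [Quintet.whR_pasteH, Quintet.whL_pasteH, Quintet.whR_pasteH, Quintet.whL_pasteH]
    simp only [Arrow.mk_left, Arrow.mk_right] at e e'
    simp only [pcomp_assoc, whL_comp, whR_comp, whR_whL, K₀.toC_comp] at c' d' e e' ⊢
    rw [pcomp_reassoc2 e.symm, c', pcomp_reassoc3 d', pcomp_reassoc2 e']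

/-- Pasting of cubes in direction `1`. -/
def comp1 (h : X.ρ = Y.π) : QCube Q01 Q02 Q12 where
  φ := X.φ.vertComp Y.φ (by rw [e2, h, e1])
  ψ := X.ψ.vertComp Y.ψ (by rw [e4, h, e3])
  π := X.π
  ρ := Y.ρ
  ω := X.ω.hcomp Y.ω (by rw [← e11, h, e9])
  ζ := X.ζ.hcomp Y.ζ (by rw [← e12, h, e10])
  comm := by
    obtain ⟨_, _, _, _, _, _, @⟨_, _, _, _, _, _, _, _, r, s, r', s', u, v, u', v', x, x', y, y',
      φ, ψ, π, ρ, ω, ζ, _, _, _, _, _, _, c⟩⟩ := X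
    obtain ⟨_, _, _, _, _, _, @⟨_, _, _, _, _, _, _, _, _, s₂, _, s₂', u₂, v₂, u₂', v₂', _, _, y₂,
      y₂', φ₂, ψ₂, _, ρ₂, ω₂, ζ₂, _, _, _, _, _, _, d⟩⟩ := Y
    cases h
    have c' := three_whR (K₁.toC v₂') c
    have d' := three_whL (K₁.toC u) d
    have e := exchange' (Arrow.mk φ) (Arrow.mk ζ₂) rfl rfl rfl rfl
    have e' := exchange' (Arrow.mk ω) (Arrow.mk ψ₂) rfl rfl rfl rfl
    refine .mk (three_of ?_)
    simp only [mk_homOf]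
    rw [Quintet.whR_pasteV, Quintet.whR_pasteH, Quintet.whL_pasteH, Quintet.whL_pasteV]
    simp only [Arrow.mk_left, Arrow.mk_right] at e e'
    simp only [pcomp_assoc, whL_comp, whR_comp, whR_whL, K₁.toC_comp] at c' d' e e' ⊢
    rw [pcomp_reassoc3 d', e', pcomp_reassoc2 e.symm, pcomp_reassoc3 c']

/-- Pasting of cubes in direction `2`. -/
def comp2 (h : X.ψ = Y.φ) : QCube Q01 Q02 Q12 where
  φ := X.φ
  ψ := Y.ψ
  π := X.π.vertComp Y.π (by rw [← e3, h, e1])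
  ρ := X.ρ.vertComp Y.ρ (by rw [← e4, h, e2])
  ω := X.ω.vertComp Y.ω (by rw [← e7, h, e5])
  ζ := X.ζ.vertComp Y.ζ (by rw [← e8, h, e6])
  comm := by
    obtain ⟨_, _, _, _, _, _, @⟨_, _, _, _, _, _, _, _, r, s, r', s', u, v, u', v', x, x', y, y',
      φ, ψ, π, ρ, ω, ζ, _, _, _, _, _, _, c⟩⟩ := X
    obtain ⟨_, _, _, _, _, _, @⟨_, _, _, _, _, _, _, _, _, _, r₂', s₂', _, _, u₂', v₂', x₂, x₂', y₂,
      y₂', _, ψ₂, π₂, ρ₂, ω₂, ζ₂, _, _, _, _, _, _, d⟩⟩ := Y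
    cases h
    have c' := three_whR (K₂.toC y₂') c
    have d' := three_whL (K₂.toC x) d
    have e := exchange' (Arrow.mk ω) (Arrow.mk ρ₂) rfl rfl rfl rfl
    have e' := exchange' (Arrow.mk π) (Arrow.mk ζ₂) rfl rfl rfl rfl
    refine .mk (three_of ?_)
    simp only [mk_homOf]
    rw [Quintet.whL_pasteV, Quintet.whR_pasteV, Quintet.whL_pasteV, Quintet.whR_pasteV]
    simp only [Arrow.mk_left, Arrow.mk_right] at e e'
    simp only [pcomp_assoc, whL_comp, whR_comp, whR_whL, K₂.toC_comp] at c' d' e e' ⊢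
    rw [pcomp_reassoc2 e, pcomp_reassoc3 c', d', pcomp_reassoc2 e'.symm]

/-- The degenerate cube on a `12`-quintet. -/
def id0 (Q01 : QuintetKind K₀ K₁) (Q02 : QuintetKind K₀ K₂) (ω : Quintet Q12) :
    QCube Q01 Q02 Q12 where
  φ := (Quintet.catH Q01).ide ω.topArr
  ψ := (Quintet.catH Q01).ide ω.botArr
  π := (Quintet.catH Q02).ide ω.leftArr
  ρ := (Quintet.catH Q02).ide ω.rightArr
  ω := ω
  ζ := ω
  comm := by
    obtain ⟨u, u', x, y, ω, c⟩ := ω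
    refine .mk (three_of ?_)
    simp only [mk_eqToHom, K₀.toC_id, whR_idc, whL_idc, whL_id, whR_id]
    exact (unit_left _ (by simp [K₀.toC_id]) (by simp [K₀.toC_id])).trans
      (unit_right _ (by simp [K₀.toC_id]) (by simp [K₀.toC_id])).symm

/-- The degenerate cube on a `02`-quintet. -/
def id1 (Q01 : QuintetKind K₀ K₁) (Q12 : QuintetKind K₁ K₂) (π : Quintet Q02) :
    QCube Q01 Q02 Q12 where
  φ := (Quintet.catV Q01).ide π.topArr
  ψ := (Quintet.catV Q01).ide π.botArr
  π := π
  ρ := π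
  ω := (Quintet.catH Q12).ide π.leftArr
  ζ := (Quintet.catH Q12).ide π.rightArr
  comm := by
    obtain ⟨u, u', x, y, ω, c⟩ := π
    refine .mk (three_of ?_)
    simp only [mk_eqToHom, K₁.toC_id, whR_idc, whL_idc, whL_id, whR_id]
    exact (unit_mid _ (by simp [K₁.toC_id]) (by simp [K₁.toC_id])).trans
      (unit_mid _ (by simp [K₁.toC_id]) (by simp [K₁.toC_id])).symm

/-- The degenerate cube on a `01`-quintet. -/
def id2 (Q02 : QuintetKind K₀ K₂) (Q12 : QuintetKind K₁ K₂) (φ : Quintet Q01) :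
    QCube Q01 Q02 Q12 where
  φ := φ
  ψ := φ
  π := (Quintet.catV Q02).ide φ.topArr
  ρ := (Quintet.catV Q02).ide φ.botArr
  ω := (Quintet.catV Q12).ide φ.leftArr
  ζ := (Quintet.catV Q12).ide φ.rightArr
  comm := by
    obtain ⟨u, u', x, y, ω, c⟩ := φ
    refine .mk (three_of ?_)
    simp only [mk_eqToHom, K₂.toC_id, whR_idc, whL_idc, whL_id, whR_id]
    exact (unit_right _ (by simp [K₂.toC_id]) (by simp [K₂.toC_id])).trans
      (unit_left _ (by simp [K₂.toC_id]) (by simp [K₂.toC_id])).symm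

end QCube
end
end TripleCat

namespace TripleCat
open Bicategory

section
variable {O M : Type*} (c : CatStr O M)

lemma CatStr.ide_comp' {x : O} {f : M} (h : c.cod (c.ide x) = c.dom f) :
    c.comp (c.ide x) f h = f := by
  obtain rfl : x = c.dom f := by rw [← h, c.cod_ide]
  exact c.ide_comp f

lemma CatStr.comp_ide' {x : O} {f : M} (h : c.cod f = c.dom (c.ide x)) :
    c.comp f (c.ide x) h = f := by
  obtain rfl : x = c.cod f := by rw [h, c.dom_ide]
  exact c.comp_ide f

lemma CatStr.comp_congr {f f' g g' : M} (hf : f = f') (hg : g = g') (h : c.cod f = c.dom g) :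
    c.comp f g h = c.comp f' g' (by rw [← hf, ← hg, h]) := by
  subst hf hg; rfl

end

section
variable {C : Type u} [Bicategory.{w, v} C] [Strict C] {Ob : Type u} {und : Ob → C}
  {K₀ K₁ K₂ : ArrowKind und} {Q01 : QuintetKind K₀ K₁}
  {Q02 : QuintetKind K₀ K₂} {Q12 : QuintetKind K₁ K₂}

namespace Quintet
variable {K L : ArrowKind und} {Q : QuintetKind K L}

lemma assoc_h (x y z : Quintet Q) (h h' p q) :
    hcomp (hcomp x y h) z p = hcomp x (hcomp y z h') q := (catH Q).assoc x y z h h'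

lemma assoc_v (x y z : Quintet Q) (h h' p q) :
    vertComp (vertComp x y h) z p = vertComp x (vertComp y z h') q := (catV Q).assoc x y z h h'

end Quintet

namespace QCube

variable (Q01 Q02 Q12)

/-- The category structure given by pasting in direction `0`. -/
abbrev cat0 : CatStr (Quintet Q12) (QCube Q01 Q02 Q12) where
  dom := ω
  cod := ζ
  ide := id0 Q01 Q02
  comp := comp0
  dom_ide _ := rfl
  cod_ide _ := rfl
  dom_comp _ _ _ := rfl
  cod_comp _ _ _ := rfl
  ide_comp _ := QCube.ext ((Quintet.catH _).ide_comp' _) ((Quintet.catH _).ide_comp' _)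
    ((Quintet.catH _).ide_comp' _) ((Quintet.catH _).ide_comp' _) rfl rfl
  comp_ide _ := QCube.ext ((Quintet.catH _).comp_ide' _) ((Quintet.catH _).comp_ide' _)
    ((Quintet.catH _).comp_ide' _) ((Quintet.catH _).comp_ide' _) rfl rfl
  assoc _ _ _ _ _ := QCube.ext (Quintet.assoc_h _ _ _ _ _ _ _) (Quintet.assoc_h _ _ _ _ _ _ _)
    (Quintet.assoc_h _ _ _ _ _ _ _) (Quintet.assoc_h _ _ _ _ _ _ _) rfl rfl

/-- The category structure given by pasting in direction `1`. -/
abbrev cat1 : CatStr (Quintet Q02) (QCube Q01 Q02 Q12) where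
  dom := π
  cod := ρ
  ide := id1 Q01 Q12
  comp := comp1
  dom_ide _ := rfl
  cod_ide _ := rfl
  dom_comp _ _ _ := rfl
  cod_comp _ _ _ := rfl
  ide_comp _ := QCube.ext ((Quintet.catV _).ide_comp' _) ((Quintet.catV _).ide_comp' _) rfl rfl
    ((Quintet.catH _).ide_comp' _) ((Quintet.catH _).ide_comp' _)
  comp_ide _ := QCube.ext ((Quintet.catV _).comp_ide' _) ((Quintet.catV _).comp_ide' _) rfl rfl
    ((Quintet.catH _).comp_ide' _) ((Quintet.catH _).comp_ide' _)
  assoc _ _ _ _ _ := QCube.ext (Quintet.assoc_v _ _ _ _ _ _ _) (Quintet.assoc_v _ _ _ _ _ _ _)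
    rfl rfl (Quintet.assoc_h _ _ _ _ _ _ _) (Quintet.assoc_h _ _ _ _ _ _ _)

/-- The category structure given by pasting in direction `2`. -/
abbrev cat2 : CatStr (Quintet Q01) (QCube Q01 Q02 Q12) where
  dom := φ
  cod := ψ
  ide := id2 Q02 Q12
  comp := comp2
  dom_ide _ := rfl
  cod_ide _ := rfl
  dom_comp _ _ _ := rfl
  cod_comp _ _ _ := rfl
  ide_comp _ := QCube.ext rfl rfl ((Quintet.catV _).ide_comp' _) ((Quintet.catV _).ide_comp' _)
    ((Quintet.catV _).ide_comp' _) ((Quintet.catV _).ide_comp' _)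
  comp_ide _ := QCube.ext rfl rfl ((Quintet.catV _).comp_ide' _) ((Quintet.catV _).comp_ide' _)
    ((Quintet.catV _).comp_ide' _) ((Quintet.catV _).comp_ide' _)
  assoc _ _ _ _ _ := QCube.ext rfl rfl (Quintet.assoc_v _ _ _ _ _ _ _)
    (Quintet.assoc_v _ _ _ _ _ _ _) (Quintet.assoc_v _ _ _ _ _ _ _) (Quintet.assoc_v _ _ _ _ _ _ _)

lemma isDouble01 : IsDouble (Quintet.catH Q02) (Quintet.catH Q12) (cat0 Q01 Q02 Q12)
    (cat1 Q01 Q02 Q12) where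
  dom_h := ⟨fun X => X.e9.symm, fun X => X.e11.symm, fun _ => rfl, fun _ _ _ => rfl⟩
  cod_h := ⟨fun X => X.e10.symm, fun X => X.e12.symm, fun _ => rfl, fun _ _ _ => rfl⟩
  ide_h := ⟨fun _ => rfl, fun _ => rfl,
    fun _ => QCube.ext ((Quintet.isDouble Q01).ide_h.ide _) ((Quintet.isDouble Q01).ide_h.ide _)
      rfl rfl rfl rfl,
    fun x y h => QCube.ext
      ((congrArg _ ((Quintet.isDouble Q12).dom_v.comp x y h)).trans
        ((Quintet.isDouble Q01).ide_h.comp _ _ _))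
      ((congrArg _ ((Quintet.isDouble Q12).cod_v.comp x y h)).trans
        ((Quintet.isDouble Q01).ide_h.comp _ _ _))
      (congrArg (Quintet.catH Q02).ide ((Quintet.catH Q12).dom_comp x y h))
      (congrArg (Quintet.catH Q02).ide ((Quintet.catH Q12).cod_comp x y h)) rfl rfl⟩
  dom_v := ⟨fun X => X.e9, fun X => X.e10, fun _ => rfl, fun _ _ _ => rfl⟩
  cod_v := ⟨fun X => X.e11, fun X => X.e12, fun _ => rfl, fun _ _ _ => rfl⟩
  ide_v := ⟨fun _ => rfl, fun _ => rfl,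
    fun _ => QCube.ext ((Quintet.isDouble Q01).ide_h.ide _).symm
      ((Quintet.isDouble Q01).ide_h.ide _).symm rfl rfl rfl rfl,
    fun x y h => QCube.ext
      ((congrArg _ ((Quintet.isDouble Q02).dom_v.comp x y h)).trans
        ((Quintet.isDouble Q01).ide_v.comp _ _ _))
      ((congrArg _ ((Quintet.isDouble Q02).cod_v.comp x y h)).trans
        ((Quintet.isDouble Q01).ide_v.comp _ _ _))
      rfl rfl
      (congrArg (Quintet.catH Q12).ide ((Quintet.catH Q02).dom_comp x y h))
      (congrArg (Quintet.catH Q12).ide ((Quintet.catH Q02).cod_comp x y h))⟩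
  interchange _ _ _ _ _ _ _ _ _ _ := QCube.ext
    ((Quintet.isDouble Q01).interchange _ _ _ _ _ _ _ _ _ _)
    ((Quintet.isDouble Q01).interchange _ _ _ _ _ _ _ _ _ _) rfl rfl rfl rfl

lemma isDouble02 : IsDouble (Quintet.catH Q01) (Quintet.catV Q12) (cat0 Q01 Q02 Q12)
    (cat2 Q01 Q02 Q12) where
  dom_h := ⟨fun X => X.e5.symm, fun X => X.e7.symm, fun _ => rfl, fun _ _ _ => rfl⟩
  cod_h := ⟨fun X => X.e6.symm, fun X => X.e8.symm, fun _ => rfl, fun _ _ _ => rfl⟩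
  ide_h := ⟨fun _ => rfl, fun _ => rfl,
    fun _ => QCube.ext rfl rfl ((Quintet.isDouble Q02).ide_h.ide _)
      ((Quintet.isDouble Q02).ide_h.ide _) rfl rfl,
    fun x y h => QCube.ext
      (congrArg (Quintet.catH Q01).ide ((Quintet.catV Q12).dom_comp x y h))
      (congrArg (Quintet.catH Q01).ide ((Quintet.catV Q12).cod_comp x y h))
      ((congrArg _ ((Quintet.isDouble Q12).dom_h.comp x y h)).trans
        ((Quintet.isDouble Q02).ide_h.comp _ _ _))
      ((congrArg _ ((Quintet.isDouble Q12).cod_h.comp x y h)).trans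
        ((Quintet.isDouble Q02).ide_h.comp _ _ _))
      rfl rfl⟩
  dom_v := ⟨fun X => X.e5, fun X => X.e6, fun _ => rfl, fun _ _ _ => rfl⟩
  cod_v := ⟨fun X => X.e7, fun X => X.e8, fun _ => rfl, fun _ _ _ => rfl⟩
  ide_v := ⟨fun _ => rfl, fun _ => rfl,
    fun _ => QCube.ext rfl rfl ((Quintet.isDouble Q02).ide_h.ide _).symm
      ((Quintet.isDouble Q02).ide_h.ide _).symm rfl rfl,
    fun x y h => QCube.ext rfl rfl
      ((congrArg _ ((Quintet.isDouble Q01).dom_v.comp x y h)).trans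
        ((Quintet.isDouble Q02).ide_v.comp _ _ _))
      ((congrArg _ ((Quintet.isDouble Q01).cod_v.comp x y h)).trans
        ((Quintet.isDouble Q02).ide_v.comp _ _ _))
      (congrArg (Quintet.catV Q12).ide ((Quintet.catH Q01).dom_comp x y h))
      (congrArg (Quintet.catV Q12).ide ((Quintet.catH Q01).cod_comp x y h))⟩
  interchange _ _ _ _ _ _ _ _ _ _ := QCube.ext rfl rfl
    ((Quintet.isDouble Q02).interchange _ _ _ _ _ _ _ _ _ _)
    ((Quintet.isDouble Q02).interchange _ _ _ _ _ _ _ _ _ _) rfl rfl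

lemma isDouble12 : IsDouble (Quintet.catV Q01) (Quintet.catV Q02) (cat1 Q01 Q02 Q12)
    (cat2 Q01 Q02 Q12) where
  dom_h := ⟨fun X => X.e1.symm, fun X => X.e3.symm, fun _ => rfl, fun _ _ _ => rfl⟩
  cod_h := ⟨fun X => X.e2.symm, fun X => X.e4.symm, fun _ => rfl, fun _ _ _ => rfl⟩
  ide_h := ⟨fun _ => rfl, fun _ => rfl,
    fun _ => QCube.ext rfl rfl rfl rfl ((Quintet.isDouble Q12).ide_h.ide _)
      ((Quintet.isDouble Q12).ide_h.ide _),
    fun x y h => QCube.ext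
      (congrArg (Quintet.catV Q01).ide ((Quintet.catV Q02).dom_comp x y h))
      (congrArg (Quintet.catV Q01).ide ((Quintet.catV Q02).cod_comp x y h))
      rfl rfl
      ((congrArg _ ((Quintet.isDouble Q02).dom_h.comp x y h)).trans
        ((Quintet.isDouble Q12).ide_h.comp _ _ _))
      ((congrArg _ ((Quintet.isDouble Q02).cod_h.comp x y h)).trans
        ((Quintet.isDouble Q12).ide_h.comp _ _ _))⟩
  dom_v := ⟨fun X => X.e1, fun X => X.e2, fun _ => rfl, fun _ _ _ => rfl⟩
  cod_v := ⟨fun X => X.e3, fun X => X.e4, fun _ => rfl, fun _ _ _ => rfl⟩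
  ide_v := ⟨fun _ => rfl, fun _ => rfl,
    fun _ => QCube.ext rfl rfl rfl rfl ((Quintet.isDouble Q12).ide_h.ide _).symm
      ((Quintet.isDouble Q12).ide_h.ide _).symm,
    fun x y h => QCube.ext rfl rfl
      (congrArg (Quintet.catV Q02).ide ((Quintet.catV Q01).dom_comp x y h))
      (congrArg (Quintet.catV Q02).ide ((Quintet.catV Q01).cod_comp x y h))
      ((congrArg _ ((Quintet.isDouble Q01).dom_h.comp x y h)).trans
        ((Quintet.isDouble Q12).ide_v.comp _ _ _))
      ((congrArg _ ((Quintet.isDouble Q01).cod_h.comp x y h)).trans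
        ((Quintet.isDouble Q12).ide_v.comp _ _ _))⟩
  interchange _ _ _ _ _ _ _ _ _ _ := QCube.ext rfl rfl rfl rfl
    ((Quintet.isDouble Q12).interchange _ _ _ _ _ _ _ _ _ _)
    ((Quintet.isDouble Q12).interchange _ _ _ _ _ _ _ _ _ _)

end QCube
end

/-- Three kinds of arrows on the same objects, and quintets for each pair of kinds. -/
structure CellKinds {C : Type (u + 1)} [Bicategory.{u, u} C] [Strict C] {Ob : Type (u + 1)}
    (und : Ob → C) where
  K₀ : ArrowKind und
  K₁ : ArrowKind und
  K₂ : ArrowKind und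
  Q01 : QuintetKind K₀ K₁
  Q02 : QuintetKind K₀ K₂
  Q12 : QuintetKind K₁ K₂

variable {C : Type (u + 1)} [Bicategory.{u, u} C] [Strict C] {Ob : Type (u + 1)} {und : Ob → C}

/-- The triple category of the quintets of the given kinds, and their commutative cubes. -/
abbrev CellKinds.triple (K : CellKinds und) : TripleCategory.{u + 1} where
  Ob := Ob
  A0 := KArr K.K₀
  A1 := KArr K.K₁
  A2 := KArr K.K₂
  S01 := Quintet K.Q01
  S02 := Quintet K.Q02
  S12 := Quintet K.Q12
  Cube := QCube K.Q01 K.Q02 K.Q12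
  c0 := KArr.cat _
  c1 := KArr.cat _
  c2 := KArr.cat _
  c01_0 := Quintet.catH _
  c01_1 := Quintet.catV _
  c02_0 := Quintet.catH _
  c02_2 := Quintet.catV _
  c12_1 := Quintet.catH _
  c12_2 := Quintet.catV _
  q0 := QCube.cat0 _ _ _
  q1 := QCube.cat1 _ _ _
  q2 := QCube.cat2 _ _ _
  dbl01 := Quintet.isDouble _
  dbl02 := Quintet.isDouble _
  dbl12 := Quintet.isDouble _
  dbl01_2 := QCube.isDouble01 _ _ _
  dbl02_1 := QCube.isDouble02 _ _ _
  dbl12_0 := QCube.isDouble12 _ _ _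

/-- All the arrows of `C`. -/
def ArrowKind.all (C : Type (u + 1)) [Bicategory.{u, u} C] [Strict C] :
    ArrowKind (fun X : C => X) where
  Hom X Y := X ⟶ Y
  id X := 𝟙 X
  comp f g := f ≫ g
  id_comp := Strict.id_comp
  comp_id := Strict.comp_id
  assoc := Strict.assoc
  toC f := f
  toC_id _ := rfl
  toC_comp _ _ := rfl

/-- All the 2-cells of `C`, as quintets. -/
def QuintetKind.all {C : Type (u + 1)} [Bicategory.{u, u} C] [Strict C] {Ob : Type (u + 1)}
    {und : Ob → C} (K L : ArrowKind und) : QuintetKind K L where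
  Coh _ _ _ _ _ := True
  idH _ := trivial
  idV _ := trivial
  compH _ _ := trivial
  compV _ _ := trivial

/-- The kinds of all arrows and all quintets of `C`. -/
def CellKinds.all (C : Type (u + 1)) [Bicategory.{u, u} C] [Strict C] :
    CellKinds (fun X : C => X) :=
  ⟨.all C, .all C, .all C, .all _ _, .all _ _, .all _ _⟩

namespace CellKinds

/-- The underlying arrow of `C`. -/
def forgetArr {K : ArrowKind und} (f : KArr K) : KArr (.all C) := ⟨K.toC f.hom⟩

/-- The underlying quintet of `C`. -/
def forgetQuintet {K L : ArrowKind und} {Q : QuintetKind K L} (x : Quintet Q) :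
    Quintet (.all (.all C) (.all C)) :=
  ⟨K.toC x.top, K.toC x.bot, L.toC x.left, L.toC x.right, x.cell, trivial⟩

lemma isFun_forgetArr (K : ArrowKind und) :
    IsFun (KArr.cat K) (KArr.cat (.all C)) und forgetArr where
  dom _ := rfl
  cod _ := rfl
  ide x := congrArg KArr.mk (K.toC_id x)
  comp := by
    rintro ⟨f⟩ ⟨g⟩ h
    dsimp only at h
    subst h
    exact congrArg KArr.mk (K.toC_comp _ _)

lemma isFun_forgetH {K L : ArrowKind und} (Q : QuintetKind K L) :
    IsFun (Quintet.catH Q) (Quintet.catH (.all (.all C) (.all C))) forgetArr forgetQuintet where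
  dom _ := rfl
  cod _ := rfl
  ide x := Quintet.mk_congr (K.toC_id _) (K.toC_id _) rfl rfl ((mk_eqToHom
    ((congrArg (· ≫ L.toC x.hom) (K.toC_id _)).trans ((Strict.id_comp _).trans
      ((Strict.comp_id _).symm.trans (congrArg (L.toC x.hom ≫ ·) (K.toC_id _).symm))))).trans
    ((congrArg (fun f => Arrow.mk (𝟙 (f ≫ L.toC x.hom))) (K.toC_id _)).trans (mk_eqToHom _).symm))
  comp := by
    rintro ⟨r, s, u, v, π, c⟩ ⟨r', s', v', w, θ, c'⟩ ⟨⟩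
    have h₁ : (pasteH π θ).left = K.toC (K.comp r r') ≫ L.toC w := by
      rw [pasteH_left, K.toC_comp]
    have h₂ : (pasteH π θ).right = L.toC u ≫ K.toC (K.comp s s') := by
      rw [pasteH_right, K.toC_comp]
    refine Quintet.mk_congr (K.toC_comp _ _) (K.toC_comp _ _) rfl rfl
      ((mk_homOf (pasteH π θ) h₁ h₂).trans
        (mk_homOf (pasteH π θ) (pasteH_left _ _) (pasteH_right _ _)).symm)

lemma isFun_forgetV {K L : ArrowKind und} (Q : QuintetKind K L) :
    IsFun (Quintet.catV Q) (Quintet.catV (.all (.all C) (.all C))) forgetArr forgetQuintet where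
  dom _ := rfl
  cod _ := rfl
  ide x := Quintet.mk_congr rfl rfl (L.toC_id _) (L.toC_id _) ((mk_eqToHom
    ((congrArg (K.toC x.hom ≫ ·) (L.toC_id _)).trans ((Strict.comp_id _).trans
      ((Strict.id_comp _).symm.trans (congrArg (· ≫ K.toC x.hom) (L.toC_id _).symm))))).trans
    ((congrArg (fun f => Arrow.mk (𝟙 (K.toC x.hom ≫ f))) (L.toC_id _)).trans (mk_eqToHom _).symm))
  comp := by
    rintro ⟨r, s, u, v, π, c⟩ ⟨r', s', v', w, θ, c'⟩ ⟨⟩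
    have h₁ : (pasteV π θ).left = K.toC r ≫ L.toC (L.comp v w) := by
      rw [pasteV_left, L.toC_comp]
    have h₂ : (pasteV π θ).right = L.toC (L.comp u v') ≫ K.toC s' := by
      rw [pasteV_right, L.toC_comp]
    refine Quintet.mk_congr rfl rfl (L.toC_comp _ _) (L.toC_comp _ _)
      ((mk_homOf (pasteV π θ) h₁ h₂).trans
        (mk_homOf (pasteV π θ) (pasteV_left _ _) (pasteV_right _ _)).symm)

/-- The forgetful triple functor. -/
def forget (K : CellKinds und) : TripleFunctor K.triple (CellKinds.all C).triple where
  ob := und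
  a0 := forgetArr
  a1 := forgetArr
  a2 := forgetArr
  s01 := forgetQuintet
  s02 := forgetQuintet
  s12 := forgetQuintet
  cube X := ⟨forgetQuintet X.φ, forgetQuintet X.ψ, forgetQuintet X.π, forgetQuintet X.ρ,
    forgetQuintet X.ω, forgetQuintet X.ζ, by
      obtain ⟨_, _, _, _, _, _, ⟨c⟩⟩ := X
      exact .mk c⟩
  f0 := isFun_forgetArr _
  f1 := isFun_forgetArr _
  f2 := isFun_forgetArr _
  f01_0 := isFun_forgetH _
  f01_1 := isFun_forgetV _
  f02_0 := isFun_forgetH _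
  f02_2 := isFun_forgetV _
  f12_1 := isFun_forgetH _
  f12_2 := isFun_forgetV _
  fq0 := ⟨fun _ => rfl, fun _ => rfl,
    fun _ => QCube.ext ((isFun_forgetH _).ide _) ((isFun_forgetH _).ide _)
      ((isFun_forgetH _).ide _) ((isFun_forgetH _).ide _) rfl rfl,
    fun _ _ _ => QCube.ext ((isFun_forgetH _).comp _ _ _) ((isFun_forgetH _).comp _ _ _)
      ((isFun_forgetH _).comp _ _ _) ((isFun_forgetH _).comp _ _ _) rfl rfl⟩
  fq1 := ⟨fun _ => rfl, fun _ => rfl,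
    fun _ => QCube.ext ((isFun_forgetV _).ide _) ((isFun_forgetV _).ide _) rfl rfl
      ((isFun_forgetH _).ide _) ((isFun_forgetH _).ide _),
    fun _ _ _ => QCube.ext ((isFun_forgetV _).comp _ _ _) ((isFun_forgetV _).comp _ _ _) rfl rfl
      ((isFun_forgetH _).comp _ _ _) ((isFun_forgetH _).comp _ _ _)⟩
  fq2 := ⟨fun _ => rfl, fun _ => rfl,
    fun _ => QCube.ext rfl rfl ((isFun_forgetV _).ide _) ((isFun_forgetV _).ide _)
      ((isFun_forgetV _).ide _) ((isFun_forgetV _).ide _),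
    fun _ _ _ => QCube.ext rfl rfl ((isFun_forgetV _).comp _ _ _) ((isFun_forgetV _).comp _ _ _)
      ((isFun_forgetV _).comp _ _ _) ((isFun_forgetV _).comp _ _ _)⟩

end CellKinds
end TripleCat

namespace TripleCat
open Bicategory

section
variable {C : Type u} [Bicategory.{w, v} C]

/-- The action of a 2-functor on a 2-cell. -/
def mapCell (T : StrictPseudofunctor C C) {X Y : C} (a : Arrow (X ⟶ Y)) :
    Arrow (T.obj X ⟶ T.obj Y) := Arrow.mk (T.map₂ a.hom)

section
variable (T : StrictPseudofunctor C C) {X Y Z : C}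

@[simp] lemma mapCell_left (a : Arrow (X ⟶ Y)) : (mapCell T a).left = T.map a.left := rfl
@[simp] lemma mapCell_right (a : Arrow (X ⟶ Y)) : (mapCell T a).right = T.map a.right := rfl

lemma mapCell_id (f : X ⟶ Y) : mapCell T (Arrow.mk (𝟙 f)) = Arrow.mk (𝟙 (T.map f)) := by
  simp [mapCell]

lemma mapCell_vcomp (a b : Arrow (X ⟶ Y)) (h) :
    mapCell T (vcomp a b h) = vcomp (mapCell T a) (mapCell T b) (congrArg T.map h) := by
  simp [mapCell, vcomp, PrelaxFunctor.map₂_eqToHom]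

lemma mapCell_whL (f : X ⟶ Y) (a : Arrow (Y ⟶ Z)) :
    mapCell T (whL f a) = whL (T.map f) (mapCell T a) := by
  simp [mapCell, whL, Pseudofunctor.map₂_whisker_left, StrictPseudofunctor.mapComp_eq_eqToIso]

lemma mapCell_whR (a : Arrow (X ⟶ Y)) (g : Y ⟶ Z) :
    mapCell T (whR a g) = whR (mapCell T a) (T.map g) := by
  simp [mapCell, whR, Pseudofunctor.map₂_whisker_right, StrictPseudofunctor.mapComp_eq_eqToIso]

end
end

/-- A 2-monad on a 2-category: a 2-functor `T`, and 2-natural transformations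
`unit : 1 ⟶ T` and `mult : T ∘ T ⟶ T`, satisfying the axioms of a monad. -/
structure TwoMonad (C : Type u) [Bicategory.{w, v} C] [Strict C] where
  T : StrictPseudofunctor C C
  unit : ∀ X, X ⟶ T.obj X
  mult : ∀ X, T.obj (T.obj X) ⟶ T.obj X
  unit_nat : ∀ {X Y : C} (f : X ⟶ Y), f ≫ unit Y = unit X ≫ T.map f
  unit_nat₂ : ∀ {X Y : C} (a : Arrow (X ⟶ Y)), whR a (unit Y) = whL (unit X) (mapCell T a)
  mult_nat : ∀ {X Y : C} (f : X ⟶ Y), T.map (T.map f) ≫ mult Y = mult X ≫ T.map f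
  mult_nat₂ : ∀ {X Y : C} (a : Arrow (X ⟶ Y)),
    whR (mapCell T (mapCell T a)) (mult Y) = whL (mult X) (mapCell T a)
  unit_mult : ∀ X, unit (T.obj X) ≫ mult X = 𝟙 (T.obj X)
  map_unit_mult : ∀ X, T.map (unit X) ≫ mult X = 𝟙 (T.obj X)
  mult_mult : ∀ X, T.map (mult X) ≫ mult X = mult (T.obj X) ≫ mult X

section
variable {C : Type u} [Bicategory.{w, v} C] [Strict C] (M : TwoMonad C)

/-- The structure of a pseudo algebra on `X`. -/
structure PseudoAlgStr (X : C) where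
  a : M.T.obj X ⟶ X
  ω : 𝟙 X ≅ M.unit X ≫ a
  κ : M.T.map a ≫ a ≅ M.mult X ≫ a
  unit_left : vcomp (whR (mapCell M.T (Arrow.mk ω.hom)) a)
    (whL (M.T.map (M.unit X)) (Arrow.mk κ.hom))
      (by simp [StrictPseudofunctor.map_comp]) = Arrow.mk (𝟙 a)
  unit_right : vcomp (whL a (Arrow.mk ω.hom)) (whL (M.unit (M.T.obj X)) (Arrow.mk κ.hom))
      (by
        change a ≫ M.unit X ≫ a = M.unit (M.T.obj X) ≫ M.T.map a ≫ a
        rw [← Strict.assoc, M.unit_nat, Strict.assoc]) = Arrow.mk (𝟙 a)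
  assoc : vcomp (whL (M.T.map (M.T.map a)) (Arrow.mk κ.hom))
      (whL (M.mult (M.T.obj X)) (Arrow.mk κ.hom))
      (by
        change M.T.map (M.T.map a) ≫ M.mult X ≫ a = M.mult (M.T.obj X) ≫ M.T.map a ≫ a
        rw [← Strict.assoc, M.mult_nat, Strict.assoc]) =
    vcomp (whR (mapCell M.T (Arrow.mk κ.hom)) a) (whL (M.T.map (M.mult X)) (Arrow.mk κ.hom))
      (by simp [StrictPseudofunctor.map_comp])

/-- A pseudo algebra structure is normal if its normaliser is an identity. -/
def PseudoAlgStr.IsNormal {M : TwoMonad C} {X : C} (s : PseudoAlgStr M X) : Prop :=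
  Arrow.mk s.ω.hom = Arrow.mk (𝟙 (𝟙 X))

/-- A pseudo algebra. -/
structure PseudoAlg where
  carrier : C
  str : PseudoAlgStr M carrier

variable {M}

/-- A lax morphism of pseudo algebras. -/
structure LaxMor (A B : PseudoAlg M) where
  f : A.carrier ⟶ B.carrier
  φ : M.T.map f ≫ B.str.a ⟶ A.str.a ≫ f
  unit : vcomp (whL f (Arrow.mk B.str.ω.hom)) (whL (M.unit A.carrier) (Arrow.mk φ))
      (by
        change f ≫ M.unit _ ≫ B.str.a = M.unit _ ≫ M.T.map f ≫ B.str.a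
        rw [← Strict.assoc, M.unit_nat, Strict.assoc]) =
    whR (Arrow.mk A.str.ω.hom) f
  mult : vcomp (whL (M.T.map (M.T.map f)) (Arrow.mk B.str.κ.hom))
      (whL (M.mult A.carrier) (Arrow.mk φ))
      (by
        change M.T.map (M.T.map f) ≫ M.mult _ ≫ B.str.a = M.mult _ ≫ M.T.map f ≫ B.str.a
        rw [← Strict.assoc, M.mult_nat, Strict.assoc]) =
    vcomp₃ (whR (mapCell M.T (Arrow.mk φ)) B.str.a) (whL (M.T.map A.str.a) (Arrow.mk φ))
      (whR (Arrow.mk A.str.κ.hom) f)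
      (by simp [StrictPseudofunctor.map_comp]) (by simp)

/-- A colax morphism of pseudo algebras. -/
structure ColaxMor (A B : PseudoAlg M) where
  r : A.carrier ⟶ B.carrier
  ρ : A.str.a ≫ r ⟶ M.T.map r ≫ B.str.a
  unit : vcomp (whR (Arrow.mk A.str.ω.hom) r) (whL (M.unit A.carrier) (Arrow.mk ρ)) (by simp) =
    whL r (Arrow.mk B.str.ω.hom)
  mult : vcomp (whR (Arrow.mk A.str.κ.hom) r) (whL (M.mult A.carrier) (Arrow.mk ρ)) (by simp) =
    vcomp₃ (whL (M.T.map A.str.a) (Arrow.mk ρ)) (whR (mapCell M.T (Arrow.mk ρ)) B.str.a)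
      (whL (M.T.map (M.T.map r)) (Arrow.mk B.str.κ.hom))
      (by simp [StrictPseudofunctor.map_comp]) (by simp [StrictPseudofunctor.map_comp])

/-- A pseudo morphism of pseudo algebras: a lax morphism whose comparison is invertible. -/
structure PseudoMor (A B : PseudoAlg M) extends LaxMor A B where
  isIso : IsIso φ

variable {A B D E F G : PseudoAlg M}

lemma LaxMor.ext' {x y : LaxMor A B} (h : x.f = y.f) (h' : Arrow.mk x.φ = Arrow.mk y.φ) :
    x = y := by
  obtain ⟨f, φ, _, _⟩ := x
  obtain ⟨g, γ, _, _⟩ := y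
  dsimp only at h h'
  subst h
  obtain rfl := Arrow.mk_injective _ _ h'
  rfl

lemma ColaxMor.ext' {x y : ColaxMor A B} (h : x.r = y.r) (h' : Arrow.mk x.ρ = Arrow.mk y.ρ) :
    x = y := by
  obtain ⟨f, φ, _, _⟩ := x
  obtain ⟨g, γ, _, _⟩ := y
  dsimp only at h h'
  subst h
  obtain rfl := Arrow.mk_injective _ _ h'
  rfl

lemma PseudoMor.ext' {x y : PseudoMor A B} (h : x.toLaxMor = y.toLaxMor) : x = y := by
  obtain ⟨x, _⟩ := x
  obtain ⟨y, _⟩ := y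
  dsimp only at h
  subst h
  rfl

end
end TripleCat

namespace TripleCat
open Bicategory

section
variable {K : Type*} [Category K]

lemma of_two_one {a b c : Arrow K} {h} (E : vcomp a b h = c) :
    pcomp (some a) (some b) = some c :=
  (some_vcomp _ _ h).symm.trans (congrArg some E)

lemma two_one {a b c : Arrow K} {h} (E : pcomp (some a) (some b) = some c) :
    vcomp a b h = c :=
  Option.some_injective _ ((some_vcomp _ _ h).trans E)

lemma of_two_three {a b c d e : Arrow K} {h p q} (E : vcomp a b h = vcomp₃ c d e p q) :
    pcomp (some a) (some b) = pcomp (some c) (pcomp (some d) (some e)) :=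
  (some_vcomp _ _ h).symm.trans ((congrArg some E).trans (some_vcomp₃ _ _ _ _ _))

lemma two_three {a b c d e : Arrow K} {h p q}
    (E : pcomp (some a) (some b) = pcomp (some c) (pcomp (some d) (some e))) :
    vcomp a b h = vcomp₃ c d e p q :=
  Option.some_injective _ ((some_vcomp _ _ h).trans (E.trans (some_vcomp₃ _ _ _ _ _).symm))

lemma pcomp_reassoc2_1 {a b c : Option (Arrow K)} (E : pcomp a b = c) (z) :
    pcomp a (pcomp b z) = pcomp c z := by
  rw [← pcomp_assoc, E]

lemma pcomp_reassoc2_3 {a b c d e : Option (Arrow K)} (E : pcomp a b = pcomp c (pcomp d e)) (z) :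
    pcomp a (pcomp b z) = pcomp c (pcomp d (pcomp e z)) := by
  rw [← pcomp_assoc, E, pcomp_assoc, pcomp_assoc]

end

section
variable {C : Type u} [Bicategory.{w, v} C]

lemma some_whL_vcomp {W X Y : C} (f : W ⟶ X) {a b : Arrow (X ⟶ Y)} (h) :
    some (whL f (vcomp a b h)) = pcomp (some (whL f a)) (some (whL f b)) :=
  (congrArg some (whL_vcomp f a b h)).trans (some_vcomp _ _ _)

lemma some_whR_vcomp {W X Y : C} (f : Y ⟶ W) {a b : Arrow (X ⟶ Y)} (h) :
    some (whR (vcomp a b h) f) = pcomp (some (whR a f)) (some (whR b f)) :=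
  (congrArg some (whR_vcomp a b f h)).trans (some_vcomp _ _ _)

lemma some_whL_vcomp₃ {W X Y : C} (f : W ⟶ X) {a b c : Arrow (X ⟶ Y)} (h h') :
    some (whL f (vcomp₃ a b c h h')) =
      pcomp (some (whL f a)) (pcomp (some (whL f b)) (some (whL f c))) :=
  (congrArg some (whL_three f a b c h h')).trans (some_vcomp₃ _ _ _ _ _)

lemma some_whR_vcomp₃ {W X Y : C} (f : Y ⟶ W) {a b c : Arrow (X ⟶ Y)} (h h') :
    some (whR (vcomp₃ a b c h h') f) =
      pcomp (some (whR a f)) (pcomp (some (whR b f)) (some (whR c f))) :=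
  (congrArg some (whR_three f a b c h h')).trans (some_vcomp₃ _ _ _ _ _)

lemma two_one_whL {W X Y : C} (f : W ⟶ X) {a b c : Arrow (X ⟶ Y)} {h} (E : vcomp a b h = c) :
    pcomp (some (whL f a)) (some (whL f b)) = some (whL f c) :=
  (some_whL_vcomp f h).symm.trans (congrArg (fun x => some (whL f x)) E)

lemma two_one_whR {W X Y : C} (f : Y ⟶ W) {a b c : Arrow (X ⟶ Y)} {h} (E : vcomp a b h = c) :
    pcomp (some (whR a f)) (some (whR b f)) = some (whR c f) :=
  (some_whR_vcomp f h).symm.trans (congrArg (fun x => some (whR x f)) E)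

lemma two_three_whL {W X Y : C} (f : W ⟶ X) {a b c d e : Arrow (X ⟶ Y)} {h p q}
    (E : vcomp a b h = vcomp₃ c d e p q) :
    pcomp (some (whL f a)) (some (whL f b)) =
      pcomp (some (whL f c)) (pcomp (some (whL f d)) (some (whL f e))) :=
  (some_whL_vcomp f h).symm.trans
    ((congrArg (fun x => some (whL f x)) E).trans (some_whL_vcomp₃ f p q))

lemma two_three_whR {W X Y : C} (f : Y ⟶ W) {a b c d e : Arrow (X ⟶ Y)} {h p q}
    (E : vcomp a b h = vcomp₃ c d e p q) :
    pcomp (some (whR a f)) (some (whR b f)) =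
      pcomp (some (whR c f)) (pcomp (some (whR d f)) (some (whR e f))) :=
  (some_whR_vcomp f h).symm.trans
    ((congrArg (fun x => some (whR x f)) E).trans (some_whR_vcomp₃ f p q))

variable [Strict C]

lemma mapCell_pasteH (T : StrictPseudofunctor C C)
    {A B E A' D F : C} {r : A ⟶ B} {r' : B ⟶ E} {s : A' ⟶ D} {s' : D ⟶ F}
    {u : A ⟶ A'} {v : B ⟶ D} {w : E ⟶ F} (π : r ≫ v ⟶ u ≫ s) (θ : r' ≫ w ⟶ v ≫ s') :
    some (mapCell T (pasteH π θ)) = pcomp (some (whL (T.map r) (mapCell T (Arrow.mk θ))))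
      (some (whR (mapCell T (Arrow.mk π)) (T.map s'))) := by
  rw [← mapCell_whL, ← mapCell_whR]
  exact (congrArg some (mapCell_vcomp T _ _ _)).trans (some_vcomp _ _ _)

lemma mapCell_pasteV (T : StrictPseudofunctor C C)
    {A B A' D A'' F : C} {r : A ⟶ B} {s : A' ⟶ D} {t : A'' ⟶ F}
    {u : A ⟶ A'} {u' : A' ⟶ A''} {v : B ⟶ D} {v' : D ⟶ F}
    (π : r ≫ v ⟶ u ≫ s) (ζ : s ≫ v' ⟶ u' ≫ t) :
    some (mapCell T (pasteV π ζ)) = pcomp (some (whR (mapCell T (Arrow.mk π)) (T.map v')))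
      (some (whL (T.map u) (mapCell T (Arrow.mk ζ)))) := by
  rw [← mapCell_whL, ← mapCell_whR]
  exact (congrArg some (mapCell_vcomp T _ _ _)).trans (some_vcomp _ _ _)

/-- Right whiskering of a whole pasting. -/
lemma whR_map_pasteH (T : StrictPseudofunctor C C) {Z : C}
    {A B E A' D F : C} {r : A ⟶ B} {r' : B ⟶ E} {s : A' ⟶ D} {s' : D ⟶ F}
    {u : A ⟶ A'} {v : B ⟶ D} {w : E ⟶ F} (π : r ≫ v ⟶ u ≫ s) (θ : r' ≫ w ⟶ v ≫ s')
    (k : T.obj F ⟶ Z) :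
    some (whR (mapCell T (pasteH π θ)) k) =
      pcomp (some (whL (T.map r) (whR (mapCell T (Arrow.mk θ)) k)))
        (some (whR (whR (mapCell T (Arrow.mk π)) (T.map s')) k)) := by
  rw [← whR_whL, ← mapCell_whL, ← mapCell_whR]
  exact (congrArg (fun x => some (whR x k)) (mapCell_vcomp T _ _ _)).trans (some_whR_vcomp _ _)

lemma whR_map_pasteV (T : StrictPseudofunctor C C) {Z : C}
    {A B A' D A'' F : C} {r : A ⟶ B} {s : A' ⟶ D} {t : A'' ⟶ F}
    {u : A ⟶ A'} {u' : A' ⟶ A''} {v : B ⟶ D} {v' : D ⟶ F}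
    (π : r ≫ v ⟶ u ≫ s) (ζ : s ≫ v' ⟶ u' ≫ t) (k : T.obj F ⟶ Z) :
    some (whR (mapCell T (pasteV π ζ)) k) =
      pcomp (some (whR (whR (mapCell T (Arrow.mk π)) (T.map v')) k))
        (some (whL (T.map u) (whR (mapCell T (Arrow.mk ζ)) k))) := by
  rw [← whR_whL, ← mapCell_whL, ← mapCell_whR]
  exact (congrArg (fun x => some (whR x k)) (mapCell_vcomp T _ _ _)).trans (some_whR_vcomp _ _)

end

section
variable {C : Type u} [Bicategory.{w, v} C] [Strict C] {M : TwoMonad C}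
variable {A B D E F G : PseudoAlg M}

/-- The identity lax morphism. -/
def LaxMor.id (A : PseudoAlg M) : LaxMor A A where
  f := 𝟙 A.carrier
  φ := eqToHom (by rw [M.T.map_id, Strict.id_comp, Strict.comp_id])
  unit := two_one (by
    rw [mk_eqToHom, whL_idc, whL_id, whR_id]
    exact pcomp_idc _ (by simp [M.T.map_id]))
  mult := two_three (by
    simp only [mk_eqToHom, mapCell_id, whL_idc, whR_idc, whR_id, M.T.map_id, whL_id]
    exact (pcomp_idc _ (by simp [M.T.map_id])).trans
      (unit_left _ (by simp [M.T.map_id]) (by simp [M.T.map_id])).symm)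

/-- Composition of lax morphisms. -/
def LaxMor.comp (x : LaxMor A B) (y : LaxMor B D) : LaxMor A D where
  f := x.f ≫ y.f
  φ := homOf (pasteH x.φ y.φ) (by rw [pasteH_left, M.T.map_comp]) (pasteH_right _ _)
  unit := two_one (by
    have h₁ := two_one_whL x.f y.unit
    have h₂ := two_one_whR y.f x.unit
    have e := M.unit_nat x.f
    rw [mk_homOf, Quintet.whL_pasteH, ← whL_comp, ← e, whR_comp]
    simp only [whL_comp, whR_whL] at h₁ h₂ ⊢
    rw [← pcomp_assoc, h₁, h₂])
  mult := two_three (by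
    have h₁ := two_three_whL (M.T.map (M.T.map x.f)) y.mult
    have h₂ := two_three_whR y.f x.mult
    have e := M.mult_nat x.f
    have e' := exchange' (mapCell M.T (Arrow.mk x.φ)) (Arrow.mk y.φ) rfl rfl rfl rfl
    rw [mk_homOf, Quintet.whL_pasteH, Quintet.whL_pasteH, whR_map_pasteH, whR_comp, ← whL_comp,
      ← e]
    simp only [mapCell_left, mapCell_right, Arrow.mk_left, Arrow.mk_right] at e'
    simp only [M.T.map_comp, pcomp_assoc, whL_comp, whR_comp, whR_whL] at h₁ h₂ e' ⊢
    rw [pcomp_reassoc2_3 h₁, h₂, pcomp_reassoc2 e'])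

/-- The identity colax morphism. -/
def ColaxMor.id (A : PseudoAlg M) : ColaxMor A A where
  r := 𝟙 A.carrier
  ρ := eqToHom (by rw [M.T.map_id, Strict.id_comp, Strict.comp_id])
  unit := two_one (by
    rw [mk_eqToHom, whL_idc, whL_id, whR_id]
    exact pcomp_idc _ (by simp))
  mult := two_three (by
    simp only [mk_eqToHom, mapCell_id, whL_idc, whR_idc, whR_id, M.T.map_id, whL_id]
    exact (pcomp_idc _ (by simp)).trans
      (unit_left _ (by simp) (by simp)).symm)

/-- Composition of colax morphisms. -/
def ColaxMor.comp (x : ColaxMor A B) (y : ColaxMor B D) : ColaxMor A D where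
  r := x.r ≫ y.r
  ρ := homOf (pasteV x.ρ y.ρ) (pasteV_left _ _) (by rw [pasteV_right, M.T.map_comp])
  unit := two_one (by
    have h₁ := two_one_whL x.r y.unit
    have h₂ := two_one_whR y.r x.unit
    have e := M.unit_nat x.r
    rw [mk_homOf, Quintet.whL_pasteV, ← e, whR_comp]
    simp only [whL_comp, whR_whL] at h₁ h₂ ⊢
    rw [← pcomp_assoc, h₂, h₁])
  mult := two_three (by
    have h₁ := two_three_whL (M.T.map (M.T.map x.r)) y.mult
    have h₂ := two_three_whR y.r x.mult
    have e := M.mult_nat x.r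
    have e' := exchange' (mapCell M.T (Arrow.mk x.ρ)) (Arrow.mk y.ρ) rfl rfl rfl rfl
    rw [mk_homOf, Quintet.whL_pasteV, Quintet.whL_pasteV, whR_map_pasteV, whR_comp, ← e]
    simp only [mapCell_left, mapCell_right, Arrow.mk_left, Arrow.mk_right] at e'
    simp only [M.T.map_comp, pcomp_assoc, whL_comp, whR_comp, whR_whL] at h₁ h₂ e' ⊢
    rw [pcomp_reassoc2_3 h₂, h₁, pcomp_reassoc2 e'])

lemma LaxMor.mk_comp (x : LaxMor A B) (y : LaxMor B D) :
    Arrow.mk (x.comp y).φ = pasteH x.φ y.φ :=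
  mk_homOf _ ((pasteH_left _ _).trans (congrArg (· ≫ D.str.a) (M.T.map_comp x.f y.f).symm))
    (pasteH_right _ _)

lemma LaxMor.mk_id (A : PseudoAlg M) :
    Arrow.mk (LaxMor.id A).φ = Arrow.mk (𝟙 (M.T.map (𝟙 _) ≫ A.str.a)) :=
  mk_eqToHom ((congrArg (· ≫ A.str.a) (M.T.map_id _)).trans
    ((Strict.id_comp _).trans (Strict.comp_id _).symm))

lemma ColaxMor.mk_comp (x : ColaxMor A B) (y : ColaxMor B D) :
    Arrow.mk (x.comp y).ρ = pasteV x.ρ y.ρ :=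
  mk_homOf _ (pasteV_left _ _)
    ((pasteV_right _ _).trans (congrArg (· ≫ D.str.a) (M.T.map_comp x.r y.r).symm))

lemma ColaxMor.mk_id (A : PseudoAlg M) :
    Arrow.mk (ColaxMor.id A).ρ = Arrow.mk (𝟙 (A.str.a ≫ 𝟙 _)) :=
  mk_eqToHom ((Strict.comp_id _).trans
    ((Strict.id_comp _).symm.trans (congrArg (· ≫ A.str.a) (M.T.map_id _).symm)))

lemma LaxMor.id_comp' (x : LaxMor A B) : LaxMor.comp (.id A) x = x :=
  LaxMor.ext' (Strict.id_comp _) (Option.some_injective _ (by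
    rw [LaxMor.mk_comp, Quintet.some_pasteH, LaxMor.mk_id]
    change pcomp (some (whL (M.T.map (𝟙 _)) _)) _ = _
    rw [whR_idc, M.T.map_id, whL_id]
    exact pcomp_idc _ (by simp)))

lemma LaxMor.comp_id' (x : LaxMor A B) : LaxMor.comp x (.id B) = x :=
  LaxMor.ext' (Strict.comp_id _) (Option.some_injective _ (by
    rw [LaxMor.mk_comp, Quintet.some_pasteH, LaxMor.mk_id]
    change pcomp _ (some (whR _ (𝟙 _))) = _
    rw [whL_idc, whR_id]
    exact idc_pcomp _ (by simp [M.T.map_id])))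

lemma LaxMor.assoc' (x : LaxMor A B) (y : LaxMor B D) (z : LaxMor D E) :
    (x.comp y).comp z = x.comp (y.comp z) :=
  LaxMor.ext' (Strict.assoc _ _ _) (Option.some_injective _ (by
    rw [LaxMor.mk_comp, LaxMor.mk_comp, Quintet.some_pasteH, Quintet.some_pasteH,
      LaxMor.mk_comp, LaxMor.mk_comp, Quintet.whL_pasteH, Quintet.whR_pasteH, pcomp_assoc]
    change pcomp (some (whL (M.T.map (_ ≫ _)) _)) _ = pcomp _ (pcomp _ (some (whR _ (_ ≫ _))))
    rw [M.T.map_comp, whL_comp]))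

lemma ColaxMor.id_comp' (x : ColaxMor A B) : ColaxMor.comp (.id A) x = x :=
  ColaxMor.ext' (Strict.id_comp _) (Option.some_injective _ (by
    rw [ColaxMor.mk_comp, Quintet.some_pasteV, ColaxMor.mk_id]
    change pcomp _ (some (whL (M.T.map (𝟙 _)) _)) = _
    rw [whR_idc, M.T.map_id, whL_id]
    exact idc_pcomp _ (by simp)))

lemma ColaxMor.comp_id' (x : ColaxMor A B) : ColaxMor.comp x (.id B) = x :=
  ColaxMor.ext' (Strict.comp_id _) (Option.some_injective _ (by
    rw [ColaxMor.mk_comp, Quintet.some_pasteV, ColaxMor.mk_id]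
    change pcomp (some (whR _ (𝟙 _))) _ = _
    rw [whL_idc, whR_id]
    exact pcomp_idc _ (by simp)))

lemma ColaxMor.assoc' (x : ColaxMor A B) (y : ColaxMor B D) (z : ColaxMor D E) :
    (x.comp y).comp z = x.comp (y.comp z) :=
  ColaxMor.ext' (Strict.assoc _ _ _) (Option.some_injective _ (by
    rw [ColaxMor.mk_comp, ColaxMor.mk_comp, Quintet.some_pasteV, Quintet.some_pasteV,
      ColaxMor.mk_comp, ColaxMor.mk_comp, Quintet.whL_pasteV, Quintet.whR_pasteV, pcomp_assoc]
    change pcomp _ (pcomp _ (some (whL (M.T.map (_ ≫ _)) _))) = pcomp (some (whR _ (_ ≫ _))) _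
    rw [M.T.map_comp, whL_comp]))

lemma isIso_homOf {K : Type*} [Category K] (a : Arrow K) [IsIso a.hom] {X Y : K} (h : a.left = X)
    (h' : a.right = Y) : IsIso (homOf a h h') := by
  unfold homOf; infer_instance

lemma isIso_vcomp {K : Type*} [Category K] (a b : Arrow K) [IsIso a.hom] [IsIso b.hom] (h) :
    IsIso (vcomp a b h).hom := by
  change IsIso (a.hom ≫ eqToHom h ≫ b.hom)
  infer_instance

/-- The identity pseudo morphism. -/
def PseudoMor.id (A : PseudoAlg M) : PseudoMor A A where
  toLaxMor := .id A
  isIso := by unfold LaxMor.id; infer_instance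

/-- Composition of pseudo morphisms. -/
def PseudoMor.comp (x : PseudoMor A B) (y : PseudoMor B D) : PseudoMor A D where
  toLaxMor := x.toLaxMor.comp y.toLaxMor
  isIso := by
    have := x.isIso
    have := y.isIso
    have h₁ : IsIso (whL (M.T.map x.f) (Arrow.mk y.φ)).hom := by
      change IsIso (_ ◁ y.φ); infer_instance
    have h₂ : IsIso (whR (Arrow.mk x.φ) y.f).hom := by
      change IsIso (x.φ ▷ _); infer_instance
    have h₃ : IsIso (pasteH x.φ y.φ).hom := isIso_vcomp _ _ _
    exact isIso_homOf _
      ((pasteH_left _ _).trans (congrArg (· ≫ D.str.a) (M.T.map_comp x.f y.f).symm))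
      (pasteH_right _ _)

end

section
variable {C : Type (u + 1)} [Bicategory.{u, u} C] [Strict C] (M : TwoMonad C)

/-- Lax morphisms. -/
def laxKind : ArrowKind (PseudoAlg.carrier (M := M)) where
  Hom := LaxMor
  id := .id
  comp := .comp
  id_comp := LaxMor.id_comp'
  comp_id := LaxMor.comp_id'
  assoc := LaxMor.assoc'
  toC x := x.f
  toC_id _ := rfl
  toC_comp _ _ := rfl

/-- Colax morphisms. -/
def colaxKind : ArrowKind (PseudoAlg.carrier (M := M)) where
  Hom := ColaxMor
  id := .id
  comp := .comp
  id_comp := ColaxMor.id_comp'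
  comp_id := ColaxMor.comp_id'
  assoc := ColaxMor.assoc'
  toC x := x.r
  toC_id _ := rfl
  toC_comp _ _ := rfl

/-- Pseudo morphisms. -/
def pseudoKind : ArrowKind (PseudoAlg.carrier (M := M)) where
  Hom := PseudoMor
  id := .id
  comp := .comp
  id_comp _ := PseudoMor.ext' (LaxMor.id_comp' _)
  comp_id _ := PseudoMor.ext' (LaxMor.comp_id' _)
  assoc _ _ _ := PseudoMor.ext' (LaxMor.assoc' _ _ _)
  toC x := x.f
  toC_id _ := rfl
  toC_comp _ _ := rfl

end
end TripleCat

namespace TripleCat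
open Bicategory

section
variable {C : Type u} [Bicategory.{w, v} C] [Strict C] {M : TwoMonad C}
variable {A B D E F G : PseudoAlg M}

/-- Coherence of a 2-cell with four lax morphisms. -/
def LaxCoh (r : LaxMor A B) (s : LaxMor D E) (u : LaxMor A D) (v : LaxMor B E)
    (π : r.f ≫ v.f ⟶ u.f ≫ s.f) : Prop :=
  vcomp₃ (whL (M.T.map r.f) (Arrow.mk v.φ)) (whR (Arrow.mk r.φ) v.f) (whL A.str.a (Arrow.mk π))
      (by simp) (by simp) =
    vcomp₃ (whR (mapCell M.T (Arrow.mk π)) E.str.a) (whL (M.T.map u.f) (Arrow.mk s.φ))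
      (whR (Arrow.mk u.φ) s.f) (by simp [M.T.map_comp]) (by simp)

/-- Coherence of a 2-cell with two lax morphisms (top and bottom) and two colax morphisms
(left and right). -/
def LaxColaxCoh (f : LaxMor A B) (g : LaxMor D E) (r : ColaxMor A D) (s : ColaxMor B E)
    (π : f.f ≫ s.r ⟶ r.r ≫ g.f) : Prop :=
  vcomp₃ (whR (Arrow.mk f.φ) s.r) (whL A.str.a (Arrow.mk π)) (whR (Arrow.mk r.ρ) g.f)
      (by simp) (by simp) =
    vcomp₃ (whL (M.T.map f.f) (Arrow.mk s.ρ)) (whR (mapCell M.T (Arrow.mk π)) E.str.a)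
      (whL (M.T.map r.r) (Arrow.mk g.φ)) (by simp [M.T.map_comp]) (by simp [M.T.map_comp])

lemma LaxCoh.idH (u : LaxMor A D) (h) : LaxCoh (.id A) (.id D) u u (eqToHom h) :=
  three_of (by
    rw [LaxMor.mk_id, LaxMor.mk_id, mk_eqToHom, mapCell_id, whL_idc, whR_idc, whR_idc, whL_idc]
    change pcomp (some (whL (M.T.map (𝟙 _)) _)) _ = pcomp _ (pcomp _ (some (whR _ (𝟙 _))))
    rw [M.T.map_id, whL_id, whR_id]
    exact (unit_right _ (by simp) (by simp [LaxMor.id])).trans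
      (unit_left _ (by simp [LaxMor.id]) (by simp [M.T.map_id])).symm)

lemma LaxCoh.idV (r : LaxMor A B) (h) : LaxCoh r r (.id A) (.id B) (eqToHom h) :=
  three_of (by
    rw [LaxMor.mk_id, LaxMor.mk_id, mk_eqToHom, mapCell_id, whL_idc, whR_idc, whR_idc, whL_idc]
    change pcomp _ (pcomp (some (whR _ (𝟙 _))) _) = pcomp _ (pcomp (some (whL (M.T.map (𝟙 _)) _)) _)
    rw [M.T.map_id A.carrier, whL_id, whR_id]
    exact (unit_mid _ (by simp [M.T.map_id]) (by simp [LaxMor.id])).trans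
      (unit_mid _ (by simp [LaxMor.id]) (by simp)).symm)

lemma LaxCoh.compH {r : LaxMor A B} {r' : LaxMor B F} {s : LaxMor D E} {s' : LaxMor E G}
    {u : LaxMor A D} {v : LaxMor B E} {w : LaxMor F G} {π θ} (c : LaxCoh r s u v π)
    (d : LaxCoh r' s' v w θ) (h h') :
    LaxCoh (r.comp r') (s.comp s') u w (homOf (pasteH π θ) h h') :=
  three_of (by
    rw [mk_homOf, LaxMor.mk_comp, LaxMor.mk_comp, Quintet.whR_pasteH, Quintet.whL_pasteH,
      Quintet.whL_pasteH, whR_map_pasteH]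
    change pcomp (some (whL (M.T.map (r.f ≫ r'.f)) _)) _ =
      pcomp _ (pcomp _ (some (whR _ (s.f ≫ s'.f))))
    have c' := three_whR s'.f c
    have d' := three_whL (M.T.map r.f) d
    have e := exchange' (Arrow.mk r.φ) (Arrow.mk θ) rfl rfl rfl rfl
    have e' := exchange' (mapCell M.T (Arrow.mk π)) (Arrow.mk s'.φ) rfl rfl rfl rfl
    simp only [mapCell_left, mapCell_right, Arrow.mk_left, Arrow.mk_right] at e e'
    simp only [pcomp_assoc, whL_comp, whR_comp, whR_whL, M.T.map_comp] at c' d' e e' ⊢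
    rw [pcomp_reassoc2 e.symm, pcomp_reassoc3 d', c', pcomp_reassoc2 e'])

lemma LaxCoh.compV {r : LaxMor A B} {s : LaxMor D E} {t : LaxMor F G} {u : LaxMor A D}
    {u' : LaxMor D F} {v : LaxMor B E} {v' : LaxMor E G} {π ζ} (c : LaxCoh r s u v π)
    (d : LaxCoh s t u' v' ζ) (h h') :
    LaxCoh r t (u.comp u') (v.comp v') (homOf (pasteV π ζ) h h') :=
  three_of (by
    rw [mk_homOf, LaxMor.mk_comp, LaxMor.mk_comp, Quintet.whL_pasteH, Quintet.whR_pasteH,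
      Quintet.whL_pasteV, whR_map_pasteV]
    change pcomp _ (pcomp (some (whR _ (v.f ≫ v'.f))) _) =
      pcomp _ (pcomp (some (whL (M.T.map (u.f ≫ u'.f)) _)) _)
    have c' := three_whR v'.f c
    have d' := three_whL (M.T.map u.f) d
    have e := exchange' (Arrow.mk u.φ) (Arrow.mk ζ) rfl rfl rfl rfl
    have e' := exchange' (mapCell M.T (Arrow.mk π)) (Arrow.mk v'.φ) rfl rfl rfl rfl
    simp only [mapCell_left, mapCell_right, Arrow.mk_left, Arrow.mk_right] at e e'
    simp only [pcomp_assoc, whL_comp, whR_comp, whR_whL, M.T.map_comp] at c' d' e e' ⊢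
    rw [pcomp_reassoc3 c', e.symm, pcomp_reassoc2 e', pcomp_reassoc3 d'])

lemma LaxColaxCoh.idH (u : ColaxMor A D) (h) : LaxColaxCoh (.id A) (.id D) u u (eqToHom h) :=
  three_of (by
    rw [LaxMor.mk_id, LaxMor.mk_id, mk_eqToHom, mapCell_id, whL_idc, whR_idc, whR_idc, whL_idc]
    change pcomp _ (pcomp _ (some (whR _ (𝟙 _)))) = pcomp (some (whL (M.T.map (𝟙 _)) _)) _
    rw [M.T.map_id, whL_id, whR_id]
    exact (unit_left _ (by simp) (by simp [LaxMor.id])).trans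
      (unit_right _ (by simp [LaxMor.id]) (by simp [M.T.map_id])).symm)

lemma LaxColaxCoh.idV (r : LaxMor A B) (h) : LaxColaxCoh r r (.id A) (.id B) (eqToHom h) :=
  three_of (by
    rw [ColaxMor.mk_id, ColaxMor.mk_id, mk_eqToHom, mapCell_id, whL_idc, whR_idc, whR_idc, whL_idc]
    change pcomp (some (whR _ (𝟙 _))) _ = pcomp _ (pcomp _ (some (whL (M.T.map (𝟙 _)) _)))
    rw [M.T.map_id, whL_id, whR_id]
    exact (unit_right _ (by simp [ColaxMor.id]) (by simp)).trans
      (unit_left _ (by simp) (by simp [ColaxMor.id])).symm)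

lemma LaxColaxCoh.compH {r : LaxMor A B} {r' : LaxMor B F} {s : LaxMor D E} {s' : LaxMor E G}
    {u : ColaxMor A D} {v : ColaxMor B E} {w : ColaxMor F G} {π θ} (c : LaxColaxCoh r s u v π)
    (d : LaxColaxCoh r' s' v w θ) (h h') :
    LaxColaxCoh (r.comp r') (s.comp s') u w (homOf (pasteH π θ) h h') :=
  three_of (by
    rw [mk_homOf, LaxMor.mk_comp, LaxMor.mk_comp, Quintet.whR_pasteH, Quintet.whL_pasteH,
      Quintet.whL_pasteH, whR_map_pasteH]
    change pcomp _ (pcomp _ (some (whR _ (s.f ≫ s'.f)))) =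
      pcomp (some (whL (M.T.map (r.f ≫ r'.f)) _)) _
    have c' := three_whR s'.f c
    have d' := three_whL (M.T.map r.f) d
    have e := exchange' (Arrow.mk r.φ) (Arrow.mk θ) rfl rfl rfl rfl
    have e' := exchange' (mapCell M.T (Arrow.mk π)) (Arrow.mk s'.φ) rfl rfl rfl rfl
    simp only [mapCell_left, mapCell_right, Arrow.mk_left, Arrow.mk_right] at e e'
    simp only [pcomp_assoc, whL_comp, whR_comp, whR_whL, M.T.map_comp] at c' d' e e' ⊢
    rw [pcomp_reassoc2 e.symm, c', pcomp_reassoc3 d', pcomp_reassoc2 e'])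

lemma LaxColaxCoh.compV {r : LaxMor A B} {s : LaxMor D E} {t : LaxMor F G} {u : ColaxMor A D}
    {u' : ColaxMor D F} {v : ColaxMor B E} {v' : ColaxMor E G} {π ζ} (c : LaxColaxCoh r s u v π)
    (d : LaxColaxCoh s t u' v' ζ) (h h') :
    LaxColaxCoh r t (u.comp u') (v.comp v') (homOf (pasteV π ζ) h h') :=
  three_of (by
    rw [mk_homOf, ColaxMor.mk_comp, ColaxMor.mk_comp, Quintet.whL_pasteV, Quintet.whR_pasteV,
      Quintet.whL_pasteV, whR_map_pasteV]
    change pcomp (some (whR _ (v.r ≫ v'.r))) _ =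
      pcomp _ (pcomp _ (some (whL (M.T.map (u.r ≫ u'.r)) _)))
    have c' := three_whR v'.r c
    have d' := three_whL (M.T.map u.r) d
    have e := exchange' (Arrow.mk u.ρ) (Arrow.mk ζ) rfl rfl rfl rfl
    have e' := exchange' (mapCell M.T (Arrow.mk π)) (Arrow.mk v'.ρ) rfl rfl rfl rfl
    simp only [mapCell_left, mapCell_right, Arrow.mk_left, Arrow.mk_right] at e e'
    simp only [pcomp_assoc, whL_comp, whR_comp, whR_whL, M.T.map_comp] at c' d' e e' ⊢
    rw [pcomp_reassoc2 e, pcomp_reassoc3 c', d', pcomp_reassoc2 e'.symm])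

end

section
variable {C : Type (u + 1)} [Bicategory.{u, u} C] [Strict C] (M : TwoMonad C)

/-- The triple category of pseudo algebras has pseudo, lax and colax morphisms as arrows; the
pseudo morphisms are viewed as lax morphisms in the conditions for the double cells. -/
def algKinds : CellKinds (PseudoAlg.carrier (M := M)) where
  K₀ := pseudoKind M
  K₁ := laxKind M
  K₂ := colaxKind M
  Q01 :=
    { Coh := fun r s u v π => LaxCoh r.toLaxMor s.toLaxMor u v π
      idH := fun u => LaxCoh.idH u _
      idV := fun r => LaxCoh.idV r.toLaxMor _
      compH := fun c d => LaxCoh.compH c d _ _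
      compV := fun c d => LaxCoh.compV c d _ _ }
  Q02 :=
    { Coh := fun r s u v π => LaxColaxCoh r.toLaxMor s.toLaxMor u v π
      idH := fun u => LaxColaxCoh.idH u _
      idV := fun r => LaxColaxCoh.idV r.toLaxMor _
      compH := fun c d => LaxColaxCoh.compH c d _ _
      compV := fun c d => LaxColaxCoh.compV c d _ _ }
  Q12 :=
    { Coh := fun r s u v π => LaxColaxCoh r s u v π
      idH := fun u => LaxColaxCoh.idH u _
      idV := fun r => LaxColaxCoh.idV r _
      compH := fun c d => LaxColaxCoh.compH c d _ _
      compV := fun c d => LaxColaxCoh.compV c d _ _ }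

end

section
variable {C : Type (u + 1)} [Bicategory.{u, u} C] [Strict C] {Ob Ob' : Type (u + 1)} {und : Ob → C}

/-- All arrows between the objects of a subfamily. -/
def ArrowKind.full (K : ArrowKind und) (i : Ob' → Ob) : ArrowKind (fun x => und (i x)) where
  Hom x y := K.Hom (i x) (i y)
  id x := K.id (i x)
  comp := K.comp
  id_comp := K.id_comp
  comp_id := K.comp_id
  assoc := K.assoc
  toC := K.toC
  toC_id x := K.toC_id (i x)
  toC_comp := K.toC_comp

/-- All quintets between the objects of a subfamily. -/
def QuintetKind.full {K L : ArrowKind und} (Q : QuintetKind K L) (i : Ob' → Ob) :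
    QuintetKind (K.full i) (L.full i) where
  Coh := Q.Coh
  idH := Q.idH
  idV := Q.idV
  compH := Q.compH
  compV := Q.compV

/-- The full substructure on a subfamily of the objects. -/
def CellKinds.full (K : CellKinds und) (i : Ob' → Ob) : CellKinds (fun x => und (i x)) :=
  ⟨K.K₀.full i, K.K₁.full i, K.K₂.full i, K.Q01.full i, K.Q02.full i, K.Q12.full i⟩

/-- A normal pseudo algebra. -/
structure NormalPseudoAlg (M : TwoMonad C) extends PseudoAlg M where
  normal : str.IsNormal

/-- The kinds of cells of the triple category of normal pseudo algebras. -/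
def normalAlgKinds (M : TwoMonad C) :
    CellKinds (fun A : NormalPseudoAlg M => A.toPseudoAlg.carrier) :=
  (algKinds M).full NormalPseudoAlg.toPseudoAlg

end
end TripleCat

namespace TripleCat

/-- A graph in the 2-category of (small) categories. -/
structure GphCat : Type (u + 1) where
  A₀ : Type u
  A₁ : Type u
  [cat₀ : SmallCategory A₀]
  [cat₁ : SmallCategory A₁]
  src : A₁ ⥤ A₀
  tgt : A₁ ⥤ A₀

namespace GphCat

attribute [instance] GphCat.cat₀ GphCat.cat₁

/-- A morphism of graphs of categories. -/
@[ext]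
structure Hom (A B : GphCat.{u}) : Type u where
  F₀ : A.A₀ ⥤ B.A₀
  F₁ : A.A₁ ⥤ B.A₁
  src : F₁ ⋙ B.src = A.src ⋙ F₀
  tgt : F₁ ⋙ B.tgt = A.tgt ⋙ F₀

variable {A B D E : GphCat.{u}}

/-- A 2-cell between morphisms of graphs of categories: a pair of natural transformations,
consistent with the faces. -/
@[ext]
structure Hom₂ (F G : Hom A B) : Type u where
  φ₀ : F.F₀ ⟶ G.F₀
  φ₁ : F.F₁ ⟶ G.F₁
  src : ∀ x, Arrow.mk (B.src.map (φ₁.app x)) = Arrow.mk (φ₀.app (A.src.obj x))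
  tgt : ∀ x, Arrow.mk (B.tgt.map (φ₁.app x)) = Arrow.mk (φ₀.app (A.tgt.obj x))

lemma Hom.src_obj (F : Hom A B) (x : A.A₁) : B.src.obj (F.F₁.obj x) = F.F₀.obj (A.src.obj x) :=
  Functor.congr_obj F.src x

lemma Hom.tgt_obj (F : Hom A B) (x : A.A₁) : B.tgt.obj (F.F₁.obj x) = F.F₀.obj (A.tgt.obj x) :=
  Functor.congr_obj F.tgt x

/-- Functors act on arrows. -/
abbrev mapA {K L : Type*} [Category K] [Category L] (F : K ⥤ L) (a : Arrow K) : Arrow L :=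
  Arrow.mk (F.map a.hom)

lemma mapA_congr {K L : Type*} [Category K] [Category L] {F G : K ⥤ L} (h : F = G) {a b : Arrow K}
    (h' : a = b) : mapA F a = mapA G b := by subst h h'; rfl

lemma Hom.src_map (F : Hom A B) {x y : A.A₁} (f : x ⟶ y) :
    Arrow.mk (B.src.map (F.F₁.map f)) = Arrow.mk (F.F₀.map (A.src.map f)) :=
  mapA_congr F.src (a := Arrow.mk f) rfl

lemma Hom.tgt_map (F : Hom A B) {x y : A.A₁} (f : x ⟶ y) :
    Arrow.mk (B.tgt.map (F.F₁.map f)) = Arrow.mk (F.F₀.map (A.tgt.map f)) :=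
  mapA_congr F.tgt (a := Arrow.mk f) rfl

lemma mk_comp_congr {K : Type*} [Category K] {X Y Z X' Y' Z' : K} {f : X ⟶ Y} {g : Y ⟶ Z}
    {f' : X' ⟶ Y'} {g' : Y' ⟶ Z'} (h : Arrow.mk f = Arrow.mk f') (h' : Arrow.mk g = Arrow.mk g') :
    Arrow.mk (f ≫ g) = Arrow.mk (f' ≫ g') := by
  obtain rfl : X = X' := congrArg (·.left) h
  obtain rfl : Y = Y' := congrArg (·.right) h
  obtain rfl : Z = Z' := congrArg (·.right) h'
  obtain rfl := Arrow.mk_injective _ _ h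
  obtain rfl := Arrow.mk_injective _ _ h'
  rfl

instance (A B : GphCat.{u}) : Category (Hom A B) where
  Hom F G := Hom₂ F G
  id F :=
    { φ₀ := 𝟙 F.F₀
      φ₁ := 𝟙 F.F₁
      src := fun x => by
        change Arrow.mk (B.src.map (𝟙 _)) = Arrow.mk (𝟙 _)
        rw [CategoryTheory.Functor.map_id, F.src_obj]
      tgt := fun x => by
        change Arrow.mk (B.tgt.map (𝟙 _)) = Arrow.mk (𝟙 _)
        rw [CategoryTheory.Functor.map_id, F.tgt_obj] }
  comp a b :=
    { φ₀ := a.φ₀ ≫ b.φ₀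
      φ₁ := a.φ₁ ≫ b.φ₁
      src := fun x => by
        rw [NatTrans.comp_app, NatTrans.comp_app, Functor.map_comp]
        exact mk_comp_congr (a.src x) (b.src x)
      tgt := fun x => by
        rw [NatTrans.comp_app, NatTrans.comp_app, Functor.map_comp]
        exact mk_comp_congr (a.tgt x) (b.tgt x) }
  id_comp a := Hom₂.ext (Category.id_comp _) (Category.id_comp _)
  comp_id a := Hom₂.ext (Category.comp_id _) (Category.comp_id _)
  assoc a b c := Hom₂.ext (Category.assoc _ _ _) (Category.assoc _ _ _)

lemma id_φ₀ (F : Hom A B) : Hom₂.φ₀ (𝟙 F) = 𝟙 F.F₀ := rfl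
lemma id_φ₁ (F : Hom A B) : Hom₂.φ₁ (𝟙 F) = 𝟙 F.F₁ := rfl
lemma comp_φ₀ {F G H : Hom A B} (a : F ⟶ G) (b : G ⟶ H) : (a ≫ b).φ₀ = a.φ₀ ≫ b.φ₀ := rfl
lemma comp_φ₁ {F G H : Hom A B} (a : F ⟶ G) (b : G ⟶ H) : (a ≫ b).φ₁ = a.φ₁ ≫ b.φ₁ := rfl

/-- The identity morphism. -/
def Hom.id (A : GphCat.{u}) : Hom A A := ⟨𝟭 _, 𝟭 _, rfl, rfl⟩

/-- Composition of morphisms. -/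
def Hom.comp (F : Hom A B) (G : Hom B D) : Hom A D :=
  ⟨F.F₀ ⋙ G.F₀, F.F₁ ⋙ G.F₁,
    (congrArg (F.F₁ ⋙ ·) G.src).trans (congrArg (· ⋙ G.F₀) F.src),
    (congrArg (F.F₁ ⋙ ·) G.tgt).trans (congrArg (· ⋙ G.F₀) F.tgt)⟩

/-- Whiskering on the left. -/
def whiskL (F : Hom A B) {G H : Hom B D} (a : G ⟶ H) : F.comp G ⟶ F.comp H where
  φ₀ := Functor.whiskerLeft F.F₀ a.φ₀
  φ₁ := Functor.whiskerLeft F.F₁ a.φ₁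
  src x := (a.src (F.F₁.obj x)).trans (by
    change Arrow.mk (a.φ₀.app _) = Arrow.mk (a.φ₀.app _)
    rw [F.src_obj])
  tgt x := (a.tgt (F.F₁.obj x)).trans (by
    change Arrow.mk (a.φ₀.app _) = Arrow.mk (a.φ₀.app _)
    rw [F.tgt_obj])

/-- Whiskering on the right. -/
def whiskR {F G : Hom A B} (a : F ⟶ G) (H : Hom B D) : F.comp H ⟶ G.comp H where
  φ₀ := Functor.whiskerRight a.φ₀ H.F₀
  φ₁ := Functor.whiskerRight a.φ₁ H.F₁
  src x := (H.src_map _).trans (mapA_congr rfl (a.src x))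
  tgt x := (H.tgt_map _).trans (mapA_congr rfl (a.tgt x))

lemma unit_eq {F G : Hom A B} (a : F ⟶ G) : a = 𝟙 F ≫ a ≫ 𝟙 G := by
  rw [Category.comp_id, Category.id_comp]

instance : Bicategory GphCat.{u} where
  Hom := Hom
  id := Hom.id
  comp := Hom.comp
  homCategory A B := inferInstanceAs (Category (Hom A B))
  whiskerLeft := whiskL
  whiskerRight := whiskR
  associator F G H := Iso.refl (F.comp (G.comp H))
  leftUnitor F := Iso.refl F
  rightUnitor F := Iso.refl F
  whiskerLeft_id F G := Hom₂.ext rfl rfl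
  whiskerLeft_comp F _ _ _ a b := Hom₂.ext rfl rfl
  id_whiskerLeft a := unit_eq a
  comp_whiskerLeft F G _ _ a := unit_eq (whiskL F (whiskL G a))
  id_whiskerRight F G := Hom₂.ext (NatTrans.ext (funext fun _ => G.F₀.map_id _))
    (NatTrans.ext (funext fun _ => G.F₁.map_id _))
  comp_whiskerRight a b G := Hom₂.ext (NatTrans.ext (funext fun _ => G.F₀.map_comp _ _))
    (NatTrans.ext (funext fun _ => G.F₁.map_comp _ _))
  whiskerRight_id a := unit_eq a
  whiskerRight_comp a G H := unit_eq (whiskR (whiskR a G) H)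
  whisker_assoc F _ _ a G := unit_eq (whiskL F (whiskR a G))
  whisker_exchange a b := Hom₂.ext (NatTrans.ext (funext fun _ => (b.φ₀.naturality _).symm))
    (NatTrans.ext (funext fun _ => (b.φ₁.naturality _).symm))
  pentagon F G H I := Hom₂.ext
    (NatTrans.ext (funext fun x => by
      change I.F₀.map (𝟙 _) ≫ 𝟙 _ ≫ 𝟙 _ = 𝟙 _ ≫ 𝟙 (I.F₀.obj _)
      rw [CategoryTheory.Functor.map_id, Category.comp_id]
      exact Category.comp_id _))
    (NatTrans.ext (funext fun x => by
      change I.F₁.map (𝟙 _) ≫ 𝟙 _ ≫ 𝟙 _ = 𝟙 _ ≫ 𝟙 (I.F₁.obj _)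
      rw [CategoryTheory.Functor.map_id, Category.comp_id]
      exact Category.comp_id _))
  triangle F G := Hom₂.ext
    (NatTrans.ext (funext fun x => by
      change 𝟙 _ ≫ 𝟙 _ = G.F₀.map (𝟙 _)
      rw [CategoryTheory.Functor.map_id, Category.comp_id]))
    (NatTrans.ext (funext fun x => by
      change 𝟙 _ ≫ 𝟙 _ = G.F₁.map (𝟙 _)
      rw [CategoryTheory.Functor.map_id, Category.comp_id]))

instance : Bicategory.Strict GphCat.{u} where
  id_comp _ := rfl
  comp_id _ := rfl
  assoc _ _ _ := rfl
  leftUnitor_eqToIso _ := rfl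
  rightUnitor_eqToIso _ := rfl
  associator_eqToIso _ _ _ := rfl

end GphCat
end TripleCat

namespace TripleCat

section
variable {O E O' E' O'' E'' : Type*}

/-- The list `l` of edges is a path, with starting vertex `x`. -/
def Chain (s t : E → O) : O → List E → Prop
  | _, [] => True
  | x, e :: l => s e = x ∧ Chain s t (t e) l

/-- The last vertex of a path that starts at `x`. -/
def lastV (t : E → O) : O → List E → O
  | x, [] => x
  | _, e :: l => lastV t (t e) l

/-- A (finite) path in a graph of sets, with sources `s` and targets `t`: a starting vertex and a
list of consecutive edges. -/
@[ext]
structure GPath (s t : E → O) where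
  start : O
  edges : List E
  chain : Chain s t start edges

variable {s t : E → O} {s' t' : E' → O'} {s'' t'' : E'' → O''}

lemma chain_append {x : O} {l l' : List E} :
    Chain s t x (l ++ l') ↔ Chain s t x l ∧ Chain s t (lastV t x l) l' := by
  induction l generalizing x with
  | nil => simp [Chain, lastV]
  | cons e l ih => simp [Chain, lastV, ih, and_assoc]

lemma lastV_append {x : O} {l l' : List E} :
    lastV t x (l ++ l') = lastV t (lastV t x l) l' := by
  induction l generalizing x with
  | nil => rfl
  | cons e l ih => exact ih

lemma chain_map (f : O → O') (g : E → E') (hs : ∀ e, s' (g e) = f (s e))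
    (ht : ∀ e, t' (g e) = f (t e)) {x : O} {l : List E} (h : Chain s t x l) :
    Chain s' t' (f x) (l.map g) := by
  induction l generalizing x with
  | nil => trivial
  | cons e l ih => exact ⟨(hs e).trans (congrArg f h.1), by rw [ht]; exact ih h.2⟩

lemma lastV_map (f : O → O') (g : E → E') (ht : ∀ e, t' (g e) = f (t e)) {x : O} {l : List E} :
    lastV t' (f x) (l.map g) = f (lastV t x l) := by
  induction l generalizing x with
  | nil => rfl
  | cons e l ih => simp only [List.map, lastV, ht, ih]

namespace GPath

/-- The last vertex of a path. -/
def last (p : GPath s t) : O := lastV t p.start p.edges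

/-- The image of a path. -/
def map (f : O → O') (g : E → E') (hs : ∀ e, s' (g e) = f (s e)) (ht : ∀ e, t' (g e) = f (t e))
    (p : GPath s t) : GPath s' t' :=
  ⟨f p.start, p.edges.map g, chain_map f g hs ht p.chain⟩

lemma last_map (f : O → O') (g : E → E') (hs : ∀ e, s' (g e) = f (s e))
    (ht : ∀ e, t' (g e) = f (t e)) (p : GPath s t) :
    (p.map f g hs ht : GPath s' t').last = f p.last := lastV_map f g ht

/-- The path formed by one edge. -/
def single (s t : E → O) (e : E) : GPath s t := ⟨s e, [e], rfl, trivial⟩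

/-- The concatenation of a path of paths. -/
def flatten (P : GPath (start : GPath s t → O) last) : GPath s t where
  start := P.start
  edges := (P.edges.map edges).flatten
  chain := by
    obtain ⟨x, l, h⟩ := P
    induction l generalizing x with
    | nil => trivial
    | cons p l ih =>
      obtain ⟨rfl, h⟩ := h
      exact chain_append.2 ⟨p.chain, ih _ h⟩

lemma last_flatten (P : GPath (start : GPath s t → O) last) : P.flatten.last = P.last := by
  obtain ⟨x, l, h⟩ := P
  induction l generalizing x with
  | nil => rfl
  | cons p l ih =>
    obtain ⟨rfl, h⟩ := h
    exact lastV_append.trans (ih _ h)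

end GPath
end

section
variable {K L : Type*} [Category K] [Category L]

lemma mapA_vcomp (F : K ⥤ L) (a b : Arrow K) (h : a.right = b.left) :
    GphCat.mapA F (vcomp a b h) =
      vcomp (GphCat.mapA F a) (GphCat.mapA F b) (congrArg F.obj h) := by
  simp [GphCat.mapA, vcomp, eqToHom_map]

lemma vcomp_congr {a a' b b' : Arrow K} (ha : a = a') (hb : b = b') (h : a.right = b.left) :
    vcomp a b h = vcomp a' b' (by rw [← ha, ← hb, h]) := by
  subst ha hb; rfl

/-- Termwise composition of two lists of arrows. -/
def zipC : ∀ (l l' : List (Arrow K)), l.map (·.right) = l'.map (·.left) → List (Arrow K)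
  | [], [], _ => []
  | a :: l, b :: l', h => vcomp a b (List.cons.inj h).1 :: zipC l l' (List.cons.inj h).2
  | [], _ :: _, h => nomatch h
  | _ :: _, [], h => nomatch h

lemma zipC_left : ∀ (l l' : List (Arrow K)) (h), (zipC l l' h).map (·.left) = l.map (·.left)
  | [], [], _ => rfl
  | a :: l, b :: l', h => congrArg (a.left :: ·) (zipC_left l l' _)
  | [], _ :: _, h => nomatch h
  | _ :: _, [], h => nomatch h

lemma zipC_right : ∀ (l l' : List (Arrow K)) (h), (zipC l l' h).map (·.right) = l'.map (·.right)
  | [], [], _ => rfl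
  | a :: l, b :: l', h => congrArg (b.right :: ·) (zipC_right l l' _)
  | [], _ :: _, h => nomatch h
  | _ :: _, [], h => nomatch h

lemma zipC_ids (l : List K) (l' : List (Arrow K)) (h) :
    zipC (l.map fun x => Arrow.mk (𝟙 x)) l' h = l' := by
  induction l generalizing l' with
  | nil => cases l' with
    | nil => rfl
    | cons => cases h
  | cons x l ih => cases l' with
    | nil => cases h
    | cons b l' => exact congrArg₂ List.cons (id_vcomp b _) (ih l' _)

lemma zipC_ids' (l : List K) (l' : List (Arrow K)) (h) :
    zipC l' (l.map fun x => Arrow.mk (𝟙 x)) h = l' := by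
  induction l generalizing l' with
  | nil => cases l' with
    | nil => rfl
    | cons => cases h
  | cons x l ih => cases l' with
    | nil => cases h
    | cons b l' => exact congrArg₂ List.cons (vcomp_id b _) (ih l' _)

lemma zipC_assoc : ∀ (l l' l'' : List (Arrow K)) (h h' p q),
    zipC (zipC l l' h) l'' p = zipC l (zipC l' l'' h') q
  | [], [], [], _, _, _, _ => rfl
  | a :: l, b :: l', c :: l'', h, h', p, q =>
    congrArg₂ List.cons (vcomp_assoc a b c (List.cons.inj h).1 (List.cons.inj h').1)
      (zipC_assoc l l' l'' _ _ _ _)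
  | [], _ :: _, _, h, _, _, _ => nomatch h
  | _ :: _, [], _, h, _, _, _ => nomatch h
  | _, [], _ :: _, _, h, _, _ => nomatch h
  | _, _ :: _, [], _, h, _, _ => nomatch h

lemma zipC_append : ∀ (l₁ l₁' l₂ l₂' : List (Arrow K)) (h h' p),
    zipC (l₁ ++ l₂) (l₁' ++ l₂') p = zipC l₁ l₁' h ++ zipC l₂ l₂' h'
  | [], [], _, _, _, _, _ => rfl
  | _ :: l, _ :: l', l₂, l₂', _, _, _ =>
    congrArg (_ :: ·) (zipC_append l l' l₂ l₂' _ _ _)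
  | [], _ :: _, _, _, h, _, _ => nomatch h
  | _ :: _, [], _, _, h, _, _ => nomatch h

/-- Maps that preserve compositions preserve termwise compositions. -/
lemma zipC_map (F : K → L) (G : Arrow K → Arrow L) (hl : ∀ a, (G a).left = F a.left)
    (hr : ∀ a, (G a).right = F a.right)
    (hG : ∀ a b h, G (vcomp a b h) = vcomp (G a) (G b) (by rw [hr, hl, h])) :
    ∀ (l l' : List (Arrow K)) (h h'), (zipC l l' h).map G = zipC (l.map G) (l'.map G) h'
  | [], [], _, _ => rfl
  | a :: l, b :: l', h, _ => congrArg₂ List.cons (hG a b _) (zipC_map F G hl hr hG l l' _ _)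
  | [], _ :: _, h, _ => nomatch h
  | _ :: _, [], h, _ => nomatch h

lemma chain_zipC (F G : K ⥤ L) :
    ∀ (a b : Arrow L) (l l' : List (Arrow K)) (h : a.right = b.left) (h'),
    Chain (GphCat.mapA F) (GphCat.mapA G) a l → Chain (GphCat.mapA F) (GphCat.mapA G) b l' →
      Chain (GphCat.mapA F) (GphCat.mapA G) (vcomp a b h) (zipC l l' h')
  | _, _, [], [], _, _, _, _ => trivial
  | _, _, x :: l, y :: l', h, h', ⟨p, c⟩, ⟨q, d⟩ =>
    ⟨(mapA_vcomp F x y (List.cons.inj h').1).trans (vcomp_congr p q _), by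
      rw [mapA_vcomp]; exact chain_zipC F G _ _ l l' _ _ c d⟩
  | _, _, [], _ :: _, _, h, _, _ => nomatch h
  | _, _, _ :: _, [], _, h, _, _ => nomatch h

lemma lastV_zipC (G : K ⥤ L) :
    ∀ (a b : Arrow L) (l l' : List (Arrow K)) (h : a.right = b.left) (h') (h''),
      lastV (GphCat.mapA G) (vcomp a b h) (zipC l l' h') =
        vcomp (lastV (GphCat.mapA G) a l) (lastV (GphCat.mapA G) b l') h''
  | _, _, [], [], _, _, _ => rfl
  | _, _, x :: l, y :: l', h, h', _ => by
    change lastV _ (GphCat.mapA G (vcomp _ _ _)) (zipC _ _ _) = _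
    rw [mapA_vcomp]
    exact lastV_zipC G _ _ l l' _ _ _
  | _, _, [], _ :: _, _, h, _ => nomatch h
  | _, _, _ :: _, [], _, h, _ => nomatch h

end
end TripleCat

namespace TripleCat
open GphCat (mapA)

/-- The paths of objects of `A₁`. -/
def Path (A : GphCat.{u}) : Type u := GPath A.src.obj A.tgt.obj

/-- The paths of arrows of `A₁`. -/
abbrev CellPath (A : GphCat.{u}) : Type u := GPath (mapA A.src) (mapA A.tgt)

namespace CellPath
variable {A : GphCat.{u}}

/-- The path of the domains. -/
def dom (c : CellPath A) : Path A := GPath.map (·.left) (·.left) (fun _ => rfl) (fun _ => rfl) c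

/-- The path of the codomains. -/
def cod (c : CellPath A) : Path A := GPath.map (·.right) (·.right) (fun _ => rfl) (fun _ => rfl) c

/-- Termwise identities. -/
def ide (p : Path A) : CellPath A :=
  GPath.map (fun x => Arrow.mk (𝟙 x)) (fun x => Arrow.mk (𝟙 x))
    (fun x => by simp [mapA]) (fun x => by simp [mapA]) p

lemma start_of (c d : CellPath A) (h : c.cod = d.dom) : c.start.right = d.start.left :=
  congrArg GPath.start h

lemma edges_of (c d : CellPath A) (h : c.cod = d.dom) :
    c.edges.map (·.right) = d.edges.map (·.left) :=
  congrArg GPath.edges h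

/-- Termwise composition. -/
def comp (c d : CellPath A) (h : c.cod = d.dom) : CellPath A where
  start := vcomp c.start d.start (start_of c d h)
  edges := zipC c.edges d.edges (edges_of c d h)
  chain := chain_zipC _ _ _ _ _ _ _ _ c.chain d.chain

lemma dom_comp (c d : CellPath A) (h) : (comp c d h).dom = c.dom :=
  GPath.ext rfl (zipC_left _ _ _)

lemma cod_comp (c d : CellPath A) (h) : (comp c d h).cod = d.cod :=
  GPath.ext rfl (zipC_right _ _ _)

lemma dom_ide (p : Path A) : (ide p).dom = p :=
  GPath.ext rfl (List.map_map.trans (List.map_id _))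

lemma cod_ide (p : Path A) : (ide p).cod = p :=
  GPath.ext rfl (List.map_map.trans (List.map_id _))

end CellPath

/-- The arrows between paths are the paths of arrows. -/
@[ext]
structure PathHom {A : GphCat.{u}} (p q : Path A) : Type u where
  cell : CellPath A
  dom : cell.dom = p
  cod : cell.cod = q

instance (A : GphCat.{u}) : SmallCategory (Path A) where
  Hom := PathHom
  id p := ⟨.ide p, CellPath.dom_ide p, CellPath.cod_ide p⟩
  comp c d := ⟨.comp c.cell d.cell (c.cod.trans d.dom.symm), (CellPath.dom_comp _ _ _).trans c.dom,
    (CellPath.cod_comp _ _ _).trans d.cod⟩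
  id_comp _ := PathHom.ext (GPath.ext (id_vcomp _ _) (zipC_ids _ _ _))
  comp_id _ := PathHom.ext (GPath.ext (vcomp_id _ _) (zipC_ids' _ _ _))
  assoc _ _ _ := PathHom.ext (GPath.ext (vcomp_assoc _ _ _ _ _) (zipC_assoc _ _ _ _ _ _ _))

section
variable {A B : GphCat.{u}}

/-- The path of cells underlying an arrow between paths. -/
def toCell {p q : Path A} (f : p ⟶ q) : CellPath A := PathHom.cell f

lemma toCell_ext {p q : Path A} {f g : p ⟶ q} (h : toCell f = toCell g) : f = g := PathHom.ext h

lemma toCell_dom {p q : Path A} (f : p ⟶ q) : (toCell f).dom = p := PathHom.dom f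
lemma toCell_cod {p q : Path A} (f : p ⟶ q) : (toCell f).cod = q := PathHom.cod f

lemma toCell_id (p : Path A) : toCell (𝟙 p) = .ide p := rfl

lemma toCell_comp {p q r : Path A} (f : p ⟶ q) (g : q ⟶ r) :
    toCell (f ≫ g) = .comp (toCell f) (toCell g) ((toCell_cod f).trans (toCell_dom g).symm) := rfl

lemma arrow_ext {a b : Arrow (Path A)} (h : toCell a.hom = toCell b.hom) : a = b := by
  obtain ⟨p, q, f⟩ := a
  obtain ⟨p', q', g⟩ := b
  change toCell f = toCell g at h
  obtain rfl : p = p' := (toCell_dom f).symm.trans (h ▸ toCell_dom g)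
  obtain rfl : q = q' := (toCell_cod f).symm.trans (h ▸ toCell_cod g)
  exact congrArg Arrow.mk (toCell_ext h)

lemma toCell_vcomp (a b : Arrow (Path A)) (h : a.right = b.left) :
    toCell (vcomp a b h).hom = .comp (toCell a.hom) (toCell b.hom)
      ((toCell_cod a.hom).trans (h.trans (toCell_dom b.hom).symm)) := by
  obtain ⟨p, q, f⟩ := a
  obtain ⟨p', q', g⟩ := b
  obtain rfl : q = p' := h
  have : vcomp (Arrow.mk f) (Arrow.mk g) rfl = Arrow.mk (f ≫ g) := vcomp_mk f g
  exact congrArg (fun a : Arrow (Path A) => toCell a.hom) this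

/-- Functors to a category of paths are determined by their action on objects and arrows. -/
lemma pathFunctor_ext {K : Type*} [Category K] {F G : K ⥤ Path A}
    (h : ∀ ⦃x y : K⦄ (f : x ⟶ y), toCell (F.map f) = toCell (G.map f)) : F = G := by
  have h' : ∀ ⦃x y : K⦄ (f : x ⟶ y), Arrow.mk (F.map f) = Arrow.mk (G.map f) :=
    fun x y f => arrow_ext (h f)
  exact Functor.hext (fun x => congrArg Comma.left (h' (𝟙 x))) fun x y f => by
    have := h' f
    have h₁ : F.obj x = G.obj x := congrArg Comma.left this
    have h₂ : F.obj y = G.obj y := congrArg Comma.right this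
    generalize F.map f = a at *
    generalize G.map f = b at *
    revert a b
    rw [h₁, h₂]
    intro a b h''
    exact heq_of_eq (Arrow.mk_injective _ _ h'')

/-- The starting vertex. -/
def Path.srcF (A : GphCat.{u}) : Path A ⥤ A.A₀ where
  obj p := GPath.start p
  map f := homOf (toCell f).start (congrArg GPath.start (toCell_dom f))
    (congrArg GPath.start (toCell_cod f))
  map_id p := Arrow.mk_injective _ _ (mk_homOf _ _ _)
  map_comp f g := Arrow.mk_injective _ _ ((mk_homOf _ _ _).trans (by
    rw [← vcomp_mk]
    exact vcomp_congr (mk_homOf _ _ _).symm (mk_homOf _ _ _).symm _))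

lemma lastV_dom (c : CellPath A) : c.last.left = GPath.last c.dom :=
  (GPath.last_map (s' := A.src.obj) (t' := A.tgt.obj) (fun a : Arrow A.A₀ => a.left)
    (fun a : Arrow A.A₁ => a.left) (fun _ => rfl) (fun _ => rfl) c).symm

lemma lastV_cod (c : CellPath A) : c.last.right = GPath.last c.cod :=
  (GPath.last_map (s' := A.src.obj) (t' := A.tgt.obj) (fun a : Arrow A.A₀ => a.right)
    (fun a : Arrow A.A₁ => a.right) (fun _ => rfl) (fun _ => rfl) c).symm

lemma last_comp (c d : CellPath A) (h : c.cod = d.dom) :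
    (CellPath.comp c d h).last = vcomp c.last d.last
      ((lastV_cod c).trans ((congrArg GPath.last h).trans (lastV_dom d).symm)) :=
  lastV_zipC _ _ _ _ _ _ _ _

lemma last_ide (p : Path A) : (CellPath.ide p).last = Arrow.mk (𝟙 (GPath.last p)) :=
  GPath.last_map (s' := mapA A.src) (t' := mapA A.tgt) (fun x : A.A₀ => Arrow.mk (𝟙 x)) _ _ _ _

/-- The last vertex. -/
def Path.tgtF (A : GphCat.{u}) : Path A ⥤ A.A₀ where
  obj p := GPath.last p
  map f := homOf (toCell f).last ((lastV_dom _).trans (congrArg GPath.last (toCell_dom f)))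
    ((lastV_cod _).trans (congrArg GPath.last (toCell_cod f)))
  map_id p := Arrow.mk_injective _ _ ((mk_homOf _ _ _).trans (last_ide p))
  map_comp f g := Arrow.mk_injective _ _ ((mk_homOf _ _ _).trans (by
    rw [← vcomp_mk, toCell_comp, last_comp]
    exact vcomp_congr (mk_homOf _ _ _).symm (mk_homOf _ _ _).symm _))

lemma mapA_srcF {p q : Path A} (f : p ⟶ q) :
    Arrow.mk ((Path.srcF A).map f) = (toCell f).start :=
  mk_homOf _ (congrArg GPath.start (toCell_dom f)) (congrArg GPath.start (toCell_cod f))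

lemma mapA_tgtF {p q : Path A} (f : p ⟶ q) :
    Arrow.mk ((Path.tgtF A).map f) = (toCell f).last :=
  mk_homOf _ ((lastV_dom _).trans (congrArg GPath.last (toCell_dom f)))
    ((lastV_cod _).trans (congrArg GPath.last (toCell_cod f)))

end

/-- The (graph underlying the) free double category on a graph of categories. -/
abbrev pathGph (A : GphCat.{u}) : GphCat.{u} where
  A₀ := A.A₀
  A₁ := Path A
  src := Path.srcF A
  tgt := Path.tgtF A

section
variable {A B D : GphCat.{u}}

/-- The action of a morphism of graphs on paths. -/
def mapPath (F : GphCat.Hom A B) (p : Path A) : Path B :=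
  GPath.map F.F₀.obj F.F₁.obj F.src_obj F.tgt_obj p

/-- The action of a morphism of graphs on paths of cells. -/
def mapCellPath (F : GphCat.Hom A B) (c : CellPath A) : CellPath B :=
  GPath.map (s := mapA A.src) (t := mapA A.tgt) (mapA F.F₀) (mapA F.F₁)
    (fun a => F.src_map a.hom) (fun a => F.tgt_map a.hom) c

lemma dom_mapCellPath (F : GphCat.Hom A B) (c : CellPath A) :
    (mapCellPath F c).dom = mapPath F c.dom :=
  GPath.ext rfl (by
    change List.map _ (List.map _ _) = List.map _ (List.map _ _)
    rw [List.map_map, List.map_map]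
    rfl)

lemma cod_mapCellPath (F : GphCat.Hom A B) (c : CellPath A) :
    (mapCellPath F c).cod = mapPath F c.cod :=
  GPath.ext rfl (by
    change List.map _ (List.map _ _) = List.map _ (List.map _ _)
    rw [List.map_map, List.map_map]
    rfl)

/-- The action of a morphism of graphs on paths, as a functor. -/
def pathFunctor (F : GphCat.Hom A B) : Path A ⥤ Path B where
  obj := mapPath F
  map f := ⟨mapCellPath F (toCell f), (dom_mapCellPath F _).trans (congrArg _ (toCell_dom f)),
    (cod_mapCellPath F _).trans (congrArg _ (toCell_cod f))⟩
  map_id p := toCell_ext (GPath.ext (by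
    change mapA F.F₀ (Arrow.mk (𝟙 _)) = Arrow.mk (𝟙 (F.F₀.obj _))
    simp [mapA]) (by
    change List.map _ (List.map _ _) = List.map _ (List.map _ _)
    rw [List.map_map, List.map_map]
    refine List.map_congr_left fun u _ => ?_
    simp [mapA]))
  map_comp f g := toCell_ext (GPath.ext (mapA_vcomp _ _ _ _)
    (zipC_map F.F₁.obj (mapA F.F₁) (fun _ => rfl) (fun _ => rfl) (fun _ _ _ => mapA_vcomp _ _ _ _)
      _ _ _ _))

lemma toCell_pathFunctor (F : GphCat.Hom A B) {p q : Path A} (f : p ⟶ q) :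
    toCell ((pathFunctor F).map f) = mapCellPath F (toCell f) := rfl

lemma functor_ext_mk {K L : Type*} [Category K] [Category L] {F G : K ⥤ L}
    (h : ∀ ⦃x y : K⦄ (f : x ⟶ y), Arrow.mk (F.map f) = Arrow.mk (G.map f)) : F = G :=
  Functor.hext (fun x => congrArg Comma.left (h (𝟙 x))) fun x y f => by
    have := h f
    have h₁ : F.obj x = G.obj x := congrArg Comma.left this
    have h₂ : F.obj y = G.obj y := congrArg Comma.right this
    generalize F.map f = a at *
    generalize G.map f = b at *
    revert a b
    rw [h₁, h₂]
    intro a b h''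
    exact heq_of_eq (Arrow.mk_injective _ _ h'')

lemma last_mapCellPath (F : GphCat.Hom A B) (c : CellPath A) :
    (mapCellPath F c).last = mapA F.F₀ c.last := GPath.last_map _ _ _ _ _

/-- The action of the 2-monad on morphisms. -/
def pathMap (F : GphCat.Hom A B) : GphCat.Hom (pathGph A) (pathGph B) where
  F₀ := F.F₀
  F₁ := pathFunctor F
  src := functor_ext_mk fun _ _ f => (mapA_srcF _).trans
    (GphCat.mapA_congr (F := F.F₀) rfl (mapA_srcF f).symm)
  tgt := functor_ext_mk fun _ _ f => (mapA_tgtF _).trans ((last_mapCellPath F (toCell f)).trans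
    (GphCat.mapA_congr (F := F.F₀) rfl (mapA_tgtF f).symm))

/-- The path of components of a 2-cell. -/
def compPath {F G : GphCat.Hom A B} (φ : F ⟶ G) (p : Path A) : CellPath B :=
  GPath.map (fun x => Arrow.mk (φ.φ₀.app x)) (fun u => Arrow.mk (φ.φ₁.app u)) φ.src φ.tgt p

lemma dom_compPath {F G : GphCat.Hom A B} (φ : F ⟶ G) (p : Path A) :
    (compPath φ p).dom = mapPath F p := GPath.ext rfl List.map_map

lemma cod_compPath {F G : GphCat.Hom A B} (φ : F ⟶ G) (p : Path A) :
    (compPath φ p).cod = mapPath G p := GPath.ext rfl List.map_map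

lemma zip_nat {F G : GphCat.Hom A B} (φ : F ⟶ G) (l : List (Arrow A.A₁)) (h h') :
    zipC (l.map (mapA F.F₁)) (l.map fun a => Arrow.mk (φ.φ₁.app a.right)) h =
      zipC (l.map fun a => Arrow.mk (φ.φ₁.app a.left)) (l.map (mapA G.F₁)) h' := by
  induction l with
  | nil => rfl
  | cons a l ih =>
    refine congrArg₂ List.cons ?_ (ih _ _)
    have := φ.φ₁.naturality a.hom
    exact (vcomp_mk _ _).trans ((congrArg Arrow.mk this).trans (vcomp_mk _ _).symm)

/-- The action of the 2-monad on 2-cells. -/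
def pathMap₂ {F G : GphCat.Hom A B} (φ : F ⟶ G) : pathMap F ⟶ pathMap G where
  φ₀ := φ.φ₀
  φ₁ :=
    { app := fun p => ⟨compPath φ p, dom_compPath φ p, cod_compPath φ p⟩
      naturality := by
        rintro p q ⟨c, rfl, rfl⟩
        refine toCell_ext (GPath.ext ?_ ?_)
        · have := φ.φ₀.naturality c.start.hom
          exact (vcomp_mk _ _).trans ((congrArg Arrow.mk this).trans (vcomp_mk _ _).symm)
        · change zipC (List.map _ _) (List.map _ (List.map _ _)) _ =
            zipC (List.map _ (List.map _ _)) (List.map _ _) _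
          simp only [List.map_map]
          exact zip_nat φ c.edges _ _ }
  src p := mapA_srcF (A := B) (p := mapPath F p) (q := mapPath G p) _
  tgt p := (mapA_tgtF (A := B) (p := mapPath F p) (q := mapPath G p) _).trans
    (GPath.last_map _ _ _ _ _)

end
end TripleCat

namespace TripleCat
open Bicategory
open GphCat (mapA)

section
variable {A B D : GphCat.{u}}

lemma hom_ext {F G : A ⟶ B} (h₀ : F.F₀ = G.F₀) (h₁ : F.F₁ = G.F₁) : F = G :=
  GphCat.Hom.ext h₀ h₁

lemma cell_ext {F G F' G' : A ⟶ B} {a : F ⟶ G} {b : F' ⟶ G'} (hF : F = F') (hG : G = G')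
    (h₀ : ∀ x, Arrow.mk (a.φ₀.app x) = Arrow.mk (b.φ₀.app x))
    (h₁ : ∀ x, Arrow.mk (a.φ₁.app x) = Arrow.mk (b.φ₁.app x)) : Arrow.mk a = Arrow.mk b := by
  subst hF hG
  refine congrArg Arrow.mk (GphCat.Hom₂.ext (NatTrans.ext (funext fun x => ?_))
    (NatTrans.ext (funext fun x => ?_)))
  · exact Arrow.mk_injective _ _ (h₀ x)
  · exact Arrow.mk_injective _ _ (h₁ x)

lemma eq_of_mk {K : Type*} [Category K] {X Y X' Y' : K} {f : X ⟶ Y} {g : X' ⟶ Y'}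
    (h : Arrow.mk f = Arrow.mk g) (p : X = X') (q : Y' = Y) :
    f = eqToHom p ≫ g ≫ eqToHom q := by
  subst p q
  simpa using Arrow.mk_injective _ _ h

lemma mapCellPath_id (c : CellPath A) : mapCellPath (𝟙 A : A ⟶ A) c = c :=
  GPath.ext rfl (List.map_id _)

lemma mapCellPath_comp (F : A ⟶ B) (G : B ⟶ D) (c : CellPath A) :
    mapCellPath (F ≫ G) c = mapCellPath G (mapCellPath F c) :=
  GPath.ext rfl (by
    change List.map _ _ = List.map _ (List.map _ _)
    rw [List.map_map]
    rfl)

lemma pathMap_id (A : GphCat.{u}) : pathMap (𝟙 A) = 𝟙 (pathGph A) :=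
  hom_ext rfl (pathFunctor_ext fun _ _ _ => mapCellPath_id _)

lemma pathMap_comp (F : A ⟶ B) (G : B ⟶ D) :
    pathMap (F ≫ G) = (pathMap F ≫ pathMap G : pathGph A ⟶ pathGph D) :=
  hom_ext rfl (pathFunctor_ext fun _ _ _ => mapCellPath_comp _ _ _)

lemma zipC_mk {K L : Type*} [Category K] [Category L] {F G H : K ⥤ L} (a : F ⟶ G) (b : G ⟶ H)
    (l : List K) (h) :
    zipC (l.map fun x => Arrow.mk (a.app x)) (l.map fun x => Arrow.mk (b.app x)) h =
      l.map fun x => Arrow.mk ((a ≫ b).app x) := by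
  induction l with
  | nil => rfl
  | cons x l ih => exact congrArg₂ List.cons (vcomp_mk _ _) (ih _)

lemma pathMap₂_whiskL (F : A ⟶ B) {G H : B ⟶ D} (a : G ⟶ H) :
    Arrow.mk (pathMap₂ (GphCat.whiskL F a)) = Arrow.mk (GphCat.whiskL (pathMap F) (pathMap₂ a)) :=
  cell_ext (pathMap_comp F G) (pathMap_comp F H) (fun _ => rfl) fun p => arrow_ext
    (GPath.ext rfl (by
      change List.map _ _ = List.map _ (List.map _ _)
      rw [List.map_map]
      rfl))

lemma pathMap₂_whiskR {F G : A ⟶ B} (a : F ⟶ G) (H : B ⟶ D) :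
    Arrow.mk (pathMap₂ (GphCat.whiskR a H)) = Arrow.mk (GphCat.whiskR (pathMap₂ a) (pathMap H)) :=
  cell_ext (pathMap_comp F H) (pathMap_comp G H) (fun _ => rfl) fun p => arrow_ext
    (GPath.ext rfl (by
      change List.map _ _ = List.map _ (List.map _ _)
      rw [List.map_map]
      rfl))

/-- The 2-functor that sends a graph of categories to its graph of paths. -/
def pathFunctor₂ : StrictPseudofunctor GphCat.{u} GphCat.{u} :=
  StrictPseudofunctor.mk''
    { obj := pathGph
      map := fun F => pathMap F
      map₂ := fun φ => pathMap₂ φ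
      map₂_id := fun F => GphCat.Hom₂.ext rfl (NatTrans.ext (funext fun p => toCell_ext
        (GPath.ext rfl (by
          change List.map _ _ = List.map _ (List.map _ _)
          rw [List.map_map]
          rfl))))
      map₂_comp := fun a b => GphCat.Hom₂.ext rfl (NatTrans.ext (funext fun p => toCell_ext
        (GPath.ext (vcomp_mk _ _).symm (zipC_mk a.φ₁ b.φ₁ _ _).symm)))
      map_id := pathMap_id
      map_comp := pathMap_comp
      map₂_whisker_left := fun {_ _ _} F {_ _} a => eq_of_mk (pathMap₂_whiskL F a) _ _
      map₂_whisker_right := fun {_ _ _ _ _} a H => eq_of_mk (pathMap₂_whiskR a H) _ _ }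

/-- The embedding of a graph of categories in its graph of paths, as paths with one edge. -/
def pathUnit (A : GphCat.{u}) : A ⟶ pathGph A where
  F₀ := 𝟭 _
  F₁ :=
    { obj := fun u => GPath.single _ _ u
      map := fun f => ⟨GPath.single (mapA A.src) (mapA A.tgt) (Arrow.mk f), rfl, rfl⟩
      map_id := fun u => toCell_ext (GPath.ext (by
        change Arrow.mk (A.src.map (𝟙 u)) = Arrow.mk (𝟙 _)
        rw [CategoryTheory.Functor.map_id]
        rfl) rfl)
      map_comp := fun f g => toCell_ext (GPath.ext (by
        change Arrow.mk (A.src.map (f ≫ g)) = vcomp (Arrow.mk (A.src.map f)) (Arrow.mk _) rfl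
        rw [CategoryTheory.Functor.map_comp]
        exact (vcomp_mk _ _).symm) (by
          change [Arrow.mk (f ≫ g)] = [_]
          rw [← vcomp_mk])) }
  src := functor_ext_mk fun _ _ _ => mapA_srcF _
  tgt := functor_ext_mk fun _ _ _ => mapA_tgtF _

/-- Concatenation of a path of paths of cells. -/
def flattenCell (c : CellPath (pathGph A)) : CellPath A :=
  GPath.flatten (GPath.map (s := mapA (Path.srcF A)) (t := mapA (Path.tgtF A))
    (s' := GPath.start) (t' := GPath.last) id (fun a : Arrow (Path A) => toCell a.hom)
    (fun a => (mapA_srcF a.hom).symm) (fun a => (mapA_tgtF a.hom).symm) c)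

lemma map_flatten_map {α β γ δ : Type*} {f : β → γ} {h : α → List β} {k : δ → List γ} {j : α → δ}
    (H : ∀ a, (h a).map f = k (j a)) (l : List α) :
    (l.map h).flatten.map f = ((l.map j).map k).flatten := by
  rw [List.map_flatten, List.map_map, List.map_map]
  exact congrArg List.flatten (List.map_congr_left fun a _ => H a)

lemma flattenCell_edges (c : CellPath (pathGph A)) :
    (flattenCell c).edges =
      (c.edges.map fun a => GPath.edges (toCell a.hom)).flatten := by
  change (List.map _ (List.map _ _)).flatten = _
  rw [List.map_map]
  rfl

/-- Concatenation of a path of paths. -/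
def flattenPath (P : Path (pathGph A)) : Path A :=
  GPath.flatten (s := A.src.obj) (t := A.tgt.obj) P

lemma dom_flattenCell (c : CellPath (pathGph A)) : (flattenCell c).dom = flattenPath c.dom :=
  GPath.ext rfl ((congrArg (List.map _) (flattenCell_edges c)).trans
    (map_flatten_map (h := fun a : Arrow (Path A) => GPath.edges (toCell a.hom))
      (k := GPath.edges) (j := fun a : Arrow (Path A) => a.left)
      (fun a => congrArg GPath.edges (toCell_dom a.hom)) c.edges))

lemma cod_flattenCell (c : CellPath (pathGph A)) : (flattenCell c).cod = flattenPath c.cod :=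
  GPath.ext rfl ((congrArg (List.map _) (flattenCell_edges c)).trans
    (map_flatten_map (h := fun a : Arrow (Path A) => GPath.edges (toCell a.hom))
      (k := GPath.edges) (j := fun a : Arrow (Path A) => a.right)
      (fun a => congrArg GPath.edges (toCell_cod a.hom)) c.edges))

lemma last_flattenCell (c : CellPath (pathGph A)) : (flattenCell c).last = c.last :=
  (GPath.last_flatten _).trans (GPath.last_map _ _ _ _ _)

lemma zipC_congr {K : Type*} [Category K] {l l' m m' : List (Arrow K)} (hl : l = l') (hm : m = m')
    (h) : zipC l m h = zipC l' m' (by rw [← hl, ← hm, h]) := by subst hl hm; rfl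

lemma zipC_flatten : ∀ (l l' : List (Arrow (Path A))) (h h'),
    ((zipC l l' h).map fun a => GPath.edges (toCell a.hom)).flatten =
      zipC (l.map fun a => GPath.edges (toCell a.hom)).flatten
        (l'.map fun a => GPath.edges (toCell a.hom)).flatten h'
  | [], [], _, _ => rfl
  | a :: l, b :: l', h, h' => by
    have e := (List.cons.inj h).1
    have h₁ : (GPath.edges (toCell a.hom)).map (·.right) =
        (GPath.edges (toCell b.hom)).map (·.left) :=
      CellPath.edges_of _ _ ((toCell_cod a.hom).trans (e.trans (toCell_dom b.hom).symm))
    have h₂ := h'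
    simp only [List.map_cons, List.flatten_cons, List.map_append, h₁] at h₂
    have h₃ := List.append_cancel_left h₂
    have ih := zipC_flatten l l' (List.cons.inj h).2 h₃
    exact (congrArg₂ (· ++ ·) (congrArg GPath.edges (toCell_vcomp a b e)) ih).trans
      (zipC_append _ _ _ _ h₁ h₃ h').symm
  | [], _ :: _, h, _ => nomatch h
  | _ :: _, [], h, _ => nomatch h

lemma map_map_flatten {α β γ : Type*} (f : β → γ) (h : α → List β) (l : List α) :
    (l.map fun a => (h a).map f).flatten = (l.map h).flatten.map f := by
  rw [List.map_flatten, List.map_map]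
  rfl

lemma flattenCell_cod_dom (c d : CellPath (pathGph A)) (h : c.cod = d.dom) :
    (flattenCell c).cod = (flattenCell d).dom :=
  (cod_flattenCell c).trans ((congrArg flattenPath h).trans (dom_flattenCell d).symm)

lemma flattenCell_comp (c d : CellPath (pathGph A)) (h : c.cod = d.dom) :
    flattenCell (.comp c d h) =
      .comp (flattenCell c) (flattenCell d) (flattenCell_cod_dom c d h) := by
  have h' := CellPath.edges_of _ _ (flattenCell_cod_dom c d h)
  refine GPath.ext rfl ((flattenCell_edges _).trans ((zipC_flatten c.edges d.edges _ ?_).trans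
    (zipC_congr (flattenCell_edges _).symm (flattenCell_edges _).symm _)))
  rw [flattenCell_edges, flattenCell_edges] at h'
  exact h'

/-- Concatenation of paths of paths, as a functor. -/
def flattenFunctor (A : GphCat.{u}) : Path (pathGph A) ⥤ Path A where
  obj := flattenPath
  map f := ⟨flattenCell (toCell f), (dom_flattenCell _).trans (congrArg _ (toCell_dom f)),
    (cod_flattenCell _).trans (congrArg _ (toCell_cod f))⟩
  map_id P := toCell_ext (GPath.ext rfl ((flattenCell_edges _).trans
    ((congrArg List.flatten List.map_map).trans
      (map_map_flatten (fun x : A.A₁ => Arrow.mk (𝟙 x)) GPath.edges (GPath.edges P)))))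
  map_comp f g := toCell_ext (flattenCell_comp (toCell f) (toCell g)
    ((toCell_cod f).trans (toCell_dom g).symm))

lemma toCell_flattenFunctor {P Q : Path (pathGph A)} (f : P ⟶ Q) :
    toCell ((flattenFunctor A).map f) = flattenCell (toCell f) := rfl

/-- Concatenation of paths of paths. -/
def pathMult (A : GphCat.{u}) : pathGph (pathGph A) ⟶ pathGph A where
  F₀ := 𝟭 _
  F₁ := flattenFunctor A
  src := functor_ext_mk (F := flattenFunctor A ⋙ Path.srcF A) (G := Path.srcF (pathGph A) ⋙ 𝟭 _)
    fun _ _ f => (mapA_srcF ((flattenFunctor A).map f)).trans (mapA_srcF f).symm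
  tgt := functor_ext_mk (F := flattenFunctor A ⋙ Path.tgtF A) (G := Path.tgtF (pathGph A) ⋙ 𝟭 _)
    fun _ _ f => (mapA_tgtF ((flattenFunctor A).map f)).trans
      ((last_flattenCell (toCell f)).trans (mapA_tgtF f).symm)

end
end TripleCat

namespace TripleCat
open Bicategory
open GphCat (mapA)

section
variable {A B D : GphCat.{u}}

lemma flatten_single {α : Type*} (l : List α) : (l.map fun a => [a]).flatten = l := by
  induction l with
  | nil => rfl
  | cons a l ih => exact congrArg (a :: ·) ih

lemma flatten_map_flatten {α β γ : Type*} (g : α → List β) (f : β → List γ) (l : List α) :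
    (l.map fun a => ((g a).map f).flatten).flatten = ((l.map g).flatten.map f).flatten := by
  induction l with
  | nil => rfl
  | cons a l ih => simp only [List.map_cons, List.flatten_cons, List.map_append,
      List.flatten_append, ih]

lemma pathUnit_nat (F : A ⟶ B) :
    (F ≫ pathUnit B : A ⟶ pathGph B) = pathUnit A ≫ pathMap F :=
  hom_ext rfl (pathFunctor_ext (F := F.F₁ ⋙ (pathUnit B).F₁) (G := (pathUnit A).F₁ ⋙ pathFunctor F)
    fun _ _ f => GPath.ext (F.src_map f) rfl)

lemma pathUnit_nat₂ {F G : A ⟶ B} (a : F ⟶ G) :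
    Arrow.mk (GphCat.whiskR a (pathUnit B)) =
      Arrow.mk (GphCat.whiskL (pathUnit A) (pathMap₂ a)) :=
  cell_ext (pathUnit_nat F) (pathUnit_nat G) (fun _ => rfl) fun x => arrow_ext
    (GPath.ext (a.src x) rfl)

lemma pathMult_nat (F : A ⟶ B) :
    (pathMap (pathMap F) ≫ pathMult B : pathGph (pathGph A) ⟶ pathGph B) =
      pathMult A ≫ pathMap F :=
  hom_ext rfl (pathFunctor_ext (F := pathFunctor (pathMap F) ⋙ flattenFunctor B)
    (G := flattenFunctor A ⋙ pathFunctor F) fun _ _ f => GPath.ext rfl (by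
      refine (flattenCell_edges _).trans ?_
      refine Eq.trans ?_ (congrArg (List.map (mapA F.F₁)) (flattenCell_edges (toCell f)).symm)
      refine (congrArg List.flatten List.map_map).trans ?_
      exact map_map_flatten (mapA F.F₁) (fun a : Arrow (Path A) => GPath.edges (toCell a.hom))
        (toCell f).edges))

lemma pathMult_nat₂ {F G : A ⟶ B} (a : F ⟶ G) :
    Arrow.mk (GphCat.whiskR (pathMap₂ (pathMap₂ a)) (pathMult B)) =
      Arrow.mk (GphCat.whiskL (pathMult A) (pathMap₂ a)) :=
  cell_ext (pathMult_nat F) (pathMult_nat G) (fun _ => rfl) fun P => arrow_ext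
    (GPath.ext rfl (by
      refine (flattenCell_edges _).trans ?_
      refine (congrArg List.flatten List.map_map).trans ?_
      exact map_map_flatten (fun u => Arrow.mk (a.φ₁.app u)) GPath.edges (GPath.edges P)))

lemma pathUnit_mult (A : GphCat.{u}) :
    (pathUnit (pathGph A) ≫ pathMult A : pathGph A ⟶ pathGph A) = 𝟙 (pathGph A) :=
  hom_ext rfl (pathFunctor_ext (F := (pathUnit (pathGph A)).F₁ ⋙ flattenFunctor A) (G := 𝟭 _)
    fun _ _ f => GPath.ext (mapA_srcF f) ((flattenCell_edges _).trans (List.append_nil _)))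

lemma pathMap_unit_mult (A : GphCat.{u}) :
    (pathMap (pathUnit A) ≫ pathMult A : pathGph A ⟶ pathGph A) = 𝟙 (pathGph A) :=
  hom_ext rfl (pathFunctor_ext (F := pathFunctor (pathUnit A) ⋙ flattenFunctor A) (G := 𝟭 _)
    fun _ _ f => GPath.ext rfl ((flattenCell_edges _).trans
      ((congrArg List.flatten List.map_map).trans (flatten_single (toCell f).edges))))

lemma pathMult_mult (A : GphCat.{u}) :
    (pathMap (pathMult A) ≫ pathMult A : pathGph (pathGph (pathGph A)) ⟶ pathGph A) =
      pathMult (pathGph A) ≫ pathMult A :=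
  hom_ext rfl (pathFunctor_ext (F := pathFunctor (pathMult A) ⋙ flattenFunctor A)
    (G := flattenFunctor (pathGph A) ⋙ flattenFunctor A)
    fun _ _ f => GPath.ext rfl (by
      refine (flattenCell_edges _).trans ((congrArg List.flatten List.map_map).trans ?_)
      refine Eq.trans ?_ ((flattenCell_edges _).trans (congrArg List.flatten
        (congrArg (List.map fun a : Arrow (Path A) => GPath.edges (toCell a.hom))
          (flattenCell_edges (toCell f))))).symm
      refine Eq.trans ?_ (flatten_map_flatten
        (fun a : Arrow (Path (pathGph A)) => GPath.edges (toCell a.hom))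
        (fun a : Arrow (Path A) => GPath.edges (toCell a.hom)) (toCell f).edges)
      exact congrArg List.flatten (List.map_congr_left fun a _ => flattenCell_edges (toCell a.hom))))

end

/-- The 2-monad of double categories on graphs of categories: `T` sends a graph to the graph of its
paths, the unit embeds a graph as the paths of length one and the multiplication concatenates paths
of paths. -/
def pathMonad : TwoMonad GphCat.{u} where
  T := pathFunctor₂
  unit := pathUnit
  mult := pathMult
  unit_nat := pathUnit_nat
  unit_nat₂ a := pathUnit_nat₂ a.hom
  mult_nat := pathMult_nat
  mult_nat₂ a := pathMult_nat₂ a.hom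
  unit_mult := pathUnit_mult
  map_unit_mult := pathMap_unit_mult
  mult_mult := pathMult_mult

end TripleCat

namespace TripleCat
open GphCat (mapA)

section
variable {A : GphCat.{u}}

/-- Two cells are vertically consecutive. -/
def Consec {u u' v v' : A.A₁} (f : u ⟶ u') (g : v ⟶ v') : Prop :=
  Arrow.mk (A.tgt.map f) = Arrow.mk (A.src.map g)

lemma Consec.left {u u' v v' : A.A₁} {f : u ⟶ u'} {g : v ⟶ v'} (c : Consec f g) :
    A.tgt.obj u = A.src.obj v := congrArg (·.left) c

lemma Consec.right {u u' v v' : A.A₁} {f : u ⟶ u'} {g : v ⟶ v'} (c : Consec f g) :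
    A.tgt.obj u' = A.src.obj v' := congrArg (·.right) c

lemma mk_id_congr {K : Type*} [Category K] {x y : K} (h : x = y) :
    Arrow.mk (𝟙 x) = Arrow.mk (𝟙 y) := by subst h; rfl

lemma mk_map_id {K L : Type*} [Category K] [Category L] (F : K ⥤ L) (x : K) :
    Arrow.mk (F.map (𝟙 x)) = Arrow.mk (𝟙 (F.obj x)) := by
  rw [CategoryTheory.Functor.map_id]

lemma mk_map_comp {K L : Type*} [Category K] [Category L] (F : K ⥤ L) {x y z : K} (f : x ⟶ y)
    (g : y ⟶ z) : Arrow.mk (F.map (f ≫ g)) = Arrow.mk (F.map f ≫ F.map g) := by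
  rw [CategoryTheory.Functor.map_comp]

lemma Consec.id {u v : A.A₁} (h : A.tgt.obj u = A.src.obj v) : Consec (𝟙 u) (𝟙 v) :=
  (mk_map_id _ _).trans ((mk_id_congr h).trans (mk_map_id _ _).symm)

lemma Consec.comp {u u' u'' v v' v'' : A.A₁} {f : u ⟶ u'} {g : v ⟶ v'} {f' : u' ⟶ u''}
    {g' : v' ⟶ v''} (c : Consec f g) (c' : Consec f' g') : Consec (f ≫ f') (g ≫ g') :=
  (mk_map_comp _ _ _).trans ((GphCat.mk_comp_congr c c').trans (mk_map_comp _ _ _).symm)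

/-- A cell whose upper and lower horizontal arrows are identities. -/
def Special {u v : A.A₁} (f : u ⟶ v) : Prop :=
  Arrow.mk (A.src.map f) = Arrow.mk (𝟙 (A.src.obj u)) ∧
    Arrow.mk (A.tgt.map f) = Arrow.mk (𝟙 (A.tgt.obj u))

lemma Special.id (u : A.A₁) : Special (𝟙 u) := ⟨mk_map_id _ _, mk_map_id _ _⟩

lemma Special.src_eq {u v : A.A₁} {f : u ⟶ v} (s : Special f) : A.src.obj v = A.src.obj u :=
  congrArg (·.right) s.1

lemma Special.tgt_eq {u v : A.A₁} {f : u ⟶ v} (s : Special f) : A.tgt.obj v = A.tgt.obj u :=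
  congrArg (·.right) s.2

lemma mk_comp_id {K : Type*} [Category K] {x y z : K} {f : x ⟶ y} {g : y ⟶ z}
    (hf : Arrow.mk f = Arrow.mk (𝟙 x)) (hg : Arrow.mk g = Arrow.mk (𝟙 y)) :
    Arrow.mk (f ≫ g) = Arrow.mk (𝟙 x) := by
  obtain rfl : y = x := congrArg (·.right) hf
  obtain rfl : z = y := congrArg (·.right) hg
  obtain rfl := Arrow.mk_injective _ _ hf
  rw [Category.id_comp]
  exact hg

lemma Special.comp {u v w : A.A₁} {f : u ⟶ v} {g : v ⟶ w} (s : Special f) (t : Special g) :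
    Special (f ≫ g) :=
  ⟨(mk_map_comp _ _ _).trans (mk_comp_id s.1 t.1), (mk_map_comp _ _ _).trans (mk_comp_id s.2 t.2)⟩

lemma Special.map {B : GphCat.{u}} (F : A ⟶ B) {u v : A.A₁} {f : u ⟶ v} (s : Special f) :
    Special (F.F₁.map f) :=
  ⟨(F.src_map f).trans ((GphCat.mapA_congr (F := F.F₀) rfl s.1).trans ((mk_map_id _ _).trans
      (mk_id_congr (F.src_obj u).symm))),
    (F.tgt_map f).trans ((GphCat.mapA_congr (F := F.F₀) rfl s.2).trans ((mk_map_id _ _).trans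
      (mk_id_congr (F.tgt_obj u).symm)))⟩

lemma Special.consec {u u' v v' : A.A₁} {f : u ⟶ u'} {g : v ⟶ v'} (s : Special f) (t : Special g)
    (h : A.tgt.obj u = A.src.obj v) : Consec f g :=
  s.2.trans ((mk_id_congr h).trans t.1.symm)

lemma Consec.map {B : GphCat.{u}} (F : A ⟶ B) {u u' v v' : A.A₁} {f : u ⟶ u'} {g : v ⟶ v'}
    (c : Consec f g) : Consec (F.F₁.map f) (F.F₁.map g) :=
  (F.tgt_map f).trans ((GphCat.mapA_congr (F := F.F₀) rfl c).trans (F.src_map g).symm)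

lemma Consec.app {B : GphCat.{u}} {F G : A ⟶ B} (φ : F ⟶ G) {u v : A.A₁}
    (h : A.tgt.obj u = A.src.obj v) : Consec (φ.φ₁.app u) (φ.φ₁.app v) :=
  (φ.tgt u).trans ((congrArg (fun x => Arrow.mk (φ.φ₀.app x)) h).trans (φ.src v).symm)

lemma map_tgt_src {B : GphCat.{u}} (F : A ⟶ B) {u v : A.A₁} (h : A.tgt.obj u = A.src.obj v) :
    B.tgt.obj (F.F₁.obj u) = B.src.obj (F.F₁.obj v) :=
  (F.tgt_obj u).trans ((congrArg F.F₀.obj h).trans (F.src_obj v).symm)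

end

/-- Vertical identities, and functorial vertical composition of consecutive vertical arrows and
consecutive cells, in a graph of categories. -/
structure VertOps (A : GphCat.{u}) : Type u where
  one : A.A₀ ⥤ A.A₁
  one_src : one ⋙ A.src = 𝟭 A.A₀
  one_tgt : one ⋙ A.tgt = 𝟭 A.A₀
  comp : ∀ u v : A.A₁, A.tgt.obj u = A.src.obj v → A.A₁
  comp_src : ∀ u v h, A.src.obj (comp u v h) = A.src.obj u
  comp_tgt : ∀ u v h, A.tgt.obj (comp u v h) = A.tgt.obj v
  cmap : ∀ {u u' v v' : A.A₁} (f : u ⟶ u') (g : v ⟶ v') (c : Consec f g),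
    comp u v c.left ⟶ comp u' v' c.right
  cmap_src : ∀ {u u' v v' : A.A₁} (f : u ⟶ u') (g : v ⟶ v') (c : Consec f g),
    Arrow.mk (A.src.map (cmap f g c)) = Arrow.mk (A.src.map f)
  cmap_tgt : ∀ {u u' v v' : A.A₁} (f : u ⟶ u') (g : v ⟶ v') (c : Consec f g),
    Arrow.mk (A.tgt.map (cmap f g c)) = Arrow.mk (A.tgt.map g)
  cmap_id : ∀ (u v : A.A₁) (h : A.tgt.obj u = A.src.obj v),
    cmap (𝟙 u) (𝟙 v) (.id h) = 𝟙 (comp u v h)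
  cmap_comp : ∀ {u u' u'' v v' v'' : A.A₁} (f : u ⟶ u') (g : v ⟶ v') (f' : u' ⟶ u'')
    (g' : v' ⟶ v'') (c : Consec f g) (c' : Consec f' g'),
    cmap (f ≫ f') (g ≫ g') (c.comp c') = cmap f g c ≫ cmap f' g' c'

namespace VertOps
variable {A : GphCat.{u}} (D : VertOps A)

lemma src_one (x : A.A₀) : A.src.obj (D.one.obj x) = x := Functor.congr_obj D.one_src x

lemma tgt_one (x : A.A₀) : A.tgt.obj (D.one.obj x) = x := Functor.congr_obj D.one_tgt x

lemma src_map_one {x y : A.A₀} (f : x ⟶ y) : Arrow.mk (A.src.map (D.one.map f)) = Arrow.mk f :=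
  GphCat.mapA_congr D.one_src (a := Arrow.mk f) rfl

lemma tgt_map_one {x y : A.A₀} (f : x ⟶ y) : Arrow.mk (A.tgt.map (D.one.map f)) = Arrow.mk f :=
  GphCat.mapA_congr D.one_tgt (a := Arrow.mk f) rfl

variable {D} {u u' v v' w w' : A.A₁}

lemma h_left (h : A.tgt.obj u = A.src.obj v) (h' : A.tgt.obj v = A.src.obj w) :
    A.tgt.obj u = A.src.obj (D.comp v w h') := h.trans (D.comp_src _ _ _).symm

lemma h_right (h : A.tgt.obj u = A.src.obj v) (h' : A.tgt.obj v = A.src.obj w) :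
    A.tgt.obj (D.comp u v h) = A.src.obj w := (D.comp_tgt _ _ _).trans h'

lemma h_lunit {x : A.A₀} (h : x = A.src.obj u) : A.tgt.obj (D.one.obj x) = A.src.obj u :=
  (D.tgt_one x).trans h

lemma h_runit {x : A.A₀} (h : A.tgt.obj u = x) : A.tgt.obj u = A.src.obj (D.one.obj x) :=
  h.trans (D.src_one x).symm

lemma c_left {f : u ⟶ u'} {g : v ⟶ v'} {k : w ⟶ w'} (c : Consec f g) (c' : Consec g k) :
    Consec f (D.cmap g k c') := c.trans (D.cmap_src _ _ _).symm

lemma c_right {f : u ⟶ u'} {g : v ⟶ v'} {k : w ⟶ w'} (c : Consec f g) (c' : Consec g k) :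
    Consec (D.cmap f g c) k := (D.cmap_tgt _ _ _).trans c'

lemma c_lunit {x y : A.A₀} {f : x ⟶ y} {g : u ⟶ v} (c : Arrow.mk f = Arrow.mk (A.src.map g)) :
    Consec (D.one.map f) g := (D.tgt_map_one f).trans c

lemma c_runit {x y : A.A₀} {f : x ⟶ y} {g : u ⟶ v} (c : Arrow.mk (A.tgt.map g) = Arrow.mk f) :
    Consec g (D.one.map f) := c.trans (D.src_map_one f).symm

end VertOps

/-- The structure of a weak double category on a graph of categories `A`; `A.A₀` is the category of
objects and horizontal arrows, `A.A₁` the category of vertical arrows and cells, with horizontal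
composition.  The unitors and the associator are invertible, special and natural, and satisfy the
triangle and pentagon conditions. -/
structure WDblStr (A : GphCat.{u}) : Type u where
  ops : VertOps A
  lunit : ∀ (x : A.A₀) (u : A.A₁) (h : x = A.src.obj u), ops.comp (ops.one.obj x) u (VertOps.h_lunit h) ≅ u
  runit : ∀ (u : A.A₁) (x : A.A₀) (h : A.tgt.obj u = x), ops.comp u (ops.one.obj x) (VertOps.h_runit h) ≅ u
  assoc : ∀ (u v w : A.A₁) (h : A.tgt.obj u = A.src.obj v) (h' : A.tgt.obj v = A.src.obj w),
    ops.comp u (ops.comp v w h') (VertOps.h_left h h') ≅ ops.comp (ops.comp u v h) w (VertOps.h_right h h')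
  lunit_special : ∀ x u h, Special (lunit x u h).hom
  runit_special : ∀ u x h, Special (runit u x h).hom
  assoc_special : ∀ u v w h h', Special (assoc u v w h h').hom
  lunit_nat : ∀ {x y : A.A₀} {u v : A.A₁} (f : x ⟶ y) (g : u ⟶ v)
    (c : Arrow.mk f = Arrow.mk (A.src.map g)),
    ops.cmap (ops.one.map f) g (VertOps.c_lunit c) ≫ (lunit y v (congrArg (·.right) c)).hom =
      (lunit x u (congrArg (·.left) c)).hom ≫ g
  runit_nat : ∀ {x y : A.A₀} {u v : A.A₁} (g : u ⟶ v) (f : x ⟶ y)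
    (c : Arrow.mk (A.tgt.map g) = Arrow.mk f),
    ops.cmap g (ops.one.map f) (VertOps.c_runit c) ≫ (runit v y (congrArg (·.right) c)).hom =
      (runit u x (congrArg (·.left) c)).hom ≫ g
  assoc_nat : ∀ {u u' v v' w w' : A.A₁} (f : u ⟶ u') (g : v ⟶ v') (k : w ⟶ w')
    (c : Consec f g) (c' : Consec g k),
    ops.cmap f (ops.cmap g k c') (VertOps.c_left c c') ≫ (assoc u' v' w' c.right c'.right).hom =
      (assoc u v w c.left c'.left).hom ≫ ops.cmap (ops.cmap f g c) k (VertOps.c_right c c')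
  triangle : ∀ (u : A.A₁) (x : A.A₀) (v : A.A₁) (h : A.tgt.obj u = x) (h' : x = A.src.obj v),
    (assoc u (ops.one.obj x) v (VertOps.h_runit h) (VertOps.h_lunit h')).hom ≫
        ops.cmap (runit u x h).hom (𝟙 v) ((runit_special u x h).consec (.id v)
          (VertOps.h_right _ (VertOps.h_lunit h'))) =
      ops.cmap (𝟙 u) (lunit x v h').hom ((Special.id u).consec (lunit_special x v h')
        (VertOps.h_left (VertOps.h_runit h) _))
  pentagon : ∀ (u v w z : A.A₁) (h : A.tgt.obj u = A.src.obj v) (h' : A.tgt.obj v = A.src.obj w)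
    (h'' : A.tgt.obj w = A.src.obj z),
    (assoc u v (ops.comp w z h'') h (VertOps.h_left h' h'')).hom ≫
        (assoc (ops.comp u v h) w z (VertOps.h_right h h') h'').hom =
      ops.cmap (𝟙 u) (assoc v w z h' h'').hom ((Special.id u).consec (assoc_special _ _ _ _ _)
          (VertOps.h_left h _)) ≫
        (assoc u (ops.comp v w h') z (VertOps.h_left h h') (VertOps.h_right h' h'')).hom ≫
        ops.cmap (assoc u v w h h').hom (𝟙 z) ((assoc_special _ _ _ _ _).consec (.id z)
          (VertOps.h_right _ (VertOps.h_right h' h'')))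

/-- A (small) weak double category. -/
structure WDbl where
  graph : GphCat.{u}
  str : WDblStr graph

/-- A lax double functor. -/
structure LaxDbl (D E : WDbl.{u}) : Type u where
  f : D.graph ⟶ E.graph
  unit : ∀ x : D.graph.A₀, E.str.ops.one.obj (f.F₀.obj x) ⟶ f.F₁.obj (D.str.ops.one.obj x)
  mult : ∀ (u v : D.graph.A₁) (h : D.graph.tgt.obj u = D.graph.src.obj v),
    E.str.ops.comp (f.F₁.obj u) (f.F₁.obj v) (map_tgt_src f h) ⟶ f.F₁.obj (D.str.ops.comp u v h)
  unit_special : ∀ x, Special (unit x)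
  mult_special : ∀ u v h, Special (mult u v h)
  unit_nat : ∀ {x y : D.graph.A₀} (a : x ⟶ y),
    E.str.ops.one.map (f.F₀.map a) ≫ unit y = unit x ≫ f.F₁.map (D.str.ops.one.map a)
  mult_nat : ∀ {u u' v v' : D.graph.A₁} (a : u ⟶ u') (b : v ⟶ v') (c : Consec a b),
    E.str.ops.cmap (f.F₁.map a) (f.F₁.map b) (c.map f) ≫ mult u' v' c.right =
      mult u v c.left ≫ f.F₁.map (D.str.ops.cmap a b c)
  lunit : ∀ (x : D.graph.A₀) (u : D.graph.A₁) (h : x = D.graph.src.obj u),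
    E.str.ops.cmap (unit x) (𝟙 (f.F₁.obj u)) ((unit_special x).consec (.id _)
        (VertOps.h_lunit ((congrArg f.F₀.obj h).trans (f.src_obj u).symm))) ≫
      mult (D.str.ops.one.obj x) u (VertOps.h_lunit h) ≫ f.F₁.map (D.str.lunit x u h).hom =
    (E.str.lunit (f.F₀.obj x) (f.F₁.obj u)
      ((congrArg f.F₀.obj h).trans (f.src_obj u).symm)).hom
  runit : ∀ (u : D.graph.A₁) (x : D.graph.A₀) (h : D.graph.tgt.obj u = x),
    E.str.ops.cmap (𝟙 (f.F₁.obj u)) (unit x) ((Special.id _).consec (unit_special x)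
        (VertOps.h_runit ((f.tgt_obj u).trans (congrArg f.F₀.obj h)))) ≫
      mult u (D.str.ops.one.obj x) (VertOps.h_runit h) ≫ f.F₁.map (D.str.runit u x h).hom =
    (E.str.runit (f.F₁.obj u) (f.F₀.obj x)
      ((f.tgt_obj u).trans (congrArg f.F₀.obj h))).hom
  assoc : ∀ (u v w : D.graph.A₁) (h : D.graph.tgt.obj u = D.graph.src.obj v)
    (h' : D.graph.tgt.obj v = D.graph.src.obj w),
    E.str.ops.cmap (𝟙 (f.F₁.obj u)) (mult v w h') ((Special.id _).consec (mult_special v w h')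
        (VertOps.h_left (map_tgt_src f h) _)) ≫
      mult u (D.str.ops.comp v w h') (VertOps.h_left h h') ≫ f.F₁.map (D.str.assoc u v w h h').hom =
    (E.str.assoc (f.F₁.obj u) (f.F₁.obj v) (f.F₁.obj w) (map_tgt_src f h)
        (map_tgt_src f h')).hom ≫
      E.str.ops.cmap (mult u v h) (𝟙 (f.F₁.obj w)) ((mult_special u v h).consec (.id _)
        (VertOps.h_right _ (map_tgt_src f h'))) ≫
      mult (D.str.ops.comp u v h) w (VertOps.h_right h h')

/-- A colax double functor. -/
structure ColaxDbl (D E : WDbl.{u}) : Type u where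
  f : D.graph ⟶ E.graph
  unit : ∀ x : D.graph.A₀, f.F₁.obj (D.str.ops.one.obj x) ⟶ E.str.ops.one.obj (f.F₀.obj x)
  mult : ∀ (u v : D.graph.A₁) (h : D.graph.tgt.obj u = D.graph.src.obj v),
    f.F₁.obj (D.str.ops.comp u v h) ⟶ E.str.ops.comp (f.F₁.obj u) (f.F₁.obj v) (map_tgt_src f h)
  unit_special : ∀ x, Special (unit x)
  mult_special : ∀ u v h, Special (mult u v h)
  unit_nat : ∀ {x y : D.graph.A₀} (a : x ⟶ y),
    f.F₁.map (D.str.ops.one.map a) ≫ unit y = unit x ≫ E.str.ops.one.map (f.F₀.map a)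
  mult_nat : ∀ {u u' v v' : D.graph.A₁} (a : u ⟶ u') (b : v ⟶ v') (c : Consec a b),
    f.F₁.map (D.str.ops.cmap a b c) ≫ mult u' v' c.right =
      mult u v c.left ≫ E.str.ops.cmap (f.F₁.map a) (f.F₁.map b) (c.map f)
  lunit : ∀ (x : D.graph.A₀) (u : D.graph.A₁) (h : x = D.graph.src.obj u),
    mult (D.str.ops.one.obj x) u (VertOps.h_lunit h) ≫
      E.str.ops.cmap (unit x) (𝟙 (f.F₁.obj u)) ((unit_special x).consec (.id _)
        (map_tgt_src f (VertOps.h_lunit h))) ≫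
      (E.str.lunit (f.F₀.obj x) (f.F₁.obj u)
        ((congrArg f.F₀.obj h).trans (f.src_obj u).symm)).hom =
    f.F₁.map (D.str.lunit x u h).hom
  runit : ∀ (u : D.graph.A₁) (x : D.graph.A₀) (h : D.graph.tgt.obj u = x),
    mult u (D.str.ops.one.obj x) (VertOps.h_runit h) ≫
      E.str.ops.cmap (𝟙 (f.F₁.obj u)) (unit x) ((Special.id _).consec (unit_special x)
        (map_tgt_src f (VertOps.h_runit h))) ≫
      (E.str.runit (f.F₁.obj u) (f.F₀.obj x)
        ((f.tgt_obj u).trans (congrArg f.F₀.obj h))).hom =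
    f.F₁.map (D.str.runit u x h).hom
  assoc : ∀ (u v w : D.graph.A₁) (h : D.graph.tgt.obj u = D.graph.src.obj v)
    (h' : D.graph.tgt.obj v = D.graph.src.obj w),
    mult u (D.str.ops.comp v w h') (VertOps.h_left h h') ≫
      E.str.ops.cmap (𝟙 (f.F₁.obj u)) (mult v w h') ((Special.id _).consec (mult_special v w h')
        (map_tgt_src f (VertOps.h_left h h'))) ≫
      (E.str.assoc (f.F₁.obj u) (f.F₁.obj v) (f.F₁.obj w) (map_tgt_src f h)
        (map_tgt_src f h')).hom =
    f.F₁.map (D.str.assoc u v w h h').hom ≫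
      mult (D.str.ops.comp u v h) w (VertOps.h_right h h') ≫
      E.str.ops.cmap (mult u v h) (𝟙 (f.F₁.obj w)) ((mult_special u v h).consec (.id _)
        (map_tgt_src f (VertOps.h_right h h')))

/-- A pseudo double functor: a lax double functor whose comparisons are invertible. -/
structure PseudoDbl (D E : WDbl.{u}) extends LaxDbl D E where
  unit_iso : ∀ x, IsIso (unit x)
  mult_iso : ∀ u v h, IsIso (mult u v h)

end TripleCat

namespace TripleCat
open Bicategory

namespace VertOps
variable {A : GphCat.{u}} (D : VertOps A)

lemma cmap_congr {u u' v v' : A.A₁} {f f' : u ⟶ u'} {g g' : v ⟶ v'} (hf : f = f') (hg : g = g')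
    (c : Consec f g) (c' : Consec f' g') : D.cmap f g c = D.cmap f' g' c' := by
  subst hf hg; rfl

lemma cmap_comp_id {u u' u'' v : A.A₁} (f : u ⟶ u') (f' : u' ⟶ u'') (c : Consec (f ≫ f') (𝟙 v))
    (c' : Consec f (𝟙 v)) (c'' : Consec f' (𝟙 v)) :
    D.cmap (f ≫ f') (𝟙 v) c = D.cmap f (𝟙 v) c' ≫ D.cmap f' (𝟙 v) c'' := by
  rw [← D.cmap_comp]
  exact D.cmap_congr rfl (Category.comp_id _).symm _ _

lemma cmap_id_comp {u u' u'' v : A.A₁} (f : u ⟶ u') (f' : u' ⟶ u'') (c : Consec (𝟙 v) (f ≫ f'))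
    (c' : Consec (𝟙 v) f) (c'' : Consec (𝟙 v) f') :
    D.cmap (𝟙 v) (f ≫ f') c = D.cmap (𝟙 v) f c' ≫ D.cmap (𝟙 v) f' c'' := by
  rw [← D.cmap_comp]
  exact D.cmap_congr (Category.comp_id _).symm rfl _ _

end VertOps

variable {D E F G : WDbl.{u}}

lemma LaxDbl.ext' {x y : LaxDbl D E} (h : x.f = y.f)
    (h₁ : ∀ a, Arrow.mk (x.unit a) = Arrow.mk (y.unit a))
    (h₂ : ∀ u v h, Arrow.mk (x.mult u v h) = Arrow.mk (y.mult u v h)) : x = y := by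
  obtain ⟨f, μ, ν, _, _, _, _, _, _, _⟩ := x
  obtain ⟨g, μ', ν', _, _, _, _, _, _, _⟩ := y
  dsimp only at h h₁ h₂
  subst h
  obtain rfl : μ = μ' := funext fun a => Arrow.mk_injective _ _ (h₁ a)
  obtain rfl : ν = ν' := funext fun u => funext fun v => funext fun h =>
    Arrow.mk_injective _ _ (h₂ u v h)
  rfl

lemma ColaxDbl.ext' {x y : ColaxDbl D E} (h : x.f = y.f)
    (h₁ : ∀ a, Arrow.mk (x.unit a) = Arrow.mk (y.unit a))
    (h₂ : ∀ u v h, Arrow.mk (x.mult u v h) = Arrow.mk (y.mult u v h)) : x = y := by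
  obtain ⟨f, μ, ν, _, _, _, _, _, _, _⟩ := x
  obtain ⟨g, μ', ν', _, _, _, _, _, _, _⟩ := y
  dsimp only at h h₁ h₂
  subst h
  obtain rfl : μ = μ' := funext fun a => Arrow.mk_injective _ _ (h₁ a)
  obtain rfl : ν = ν' := funext fun u => funext fun v => funext fun h =>
    Arrow.mk_injective _ _ (h₂ u v h)
  rfl

lemma PseudoDbl.ext' {x y : PseudoDbl D E} (h : x.toLaxDbl = y.toLaxDbl) : x = y := by
  obtain ⟨x, _, _⟩ := x
  obtain ⟨y, _, _⟩ := y
  dsimp only at h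
  subst h
  rfl

section
variable {K : Type*} [Category K] {X Y : K}

lemma id3 {a : X ⟶ X} (h : a = 𝟙 X) (f : X ⟶ Y) : a ≫ 𝟙 X ≫ f = f := by
  rw [h, Category.id_comp, Category.id_comp]

lemma id4 {a : X ⟶ X} {b : Y ⟶ Y} (h : a = 𝟙 X) (h' : b = 𝟙 Y) (f : X ⟶ Y) :
    a ≫ 𝟙 X ≫ f = f ≫ b ≫ 𝟙 Y := by
  rw [id3 h, h', Category.comp_id, Category.comp_id]

lemma id3' {a : X ⟶ X} (h : a = 𝟙 X) (f : X ⟶ Y) : 𝟙 X ≫ a ≫ f = f := by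
  rw [h, Category.id_comp, Category.id_comp]

lemma id4' {a : X ⟶ X} {b : Y ⟶ Y} (h : a = 𝟙 X) (h' : b = 𝟙 Y) (f : X ⟶ Y) :
    𝟙 X ≫ a ≫ f = f ≫ 𝟙 Y ≫ b := by
  rw [id3' h, h', Category.comp_id, Category.comp_id]

end

lemma assoc_comp {K : Type*} [Category K] {A₁ A₂ A₃ A₄ A₅ A₆ B₁ B₂ B₃ B₃' B₄ B₅ : K}
    {p : A₁ ⟶ A₂} {q : A₂ ⟶ A₃} {r : A₃ ⟶ A₄} {k : A₁ ⟶ B₁} {l : B₁ ⟶ B₂} {m : B₂ ⟶ A₄}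
    (a : p ≫ q ≫ r = k ≫ l ≫ m)
    {s : A₃ ⟶ A₅} {t : A₅ ⟶ A₆} {z : A₆ ⟶ B₅} {y : A₄ ⟶ B₄} {x : B₄ ⟶ B₅}
    (b : s ≫ t ≫ z = r ≫ y ≫ x) {s' : A₂ ⟶ B₃} {q' : B₃ ⟶ A₅} (e : s' ≫ q' = q ≫ s)
    {y' : B₂ ⟶ B₃'} {m' : B₃' ⟶ B₄} (e' : y' ≫ m' = m ≫ y) :
    (p ≫ s') ≫ (q' ≫ t) ≫ z = k ≫ (l ≫ y') ≫ (m' ≫ x) := by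
  simp only [Category.assoc]
  rw [reassoc_of% e, b, reassoc_of% e', reassoc_of% a]

lemma unit_comp {K : Type*} [Category K] {A₁ A₂ A₃ A₄ A₅ A₆ B₃ : K}
    {p : A₁ ⟶ A₂} {q : A₂ ⟶ A₃} {r : A₃ ⟶ A₄} {k : A₁ ⟶ A₄} (a : p ≫ q ≫ r = k)
    {s : A₃ ⟶ A₅} {t : A₅ ⟶ A₆} {z : A₆ ⟶ A₄} (b : s ≫ t ≫ z = r)
    {s' : A₂ ⟶ B₃} {q' : B₃ ⟶ A₅} (e : s' ≫ q' = q ≫ s) :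
    (p ≫ s') ≫ (q' ≫ t) ≫ z = k := by
  simp only [Category.assoc]
  rw [reassoc_of% e, b, a]

lemma unit_comp' {K : Type*} [Category K] {A₁ A₂ A₃ A₄ A₅ A₆ B₃ : K}
    {p : A₃ ⟶ A₅} {q : A₅ ⟶ A₆} {k : A₆ ⟶ A₄} {z : A₃ ⟶ A₄} (a : p ≫ q ≫ k = z)
    {s : A₁ ⟶ A₂} {t : A₂ ⟶ A₃} {r : A₁ ⟶ A₄} (b : s ≫ t ≫ z = r)
    {p' : A₂ ⟶ B₃} {t' : B₃ ⟶ A₅} (e : t ≫ p = p' ≫ t') :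
    (s ≫ p') ≫ (t' ≫ q) ≫ k = r := by
  simp only [Category.assoc]
  rw [← reassoc_of% e, a, b]

lemma assoc_comp' {K : Type*} [Category K] {A₁ A₂ A₃ A₄ A₅ A₆ B₁ B₂ B₃ B₄ B₅ B₆ : K}
    {p : A₃ ⟶ A₅} {q : A₅ ⟶ A₆} {k : A₆ ⟶ B₆} {z : A₃ ⟶ A₄} {n : A₄ ⟶ B₄} {o : B₄ ⟶ B₆}
    (a : p ≫ q ≫ k = z ≫ n ≫ o)
    {s : A₁ ⟶ A₂} {t : A₂ ⟶ A₃} {r : A₁ ⟶ B₁} {l : B₁ ⟶ B₂} {m : B₂ ⟶ A₄}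
    (b : s ≫ t ≫ z = r ≫ l ≫ m)
    {p' : A₂ ⟶ B₃} {t' : B₃ ⟶ A₅} (e : t ≫ p = p' ≫ t')
    {n' : B₂ ⟶ B₅} {m' : B₅ ⟶ B₄} (e' : m ≫ n = n' ≫ m') :
    (s ≫ p') ≫ (t' ≫ q) ≫ k = r ≫ (l ≫ n') ≫ (m' ≫ o) := by
  simp only [Category.assoc]
  rw [← reassoc_of% e, a, reassoc_of% b, reassoc_of% e']

lemma LaxDbl.mult_nat_left (y : LaxDbl D E) {u u' v : D.graph.A₁} (a : u ⟶ u')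
    (c : Consec a (𝟙 v)) (c') : E.str.ops.cmap (y.f.F₁.map a) (𝟙 (y.f.F₁.obj v)) c' ≫
      y.mult u' v c.right = y.mult u v c.left ≫ y.f.F₁.map (D.str.ops.cmap a (𝟙 v) c) := by
  rw [← y.mult_nat]
  exact congrArg (· ≫ _)
    (E.str.ops.cmap_congr rfl (CategoryTheory.Functor.map_id _ _).symm _ _)

lemma LaxDbl.mult_nat_right (y : LaxDbl D E) {u u' v : D.graph.A₁} (a : u ⟶ u')
    (c : Consec (𝟙 v) a) (c') : E.str.ops.cmap (𝟙 (y.f.F₁.obj v)) (y.f.F₁.map a) c' ≫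
      y.mult v u' c.right = y.mult v u c.left ≫ y.f.F₁.map (D.str.ops.cmap (𝟙 v) a c) := by
  rw [← y.mult_nat]
  exact congrArg (· ≫ _)
    (E.str.ops.cmap_congr (CategoryTheory.Functor.map_id _ _).symm rfl _ _)

lemma ColaxDbl.mult_nat_left (y : ColaxDbl D E) {u u' v : D.graph.A₁} (a : u ⟶ u')
    (c : Consec a (𝟙 v)) (c') : y.f.F₁.map (D.str.ops.cmap a (𝟙 v) c) ≫ y.mult u' v c.right =
      y.mult u v c.left ≫ E.str.ops.cmap (y.f.F₁.map a) (𝟙 (y.f.F₁.obj v)) c' := by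
  rw [y.mult_nat]
  exact congrArg (_ ≫ ·)
    (E.str.ops.cmap_congr rfl (CategoryTheory.Functor.map_id _ _) _ _)

lemma ColaxDbl.mult_nat_right (y : ColaxDbl D E) {u u' v : D.graph.A₁} (a : u ⟶ u')
    (c : Consec (𝟙 v) a) (c') : y.f.F₁.map (D.str.ops.cmap (𝟙 v) a c) ≫ y.mult v u' c.right =
      y.mult v u c.left ≫ E.str.ops.cmap (𝟙 (y.f.F₁.obj v)) (y.f.F₁.map a) c' := by
  rw [y.mult_nat]
  exact congrArg (_ ≫ ·)
    (E.str.ops.cmap_congr (CategoryTheory.Functor.map_id _ _) rfl _ _)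

/-- The identity lax double functor. -/
def LaxDbl.id (D : WDbl.{u}) : LaxDbl D D where
  f := GphCat.Hom.id D.graph
  unit _ := 𝟙 _
  mult _ _ _ := 𝟙 _
  unit_special _ := .id _
  mult_special _ _ _ := .id _
  unit_nat _ := (Category.comp_id _).trans (Category.id_comp _).symm
  mult_nat _ _ _ := (Category.comp_id _).trans (Category.id_comp _).symm
  lunit _ _ _ := id3 (D.str.ops.cmap_id _ _ _) _
  runit _ _ _ := id3 (D.str.ops.cmap_id _ _ _) _
  assoc u v w h h' := id4 (D.str.ops.cmap_id _ _ _) (D.str.ops.cmap_id _ _ _) (D.str.assoc u v w h h').hom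

/-- The identity colax double functor. -/
def ColaxDbl.id (D : WDbl.{u}) : ColaxDbl D D where
  f := GphCat.Hom.id D.graph
  unit _ := 𝟙 _
  mult _ _ _ := 𝟙 _
  unit_special _ := .id _
  mult_special _ _ _ := .id _
  unit_nat _ := (Category.comp_id _).trans (Category.id_comp _).symm
  mult_nat _ _ _ := (Category.comp_id _).trans (Category.id_comp _).symm
  lunit _ _ _ := id3' (D.str.ops.cmap_id _ _ _) _
  runit _ _ _ := id3' (D.str.ops.cmap_id _ _ _) _
  assoc u v w h h' := id4' (D.str.ops.cmap_id _ _ _) (D.str.ops.cmap_id _ _ _) (D.str.assoc u v w h h').hom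

/-- The composite of lax double functors. -/
def LaxDbl.comp (x : LaxDbl D E) (y : LaxDbl E F) : LaxDbl D F where
  f := GphCat.Hom.comp x.f y.f
  unit a := y.unit (x.f.F₀.obj a) ≫ y.f.F₁.map (x.unit a)
  mult u v h := y.mult _ _ (map_tgt_src x.f h) ≫ y.f.F₁.map (x.mult u v h)
  unit_special a := (y.unit_special _).comp ((x.unit_special a).map y.f)
  mult_special u v h := (y.mult_special _ _ _).comp ((x.mult_special u v h).map y.f)
  unit_nat a := by
    have e := congrArg y.f.F₁.map (x.unit_nat a)
    have e' := y.unit_nat (x.f.F₀.map a)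
    rw [Functor.map_comp, Functor.map_comp] at e
    change F.str.ops.one.map (y.f.F₀.map (x.f.F₀.map a)) ≫ _ ≫ _ =
      (_ ≫ _) ≫ y.f.F₁.map (x.f.F₁.map _)
    rw [← Category.assoc, e', Category.assoc, Category.assoc, e]
  mult_nat a b c := by
    have e := congrArg y.f.F₁.map (x.mult_nat a b c)
    have e' := y.mult_nat _ _ (c.map x.f)
    rw [Functor.map_comp, Functor.map_comp] at e
    change F.str.ops.cmap (y.f.F₁.map (x.f.F₁.map a)) (y.f.F₁.map (x.f.F₁.map b)) _ ≫ _ ≫ _ =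
      (_ ≫ _) ≫ y.f.F₁.map (x.f.F₁.map _)
    rw [← Category.assoc, e', Category.assoc, Category.assoc, e]
  lunit a u h := by
    have hu := (congrArg x.f.F₀.obj h).trans (x.f.src_obj u).symm
    have c₁ : Consec (x.unit a) (𝟙 (x.f.F₁.obj u)) :=
      (x.unit_special a).consec (.id _) (VertOps.h_lunit hu)
    have c₂ := c₁.map y.f
    rw [CategoryTheory.Functor.map_id] at c₂
    have b := congrArg y.f.F₁.map (x.lunit a u h)
    simp only [Functor.map_comp] at b
    exact (congrArg (· ≫ _) (F.str.ops.cmap_comp_id _ _ _ ((y.unit_special _).consec (.id _)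
      (VertOps.h_lunit ((congrArg y.f.F₀.obj hu).trans (y.f.src_obj _).symm))) c₂)).trans
      (unit_comp (y.lunit _ _ hu) b (y.mult_nat_left _ c₁ c₂))
  runit u a h := by
    have hu := (x.f.tgt_obj u).trans (congrArg x.f.F₀.obj h)
    have c₁ : Consec (𝟙 (x.f.F₁.obj u)) (x.unit a) :=
      (Special.id _).consec (x.unit_special a) (VertOps.h_runit hu)
    have c₂ := c₁.map y.f
    rw [CategoryTheory.Functor.map_id] at c₂
    have b := congrArg y.f.F₁.map (x.runit u a h)
    simp only [Functor.map_comp] at b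
    exact (congrArg (· ≫ _) (F.str.ops.cmap_id_comp _ _ _ ((Special.id _).consec
      (y.unit_special _) (VertOps.h_runit ((y.f.tgt_obj _).trans (congrArg y.f.F₀.obj hu)))
      ) c₂)).trans (unit_comp (y.runit _ _ hu) b (y.mult_nat_right _ c₁ c₂))
  assoc u v w h h' := by
    have c₁ : Consec (𝟙 (x.f.F₁.obj u)) (x.mult v w h') := (Special.id _).consec
      (x.mult_special v w h') (VertOps.h_left (map_tgt_src x.f h) _)
    have c₂ := c₁.map y.f
    rw [CategoryTheory.Functor.map_id] at c₂
    have d₁ : Consec (x.mult u v h) (𝟙 (x.f.F₁.obj w)) := (x.mult_special u v h).consec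
      (.id _) (VertOps.h_right _ (map_tgt_src x.f h'))
    have d₂ := d₁.map y.f
    rw [CategoryTheory.Functor.map_id] at d₂
    have e := y.mult_nat_right _ c₁ c₂
    have e' := y.mult_nat_left _ d₁ d₂
    have a := y.assoc _ _ _ (map_tgt_src x.f h) (map_tgt_src x.f h')
    have b := congrArg y.f.F₁.map (x.assoc u v w h h')
    simp only [Functor.map_comp] at b
    refine (congrArg (· ≫ _) (F.str.ops.cmap_id_comp _ _ _
      ((Special.id _).consec (y.mult_special _ _ _) (VertOps.h_left
        (map_tgt_src y.f (map_tgt_src x.f h)) _)) c₂)).trans ?_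
    refine Eq.trans ?_ (congrArg (fun z => _ ≫ z ≫ _) (F.str.ops.cmap_comp_id _ _ _
      ((y.mult_special _ _ _).consec (.id _) (VertOps.h_right _
        (map_tgt_src y.f (map_tgt_src x.f h')))) d₂)).symm
    exact assoc_comp a b e e'

/-- The composite of colax double functors. -/
def ColaxDbl.comp (x : ColaxDbl D E) (y : ColaxDbl E F) : ColaxDbl D F where
  f := GphCat.Hom.comp x.f y.f
  unit a := y.f.F₁.map (x.unit a) ≫ y.unit (x.f.F₀.obj a)
  mult u v h := y.f.F₁.map (x.mult u v h) ≫ y.mult _ _ (map_tgt_src x.f h)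
  unit_special a := ((x.unit_special a).map y.f).comp (y.unit_special _)
  mult_special u v h := ((x.mult_special u v h).map y.f).comp (y.mult_special _ _ _)
  unit_nat a := by
    have e := congrArg y.f.F₁.map (x.unit_nat a)
    have e' := y.unit_nat (x.f.F₀.map a)
    rw [Functor.map_comp, Functor.map_comp] at e
    change y.f.F₁.map (x.f.F₁.map _) ≫ _ ≫ _ =
      (_ ≫ _) ≫ F.str.ops.one.map (y.f.F₀.map (x.f.F₀.map a))
    rw [Category.assoc, ← e', ← Category.assoc, e, Category.assoc]
  mult_nat a b c := by
    have e := congrArg y.f.F₁.map (x.mult_nat a b c)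
    have e' := y.mult_nat _ _ (c.map x.f)
    rw [Functor.map_comp, Functor.map_comp] at e
    change y.f.F₁.map (x.f.F₁.map _) ≫ _ ≫ _ =
      (_ ≫ _) ≫ F.str.ops.cmap (y.f.F₁.map (x.f.F₁.map a)) (y.f.F₁.map (x.f.F₁.map b)) _
    rw [Category.assoc, ← e', ← Category.assoc, e, Category.assoc]
  lunit a u h := by
    have hu := (congrArg x.f.F₀.obj h).trans (x.f.src_obj u).symm
    have c₁ : Consec (x.unit a) (𝟙 (x.f.F₁.obj u)) :=
      (x.unit_special a).consec (.id _) (map_tgt_src x.f (VertOps.h_lunit h))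
    have c₂ := c₁.map y.f
    rw [CategoryTheory.Functor.map_id] at c₂
    have b := congrArg y.f.F₁.map (x.lunit a u h)
    simp only [Functor.map_comp] at b
    exact (congrArg (fun z => _ ≫ z ≫ _) (F.str.ops.cmap_comp_id _ _ _ c₂
      ((y.unit_special _).consec (.id _) (map_tgt_src y.f (VertOps.h_lunit hu))))).trans
      (unit_comp' (y.lunit _ _ hu) b (y.mult_nat_left _ c₁ c₂))
  runit u a h := by
    have hu := (x.f.tgt_obj u).trans (congrArg x.f.F₀.obj h)
    have c₁ : Consec (𝟙 (x.f.F₁.obj u)) (x.unit a) :=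
      (Special.id _).consec (x.unit_special a) (map_tgt_src x.f (VertOps.h_runit h))
    have c₂ := c₁.map y.f
    rw [CategoryTheory.Functor.map_id] at c₂
    have b := congrArg y.f.F₁.map (x.runit u a h)
    simp only [Functor.map_comp] at b
    exact (congrArg (fun z => _ ≫ z ≫ _) (F.str.ops.cmap_id_comp _ _ _ c₂
      ((Special.id _).consec (y.unit_special _) (map_tgt_src y.f (VertOps.h_runit hu))))).trans
      (unit_comp' (y.runit _ _ hu) b (y.mult_nat_right _ c₁ c₂))
  assoc u v w h h' := by
    have c₁ : Consec (𝟙 (x.f.F₁.obj u)) (x.mult v w h') := (Special.id _).consec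
      (x.mult_special v w h') (map_tgt_src x.f (VertOps.h_left h h'))
    have c₂ := c₁.map y.f
    rw [CategoryTheory.Functor.map_id] at c₂
    have d₁ : Consec (x.mult u v h) (𝟙 (x.f.F₁.obj w)) := (x.mult_special u v h).consec
      (.id _) (map_tgt_src x.f (VertOps.h_right h h'))
    have d₂ := d₁.map y.f
    rw [CategoryTheory.Functor.map_id] at d₂
    have b := congrArg y.f.F₁.map (x.assoc u v w h h')
    simp only [Functor.map_comp] at b
    refine (congrArg (fun z => _ ≫ z ≫ _) (F.str.ops.cmap_id_comp _ _ _ c₂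
      ((Special.id _).consec (y.mult_special _ _ _) (map_tgt_src y.f
        (VertOps.h_left (map_tgt_src x.f h) (map_tgt_src x.f h')))))).trans ?_
    refine Eq.trans ?_ (congrArg (fun z => _ ≫ _ ≫ z) (F.str.ops.cmap_comp_id _ _ _ d₂
      ((y.mult_special _ _ _).consec (.id _) (map_tgt_src y.f
        (VertOps.h_right (map_tgt_src x.f h) (map_tgt_src x.f h')))))).symm
    exact assoc_comp' (y.assoc _ _ _ (map_tgt_src x.f h) (map_tgt_src x.f h')) b
      (y.mult_nat_right _ c₁ c₂) (y.mult_nat_left _ d₁ d₂)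

/-- The identity pseudo double functor. -/
def PseudoDbl.id (D : WDbl.{u}) : PseudoDbl D D :=
  ⟨.id D, fun _ => IsIso.id _, fun _ _ _ => IsIso.id _⟩

/-- The composite of pseudo double functors. -/
def PseudoDbl.comp (x : PseudoDbl D E) (y : PseudoDbl E F) : PseudoDbl D F :=
  ⟨x.toLaxDbl.comp y.toLaxDbl,
    fun a => by
      have := x.unit_iso a
      exact IsIso.comp_isIso' (y.unit_iso _) (Functor.map_isIso y.f.F₁ (x.unit a)),
    fun u v h => by
      have := x.mult_iso u v h
      exact IsIso.comp_isIso' (y.mult_iso _ _ _) (Functor.map_isIso y.f.F₁ (x.mult u v h))⟩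

lemma LaxDbl.id_comp' (x : LaxDbl D E) : (LaxDbl.id D).comp x = x :=
  LaxDbl.ext' rfl
    (fun _ => congrArg Arrow.mk ((congrArg (_ ≫ ·) (x.f.F₁.map_id _)).trans (Category.comp_id _)))
    (fun _ _ _ => congrArg Arrow.mk
      ((congrArg (_ ≫ ·) (x.f.F₁.map_id _)).trans (Category.comp_id _)))

lemma LaxDbl.comp_id' (x : LaxDbl D E) : x.comp (LaxDbl.id E) = x :=
  LaxDbl.ext' rfl (fun _ => congrArg Arrow.mk (Category.id_comp _))
    (fun _ _ _ => congrArg Arrow.mk (Category.id_comp _))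

lemma LaxDbl.assoc' (x : LaxDbl D E) (y : LaxDbl E F) (z : LaxDbl F G) :
    (x.comp y).comp z = x.comp (y.comp z) :=
  LaxDbl.ext' rfl
    (fun _ => congrArg Arrow.mk ((congrArg (_ ≫ ·) (z.f.F₁.map_comp _ _)).trans
      (Category.assoc _ _ _).symm))
    (fun _ _ _ => congrArg Arrow.mk ((congrArg (_ ≫ ·) (z.f.F₁.map_comp _ _)).trans
      (Category.assoc _ _ _).symm))

lemma ColaxDbl.id_comp' (x : ColaxDbl D E) : (ColaxDbl.id D).comp x = x :=
  ColaxDbl.ext' rfl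
    (fun _ => congrArg Arrow.mk ((congrArg (· ≫ _) (x.f.F₁.map_id _)).trans (Category.id_comp _)))
    (fun _ _ _ => congrArg Arrow.mk
      ((congrArg (· ≫ _) (x.f.F₁.map_id _)).trans (Category.id_comp _)))

lemma ColaxDbl.comp_id' (x : ColaxDbl D E) : x.comp (ColaxDbl.id E) = x :=
  ColaxDbl.ext' rfl (fun _ => congrArg Arrow.mk (Category.comp_id _))
    (fun _ _ _ => congrArg Arrow.mk (Category.comp_id _))

lemma ColaxDbl.assoc' (x : ColaxDbl D E) (y : ColaxDbl E F) (z : ColaxDbl F G) :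
    (x.comp y).comp z = x.comp (y.comp z) :=
  ColaxDbl.ext' rfl
    (fun _ => congrArg Arrow.mk ((congrArg (· ≫ _) (z.f.F₁.map_comp _ _)).trans
      (Category.assoc _ _ _)))
    (fun _ _ _ => congrArg Arrow.mk ((congrArg (· ≫ _) (z.f.F₁.map_comp _ _)).trans
      (Category.assoc _ _ _)))

/-- Lax double functors. -/
def laxDblKind : ArrowKind WDbl.graph.{u} where
  Hom := LaxDbl
  id := .id
  comp := .comp
  id_comp := LaxDbl.id_comp'
  comp_id := LaxDbl.comp_id'
  assoc := LaxDbl.assoc'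
  toC x := x.f
  toC_id _ := rfl
  toC_comp _ _ := rfl

/-- Colax double functors. -/
def colaxDblKind : ArrowKind WDbl.graph.{u} where
  Hom := ColaxDbl
  id := .id
  comp := .comp
  id_comp := ColaxDbl.id_comp'
  comp_id := ColaxDbl.comp_id'
  assoc := ColaxDbl.assoc'
  toC x := x.f
  toC_id _ := rfl
  toC_comp _ _ := rfl

/-- Pseudo double functors. -/
def pseudoDblKind : ArrowKind WDbl.graph.{u} where
  Hom := PseudoDbl
  id := .id
  comp := .comp
  id_comp _ := PseudoDbl.ext' (LaxDbl.id_comp' _)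
  comp_id _ := PseudoDbl.ext' (LaxDbl.comp_id' _)
  assoc _ _ _ := PseudoDbl.ext' (LaxDbl.assoc' _ _ _)
  toC x := x.f
  toC_id _ := rfl
  toC_comp _ _ := rfl

end TripleCat

namespace TripleCat
open Bicategory

section
variable {A B E A' D F : GphCat.{u}}

lemma vcomp_eq {K : Type*} [Category K] {X Y Z : K} (f : X ⟶ Y) (g : Y ⟶ Z) (h) :
    vcomp (Arrow.mk f) (Arrow.mk g) h = Arrow.mk (f ≫ g) := vcomp_mk f g

lemma homOf_pasteH {r : A ⟶ B} {r' : B ⟶ E} {s : A' ⟶ D} {s' : D ⟶ F}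
    {u : A ⟶ A'} {v : B ⟶ D} {w : E ⟶ F} (π : r ≫ v ⟶ u ≫ s) (θ : r' ≫ w ⟶ v ≫ s')
    (h : (pasteH π θ).left = (r ≫ r') ≫ w) (h' : (pasteH π θ).right = u ≫ (s ≫ s')) :
    homOf (pasteH π θ) h h' = ((r ◁ θ : (r ≫ r') ≫ w ⟶ r ≫ v ≫ s') ≫ (π ▷ s' :)) :=
  Arrow.mk_injective _ _ ((mk_homOf _ h h').trans
    (vcomp_eq (r ◁ θ : (r ≫ r') ≫ w ⟶ r ≫ v ≫ s') (π ▷ s' : r ≫ v ≫ s' ⟶ u ≫ s ≫ s') rfl))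

lemma homOf_pasteV {r : A ⟶ B} {s : A' ⟶ D} {t : E ⟶ F}
    {u : A ⟶ A'} {u' : A' ⟶ E} {v : B ⟶ D} {v' : D ⟶ F}
    (π : r ≫ v ⟶ u ≫ s) (ζ : s ≫ v' ⟶ u' ≫ t)
    (h : (pasteV π ζ).left = r ≫ (v ≫ v')) (h' : (pasteV π ζ).right = (u ≫ u') ≫ t) :
    homOf (pasteV π ζ) h h' = ((π ▷ v' : r ≫ v ≫ v' ⟶ u ≫ s ≫ v') ≫ (u ◁ ζ :)) :=
  Arrow.mk_injective _ _ ((mk_homOf _ h h').trans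
    (vcomp_eq (π ▷ v' : r ≫ v ≫ v' ⟶ u ≫ s ≫ v') (u ◁ ζ : u ≫ s ≫ v' ⟶ (u ≫ u') ≫ t) rfl))

end

section
variable {K : Type*} [Category K]

lemma cohLaxH {A₀ A₁ A₂ A₃ A₄ A₅ B₁ B₂ B₃ B₄ B₅ : K} {a : A₀ ⟶ A₁} {b : A₁ ⟶ A₂} {n : A₂ ⟶ A₃}
    {t : A₃ ⟶ A₄} {p : A₄ ⟶ A₅} {k : A₀ ⟶ B₁} {l : B₁ ⟶ B₂} {m : B₂ ⟶ B₃} {o : B₃ ⟶ B₄}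
    {q : B₄ ⟶ A₅} {t' : A₂ ⟶ B₅} {n' : B₅ ⟶ A₄} {X : K} {m' : B₁ ⟶ X} {z : X ⟶ B₅} {l' : X ⟶ B₃}
    (nat : n ≫ t = t' ≫ n') (d : a ≫ b ≫ t' = k ≫ m' ≫ z) (c : z ≫ n' ≫ p = l' ≫ o ≫ q)
    (un : l ≫ m = m' ≫ l') {B : A₁ ⟶ A₃} (hB : B = b ≫ n) {K' : A₀ ⟶ B₂} (hK : K' = k ≫ l) :
    a ≫ B ≫ (t ≫ p) = K' ≫ (m ≫ o) ≫ q := by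
  subst hB hK
  simp only [Category.assoc]
  rw [reassoc_of% nat, reassoc_of% d, c, reassoc_of% un]

lemma cohLaxV {A₀ A₁ A₂ A₃ A₄ A₅ B₁ B₂ B₃ B₄ B₅ B₆ : K} {a : A₀ ⟶ A₁} {z : A₁ ⟶ A₂} {n : A₂ ⟶ A₃}
    {p : A₃ ⟶ A₄} {t' : A₄ ⟶ A₅} {l' : A₁ ⟶ B₁} {o : B₁ ⟶ B₂} {q : B₂ ⟶ A₄} {l : A₀ ⟶ B₃}
    {a' : B₃ ⟶ B₁} {t : B₂ ⟶ B₄} {k : B₃ ⟶ B₅} {m : B₅ ⟶ B₆} {j : B₆ ⟶ B₄} {q' : B₄ ⟶ A₅}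
    (c : z ≫ n ≫ p = l' ≫ o ≫ q) (un : l ≫ a' = a ≫ l') (d : a' ≫ o ≫ t = k ≫ m ≫ j)
    (nat : q ≫ t' = t ≫ q') {K' : A₀ ⟶ B₅} (hK : K' = l ≫ k) {J : B₆ ⟶ A₅} (hJ : J = j ≫ q') :
    (a ≫ z) ≫ n ≫ (p ≫ t') = K' ≫ m ≫ J := by
  subst hK hJ
  simp only [Category.assoc]
  rw [reassoc_of% c, nat, ← reassoc_of% un, reassoc_of% d]

lemma cohH {A₁ A₂ A₃ A₄ A₅ A₆ B₁ B₂ B₃ B₄ B₅ X : K} {b : A₁ ⟶ A₂} {n : A₂ ⟶ A₃} {t : A₃ ⟶ A₄}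
    {p : A₄ ⟶ A₅} {q : A₅ ⟶ A₆} {a : A₁ ⟶ B₁} {k : B₁ ⟶ B₂} {l : B₂ ⟶ B₃} {m : B₃ ⟶ B₄}
    {o : B₄ ⟶ A₆} {t' : A₂ ⟶ B₅} {n' : B₅ ⟶ A₄} {z : B₅ ⟶ X} {l' : X ⟶ B₄} {m' : B₂ ⟶ X}
    (nat : n ≫ t = t' ≫ n') (c : n' ≫ p ≫ q = z ≫ l' ≫ o) (d : b ≫ t' ≫ z = a ≫ k ≫ m')
    (un : l ≫ m = m' ≫ l') {B : A₁ ⟶ A₃} (hB : B = b ≫ n) {K' : B₁ ⟶ B₃} (hK : K' = k ≫ l) :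
    B ≫ (t ≫ p) ≫ q = a ≫ K' ≫ (m ≫ o) := by
  subst hB hK
  simp only [Category.assoc]
  rw [reassoc_of% nat, c, reassoc_of% d, reassoc_of% un]

lemma cohV {A₁ A₂ A₃ A₄ A₅ A₆ B₁ B₂ B₃ B₄ B₅ B₆ : K} {n : A₁ ⟶ A₂} {p : A₂ ⟶ A₃} {t' : A₃ ⟶ A₄}
    {j : A₄ ⟶ A₅} {m : A₅ ⟶ A₆} {z : A₁ ⟶ B₁} {y : B₁ ⟶ B₂} {l : B₂ ⟶ B₃} {k : B₃ ⟶ B₄}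
    {i : B₄ ⟶ A₆} {q : A₃ ⟶ B₅} {t : B₅ ⟶ A₅} {l' : B₁ ⟶ B₆} {o : B₆ ⟶ B₅} {y' : B₆ ⟶ B₃}
    (c : n ≫ p ≫ q = z ≫ l' ≫ o) (nat : q ≫ t = t' ≫ j) (d : o ≫ t ≫ m = y' ≫ k ≫ i)
    (un : l' ≫ y' = y ≫ l) {J : A₄ ⟶ A₆} (hJ : J = j ≫ m) {K' : B₂ ⟶ B₄} (hK : K' = l ≫ k) :
    n ≫ (p ≫ t') ≫ J = (z ≫ y) ≫ K' ≫ i := by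
  subst hJ hK
  simp only [Category.assoc]
  rw [← reassoc_of% nat, reassoc_of% c, d, reassoc_of% un]

lemma coh_idL {X Y : K} (f : X ⟶ Y) {b c : Y ⟶ Y} {a a' : X ⟶ X} (hb : b = 𝟙 Y) (hc : c = 𝟙 Y)
    (ha : a = 𝟙 X) (ha' : a' = 𝟙 X) : f ≫ b ≫ c = a ≫ a' ≫ f := by
  simp [ha, ha', hb, hc]

lemma coh_idM {X Y : K} (f : X ⟶ Y) {b c : Y ⟶ Y} {a a' : X ⟶ X} (hb : b = 𝟙 Y) (hc : c = 𝟙 Y)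
    (ha : a = 𝟙 X) (ha' : a' = 𝟙 X) : a ≫ f ≫ b = a' ≫ f ≫ c := by
  simp [ha, ha', hb, hc]

lemma map3 {L : Type*} [Category L] (F : L ⥤ K) {X Y Z W Y' Z' : L} {a : X ⟶ Y} {b : Y ⟶ Z}
    {c : Z ⟶ W} {a' : X ⟶ Y'} {b' : Y' ⟶ Z'} {c' : Z' ⟶ W} (e : a ≫ b ≫ c = a' ≫ b' ≫ c') :
    F.map a ≫ F.map b ≫ F.map c = F.map a' ≫ F.map b' ≫ F.map c' := by
  simp only [← F.map_comp, e]

end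

section
variable {A B D E F G : WDbl.{u}}

/-- Coherence of a quintet of four lax double functors: horizontal composition is that of graphs of
categories, and the components commute with the comparisons. -/
structure DblLaxCoh (r : LaxDbl A B) (s : LaxDbl D E) (u : LaxDbl A D) (v : LaxDbl B E)
    (π : r.f ≫ v.f ⟶ u.f ≫ s.f) : Prop where
  unit : ∀ x, v.unit (r.f.F₀.obj x) ≫ v.f.F₁.map (r.unit x) ≫ π.φ₁.app (A.str.ops.one.obj x) =
    E.str.ops.one.map (π.φ₀.app x) ≫ s.unit (u.f.F₀.obj x) ≫ s.f.F₁.map (u.unit x)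
  mult : ∀ x y h, v.mult _ _ (map_tgt_src r.f h) ≫ v.f.F₁.map (r.mult x y h) ≫
      π.φ₁.app (A.str.ops.comp x y h) =
    E.str.ops.cmap (π.φ₁.app x) (π.φ₁.app y) (.app π h) ≫ s.mult _ _ (map_tgt_src u.f h) ≫
      s.f.F₁.map (u.mult x y h)

/-- Coherence of a quintet with two lax double functors (top and bottom) and two colax double
functors (left and right). -/
structure DblLaxColaxCoh (f : LaxDbl A B) (g : LaxDbl D E) (r : ColaxDbl A D) (s : ColaxDbl B E)
    (π : f.f ≫ s.f ⟶ r.f ≫ g.f) : Prop where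
  unit : ∀ x, s.f.F₁.map (f.unit x) ≫ π.φ₁.app (A.str.ops.one.obj x) ≫ g.f.F₁.map (r.unit x) =
    s.unit (f.f.F₀.obj x) ≫ E.str.ops.one.map (π.φ₀.app x) ≫ g.unit (r.f.F₀.obj x)
  mult : ∀ x y h, s.f.F₁.map (f.mult x y h) ≫ π.φ₁.app (A.str.ops.comp x y h) ≫
      g.f.F₁.map (r.mult x y h) =
    s.mult _ _ (map_tgt_src f.f h) ≫ E.str.ops.cmap (π.φ₁.app x) (π.φ₁.app y) (.app π h) ≫
      g.mult _ _ (map_tgt_src r.f h)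

lemma cmap_ids {X : GphCat.{u}} (V : VertOps X) {u v : X.A₁} {f : u ⟶ u} {g : v ⟶ v} (hf : f = 𝟙 u)
    (hg : g = 𝟙 v) (c : Consec f g) : V.cmap f g c = 𝟙 (V.comp u v c.left) := by
  subst hf hg
  exact V.cmap_id _ _ _

lemma DblLaxCoh.of_eq {r : LaxDbl A B} {s : LaxDbl D E} {u : LaxDbl A D} {v : LaxDbl B E}
    {π θ : r.f ≫ v.f ⟶ u.f ≫ s.f} (h : π = θ) (c : DblLaxCoh r s u v θ) : DblLaxCoh r s u v π :=
  h ▸ c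

lemma DblLaxColaxCoh.of_eq {r : LaxDbl A B} {s : LaxDbl D E} {u : ColaxDbl A D} {v : ColaxDbl B E}
    {π θ : r.f ≫ v.f ⟶ u.f ≫ s.f} (h : π = θ) (c : DblLaxColaxCoh r s u v θ) :
    DblLaxColaxCoh r s u v π :=
  h ▸ c

lemma DblLaxCoh.idH (u : LaxDbl A D) (h) : DblLaxCoh (.id A) (.id D) u u (eqToHom h) where
  unit _ := coh_idL _ (u.f.F₁.map_id _) rfl (D.str.ops.one.map_id _) rfl
  mult _ _ _ := coh_idL _ (u.f.F₁.map_id _) rfl (D.str.ops.cmap_id _ _ _) rfl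

lemma DblLaxCoh.idV (r : LaxDbl A B) (h) : DblLaxCoh r r (.id A) (.id B) (eqToHom h) where
  unit _ := coh_idM _ rfl (r.f.F₁.map_id _) rfl (B.str.ops.one.map_id _)
  mult _ _ _ := coh_idM _ rfl (r.f.F₁.map_id _) rfl (B.str.ops.cmap_id _ _ _)

lemma DblLaxColaxCoh.idH (u : ColaxDbl A D) (h) :
    DblLaxColaxCoh (.id A) (.id D) u u (eqToHom h) where
  unit _ := (coh_idL _ (D.str.ops.one.map_id _) rfl (u.f.F₁.map_id _) rfl).symm
  mult _ _ _ := (coh_idL _ (D.str.ops.cmap_id _ _ _) rfl (u.f.F₁.map_id _) rfl).symm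

lemma DblLaxColaxCoh.idV (r : LaxDbl A B) (h) :
    DblLaxColaxCoh r r (.id A) (.id B) (eqToHom h) where
  unit _ := coh_idL _ rfl (r.f.F₁.map_id _) rfl (B.str.ops.one.map_id _)
  mult _ _ _ := coh_idL _ rfl (r.f.F₁.map_id _) rfl (B.str.ops.cmap_id _ _ _)

lemma DblLaxCoh.compH {r : LaxDbl A B} {r' : LaxDbl B F} {s : LaxDbl D E} {s' : LaxDbl E G}
    {u : LaxDbl A D} {v : LaxDbl B E} {w : LaxDbl F G} {π θ} (c : DblLaxCoh r s u v π)
    (d : DblLaxCoh r' s' v w θ) (h h') :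
    DblLaxCoh (r.comp r') (s.comp s') u w (homOf (pasteH π θ) h h') :=
  .of_eq (homOf_pasteH π θ h h')
    { unit := fun x => cohLaxH (θ.φ₁.naturality (r.unit x)) (d.unit (r.f.F₀.obj x)) (map3 s'.f.F₁ (c.unit x))
        (s'.unit_nat _) (w.f.F₁.map_comp _ _) (G.str.ops.one.map_comp _ _)
      mult := fun x y k => cohLaxH (θ.φ₁.naturality (r.mult x y k)) (d.mult _ _ (map_tgt_src r.f k))
        (map3 s'.f.F₁ (c.mult x y k)) (s'.mult_nat _ _ (.app π k)) (w.f.F₁.map_comp _ _)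
        (G.str.ops.cmap_comp _ _ _ _ (.app θ (map_tgt_src r.f k)) ((Consec.app π k).map s'.f)) }

lemma DblLaxCoh.compV {r : LaxDbl A B} {s : LaxDbl D E} {t : LaxDbl F G} {u : LaxDbl A D}
    {u' : LaxDbl D F} {v : LaxDbl B E} {v' : LaxDbl E G} {π ζ} (c : DblLaxCoh r s u v π)
    (d : DblLaxCoh s t u' v' ζ) (h h') :
    DblLaxCoh r t (u.comp u') (v.comp v') (homOf (pasteV π ζ) h h') :=
  .of_eq (homOf_pasteV π ζ h h')
    { unit := fun x => cohLaxV (map3 v'.f.F₁ (c.unit x)) (v'.unit_nat _) (d.unit (u.f.F₀.obj x))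
        (ζ.φ₁.naturality (u.unit x)) (G.str.ops.one.map_comp _ _) (t.f.F₁.map_comp _ _)
      mult := fun x y k => cohLaxV (map3 v'.f.F₁ (c.mult x y k)) (v'.mult_nat _ _ (.app π k))
        (d.mult _ _ (map_tgt_src u.f k)) (ζ.φ₁.naturality (u.mult x y k))
        (G.str.ops.cmap_comp _ _ _ _ ((Consec.app π k).map v'.f) (.app ζ (map_tgt_src u.f k)))
        (t.f.F₁.map_comp _ _) }

lemma DblLaxColaxCoh.compH {r : LaxDbl A B} {r' : LaxDbl B F} {s : LaxDbl D E} {s' : LaxDbl E G}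
    {u : ColaxDbl A D} {v : ColaxDbl B E} {w : ColaxDbl F G} {π θ}
    (c : DblLaxColaxCoh r s u v π) (d : DblLaxColaxCoh r' s' v w θ) (h h') :
    DblLaxColaxCoh (r.comp r') (s.comp s') u w (homOf (pasteH π θ) h h') :=
  .of_eq (homOf_pasteH π θ h h')
    { unit := fun x => cohH (θ.φ₁.naturality (r.unit x)) (map3 s'.f.F₁ (c.unit x)) (d.unit (r.f.F₀.obj x))
        (s'.unit_nat _) (w.f.F₁.map_comp _ _) (G.str.ops.one.map_comp _ _)
      mult := fun x y k => cohH (θ.φ₁.naturality (r.mult x y k)) (map3 s'.f.F₁ (c.mult x y k))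
        (d.mult _ _ (map_tgt_src r.f k)) (s'.mult_nat _ _ (.app π k)) (w.f.F₁.map_comp _ _)
        (G.str.ops.cmap_comp _ _ _ _ (.app θ (map_tgt_src r.f k)) ((Consec.app π k).map s'.f)) }

lemma DblLaxColaxCoh.compV {r : LaxDbl A B} {s : LaxDbl D E} {t : LaxDbl F G} {u : ColaxDbl A D}
    {u' : ColaxDbl D F} {v : ColaxDbl B E} {v' : ColaxDbl E G} {π ζ}
    (c : DblLaxColaxCoh r s u v π) (d : DblLaxColaxCoh s t u' v' ζ) (h h') :
    DblLaxColaxCoh r t (u.comp u') (v.comp v') (homOf (pasteV π ζ) h h') :=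
  .of_eq (homOf_pasteV π ζ h h')
    { unit := fun x => cohV (map3 v'.f.F₁ (c.unit x)) (ζ.φ₁.naturality (u.unit x)) (d.unit (u.f.F₀.obj x))
        (v'.unit_nat _) (t.f.F₁.map_comp _ _) (G.str.ops.one.map_comp _ _)
      mult := fun x y k => cohV (map3 v'.f.F₁ (c.mult x y k)) (ζ.φ₁.naturality (u.mult x y k))
        (d.mult _ _ (map_tgt_src u.f k)) (v'.mult_nat _ _ (.app π k)) (t.f.F₁.map_comp _ _)
        (G.str.ops.cmap_comp _ _ _ _ ((Consec.app π k).map v'.f) (.app ζ (map_tgt_src u.f k))) }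

end

/-- The triple category of weak double categories has pseudo, lax and colax double functors as
arrows; the pseudo double functors are viewed as lax ones in the conditions for the double
cells. -/
def dblKinds : CellKinds WDbl.graph.{u} where
  K₀ := pseudoDblKind
  K₁ := laxDblKind
  K₂ := colaxDblKind
  Q01 :=
    { Coh := fun r s u v π => DblLaxCoh r.toLaxDbl s.toLaxDbl u v π
      idH := fun u => DblLaxCoh.idH u _
      idV := fun r => DblLaxCoh.idV r.toLaxDbl _
      compH := fun c d => DblLaxCoh.compH c d _ _
      compV := fun c d => DblLaxCoh.compV c d _ _ }
  Q02 :=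
    { Coh := fun r s u v π => DblLaxColaxCoh r.toLaxDbl s.toLaxDbl u v π
      idH := fun u => DblLaxColaxCoh.idH u _
      idV := fun r => DblLaxColaxCoh.idV r.toLaxDbl _
      compH := fun c d => DblLaxColaxCoh.compH c d _ _
      compV := fun c d => DblLaxColaxCoh.compV c d _ _ }
  Q12 :=
    { Coh := fun r s u v π => DblLaxColaxCoh r s u v π
      idH := fun u => DblLaxColaxCoh.idH u _
      idV := fun r => DblLaxColaxCoh.idV r _
      compH := fun c d => DblLaxColaxCoh.compH c d _ _
      compV := fun c d => DblLaxColaxCoh.compV c d _ _ }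

end TripleCat

namespace TransversalTransformation
variable {X Y Z : TripleCategory.{u}} {F G : TripleFunctor X Y}

/-- All the components are identities in the transversal direction. -/
structure IsIdentity (t : TransversalTransformation F G) : Prop where
  ob : ∀ x, t.ob x = Y.c0.ide (F.ob x)
  a1 : ∀ x, t.a1 x = Y.c01_0.ide (F.a1 x)
  a2 : ∀ x, t.a2 x = Y.c02_0.ide (F.a2 x)
  s12 : ∀ x, t.s12 x = Y.q0.ide (F.s12 x)

/-- Precomposition with a triple functor. -/
def whiskerLeft (H : TripleFunctor Z X) (t : TransversalTransformation F G) :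
    TransversalTransformation (H.comp F) (H.comp G) where
  ob x := t.ob (H.ob x)
  a1 x := t.a1 (H.a1 x)
  a2 x := t.a2 (H.a2 x)
  s12 x := t.s12 (H.s12 x)
  dom_ob _ := t.dom_ob _
  cod_ob _ := t.cod_ob _
  dom_a1 _ := t.dom_a1 _
  cod_a1 _ := t.cod_a1 _
  dom_a2 _ := t.dom_a2 _
  cod_a2 _ := t.cod_a2 _
  dom_s12 _ := t.dom_s12 _
  cod_s12 _ := t.cod_s12 _
  f1 := H.f1.trans t.f1
  f2 := H.f2.trans t.f2
  f12_1 := H.f12_1.trans t.f12_1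
  f12_2 := H.f12_2.trans t.f12_2
  nat_a0 f := by
    have := t.nat_a0 (H.a0 f)
    simp only [H.f0.dom, H.f0.cod] at this
    exact this
  nat_s01 f := by
    have := t.nat_s01 (H.s01 f)
    simp only [H.f01_0.dom, H.f01_0.cod] at this
    exact this
  nat_s02 f := by
    have := t.nat_s02 (H.s02 f)
    simp only [H.f02_0.dom, H.f02_0.cod] at this
    exact this
  nat_cube f := by
    have := t.nat_cube (H.cube f)
    simp only [H.fq0.dom, H.fq0.cod] at this
    exact this

/-- Postcomposition with a triple functor. -/
def whiskerRight (t : TransversalTransformation F G) (H : TripleFunctor Y Z) :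
    TransversalTransformation (F.comp H) (G.comp H) where
  ob x := H.a0 (t.ob x)
  a1 x := H.s01 (t.a1 x)
  a2 x := H.s02 (t.a2 x)
  s12 x := H.cube (t.s12 x)
  dom_ob _ := (H.f0.dom _).trans (congrArg _ (t.dom_ob _))
  cod_ob _ := (H.f0.cod _).trans (congrArg _ (t.cod_ob _))
  dom_a1 _ := (H.f01_0.dom _).trans (congrArg _ (t.dom_a1 _))
  cod_a1 _ := (H.f01_0.cod _).trans (congrArg _ (t.cod_a1 _))
  dom_a2 _ := (H.f02_0.dom _).trans (congrArg _ (t.dom_a2 _))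
  cod_a2 _ := (H.f02_0.cod _).trans (congrArg _ (t.cod_a2 _))
  dom_s12 _ := (H.fq0.dom _).trans (congrArg _ (t.dom_s12 _))
  cod_s12 _ := (H.fq0.cod _).trans (congrArg _ (t.cod_s12 _))
  f1 := t.f1.trans H.f01_1
  f2 := t.f2.trans H.f02_2
  f12_1 := t.f12_1.trans H.fq1
  f12_2 := t.f12_2.trans H.fq2
  nat_a0 f := (H.f0.comp _ _ _).symm.trans ((congrArg H.a0 (t.nat_a0 f)).trans (H.f0.comp _ _ _))
  nat_s01 f := (H.f01_0.comp _ _ _).symm.trans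
    ((congrArg H.s01 (t.nat_s01 f)).trans (H.f01_0.comp _ _ _))
  nat_s02 f := (H.f02_0.comp _ _ _).symm.trans
    ((congrArg H.s02 (t.nat_s02 f)).trans (H.f02_0.comp _ _ _))
  nat_cube f := (H.fq0.comp _ _ _).symm.trans
    ((congrArg H.cube (t.nat_cube f)).trans (H.fq0.comp _ _ _))

end TransversalTransformation

namespace TripleCat

section
variable {A : GphCat.{u}}

/-- The empty path. -/
def nilPath (x : A.A₀) : Path A := GPath.mk x [] trivial

/-- The empty path of cells. -/
def nilHom {x y : A.A₀} (f : x ⟶ y) : nilPath x ⟶ nilPath y :=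
  PathHom.mk (GPath.mk (Arrow.mk f) [] trivial) rfl rfl

/-- The path with two edges. -/
def pairPath (u v : A.A₁) (h : A.tgt.obj u = A.src.obj v) : Path A :=
  GPath.mk (A.src.obj u) [u, v] ⟨rfl, h.symm, trivial⟩

/-- The path with two cells. -/
def pairHom {u u' v v' : A.A₁} (f : u ⟶ u') (g : v ⟶ v') (c : Consec f g) :
    pairPath u v c.left ⟶ pairPath u' v' c.right :=
  PathHom.mk (GPath.mk (Arrow.mk (A.src.map f)) [Arrow.mk f, Arrow.mk g] ⟨rfl, c.symm, trivial⟩)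
    rfl rfl

/-- The path with one edge. -/
abbrev onePath (u : A.A₁) : Path A := (pathUnit A).F₁.obj u

/-- The path with one cell. -/
abbrev oneHom {u v : A.A₁} (f : u ⟶ v) : onePath u ⟶ onePath v := (pathUnit A).F₁.map f

lemma nil_one (u : A.A₁) (x : A.A₀) (h : x = A.src.obj u) :
    (pathGph A).tgt.obj (nilPath x) = (pathGph A).src.obj (onePath u) := h

lemma one_nil (u : A.A₁) (x : A.A₀) (h : A.tgt.obj u = x) :
    (pathGph A).tgt.obj (onePath u) = (pathGph A).src.obj (nilPath x) := h

lemma one_pair (u v w : A.A₁) (h : A.tgt.obj u = A.src.obj v) (h' : A.tgt.obj v = A.src.obj w) :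
    (pathGph A).tgt.obj (onePath u) = (pathGph A).src.obj (pairPath v w h') := h

lemma pair_one (u v w : A.A₁) (h : A.tgt.obj u = A.src.obj v) (h' : A.tgt.obj v = A.src.obj w) :
    (pathGph A).tgt.obj (pairPath u v h) = (pathGph A).src.obj (onePath w) := h'

/-- The component of the extended associator on a path of paths `P`. -/
abbrev PseudoAlgStr.kap {A : GphCat.{u}} (s : PseudoAlgStr pathMonad A) (P : Path (pathGph A)) :
    Arrow A.A₁ :=
  Arrow.mk (GphCat.Hom₂.φ₁ s.κ.hom |>.app P)

/-- `D` is the weak double category formed by the zeroary and binary vertical compositions of a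
pseudo algebra structure `a` on the same graph: the units and the vertical composition are given by
`a` on paths of length zero and two, the unitors are the components of the extended associator on
`([], [u])` and `([u], [])`, and the associator is its component on `([u], [v, w])` followed by the
inverse of its component on `([u, v], [w])`. -/
structure IsBiasedReduct (a : PseudoAlgStr pathMonad A) (D : WDblStr A) : Prop where
  one : ∀ {x y : A.A₀} (f : x ⟶ y), Arrow.mk (D.ops.one.map f) = Arrow.mk (a.a.F₁.map (nilHom f))
  comp : ∀ u v h, D.ops.comp u v h = a.a.F₁.obj (pairPath u v h)
  cmap : ∀ {u u' v v' : A.A₁} (f : u ⟶ u') (g : v ⟶ v') (c : Consec f g),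
    Arrow.mk (D.ops.cmap f g c) = Arrow.mk (a.a.F₁.map (pairHom f g c))
  lunit : ∀ x u h, Arrow.mk (D.lunit x u h).hom =
    a.kap (pairPath (nilPath x) (onePath u) (nil_one u x h))
  runit : ∀ u x h, Arrow.mk (D.runit u x h).hom =
    a.kap (pairPath (onePath u) (nilPath x) (one_nil u x h))
  assoc : ∀ u v w h h', ∃ e,
    vcomp (Arrow.mk (D.assoc u v w h h').hom)
        (a.kap (pairPath (pairPath u v h) (onePath w) (pair_one u v w h h'))) e =
      a.kap (pairPath (onePath u) (pairPath v w h') (one_pair u v w h h'))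

/-- `a` is the structure of a pseudo algebra obtained from a weak double category `D` on the same
graph by the left bracketing of the vertical compositions:
`x₁ ⊗ ... ⊗ xₙ = (... ((x₁ ⊗ x₂) ⊗ x₃) ... ⊗ xₙ)`, for vertical arrows (take identity cells) and
cells.  The extended associator is an identity on `([u₁, ..., uₙ], [v])`, for `n ≥ 1`. -/
structure IsLeftBracketing (D : WDblStr A) (a : PseudoAlgStr pathMonad A) : Prop where
  nil : ∀ {x y : A.A₀} (f : x ⟶ y), Arrow.mk (a.a.F₁.map (nilHom f)) = Arrow.mk (D.ops.one.map f)
  one : ∀ {u v : A.A₁} (f : u ⟶ v), Arrow.mk (a.a.F₁.map (oneHom f)) = Arrow.mk f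
  snoc : ∀ {p q : Path A} (f : p ⟶ q) {u v : A.A₁} (g : u ⟶ v)
    (c : Consec (A := pathGph A) f (oneHom g)), GPath.edges p ≠ [] → ∃ c',
      Arrow.mk (a.a.F₁.map ((pathMult A).F₁.map (pairHom f (oneHom g) c))) =
        Arrow.mk (D.ops.cmap (a.a.F₁.map f) g c')
  kap_snoc : ∀ (p : Path A) (v : A.A₁) (h : (pathGph A).tgt.obj p = (pathGph A).src.obj (onePath v)),
    GPath.edges p ≠ [] →
      a.kap (pairPath p (onePath v) h) =
        Arrow.mk (𝟙 (a.a.F₁.obj ((pathMult A).F₁.obj (pairPath p (onePath v) h))))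

/-- `g` is a lax double functor that has the same underlying morphism of graphs as the lax morphism
`f` of pseudo algebras, and whose comparisons are those of `f` on paths of length zero and two. -/
structure IsLaxReduct {M N : PseudoAlg pathMonad.{u}} (f : LaxMor M N) {s : WDblStr M.carrier}
    {t : WDblStr N.carrier} (g : LaxDbl ⟨M.carrier, s⟩ ⟨N.carrier, t⟩) : Prop where
  map : g.f = f.f
  unit : ∀ x, Arrow.mk (g.unit x) = Arrow.mk (GphCat.Hom₂.φ₁ f.φ |>.app (nilPath x))
  mult : ∀ u v h, Arrow.mk (g.mult u v h) =
    Arrow.mk (GphCat.Hom₂.φ₁ f.φ |>.app (pairPath u v h))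

/-- The same, for colax morphisms and colax double functors. -/
structure IsColaxReduct {M N : PseudoAlg pathMonad.{u}} (f : ColaxMor M N) {s : WDblStr M.carrier}
    {t : WDblStr N.carrier} (g : ColaxDbl ⟨M.carrier, s⟩ ⟨N.carrier, t⟩) : Prop where
  map : g.f = f.r
  unit : ∀ x, Arrow.mk (g.unit x) = Arrow.mk (GphCat.Hom₂.φ₁ f.ρ |>.app (nilPath x))
  mult : ∀ u v h, Arrow.mk (g.mult u v h) =
    Arrow.mk (GphCat.Hom₂.φ₁ f.ρ |>.app (pairPath u v h))

end

/-- The triple category of normal pseudo algebras of the 2-monad of double categories, with pseudo,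
lax and colax morphisms. -/
abbrev PsNPsa : TripleCategory.{u + 1} := (normalAlgKinds pathMonad.{u}).triple

/-- The triple category of weak double categories, with pseudo, lax and colax double functors. -/
abbrev PsDbl : TripleCategory.{u + 1} := dblKinds.{u}.triple

/-- `V` extracts the biased structure: it takes a normal pseudo algebra to the weak double category
of its zeroary and binary vertical compositions, and reduces the comparisons of the morphisms to
those of zeroary and binary compositions; the underlying graphs, their morphisms and 2-cells stay
the same. -/
structure IsBiasedExtraction (V : TripleFunctor PsNPsa.{u} PsDbl.{u}) : Prop where
  forget : V.comp dblKinds.forget = (normalAlgKinds pathMonad).forget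
  ob : ∀ N : NormalPseudoAlg pathMonad.{u}, ∃ s : WDblStr N.carrier,
    V.ob N = ⟨N.carrier, s⟩ ∧ IsBiasedReduct N.str s
  lax : ∀ {M N : NormalPseudoAlg pathMonad.{u}} (f : LaxMor M.toPseudoAlg N.toPseudoAlg),
    ∃ (s : WDblStr M.carrier) (t : WDblStr N.carrier)
      (g : LaxDbl ⟨M.carrier, s⟩ ⟨N.carrier, t⟩), V.a1 ⟨f⟩ = ⟨g⟩ ∧ IsLaxReduct f g
  colax : ∀ {M N : NormalPseudoAlg pathMonad.{u}} (f : ColaxMor M.toPseudoAlg N.toPseudoAlg),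
    ∃ (s : WDblStr M.carrier) (t : WDblStr N.carrier)
      (g : ColaxDbl ⟨M.carrier, s⟩ ⟨N.carrier, t⟩), V.a2 ⟨f⟩ = ⟨g⟩ ∧ IsColaxReduct f g
  pseudo : ∀ {M N : NormalPseudoAlg pathMonad.{u}} (f : PseudoMor M.toPseudoAlg N.toPseudoAlg),
    ∃ (s : WDblStr M.carrier) (t : WDblStr N.carrier)
      (g : PseudoDbl ⟨M.carrier, s⟩ ⟨N.carrier, t⟩),
      V.a0 ⟨f⟩ = ⟨g⟩ ∧ IsLaxReduct f.toLaxMor g.toLaxDbl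

/-- `J` extends a weak double category to a normal pseudo algebra on the same graph, by choosing the
left bracketing of the vertical compositions; the underlying morphisms of graphs and 2-cells stay
the same. -/
structure IsLeftBracketExtension (J : TripleFunctor PsDbl.{u} PsNPsa.{u}) : Prop where
  forget : J.comp (normalAlgKinds pathMonad).forget = dblKinds.forget
  ob : ∀ D : WDbl.{u}, ∃ (a : PseudoAlgStr pathMonad D.graph) (n : a.IsNormal),
    J.ob D = ⟨⟨D.graph, a⟩, n⟩ ∧ IsLeftBracketing D.str a

end TripleCat

namespace TripleCat

open Bicategory
open GphCat (mapA)

section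
variable {C : Type (u + 1)} [Bicategory.{u, u} C] [Strict C] {Ob Ob' : Type (u + 1)}
  {und' : Ob' → C} {i : Ob → Ob'}

lemma Quintet.eq_of_forget {und : Ob → C} {K L : ArrowKind und} {Q : QuintetKind K L}
    {x y : Quintet Q} (h₁ : x.topArr = y.topArr) (h₂ : x.botArr = y.botArr)
    (h₃ : x.leftArr = y.leftArr) (h₄ : x.rightArr = y.rightArr)
    (h : CellKinds.forgetQuintet x = CellKinds.forgetQuintet y) : x = y := by
  obtain ⟨r, s, l, m, π, c⟩ := x
  obtain ⟨r', s', l', m', π', c'⟩ := y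
  cases h₁
  cases h₂
  cases h₃
  cases h₄
  refine Quintet.mk_congr rfl rfl rfl rfl ?_
  simp only [CellKinds.forgetQuintet] at h
  injection h with _ _ _ _ _ _ _ _ h
  rw [h]

/-- A functor between kinds of arrows that commutes with the forgetful functors. -/
structure ArrowKind.Mor (K : ArrowKind (fun x => und' (i x))) (K' : ArrowKind und') where
  map : ∀ {x y}, K.Hom x y → K'.Hom (i x) (i y)
  map_id : ∀ x, map (K.id x) = K'.id (i x)
  map_comp : ∀ {x y z} (f : K.Hom x y) (g : K.Hom y z),
    map (K.comp f g) = K'.comp (map f) (map g)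
  forget : ∀ {x y} (f : K.Hom x y), K'.toC (map f) = K.toC f

namespace ArrowKind.Mor
variable {K : ArrowKind (fun x => und' (i x))} {K' : ArrowKind und'} (F : ArrowKind.Mor K K')

/-- The action on arrows with their ends. -/
def arr (f : KArr K) : KArr K' := ⟨F.map f.hom⟩

lemma isFun : IsFun (KArr.cat K) (KArr.cat K') i F.arr where
  dom _ := rfl
  cod _ := rfl
  ide x := congrArg KArr.mk (F.map_id x)
  comp := by
    rintro ⟨f⟩ ⟨g⟩ h
    dsimp only at h
    subst h
    exact congrArg KArr.mk (F.map_comp _ _)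

lemma forget_arr (f : KArr K) : CellKinds.forgetArr (F.arr f) = CellKinds.forgetArr f :=
  congrArg KArr.mk (F.forget f.hom)

end ArrowKind.Mor

/-- The functors on arrows extend to quintets with the same underlying 2-cell. -/
structure QuintetKind.Preserved {K L : ArrowKind (fun x => und' (i x))} {K' L' : ArrowKind und'}
    (Q : QuintetKind K L) (Q' : QuintetKind K' L') (F : K.Mor K') (G : L.Mor L') : Prop where
  coh : ∀ {A B D E : Ob} (r : K.Hom A B) (s : K.Hom D E) (l : L.Hom A D) (m : L.Hom B E)
    (π : K.toC r ≫ L.toC m ⟶ L.toC l ≫ K.toC s)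
    (π' : K'.toC (F.map r) ≫ L'.toC (G.map m) ⟶ L'.toC (G.map l) ≫ K'.toC (F.map s)),
    Arrow.mk π' = Arrow.mk π → Q.Coh r s l m π → Q'.Coh (F.map r) (F.map s) (G.map l) (G.map m) π'

namespace QuintetKind.Preserved
variable {K L : ArrowKind (fun x => und' (i x))} {K' L' : ArrowKind und'}
    {Q : QuintetKind K L} {Q' : QuintetKind K' L'} {F : K.Mor K'} {G : L.Mor L'}
    (P : Q.Preserved Q' F G)

/-- The action on quintets. -/
def map (x : Quintet Q) : Quintet Q' where
  top := F.map x.top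
  bot := F.map x.bot
  left := G.map x.left
  right := G.map x.right
  cell := homOf (Arrow.mk x.cell) (congrArg₂ (· ≫ ·) (F.forget x.top) (G.forget x.right)).symm
    (congrArg₂ (· ≫ ·) (G.forget x.left) (F.forget x.bot)).symm
  coh := P.coh _ _ _ _ _ _ (mk_homOf _ _ _) x.coh

lemma forget_map (x : Quintet Q) : CellKinds.forgetQuintet (P.map x) = CellKinds.forgetQuintet x :=
  Quintet.mk_congr (F.forget _) (F.forget _) (G.forget _) (G.forget _) (mk_homOf (Arrow.mk x.cell)
    (congrArg₂ (· ≫ ·) (F.forget x.top) (G.forget x.right)).symm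
    (congrArg₂ (· ≫ ·) (G.forget x.left) (F.forget x.bot)).symm)

lemma isFunH : IsFun (Quintet.catH Q) (Quintet.catH Q') G.arr P.map where
  dom _ := rfl
  cod _ := rfl
  ide x := Quintet.eq_of_forget (F.isFun.ide _) (F.isFun.ide _) rfl rfl (by
    rw [P.forget_map, (CellKinds.isFun_forgetH Q).ide, (CellKinds.isFun_forgetH Q').ide,
      G.forget_arr])
  comp x y h := by
    have h' : (Quintet.catH Q').cod (P.map x) = (Quintet.catH Q').dom (P.map y) :=
      congrArg G.arr h
    have e₁ := (Quintet.isDouble Q).dom_v.comp x y h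
    have e₂ := (Quintet.isDouble Q').dom_v.comp _ _ h'
    have e₃ := (Quintet.isDouble Q).cod_v.comp x y h
    have e₄ := (Quintet.isDouble Q').cod_v.comp _ _ h'
    refine Quintet.eq_of_forget ((congrArg F.arr e₁).trans ((F.isFun.comp _ _ _).trans e₂.symm))
      ((congrArg F.arr e₃).trans ((F.isFun.comp _ _ _).trans e₄.symm)) ?_ ?_ ?_
    · exact (congrArg G.arr ((Quintet.catH Q).dom_comp x y h)).trans
        ((Quintet.catH Q').dom_comp _ _ h').symm
    · exact (congrArg G.arr ((Quintet.catH Q).cod_comp x y h)).trans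
        ((Quintet.catH Q').cod_comp _ _ h').symm
    · rw [P.forget_map, (CellKinds.isFun_forgetH Q).comp, (CellKinds.isFun_forgetH Q').comp _ _ h']
      simp only [P.forget_map]

lemma isFunV : IsFun (Quintet.catV Q) (Quintet.catV Q') F.arr P.map where
  dom _ := rfl
  cod _ := rfl
  ide x := Quintet.eq_of_forget rfl rfl (G.isFun.ide _) (G.isFun.ide _) (by
    rw [P.forget_map, (CellKinds.isFun_forgetV Q).ide, (CellKinds.isFun_forgetV Q').ide,
      F.forget_arr])
  comp x y h := by
    have h' : (Quintet.catV Q').cod (P.map x) = (Quintet.catV Q').dom (P.map y) :=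
      congrArg F.arr h
    have e₁ := (Quintet.isDouble Q).dom_h.comp x y h
    have e₂ := (Quintet.isDouble Q').dom_h.comp _ _ h'
    have e₃ := (Quintet.isDouble Q).cod_h.comp x y h
    have e₄ := (Quintet.isDouble Q').cod_h.comp _ _ h'
    refine Quintet.eq_of_forget ?_ ?_
      ((congrArg G.arr e₁).trans ((G.isFun.comp _ _ _).trans e₂.symm))
      ((congrArg G.arr e₃).trans ((G.isFun.comp _ _ _).trans e₄.symm)) ?_
    · exact (congrArg F.arr ((Quintet.catV Q).dom_comp x y h)).trans
        ((Quintet.catV Q').dom_comp _ _ h').symm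
    · exact (congrArg F.arr ((Quintet.catV Q).cod_comp x y h)).trans
        ((Quintet.catV Q').cod_comp _ _ h').symm
    · rw [P.forget_map, (CellKinds.isFun_forgetV Q).comp, (CellKinds.isFun_forgetV Q').comp _ _ h']
      simp only [P.forget_map]

end QuintetKind.Preserved

/-- A cube of quintets is commutative if the underlying cube is. -/
lemma IsCommCube.of_forget {und : Ob → C} {K₀ K₁ K₂ : ArrowKind und} {Q01 : QuintetKind K₀ K₁}
    {Q02 : QuintetKind K₀ K₂} {Q12 : QuintetKind K₁ K₂} {φ ψ : Quintet Q01} {π ρ : Quintet Q02}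
    {ω ζ : Quintet Q12}
    (e₁ : φ.topArr = π.topArr) (e₂ : φ.botArr = ρ.topArr) (e₃ : ψ.topArr = π.botArr)
    (e₄ : ψ.botArr = ρ.botArr) (e₅ : φ.leftArr = ω.topArr) (e₆ : φ.rightArr = ζ.topArr)
    (e₇ : ψ.leftArr = ω.botArr) (e₈ : ψ.rightArr = ζ.botArr) (e₉ : π.leftArr = ω.leftArr)
    (e₁₀ : π.rightArr = ζ.leftArr) (e₁₁ : ρ.leftArr = ω.rightArr) (e₁₂ : ρ.rightArr = ζ.rightArr)
    (h : IsCommCube (CellKinds.forgetQuintet φ) (CellKinds.forgetQuintet ψ)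
      (CellKinds.forgetQuintet π) (CellKinds.forgetQuintet ρ) (CellKinds.forgetQuintet ω)
      (CellKinds.forgetQuintet ζ)) : IsCommCube φ ψ π ρ ω ζ := by
  obtain ⟨r, s, l, m, φ, _⟩ := φ
  obtain ⟨r', s', l', m', ψ, _⟩ := ψ
  obtain ⟨_, _, x, x', π, _⟩ := π
  obtain ⟨_, _, y, y', ρ, _⟩ := ρ
  obtain ⟨_, _, _, _, ω, _⟩ := ω
  obtain ⟨_, _, _, _, ζ, _⟩ := ζ
  cases e₁
  cases e₂
  cases e₃
  cases e₄
  cases e₅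
  cases e₆
  cases e₇
  cases e₈
  cases e₉
  cases e₁₀
  cases e₁₁
  cases e₁₂
  refine .mk ?_
  simp only [CellKinds.forgetQuintet] at h
  cases h
  assumption

/-- A cube with the same underlying cube as a given one. -/
lemma QCube.forget_comm {und : Ob → C} {K₀ K₁ K₂ : ArrowKind und} {Q01 : QuintetKind K₀ K₁}
    {Q02 : QuintetKind K₀ K₂} {Q12 : QuintetKind K₁ K₂} (X : QCube Q01 Q02 Q12) :
    IsCommCube (CellKinds.forgetQuintet X.φ) (CellKinds.forgetQuintet X.ψ)
      (CellKinds.forgetQuintet X.π) (CellKinds.forgetQuintet X.ρ) (CellKinds.forgetQuintet X.ω)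
      (CellKinds.forgetQuintet X.ζ) := by
  obtain ⟨_, _, _, _, _, _, ⟨c⟩⟩ := X
  exact .mk c

/-- A morphism of kinds of cells over a map of objects. -/
structure CellKinds.Mor (K : CellKinds (fun x => und' (i x))) (K' : CellKinds und') where
  m₀ : K.K₀.Mor K'.K₀
  m₁ : K.K₁.Mor K'.K₁
  m₂ : K.K₂.Mor K'.K₂
  p01 : K.Q01.Preserved K'.Q01 m₀ m₁
  p02 : K.Q02.Preserved K'.Q02 m₀ m₂
  p12 : K.Q12.Preserved K'.Q12 m₁ m₂

namespace CellKinds.Mor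
variable {K : CellKinds (fun x => und' (i x))} {K' : CellKinds und'} (F : K.Mor K')

/-- The triple functor induced by a morphism of kinds of cells. -/
def functor : TripleFunctor K.triple K'.triple where
  ob := i
  a0 := F.m₀.arr
  a1 := F.m₁.arr
  a2 := F.m₂.arr
  s01 := F.p01.map
  s02 := F.p02.map
  s12 := F.p12.map
  cube X := ⟨F.p01.map X.φ, F.p01.map X.ψ, F.p02.map X.π, F.p02.map X.ρ, F.p12.map X.ω,
    F.p12.map X.ζ, .of_forget (congrArg F.m₀.arr X.e1) (congrArg F.m₀.arr X.e2)
      (congrArg F.m₀.arr X.e3) (congrArg F.m₀.arr X.e4) (congrArg F.m₁.arr X.e5)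
      (congrArg F.m₁.arr X.e6) (congrArg F.m₁.arr X.e7) (congrArg F.m₁.arr X.e8)
      (congrArg F.m₂.arr X.e9) (congrArg F.m₂.arr X.e10) (congrArg F.m₂.arr X.e11)
      (congrArg F.m₂.arr X.e12) (by
        simp only [QuintetKind.Preserved.forget_map]
        exact X.forget_comm)⟩
  f0 := F.m₀.isFun
  f1 := F.m₁.isFun
  f2 := F.m₂.isFun
  f01_0 := F.p01.isFunH
  f01_1 := F.p01.isFunV
  f02_0 := F.p02.isFunH
  f02_2 := F.p02.isFunV
  f12_1 := F.p12.isFunH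
  f12_2 := F.p12.isFunV
  fq0 := ⟨fun _ => rfl, fun _ => rfl,
    fun _ => QCube.ext (F.p01.isFunH.ide _) (F.p01.isFunH.ide _)
      (F.p02.isFunH.ide _) (F.p02.isFunH.ide _) rfl rfl,
    fun _ _ _ => QCube.ext (F.p01.isFunH.comp _ _ _) (F.p01.isFunH.comp _ _ _)
      (F.p02.isFunH.comp _ _ _) (F.p02.isFunH.comp _ _ _) rfl rfl⟩
  fq1 := ⟨fun _ => rfl, fun _ => rfl,
    fun _ => QCube.ext (F.p01.isFunV.ide _) (F.p01.isFunV.ide _) rfl rfl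
      (F.p12.isFunH.ide _) (F.p12.isFunH.ide _),
    fun _ _ _ => QCube.ext (F.p01.isFunV.comp _ _ _) (F.p01.isFunV.comp _ _ _) rfl rfl
      (F.p12.isFunH.comp _ _ _) (F.p12.isFunH.comp _ _ _)⟩
  fq2 := ⟨fun _ => rfl, fun _ => rfl,
    fun _ => QCube.ext rfl rfl (F.p02.isFunV.ide _) (F.p02.isFunV.ide _)
      (F.p12.isFunV.ide _) (F.p12.isFunV.ide _),
    fun _ _ _ => QCube.ext rfl rfl (F.p02.isFunV.comp _ _ _) (F.p02.isFunV.comp _ _ _)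
      (F.p12.isFunV.comp _ _ _) (F.p12.isFunV.comp _ _ _)⟩

lemma functor_forget : F.functor.comp K'.forget = K.forget :=
  TripleFunctor.ext rfl (funext F.m₀.forget_arr) (funext F.m₁.forget_arr)
    (funext F.m₂.forget_arr) (funext F.p01.forget_map) (funext F.p02.forget_map)
    (funext F.p12.forget_map) (funext fun _ => QCube.ext (F.p01.forget_map _) (F.p01.forget_map _)
      (F.p02.forget_map _) (F.p02.forget_map _) (F.p12.forget_map _) (F.p12.forget_map _))

end CellKinds.Mor

/-- An endofunctor over the forgetful functor is the identity if it fixes objects and arrows. -/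
lemma TripleFunctor.eq_id_of_forget {und : Ob → C} {K : CellKinds und}
    (F : TripleFunctor K.triple K.triple) (hF : F.comp K.forget = K.forget)
    (h₀ : ∀ f, F.a0 f = f) (h₁ : ∀ f, F.a1 f = f) (h₂ : ∀ f, F.a2 f = f)
    (ho : ∀ x, F.ob x = x) : F = TripleFunctor.id K.triple := by
  have k01 : ∀ x, F.s01 x = x := fun x => Quintet.eq_of_forget
    ((F.f01_1.dom x).trans (h₀ _)) ((F.f01_1.cod x).trans (h₀ _))
    ((F.f01_0.dom x).trans (h₁ _)) ((F.f01_0.cod x).trans (h₁ _))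
    (congrFun (congrArg TripleFunctor.s01 hF) x)
  have k02 : ∀ x, F.s02 x = x := fun x => Quintet.eq_of_forget
    ((F.f02_2.dom x).trans (h₀ _)) ((F.f02_2.cod x).trans (h₀ _))
    ((F.f02_0.dom x).trans (h₂ _)) ((F.f02_0.cod x).trans (h₂ _))
    (congrFun (congrArg TripleFunctor.s02 hF) x)
  have k12 : ∀ x, F.s12 x = x := fun x => Quintet.eq_of_forget
    ((F.f12_2.dom x).trans (h₁ _)) ((F.f12_2.cod x).trans (h₁ _))
    ((F.f12_1.dom x).trans (h₂ _)) ((F.f12_1.cod x).trans (h₂ _))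
    (congrFun (congrArg TripleFunctor.s12 hF) x)
  exact TripleFunctor.ext (funext ho) (funext h₀) (funext h₁) (funext h₂) (funext k01)
    (funext k02) (funext k12) (funext fun X => QCube.ext
      ((F.fq2.dom X).trans (k01 _)) ((F.fq2.cod X).trans (k01 _)) ((F.fq1.dom X).trans (k02 _))
      ((F.fq1.cod X).trans (k02 _)) ((F.fq0.dom X).trans (k12 _)) ((F.fq0.cod X).trans (k12 _)))

end

section
variable {K : Type*} [Category K]

/-- An arrow, as an element of the monoid with zero of arrows. -/
abbrev oa {X Y : K} (f : X ⟶ Y) : Option (Arrow K) := some (Arrow.mk f)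

lemma oa_inj {X Y : K} {f g : X ⟶ Y} (h : oa f = oa g) : f = g :=
  Arrow.mk_injective _ _ (Option.some_injective _ h)

lemma oa_comp {X Y Z : K} (f : X ⟶ Y) (g : Y ⟶ Z) : oa (f ≫ g) = pcomp (oa f) (oa g) := by
  rw [← some_vcomp _ _ rfl, vcomp_mk]

lemma oa_homOf (a : Arrow K) {X Y : K} (hl : a.left = X) (hr : a.right = Y) :
    oa (homOf a hl hr) = some a := by rw [oa, mk_homOf]

/-- An isomorphism with prescribed ends. -/
def isoCast {X Y X' Y' : K} (i : X ≅ Y) (h : X = X') (h' : Y = Y') : X' ≅ Y' :=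
  (eqToIso h).symm ≪≫ i ≪≫ eqToIso h'

lemma mk_isoCast {X Y X' Y' : K} (i : X ≅ Y) (h : X = X') (h' : Y = Y') :
    Arrow.mk (isoCast i h h').hom = Arrow.mk i.hom := by
  subst h h'
  simp [isoCast]

lemma isIso_of_mk {X Y X' Y' : K} {f : X ⟶ Y} {g : X' ⟶ Y'} (h : Arrow.mk f = Arrow.mk g)
    [IsIso g] : IsIso f := by
  obtain rfl : X = X' := congrArg (·.left) h
  obtain rfl : Y = Y' := congrArg (·.right) h
  obtain rfl := Arrow.mk_injective _ _ h
  infer_instance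

lemma mk_id_of {X Y Z : K} {f : X ⟶ Y} (h : Arrow.mk f = Arrow.mk (𝟙 Z)) :
    Arrow.mk f = Arrow.mk (𝟙 X) := by
  obtain rfl : X = Z := congrArg (·.left) h
  exact h

end

section
variable {X Y Z : GphCat.{u}}

/-- The component of a 2-cell on a vertical arrow. -/
def ap (α : Arrow (X ⟶ Y)) (p : X.A₁) : Arrow Y.A₁ := Arrow.mk (α.hom.φ₁.app p)

/-- The component of a 2-cell on an object. -/
def ap₀ (α : Arrow (X ⟶ Y)) (x : X.A₀) : Arrow Y.A₀ := Arrow.mk (α.hom.φ₀.app x)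

lemma ap_vcomp (α β : Arrow (X ⟶ Y)) (h) (p : X.A₁) :
    some (ap (vcomp α β h) p) = pcomp (some (ap α p)) (some (ap β p)) := by
  obtain ⟨f, g, α⟩ := α
  obtain ⟨g', k, β⟩ := β
  obtain rfl : g = g' := h
  have : vcomp (Arrow.mk α) (Arrow.mk β) rfl = Arrow.mk (α ≫ β) := vcomp_mk α β
  exact (congrArg (fun a => some (ap a p)) this).trans (oa_comp _ _)

lemma ap₀_vcomp (α β : Arrow (X ⟶ Y)) (h) (p : X.A₀) :
    some (ap₀ (vcomp α β h) p) = pcomp (some (ap₀ α p)) (some (ap₀ β p)) := by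
  obtain ⟨f, g, α⟩ := α
  obtain ⟨g', k, β⟩ := β
  obtain rfl : g = g' := h
  have : vcomp (Arrow.mk α) (Arrow.mk β) rfl = Arrow.mk (α ≫ β) := vcomp_mk α β
  exact (congrArg (fun a => some (ap₀ a p)) this).trans (oa_comp _ _)

lemma ap_vcomp₃ (α β γ : Arrow (X ⟶ Y)) (h h') (p : X.A₁) :
    some (ap (vcomp₃ α β γ h h') p) =
      pcomp (some (ap α p)) (pcomp (some (ap β p)) (some (ap γ p))) := by
  rw [← ap_vcomp β γ h', ← ap_vcomp]
  rfl

lemma ap₀_vcomp₃ (α β γ : Arrow (X ⟶ Y)) (h h') (p : X.A₀) :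
    some (ap₀ (vcomp₃ α β γ h h') p) =
      pcomp (some (ap₀ α p)) (pcomp (some (ap₀ β p)) (some (ap₀ γ p))) := by
  rw [← ap₀_vcomp β γ h', ← ap₀_vcomp]
  rfl

lemma cell_arrow_ext {α β : Arrow (X ⟶ Y)} (hl : α.left = β.left) (hr : α.right = β.right)
    (h₀ : ∀ x, ap₀ α x = ap₀ β x) (h₁ : ∀ x, ap α x = ap β x) : α = β :=
  cell_ext hl hr h₀ h₁

lemma ap_src (α : Arrow (X ⟶ Y)) (p : X.A₁) : mapA Y.src (ap α p) = ap₀ α (X.src.obj p) :=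
  α.hom.src p

lemma ap_tgt (α : Arrow (X ⟶ Y)) (p : X.A₁) : mapA Y.tgt (ap α p) = ap₀ α (X.tgt.obj p) :=
  α.hom.tgt p

lemma ap_nat (α : Arrow (X ⟶ Y)) {p q : X.A₁} (f : p ⟶ q) :
    pcomp (oa (α.left.F₁.map f)) (some (ap α q)) = pcomp (some (ap α p)) (oa (α.right.F₁.map f)) :=
  (oa_comp _ _).symm.trans ((congrArg oa (α.hom.φ₁.naturality f)).trans (oa_comp _ _))

/-- A 2-cell whose components on objects are identities. -/
def Flat (α : Arrow (X ⟶ Y)) : Prop := ∀ x, ap₀ α x = Arrow.mk (𝟙 (α.left.F₀.obj x))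

lemma Flat.of_id {α : Arrow (X ⟶ Y)} {f : X.A₀ → Y.A₀} (h : ∀ x, ap₀ α x = Arrow.mk (𝟙 (f x))) :
    Flat α := fun x => mk_id_of (h x)

lemma Flat.special {α : Arrow (X ⟶ Y)} (h : Flat α) (p : X.A₁) : Special (ap α p).hom :=
  ⟨mk_id_of ((ap_src α p).trans (h _)), mk_id_of ((ap_tgt α p).trans (h _))⟩

lemma Special.of_mk {u v u' v' : X.A₁} {f : u ⟶ v} {g : u' ⟶ v'} (h : Arrow.mk f = Arrow.mk g)
    (s : Special g) : Special f := by
  obtain rfl : u = u' := congrArg (·.left) h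
  obtain rfl : v = v' := congrArg (·.right) h
  obtain rfl := Arrow.mk_injective _ _ h
  exact s

lemma Special.inv {u v : X.A₁} (i : u ≅ v) (s : Special i.hom) : Special i.inv := by
  have key : ∀ {K : Type u} [SmallCategory K] (F : X.A₁ ⥤ K),
      Arrow.mk (F.map i.hom) = Arrow.mk (𝟙 (F.obj u)) →
        Arrow.mk (F.map i.inv) = Arrow.mk (𝟙 (F.obj v)) := fun F h => by
    have e : oa (F.map i.inv) = oa (𝟙 (F.obj v)) := by
      have h₁ := congrArg oa (F.map_comp i.inv i.hom)
      rw [i.inv_hom_id, F.map_id, oa_comp] at h₁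
      rw [h₁, oa, oa, h]
      exact (pcomp_idc _ rfl).symm
    exact Option.some_injective _ e
  exact ⟨key _ s.1, key _ s.2⟩

end

section
variable {A B : GphCat.{u}}

lemma cmap_mk_congr (D : VertOps A) {u u' v v' u₁ u₁' v₁ v₁' : A.A₁} {f : u ⟶ u'} {g : v ⟶ v'}
    {f₁ : u₁ ⟶ u₁'} {g₁ : v₁ ⟶ v₁'} (hf : Arrow.mk f = Arrow.mk f₁) (hg : Arrow.mk g = Arrow.mk g₁)
    (c : Consec f g) (c' : Consec f₁ g₁) :
    Arrow.mk (D.cmap f g c) = Arrow.mk (D.cmap f₁ g₁ c') := by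
  obtain rfl : u = u₁ := congrArg (·.left) hf
  obtain rfl : u' = u₁' := congrArg (·.right) hf
  obtain rfl : v = v₁ := congrArg (·.left) hg
  obtain rfl : v' = v₁' := congrArg (·.right) hg
  obtain rfl := Arrow.mk_injective _ _ hf
  obtain rfl := Arrow.mk_injective _ _ hg
  rfl

lemma pairPath_congr {u u' v v' : A.A₁} (hu : u = u') (hv : v = v') (h h') :
    pairPath u v h = pairPath u' v' h' := by subst hu hv; rfl

lemma mapPath_pair (F : A ⟶ B) (u v : A.A₁) (h) :
    mapPath F (pairPath u v h) = pairPath (F.F₁.obj u) (F.F₁.obj v) (map_tgt_src F h) :=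
  GPath.ext (F.src_obj u).symm rfl

lemma mapPath_one (F : A ⟶ B) (u : A.A₁) : mapPath F (onePath u) = onePath (F.F₁.obj u) :=
  GPath.ext (F.src_obj u).symm rfl

lemma flatten_one (p : Path A) : flattenPath (onePath (A := pathGph A) p) = p :=
  GPath.ext rfl (List.append_nil _)

lemma nilHom_id (x : A.A₀) : nilHom (𝟙 x) = 𝟙 (nilPath x) := rfl

lemma nilHom_comp {x y z : A.A₀} (f : x ⟶ y) (g : y ⟶ z) :
    nilHom (f ≫ g) = nilHom f ≫ nilHom g :=
  toCell_ext (GPath.ext (vcomp_mk f g).symm rfl)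

lemma pairHom_id (u v : A.A₁) (h : A.tgt.obj u = A.src.obj v) :
    pairHom (𝟙 u) (𝟙 v) (.id h) = 𝟙 (pairPath u v h) :=
  toCell_ext (GPath.ext (mk_map_id _ _) rfl)

lemma pairHom_comp {u u' u'' v v' v'' : A.A₁} (f : u ⟶ u') (g : v ⟶ v') (f' : u' ⟶ u'')
    (g' : v' ⟶ v'') (c : Consec f g) (c' : Consec f' g') :
    pairHom (f ≫ f') (g ≫ g') (c.comp c') = pairHom f g c ≫ pairHom f' g' c' :=
  toCell_ext (GPath.ext ((mk_map_comp _ _ _).trans (vcomp_mk _ _).symm) (by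
    change [_, _] = [vcomp _ _ _, vcomp _ _ _]
    rw [vcomp_mk, vcomp_mk]))

lemma mapCellPath_pairHom (F : A ⟶ B) {u u' v v' : A.A₁} (f : u ⟶ u') (g : v ⟶ v')
    (c : Consec f g) : Arrow.mk ((pathFunctor F).map (pairHom f g c)) =
      Arrow.mk (pairHom (F.F₁.map f) (F.F₁.map g) (c.map F)) :=
  arrow_ext (GPath.ext (F.src_map f).symm rfl)

end

lemma iso_trans_symm_hom {K : Type*} [Category K] {X Y Z W : K} (i : X ≅ Y) (j : Z ≅ Y)
    (f : Y ⟶ W) : (i ≪≫ j.symm).hom ≫ j.hom ≫ f = i.hom ≫ f := by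
  simp

lemma iso_square {K : Type*} [Category K] {X Y Z X' Y' Z' : K} {i : X ≅ Y} {j : Z ≅ Y} {i' : X' ≅ Y'}
    {j' : Z' ≅ Y'} {f : X ⟶ X'} {g : Y ⟶ Y'} {k : Z ⟶ Z'} (h : f ≫ i'.hom = i.hom ≫ g)
    (h' : k ≫ j'.hom = j.hom ≫ g) : f ≫ (i' ≪≫ j'.symm).hom = (i ≪≫ j.symm).hom ≫ k := by
  rw [← cancel_mono j'.hom]
  simp [h, h']

lemma comp_of_ids {K : Type*} [Category K] {X Y Z : K} {a : X ⟶ Y} {b : Y ⟶ Z} {e : Z ⟶ Z}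
    {c : X ⟶ Z} {f : Z ⟶ Z} (h : a ≫ b ≫ e = c ≫ f) (he : e = 𝟙 Z) (hf : f = 𝟙 Z) : a ≫ b = c := by
  simpa [he, hf] using h

lemma trans_symm_comp {K : Type*} [Category K] {X Y Z : K} (i : X ≅ Y) (j : Z ≅ Y) :
    (i ≪≫ j.symm).hom ≫ j.hom = i.hom := by
  simp

lemma comp_of_id_right {K : Type*} [Category K] {X Y Z : K} {k : X ⟶ Z} {e : Z ⟶ Z} {c c' : X ⟶ Y}
    {r : Y ⟶ Z} (h : k ≫ e = c ≫ r) (he : e = 𝟙 Z) (hc : c = c') : c' ≫ r = k := by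
  rw [← hc, ← h, he, Category.comp_id]

lemma lax_assoc_of {K L : Type*} [Category K] [Category L] {F : K ⥤ L} {X Y Z : K} {X' Y' Z' V W : L}
    {i : X ≅ Y} {j : Z ≅ Y} {i' : X' ≅ Y'} {j' : Z' ≅ Y'} {t : Y' ⟶ F.obj Y} {a a' : X' ⟶ V}
    {b : V ⟶ F.obj X} {c c' : Z' ⟶ W} {d : W ⟶ F.obj Z} (h : i'.hom ≫ t = a ≫ b ≫ F.map i.hom)
    (h' : j'.hom ≫ t = c ≫ d ≫ F.map j.hom) (ha : a = a') (hc : c = c') :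
    a' ≫ b ≫ F.map (i ≪≫ j.symm).hom = (i' ≪≫ j'.symm).hom ≫ c' ≫ d := by
  subst ha hc
  rw [← cancel_mono (F.map j.hom)]
  simp only [Iso.trans_hom, Iso.symm_hom, Category.assoc, ← h', F.map_comp]
  rw [← F.map_comp, j.inv_hom_id, F.map_id, Category.comp_id, j'.inv_hom_id_assoc, h]

lemma comp_of_id_right' {K : Type*} [Category K] {X Y W Z : K} {k : X ⟶ Z} {e : Z ⟶ Z} {b : X ⟶ Y}
    {c c' : Y ⟶ W} {r : W ⟶ Z} (h : k ≫ e = b ≫ c ≫ r) (he : e = 𝟙 Z) (hc : c = c') :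
    b ≫ c' ≫ r = k := by
  rw [← hc, ← h, he, Category.comp_id]

lemma colax_assoc_of {K L : Type*} [Category K] [Category L] {F : K ⥤ L} {X Y Z : K} {X' Y' Z' V W : L}
    {i : X ≅ Y} {j : Z ≅ Y} {i' : X' ≅ Y'} {j' : Z' ≅ Y'} {t : F.obj Y ⟶ Y'} {a a' : V ⟶ X'}
    {b : F.obj X ⟶ V} {c c' : W ⟶ Z'} {d : F.obj Z ⟶ W} (h : F.map i.hom ≫ t = b ≫ a ≫ i'.hom)
    (h' : F.map j.hom ≫ t = d ≫ c ≫ j'.hom) (ha : a = a') (hc : c = c') :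
    b ≫ a' ≫ (i' ≪≫ j'.symm).hom = F.map (i ≪≫ j.symm).hom ≫ d ≫ c' := by
  subst ha hc
  rw [← cancel_mono j'.hom]
  simp only [Iso.trans_hom, Iso.symm_hom, Category.assoc, F.map_comp, j'.inv_hom_id, Category.comp_id,
    ← h', ← h]
  rw [← F.map_comp_assoc]
  simp

lemma elim_mid {K : Type*} [Category K] {X Y Z : K} {a : X ⟶ Y} {e : Y ⟶ Y} {b : Y ⟶ Z}
    {c : X ⟶ Z} (h : a ≫ e ≫ b = c) (he : e = 𝟙 Y) : a ≫ b = c := by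
  simpa [he] using h

lemma elim_left {K : Type*} [Category K] {X Z : K} {a : X ⟶ Z} {e : X ⟶ X} {b : X ⟶ Z}
    (h : a = e ≫ b) (he : e = 𝟙 X) : a = b := by
  simpa [he] using h

lemma mapA_congr' {K L : Type*} [Category K] [Category L] (F : K ⥤ L) {X Y X' Y' : K} {f : X ⟶ Y}
    {g : X' ⟶ Y'} (h : Arrow.mk f = Arrow.mk g) : Arrow.mk (F.map f) = Arrow.mk (F.map g) :=
  congrArg (mapA F) h

namespace VertOps
variable {A : GphCat.{u}} (D : VertOps A)

open Classical in
/-- The composition of cells, as a partial operation. -/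
noncomputable def cm : Option (Arrow A.A₁) → Option (Arrow A.A₁) → Option (Arrow A.A₁)
  | some a, some b => if c : Consec a.hom b.hom then some (Arrow.mk (D.cmap a.hom b.hom c)) else none
  | _, _ => none

lemma oa_cmap {u u' v v' : A.A₁} (f : u ⟶ u') (g : v ⟶ v') (c : Consec f g) :
    oa (D.cmap f g c) = D.cm (oa f) (oa g) :=
  (dif_pos (α := Option (Arrow A.A₁)) (t := fun c => some (Arrow.mk (D.cmap f g c)))
    (e := fun _ => none) c).symm

end VertOps

lemma mk_inv_congr {K : Type*} [Category K] {X Y X' Y' : K} {f : X ⟶ Y} {g : X' ⟶ Y'} [IsIso f]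
    [IsIso g] (h : Arrow.mk f = Arrow.mk g) : Arrow.mk (inv f) = Arrow.mk (inv g) := by
  obtain rfl : X = X' := congrArg (·.left) h
  obtain rfl : Y = Y' := congrArg (·.right) h
  obtain rfl := Arrow.mk_injective _ _ h
  rfl

lemma Consec.inv {A : GphCat.{u}} {u u' v v' : A.A₁} {f : u ⟶ u'} {g : v ⟶ v'} [IsIso f] [IsIso g]
    (c : Consec f g) : Consec (inv f) (inv g) := by
  unfold Consec
  rw [Functor.map_inv, Functor.map_inv]
  exact mk_inv_congr c

lemma VertOps.isIso_cmap {A : GphCat.{u}} (D : VertOps A) {u u' v v' : A.A₁} (f : u ⟶ u')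
    (g : v ⟶ v') [IsIso f] [IsIso g] (c : Consec f g) : IsIso (D.cmap f g c) :=
  ⟨D.cmap (inv f) (inv g) c.inv,
    (D.cmap_comp _ _ _ _ _ _).symm.trans ((D.cmap_congr (IsIso.hom_inv_id f)
      (IsIso.hom_inv_id g) _ (.id c.left)).trans (D.cmap_id _ _ c.left)),
    (D.cmap_comp _ _ _ _ _ _).symm.trans ((D.cmap_congr (IsIso.inv_hom_id f)
      (IsIso.inv_hom_id g) _ (.id c.right)).trans (D.cmap_id _ _ c.right))⟩

/-- The functor of empty paths. -/
def nilFunctor (A : GphCat.{u}) : A.A₀ ⥤ Path A where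
  obj := nilPath
  map := nilHom
  map_id := nilHom_id
  map_comp := nilHom_comp

/-- Three consecutive vertical arrows, as a path. -/
def triPath {A : GphCat.{u}} (u v w : A.A₁) (h : A.tgt.obj u = A.src.obj v)
    (h' : A.tgt.obj v = A.src.obj w) : Path A :=
  GPath.mk (A.src.obj u) [u, v, w] ⟨rfl, h.symm, h'.symm, trivial⟩

/-- The concatenation of two paths. -/
abbrev catPath {A : GphCat.{u}} (p q : Path A) (h : p.last = q.start) : Path A :=
  flattenPath (pairPath (A := pathGph A) p q h)

section
variable {C : Type u} [Bicategory.{w, v} C] [Strict C] {M : TwoMonad C} {X : C} {s : PseudoAlgStr M X}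

lemma PseudoAlgStr.IsNormal.whL_map_unit (hs : s.IsNormal) :
    whL (M.T.map (M.unit X)) (Arrow.mk s.κ.hom) = Arrow.mk (𝟙 s.a) := by
  have e : M.unit X ≫ s.a = 𝟙 X := congrArg (fun α : Arrow (X ⟶ X) => α.right) hs
  have h₁ := of_two_one s.unit_left
  rw [show Arrow.mk s.ω.hom = _ from hs, mapCell_id, whR_idc] at h₁
  rwa [idc_pcomp _ (by
    change M.T.map (𝟙 X) ≫ s.a = M.T.map (M.unit X) ≫ M.T.map s.a ≫ s.a
    rw [← Strict.assoc, ← StrictPseudofunctor.map_comp, e]), Option.some_inj] at h₁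

lemma PseudoAlgStr.IsNormal.whL_unit (hs : s.IsNormal) :
    whL (M.unit (M.T.obj X)) (Arrow.mk s.κ.hom) = Arrow.mk (𝟙 s.a) := by
  have e : M.unit X ≫ s.a = 𝟙 X := congrArg (fun α : Arrow (X ⟶ X) => α.right) hs
  have h₁ := of_two_one s.unit_right
  rw [show Arrow.mk s.ω.hom = _ from hs, whL_idc] at h₁
  rwa [idc_pcomp _ (by
    change s.a ≫ 𝟙 X = M.unit (M.T.obj X) ≫ M.T.map s.a ≫ s.a
    rw [← Strict.assoc, ← M.unit_nat, Strict.assoc, e]), Option.some_inj] at h₁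

end

lemma last_catPath {A : GphCat.{u}} (p q : Path A) (h : p.last = q.start) :
    GPath.last (catPath p q h) = GPath.last q := GPath.last_flatten _

/-- The action of the 2-monad of paths on a 2-cell. -/
abbrev pcell {X Y : GphCat.{u}} (α : Arrow (X ⟶ Y)) : Arrow (pathGph X ⟶ pathGph Y) :=
  Arrow.mk (pathMap₂ α.hom)

section
variable {X Y : GphCat.{u}}

lemma ap_pcell_pair (α : Arrow (X ⟶ Y)) (u v : X.A₁) (h : X.tgt.obj u = X.src.obj v)
    (c : Consec (ap α u).hom (ap α v).hom) :
    ap (pcell α) (pairPath u v h) = Arrow.mk (pairHom (ap α u).hom (ap α v).hom c) :=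
  arrow_ext (GPath.ext (ap_src α u).symm rfl)

end

lemma mapPath_tri {A B : GphCat.{u}} (F : A ⟶ B) (u v w : A.A₁) (h h') :
    mapPath F (triPath u v w h h') = triPath (F.F₁.obj u) (F.F₁.obj v) (F.F₁.obj w)
      (map_tgt_src F h) (map_tgt_src F h') :=
  GPath.ext (F.src_obj u).symm rfl

lemma flatten_tri {A : GphCat.{u}} (p q r : Path A) (h : p.last = q.start) (h' : q.last = r.start) :
    flattenPath (triPath (A := pathGph A) p q r h h') = catPath p (catPath q r h') h :=
  GPath.ext rfl (by
    change [p.edges, q.edges, r.edges].flatten = [p.edges, [q.edges, r.edges].flatten].flatten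
    simp)

namespace PseudoAlgStr
variable {A : GphCat.{u}} (s : PseudoAlgStr pathMonad A)

/-- The structural morphism. -/
abbrev c : pathGph A ⟶ A := s.a

/-- The structural functor on vertical paths. -/
abbrev c₁ : Path A ⥤ A.A₁ := s.a.F₁

/-- The extended associator. -/
abbrev kc : Arrow (pathGph (pathGph A) ⟶ A) := Arrow.mk s.κ.hom

lemma kap_assoc (P : Path (pathGph (pathGph A))) :
    pcomp (some (ap s.kc (mapPath (pathMap s.c) P))) (some (ap s.kc (flattenPath P))) =
      pcomp (some (mapA s.c₁ (ap (pcell s.kc) P)))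
        (some (ap s.kc (mapPath (pathMult A) P))) := by
  have := congrArg (fun α => some (ap (X := pathGph (pathGph (pathGph A))) (Y := A) α P)) s.assoc
  exact (ap_vcomp _ _ _ _).symm.trans (this.trans (ap_vcomp _ _ _ _))

variable {s}

lemma IsNormal.unit_a (hs : s.IsNormal) : pathUnit A ≫ s.c = 𝟙 A :=
  congrArg (fun α : Arrow (A ⟶ A) => α.right) hs

lemma IsNormal.unit_left' (hs : s.IsNormal) :
    whL (pathMap (pathUnit A)) s.kc = Arrow.mk (𝟙 s.c) := hs.whL_map_unit

lemma IsNormal.unit_right' (hs : s.IsNormal) :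
    whL (pathUnit (pathGph A)) s.kc = Arrow.mk (𝟙 s.c) := hs.whL_unit

lemma IsNormal.kap_units (hs : s.IsNormal) (p : Path A) :
    ap s.kc (mapPath (pathUnit A) p) = Arrow.mk (𝟙 (s.c₁.obj p)) :=
  congrArg (fun α : Arrow (pathGph A ⟶ A) => ap α p) hs.unit_left'

lemma IsNormal.kap_one (hs : s.IsNormal) (p : Path A) :
    ap s.kc (onePath (A := pathGph A) p) = Arrow.mk (𝟙 (s.c₁.obj p)) :=
  congrArg (fun α : Arrow (pathGph A ⟶ A) => ap α p) hs.unit_right'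

lemma IsNormal.F₀ (hs : s.IsNormal) : s.a.F₀ = 𝟭 A.A₀ := congrArg GphCat.Hom.F₀ hs.unit_a

lemma IsNormal.c_one (hs : s.IsNormal) {u v : A.A₁} (f : u ⟶ v) :
    Arrow.mk (s.c₁.map (oneHom f)) = Arrow.mk f :=
  GphCat.mapA_congr (congrArg GphCat.Hom.F₁ hs.unit_a) (a := Arrow.mk f) rfl

lemma IsNormal.c_one_obj (hs : s.IsNormal) (u : A.A₁) : s.c₁.obj (onePath u) = u :=
  congrArg (·.left) (hs.c_one (𝟙 u))

lemma IsNormal.c_src (hs : s.IsNormal) {p q : Path A} (f : p ⟶ q) :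
    Arrow.mk (A.src.map (s.c₁.map f)) = (toCell f).start :=
  (s.c.src_map f).trans ((GphCat.mapA_congr (b := Arrow.mk ((Path.srcF A).map f)) hs.F₀ rfl).trans
    (mapA_srcF f))

lemma IsNormal.c_tgt (hs : s.IsNormal) {p q : Path A} (f : p ⟶ q) :
    Arrow.mk (A.tgt.map (s.c₁.map f)) = (toCell f).last :=
  (s.c.tgt_map f).trans ((GphCat.mapA_congr (b := Arrow.mk ((Path.tgtF A).map f)) hs.F₀ rfl).trans
    (mapA_tgtF f))

lemma IsNormal.c_src_obj (hs : s.IsNormal) (p : Path A) : A.src.obj (s.c₁.obj p) = GPath.start p :=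
  congrArg (·.left) (hs.c_src (𝟙 p))

lemma IsNormal.c_tgt_obj (hs : s.IsNormal) (p : Path A) : A.tgt.obj (s.c₁.obj p) = GPath.last p :=
  (congrArg (·.left) (hs.c_tgt (𝟙 p))).trans ((lastV_dom _).trans
    (congrArg GPath.last (toCell_dom (𝟙 p))))

lemma IsNormal.flat_κ (hs : s.IsNormal) : Flat s.kc :=
  Flat.of_id (f := s.a.F₀.obj) fun x => congrArg (fun α : Arrow (pathGph A ⟶ A) => ap₀ α x) hs.unit_left'

/-- The zeroary and binary compositions of a normal pseudo algebra. -/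
def IsNormal.ops (hs : s.IsNormal) : VertOps A where
  one := nilFunctor A ⋙ s.c₁
  one_src := functor_ext_mk fun _ _ f => hs.c_src (nilHom f)
  one_tgt := functor_ext_mk fun _ _ f => hs.c_tgt (nilHom f)
  comp u v h := s.c₁.obj (pairPath u v h)
  comp_src _ _ _ := hs.c_src_obj _
  comp_tgt _ _ _ := hs.c_tgt_obj _
  cmap f g c := s.c₁.map (pairHom f g c)
  cmap_src f g c := hs.c_src _
  cmap_tgt f g c := hs.c_tgt _
  cmap_id _ _ h := (congrArg s.c₁.map (pairHom_id _ _ h)).trans (s.c₁.map_id _)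
  cmap_comp _ _ _ _ _ _ := (congrArg s.c₁.map (pairHom_comp _ _ _ _ _ _)).trans (s.c₁.map_comp _ _)

lemma IsNormal.kap_pair (hs : s.IsNormal) (P Q : Path (pathGph A)) (h : P.last = Q.start) :
    pcomp (some (ap s.kc (pairPath (mapPath s.c P) (mapPath s.c Q) (map_tgt_src (pathMap s.c) h))))
        (some (ap s.kc (catPath P Q h))) =
      pcomp (hs.ops.cm (some (ap s.kc P)) (some (ap s.kc Q)))
        (some (ap s.kc (pairPath (flattenPath P) (flattenPath Q) (map_tgt_src (pathMult A) h)))) := by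
  have c : Consec (ap s.kc P).hom (ap s.kc Q).hom := .app s.κ.hom h
  have e₁ := congrArg (fun P => some (ap s.kc P)) (mapPath_pair (pathMap s.c) P Q h)
  have e₂ := congrArg (fun P => some (ap s.kc P)) (mapPath_pair (pathMult A) P Q h)
  have e₃ := congrArg (fun α => some (mapA s.c₁ α)) (ap_pcell_pair s.kc P Q h c)
  exact (congrArg₂ pcomp e₁ rfl).symm.trans
    ((s.kap_assoc (pairPath (A := pathGph (pathGph A)) P Q h)).trans
      (congrArg₂ pcomp (e₃.trans (hs.ops.oa_cmap _ _ c)) e₂))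

/-- The comparison for the composition of two vertical paths. -/
abbrev k₂ (s : PseudoAlgStr pathMonad A) (p q : Path A) (h : p.last = q.start) : Option (Arrow A.A₁) :=
  some (ap s.kc (pairPath (A := pathGph A) p q h))

lemma IsNormal.k₂_right (hs : s.IsNormal) (p q r : Path A) (h : p.last = q.start)
    (h' : q.last = r.start) :
    pcomp (s.k₂ (onePath (s.c₁.obj p)) (pairPath (s.c₁.obj q) (s.c₁.obj r)
        (map_tgt_src s.c h')) (map_tgt_src s.c h)) (some (ap s.kc (triPath (A := pathGph A) p q r h h'))) =
      pcomp (hs.ops.cm (oa (𝟙 (s.c₁.obj p))) (s.k₂ q r h')) (s.k₂ p (catPath q r h') h) := by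
  have h₁ := hs.kap_pair (onePath (A := pathGph A) p) (pairPath (A := pathGph A) q r h') h
  have e₁ : pairPath (A := pathGph A) (mapPath s.c (onePath (A := pathGph A) p))
      (mapPath s.c (pairPath (A := pathGph A) q r h')) (map_tgt_src (pathMap s.c) h) =
      pairPath (A := pathGph A) (onePath (s.c₁.obj p)) (pairPath (s.c₁.obj q) (s.c₁.obj r)
        (map_tgt_src s.c h')) (map_tgt_src s.c h) :=
    pairPath_congr (mapPath_one s.c p) (mapPath_pair s.c q r h') _ _
  have e₂ : catPath (onePath (A := pathGph A) p) (pairPath (A := pathGph A) q r h') h =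
    triPath (A := pathGph A) p q r h h' := rfl
  have e₃ : pairPath (A := pathGph A) (flattenPath (onePath (A := pathGph A) p))
      (catPath q r h') (map_tgt_src (pathMult A) h) = pairPath (A := pathGph A) p (catPath q r h') h :=
    pairPath_congr (flatten_one p) rfl _ _
  rw [hs.kap_one, e₁, e₂, e₃] at h₁
  exact h₁

lemma IsNormal.k₂_left (hs : s.IsNormal) (p q r : Path A) (h : p.last = q.start)
    (h' : q.last = r.start) :
    pcomp (s.k₂ (pairPath (s.c₁.obj p) (s.c₁.obj q) (map_tgt_src s.c h)) (onePath (s.c₁.obj r))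
        (map_tgt_src s.c h')) (some (ap s.kc (triPath (A := pathGph A) p q r h h'))) =
      pcomp (hs.ops.cm (s.k₂ p q h) (oa (𝟙 (s.c₁.obj r))))
        (s.k₂ (catPath p q h) r ((last_catPath p q h).trans h')) := by
  have h₁ := hs.kap_pair (pairPath (A := pathGph A) p q h) (onePath (A := pathGph A) r) h'
  have e₁ : pairPath (A := pathGph A) (mapPath s.c (pairPath (A := pathGph A) p q h))
      (mapPath s.c (onePath (A := pathGph A) r)) (map_tgt_src (pathMap s.c) h') =
      pairPath (A := pathGph A) (pairPath (s.c₁.obj p) (s.c₁.obj q) (map_tgt_src s.c h))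
        (onePath (s.c₁.obj r)) (map_tgt_src s.c h') :=
    pairPath_congr (mapPath_pair s.c p q h) (mapPath_one s.c r) _ _
  have e₂ : catPath (pairPath (A := pathGph A) p q h) (onePath (A := pathGph A) r) h' =
    triPath (A := pathGph A) p q r h h' := rfl
  have e₃ : pairPath (A := pathGph A) (catPath p q h) (flattenPath (onePath (A := pathGph A) r))
      (map_tgt_src (pathMult A) h') =
        pairPath (A := pathGph A) (catPath p q h) r ((last_catPath p q h).trans h') :=
    pairPath_congr rfl (flatten_one r) _ _
  rw [hs.kap_one, e₁, e₂, e₃] at h₁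
  exact h₁

/-- The concatenation of two paths of cells. -/
abbrev _root_.TripleCat.catHom {p p' q q' : Path A} (f : p ⟶ p') (g : q ⟶ q')
    (c : Consec (A := pathGph A) f g) : catPath p q c.left ⟶ catPath p' q' c.right :=
  (flattenFunctor A).map (pairHom (A := pathGph A) f g c)

lemma IsNormal.k₂_nat (hs : s.IsNormal) {p p' q q' : Path A} (f : p ⟶ p') (g : q ⟶ q')
    (c : Consec (A := pathGph A) f g) :
    pcomp (hs.ops.cm (oa (s.c₁.map f)) (oa (s.c₁.map g))) (s.k₂ p' q' c.right) =
      pcomp (s.k₂ p q c.left) (oa (s.c₁.map (catHom f g c))) := by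
  have h₁ := ap_nat s.kc (pairHom (A := pathGph A) f g c)
  refine Eq.trans (congrArg₂ pcomp ?_ rfl) h₁
  refine (hs.ops.oa_cmap _ _ (c.map s.c)).symm.trans ?_
  exact congrArg (fun a => some (mapA s.c₁ a)) (mapCellPath_pairHom s.c f g c).symm

instance (P : Path (pathGph A)) : IsIso (ap s.kc P).hom :=
  ⟨s.κ.inv.φ₁.app P, congrArg (fun a => GphCat.Hom₂.φ₁ a |>.app P) s.κ.hom_inv_id,
    congrArg (fun a => GphCat.Hom₂.φ₁ a |>.app P) s.κ.inv_hom_id⟩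

/-- The comparison for the composition of two vertical paths, with prescribed ends. -/
noncomputable def IsNormal.k₂iso (hs : s.IsNormal) (p q : Path A) (h : p.last = q.start) {u v t : A.A₁}
    (hu : s.c₁.obj p = u) (hv : s.c₁.obj q = v) (ht : s.c₁.obj (catPath p q h) = t)
    (h' : A.tgt.obj u = A.src.obj v) : hs.ops.comp u v h' ≅ t :=
  isoCast (asIso (ap s.kc (pairPath (A := pathGph A) p q h)).hom)
    (congrArg s.c₁.obj ((mapPath_pair s.c p q h).trans (pairPath_congr hu hv _ _))) ht

lemma IsNormal.oa_k₂iso (hs : s.IsNormal) (p q : Path A) (h : p.last = q.start) {u v t : A.A₁}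
    (hu : s.c₁.obj p = u) (hv : s.c₁.obj q = v) (ht : s.c₁.obj (catPath p q h) = t)
    (h' : A.tgt.obj u = A.src.obj v) : oa (hs.k₂iso p q h hu hv ht h').hom = s.k₂ p q h :=
  congrArg some (mk_isoCast _ _ _)

lemma IsNormal.k₂iso_special (hs : s.IsNormal) (p q : Path A) (h : p.last = q.start) {u v t : A.A₁}
    (hu : s.c₁.obj p = u) (hv : s.c₁.obj q = v) (ht : s.c₁.obj (catPath p q h) = t)
    (h' : A.tgt.obj u = A.src.obj v) : Special (hs.k₂iso p q h hu hv ht h').hom :=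
  (Flat.special hs.flat_κ (pairPath (A := pathGph A) p q h)).of_mk (mk_isoCast _ _ _)

section
variable (hs : s.IsNormal)

/-- The associator, as a composite of comparisons with the ternary composition. -/
noncomputable def IsNormal.associator (hs : s.IsNormal) (u v w : A.A₁) (h : A.tgt.obj u = A.src.obj v)
    (h' : A.tgt.obj v = A.src.obj w) :
    hs.ops.comp u (hs.ops.comp v w h') (VertOps.h_left h h') ≅
      hs.ops.comp (hs.ops.comp u v h) w (VertOps.h_right h h') :=
  hs.k₂iso (onePath u) (pairPath v w h') h (hs.c_one_obj u) rfl
      (t := s.c₁.obj (triPath u v w h h')) rfl _ ≪≫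
    (hs.k₂iso (pairPath u v h) (onePath w) h' rfl (hs.c_one_obj w)
      (t := s.c₁.obj (triPath u v w h h')) rfl _).symm

lemma IsNormal.associator_special (hs : s.IsNormal) (u v w : A.A₁) (h : A.tgt.obj u = A.src.obj v)
    (h' : A.tgt.obj v = A.src.obj w) : Special (hs.associator u v w h h').hom :=
  (hs.k₂iso_special _ _ _ _ _ _ _).comp (Special.inv _ (hs.k₂iso_special _ _ _ _ _ _ _))

lemma IsNormal.associator_k₂ (hs : s.IsNormal) (p q r : Path A) (h : p.last = q.start)
    (h' : q.last = r.start) {u v w uv vw t : A.A₁} (hu : s.c₁.obj p = u) (hv : s.c₁.obj q = v)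
    (hw : s.c₁.obj r = w) (huv : s.c₁.obj (catPath p q h) = uv)
    (hvw : s.c₁.obj (catPath q r h') = vw) (k k' l l')
    (ht : s.c₁.obj (catPath (catPath p q h) r ((last_catPath p q h).trans h')) = t)
    (ht' : s.c₁.obj (catPath p (catPath q r h') h) = t) (c c') :
    (hs.associator u v w k k').hom ≫
        hs.ops.cmap (hs.k₂iso p q h hu hv huv k).hom (𝟙 w) c ≫ (hs.k₂iso _ r _ huv hw ht l).hom =
      hs.ops.cmap (𝟙 u) (hs.k₂iso q r h' hv hw hvw k').hom c' ≫ (hs.k₂iso p _ _ hu hvw ht' l').hom := by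
  subst hu hv hw huv hvw
  have hr := hs.k₂_right p q r h h'
  have hl := hs.k₂_left p q r h h'
  have e₁ : (ap s.kc (triPath (A := pathGph A) p q r h h')).left =
      s.c₁.obj (triPath (s.c₁.obj p) (s.c₁.obj q) (s.c₁.obj r) k k') :=
    congrArg s.c₁.obj (mapPath_tri s.c p q r h h')
  have e₂ : (ap s.kc (triPath (A := pathGph A) p q r h h')).right = t :=
    (congrArg s.c₁.obj (flatten_tri p q r h h')).trans ht'
  rw [← oa_homOf _ e₁ e₂] at hr hl
  have hr' : (hs.k₂iso (onePath (s.c₁.obj p)) (pairPath _ _ k') k (hs.c_one_obj _) rfl rfl _).hom ≫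
      homOf _ e₁ e₂ = hs.ops.cmap (𝟙 _) (hs.k₂iso q r h' rfl rfl rfl k').hom c' ≫
        (hs.k₂iso p _ _ rfl rfl ht' l').hom := by
    refine oa_inj ((oa_comp _ _).trans (Eq.trans ?_ (oa_comp _ _).symm))
    exact (congrArg₂ pcomp (hs.oa_k₂iso _ _ _ _ _ _ _) rfl).trans (hr.trans (congrArg₂ pcomp
      ((VertOps.oa_cmap _ _ _ _).trans (congrArg₂ _ rfl (hs.oa_k₂iso _ _ _ _ _ _ _)))
      (hs.oa_k₂iso _ _ _ _ _ _ _)).symm)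
  have hl' : (hs.k₂iso (pairPath _ _ k) (onePath (s.c₁.obj r)) k' rfl (hs.c_one_obj _) rfl _).hom ≫
      homOf _ e₁ e₂ = hs.ops.cmap (hs.k₂iso p q h rfl rfl rfl k).hom (𝟙 _) c ≫
        (hs.k₂iso _ r _ rfl rfl ht l).hom := by
    refine oa_inj ((oa_comp _ _).trans (Eq.trans ?_ (oa_comp _ _).symm))
    exact (congrArg₂ pcomp (hs.oa_k₂iso _ _ _ _ _ _ _) rfl).trans (hl.trans (congrArg₂ pcomp
      ((VertOps.oa_cmap _ _ _ _).trans (congrArg₂ _ (hs.oa_k₂iso _ _ _ _ _ _ _) rfl))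
      (hs.oa_k₂iso _ _ _ _ _ _ _)).symm)
  exact (congrArg (_ ≫ ·) hl'.symm).trans ((iso_trans_symm_hom _ _ _).trans hr')

lemma IsNormal.kap_nil_one (hs : s.IsNormal) {x : A.A₀} {u : A.A₁} (h : x = A.src.obj u) :
    s.c₁.obj (catPath (nilPath x) (onePath u) h) = u := by
  subst h
  exact hs.c_one_obj u

lemma IsNormal.k₂iso_one (hs : s.IsNormal) {u v : A.A₁} (h h')
    (ht : s.c₁.obj (catPath (onePath u) (onePath v) h) = hs.ops.comp u v h') :
    (hs.k₂iso (onePath u) (onePath v) h (hs.c_one_obj u) (hs.c_one_obj v) ht h').hom = 𝟙 _ := by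
  refine oa_inj ((hs.oa_k₂iso _ _ _ _ _ _ _).trans ?_)
  have e : pairPath (A := pathGph A) (onePath u) (onePath v) h =
      mapPath (pathUnit A) (pairPath u v h) := (mapPath_pair (pathUnit A) u v h).symm
  exact congrArg some ((congrArg (ap s.kc) e).trans (hs.kap_units _))

lemma IsNormal.k₂iso_nat (hs : s.IsNormal) {p p' q q' : Path A} (f : p ⟶ p') (g : q ⟶ q')
    (c : Consec (A := pathGph A) f g) {u u' v v' t t' : A.A₁} {a : u ⟶ u'} {b : v ⟶ v'} {d : t ⟶ t'}
    (ha : Arrow.mk (s.c₁.map f) = Arrow.mk a) (hb : Arrow.mk (s.c₁.map g) = Arrow.mk b)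
    (hd : Arrow.mk (s.c₁.map (catHom f g c)) = Arrow.mk d) (c') (h₁ h₂ h₃ h₄ h₁' h₂' h₃' h₄') :
    hs.ops.cmap a b c' ≫ (hs.k₂iso p' q' c.right (u := u') (v := v') (t := t') h₁ h₂ h₃ h₄).hom =
      (hs.k₂iso p q c.left (u := u) (v := v) (t := t) h₁' h₂' h₃' h₄').hom ≫ d := by
  refine oa_inj ((oa_comp _ _).trans (Eq.trans ?_ (oa_comp _ _).symm))
  rw [VertOps.oa_cmap, hs.oa_k₂iso p' q' c.right h₁ h₂ h₃ h₄,
    hs.oa_k₂iso p q c.left h₁' h₂' h₃' h₄']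
  have := hs.k₂_nat f g c
  rwa [oa, oa, ha, hb, oa, hd] at this

lemma _root_.TripleCat.catHom_nil_one {x y : A.A₀} {u v : A.A₁} (f : x ⟶ y) (g : u ⟶ v)
    (c : Consec (A := pathGph A) (nilHom f) (oneHom g)) (c' : Arrow.mk f = Arrow.mk (A.src.map g)) :
    Arrow.mk (catHom (nilHom f) (oneHom g) c) = Arrow.mk (oneHom g) :=
  arrow_ext (GPath.ext ((mapA_srcF (nilHom f)).trans c') rfl)

lemma _root_.TripleCat.catHom_one_nil {x y : A.A₀} {u v : A.A₁} (f : x ⟶ y) (g : u ⟶ v)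
    (c : Consec (A := pathGph A) (oneHom g) (nilHom f)) :
    Arrow.mk (catHom (oneHom g) (nilHom f) c) = Arrow.mk (oneHom g) :=
  arrow_ext (GPath.ext (mapA_srcF (oneHom g)) rfl)

lemma _root_.TripleCat.catHom_one_pair {u v w u' v' w' : A.A₁} (f : u ⟶ u') (g : v ⟶ v') (k : w ⟶ w')
    (c : Consec f g) (c' : Consec g k) (d d') :
    Arrow.mk (catHom (oneHom f) (pairHom g k c') d) = Arrow.mk (catHom (pairHom f g c) (oneHom k) d') :=
  arrow_ext (GPath.ext ((mapA_srcF (oneHom f)).trans (mapA_srcF (pairHom f g c)).symm) rfl)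

lemma _root_.TripleCat.consec_path {p p' q q' : Path A} {f : p ⟶ p'} {g : q ⟶ q'}
    (h : (toCell f).last = (toCell g).start) : Consec (A := pathGph A) f g :=
  (mapA_tgtF f).trans (h.trans (mapA_srcF g).symm)

lemma IsNormal.k₂iso_eq_id (hs : s.IsNormal) {p q : Path A} {u v : A.A₁} (hp : p = onePath u)
    (hq : q = onePath v) (h h' hu hv) (ht : s.c₁.obj (catPath p q h) = hs.ops.comp u v h') :
    (hs.k₂iso p q h hu hv ht h').hom = 𝟙 _ := by
  subst hp hq
  exact hs.k₂iso_one _ _ _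

lemma IsNormal.triangle (hs : s.IsNormal) (u : A.A₁) (x : A.A₀) (v : A.A₁) (h : A.tgt.obj u = x)
    (h' : x = A.src.obj v) (c c') :
    (hs.associator u (s.c₁.obj (nilPath x)) v (VertOps.h_runit (D := hs.ops) h)
        (VertOps.h_lunit (D := hs.ops) h')).hom ≫
      hs.ops.cmap (hs.k₂iso (onePath u) (nilPath x) h (hs.c_one_obj u) rfl (hs.c_one_obj u)
        (VertOps.h_runit (D := hs.ops) h)).hom (𝟙 v) c =
      hs.ops.cmap (𝟙 u) (hs.k₂iso (nilPath x) (onePath v) h' rfl (hs.c_one_obj v) (hs.kap_nil_one h')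
        (VertOps.h_lunit (D := hs.ops) h')).hom c' := by
  subst h'
  have h₁ := hs.associator_k₂ (onePath u) (nilPath _) (onePath v) h rfl (hs.c_one_obj u) rfl
      (hs.c_one_obj v) (hs.c_one_obj u) (hs.c_one_obj v) (VertOps.h_runit (D := hs.ops) h)
      (VertOps.h_lunit (D := hs.ops) rfl) h h (t := hs.ops.comp u v h) rfl rfl c c'
  exact comp_of_ids h₁ (hs.k₂iso_eq_id rfl rfl _ _ _ _ _) (hs.k₂iso_eq_id rfl rfl _ _ _ _ _)

lemma pentagon_of {K : Type*} [Category K] {P₁ P₂ P₃ P₄ P₅ Q₁ Q₂ T : K} {a₁ : P₁ ⟶ P₂} {a₂ : P₂ ⟶ P₃}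
    {b₁ : P₁ ⟶ P₄} {b₂ : P₄ ⟶ P₅} {b₃ : P₅ ⟶ P₃} {x : P₃ ⟶ Q₁} {y : Q₁ ⟶ T} {z : P₂ ⟶ T}
    {w : P₅ ⟶ Q₁} {r : P₄ ⟶ Q₂} {t : Q₂ ⟶ T} {l : P₁ ⟶ Q₂} (hx : IsIso x) (hy : IsIso y)
    (h₁ : a₁ ≫ z = l ≫ t) (h₂ : a₂ ≫ x ≫ y = z) (h₃ : b₂ ≫ w ≫ y = r ≫ t) (h₄ : b₃ ≫ x = w)
    (h₅ : b₁ ≫ r = l) : a₁ ≫ a₂ = b₁ ≫ b₂ ≫ b₃ := by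
  rw [← cancel_mono (x ≫ y)]
  simp only [Category.assoc]
  rw [h₂, h₁, ← Category.assoc b₃, h₄, h₃, ← h₅, Category.assoc]

lemma IsNormal.pentagon (hs : s.IsNormal) (u v w z : A.A₁) (h : A.tgt.obj u = A.src.obj v)
    (h' : A.tgt.obj v = A.src.obj w) (h'' : A.tgt.obj w = A.src.obj z) (c c') :
    (hs.associator u v (hs.ops.comp w z h'') h (VertOps.h_left h' h'')).hom ≫
        (hs.associator (hs.ops.comp u v h) w z (VertOps.h_right h h') h'').hom =
      hs.ops.cmap (𝟙 u) (hs.associator v w z h' h'').hom c ≫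
        (hs.associator u (hs.ops.comp v w h') z (VertOps.h_left h h') (VertOps.h_right h' h'')).hom ≫
        hs.ops.cmap (hs.associator u v w h h').hom (𝟙 z) c' := by
  have tl : A.tgt.obj (s.c₁.obj (triPath u v w h h')) = A.src.obj z := (hs.c_tgt_obj _).trans h''
  have tr : A.tgt.obj u = A.src.obj (s.c₁.obj (triPath v w z h' h'')) := h.trans (hs.c_src_obj (triPath v w z h' h'')).symm
  have m₁ : A.tgt.obj v = A.src.obj (hs.ops.comp w z h'') := VertOps.h_left h' h''
  have m₂ : A.tgt.obj (hs.ops.comp u v h) = A.src.obj w := VertOps.h_right h h'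
  have m₃ : A.tgt.obj u = A.src.obj (hs.ops.comp v w h') := VertOps.h_left h h'
  have m₄ : A.tgt.obj (hs.ops.comp v w h') = A.src.obj z := VertOps.h_right h' h''
  have m₅ : A.tgt.obj (hs.ops.comp u v h) = A.src.obj (hs.ops.comp w z h'') := VertOps.h_right h m₁
  have h₁ := hs.associator_k₂ (onePath u) (onePath v) (pairPath w z h'') h h' (hs.c_one_obj u)
    (hs.c_one_obj v) rfl (uv := hs.ops.comp u v h) rfl (vw := s.c₁.obj (triPath v w z h' h'')) rfl h
    m₁ m₅ tr (t := s.c₁.obj (catPath (pairPath u v h) (pairPath w z h'') h')) rfl rfl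
    ((hs.k₂iso_special _ _ _ _ _ _ _).consec (.id _) (VertOps.h_right h m₁))
    ((Special.id _).consec (hs.k₂iso_special _ _ _ _ _ _ _) (VertOps.h_left (D := hs.ops) h m₁))
  have h₂ := hs.associator_k₂ (pairPath u v h) (onePath w) (onePath z) h' h'' rfl (hs.c_one_obj w)
    (hs.c_one_obj z) (uv := s.c₁.obj (triPath u v w h h')) rfl (vw := hs.ops.comp w z h'') rfl
    m₂ h'' tl m₅ (t := s.c₁.obj (catPath (pairPath u v h) (pairPath w z h'') h')) rfl rfl
    ((hs.k₂iso_special _ _ _ _ _ _ _).consec (.id _) (VertOps.h_right (D := hs.ops) m₂ h''))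
    ((Special.id _).consec (hs.k₂iso_special _ _ _ _ _ _ _) (VertOps.h_left (D := hs.ops) m₂ h''))
  have h₃ := hs.associator_k₂ (onePath u) (pairPath v w h') (onePath z) h h'' (hs.c_one_obj u) rfl
    (hs.c_one_obj z) (uv := s.c₁.obj (triPath u v w h h')) rfl (vw := s.c₁.obj (triPath v w z h' h''))
    rfl m₃ m₄ tl tr (t := s.c₁.obj (catPath (pairPath u v h) (pairPath w z h'') h')) rfl rfl
    ((hs.k₂iso_special _ _ _ _ _ _ _).consec (.id _) (VertOps.h_right (D := hs.ops) m₃ m₄))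
    ((Special.id _).consec (hs.k₂iso_special _ _ _ _ _ _ _) (VertOps.h_left (D := hs.ops) m₃ m₄))
  have := hs.ops.isIso_cmap (hs.k₂iso (pairPath u v h) (onePath w) h' rfl (hs.c_one_obj w)
    (t := s.c₁.obj (triPath u v w h h')) rfl m₂).hom (𝟙 z)
    ((hs.k₂iso_special _ _ _ _ _ _ _).consec (.id _) (VertOps.h_right (D := hs.ops) m₂ h''))
  refine pentagon_of this inferInstance (elim_mid h₁ (cmap_ids _ (hs.k₂iso_one _ _ _) rfl _)) (elim_left h₂
    (cmap_ids _ rfl (hs.k₂iso_one _ _ _) _)) h₃ ?_ ?_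
  · exact (hs.ops.cmap_comp_id _ _ (((hs.associator_special _ _ _ _ _).comp
      (hs.k₂iso_special _ _ _ _ _ _ _)).consec (.id _) (VertOps.h_right (D := hs.ops) m₃ m₄)) _
      _).symm.trans (hs.ops.cmap_congr (trans_symm_comp _ _) rfl _ _)
  · exact (hs.ops.cmap_id_comp _ _ ((Special.id _).consec ((hs.associator_special _ _ _ _ _).comp
      (hs.k₂iso_special _ _ _ _ _ _ _)) (VertOps.h_left (D := hs.ops) h m₁)) _
      _).symm.trans (hs.ops.cmap_congr rfl (trans_symm_comp _ _) _ _)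

/-- The weak double category formed by the zeroary and binary compositions of a normal pseudo
algebra. -/
noncomputable def IsNormal.biased (hs : s.IsNormal) : WDblStr A where
  ops := hs.ops
  lunit x u h := hs.k₂iso (nilPath x) (onePath u) h rfl (hs.c_one_obj u) (hs.kap_nil_one h) _
  runit u x h := hs.k₂iso (onePath u) (nilPath x) h (hs.c_one_obj u) rfl (hs.c_one_obj u) _
  assoc u v w h h' := hs.associator u v w h h'
  lunit_special _ _ _ := hs.k₂iso_special _ _ _ _ _ _ _
  runit_special _ _ _ := hs.k₂iso_special _ _ _ _ _ _ _
  assoc_special _ _ _ _ _ := hs.associator_special _ _ _ _ _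
  lunit_nat {x y u v} f g c :=
    hs.k₂iso_nat (nilHom f) (oneHom g) (consec_path c) rfl (hs.c_one g)
      ((mapA_congr' s.c₁ (catHom_nil_one f g _ c)).trans (hs.c_one g)) _ _ _ _ _ _ _ _ _
  runit_nat {x y u v} g f c :=
    hs.k₂iso_nat (oneHom g) (nilHom f) (consec_path c) (hs.c_one g) rfl
      ((mapA_congr' s.c₁ (catHom_one_nil f g _)).trans (hs.c_one g)) _ _ _ _ _ _ _ _ _
  assoc_nat {u u' v v' w w'} f g k c c' := by
    have h₁ := hs.k₂iso_nat (b := hs.ops.cmap g k c') (oneHom f) (pairHom g k c') (consec_path c)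
      (hs.c_one f) rfl rfl
      (VertOps.c_left c c') (hs.c_one_obj _) rfl rfl
      (VertOps.h_left (D := hs.ops) c.right c'.right) (hs.c_one_obj _) rfl rfl
      (VertOps.h_left (D := hs.ops) c.left c'.left)
    have h₂ := hs.k₂iso_nat (a := hs.ops.cmap f g c) (pairHom f g c) (oneHom k) (consec_path c') rfl
      (hs.c_one k)
      (mapA_congr' s.c₁ (catHom_one_pair f g k c c' (consec_path c) (consec_path c')).symm)
      (VertOps.c_right c c') rfl (hs.c_one_obj _) rfl
      (VertOps.h_right (D := hs.ops) c.right c'.right) rfl (hs.c_one_obj _) rfl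
      (VertOps.h_right (D := hs.ops) c.left c'.left)
    exact iso_square h₁ h₂
  triangle u x v h h' := hs.triangle u x v h h' _ _
  pentagon u v w z h h' h'' := hs.pentagon u v w z h h' h'' _ _

lemma IsNormal.isBiasedReduct (hs : s.IsNormal) : IsBiasedReduct s hs.biased where
  one _ := rfl
  comp _ _ _ := rfl
  cmap _ _ _ := rfl
  lunit _ _ _ := mk_isoCast _ _ _
  runit _ _ _ := mk_isoCast _ _ _
  assoc u v w h h' := by
    have e := hs.oa_k₂iso (pairPath u v h) (onePath w) h' rfl (hs.c_one_obj w)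
      (t := s.c₁.obj (triPath u v w h h')) rfl (VertOps.h_right (D := hs.ops) h h')
    have e' := hs.oa_k₂iso (onePath u) (pairPath v w h') h (hs.c_one_obj u) rfl
      (t := s.c₁.obj (triPath u v w h h')) rfl (VertOps.h_left (D := hs.ops) h h')
    have key : pcomp (oa (hs.associator u v w h h').hom) (s.k₂ (pairPath u v h) (onePath w) h') =
      s.k₂ (onePath u) (pairPath v w h') h := ?_
    · exact ⟨(congrArg s.c₁.obj ((mapPath_pair s.c _ _ (pair_one u v w h h')).trans
        (pairPath_congr rfl (hs.c_one_obj w) _ (VertOps.h_right (D := hs.ops) h h')))).symm, two_one key⟩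
    refine (congrArg (pcomp (oa (hs.associator u v w h h').hom)) e.symm).trans (Eq.trans ?_ e')
    exact (oa_comp _ _).symm.trans (congrArg oa (trans_symm_comp _ _))

end

end PseudoAlgStr

section
variable {C : Type u} [Bicategory.{w, v} C] [Strict C] {T : TwoMonad C} {M N : PseudoAlg T}

lemma LaxMor.whL_unit_eq (f : LaxMor M N) (hM : M.str.IsNormal) (hN : N.str.IsNormal) :
    whL (T.unit M.carrier) (Arrow.mk f.φ) = Arrow.mk (𝟙 f.f) := by
  have e : T.unit N.carrier ≫ N.str.a = 𝟙 _ :=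
    congrArg (fun α : Arrow (N.carrier ⟶ N.carrier) => α.right) hN
  have h₁ := of_two_one f.unit
  rw [show Arrow.mk N.str.ω.hom = _ from hN, show Arrow.mk M.str.ω.hom = _ from hM, whL_idc,
    whR_idc, idc_pcomp _ (by
      change f.f ≫ 𝟙 _ = T.unit _ ≫ T.T.map f.f ≫ N.str.a
      rw [← Strict.assoc, ← T.unit_nat, Strict.assoc, e]), Option.some_inj] at h₁
  rw [h₁, Strict.id_comp]

lemma ColaxMor.whL_unit_eq (f : ColaxMor M N) (hM : M.str.IsNormal) (hN : N.str.IsNormal) :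
    whL (T.unit M.carrier) (Arrow.mk f.ρ) = Arrow.mk (𝟙 f.r) := by
  have e : T.unit M.carrier ≫ M.str.a = 𝟙 _ :=
    congrArg (fun α : Arrow (M.carrier ⟶ M.carrier) => α.right) hM
  have h₁ := of_two_one f.unit
  rw [show Arrow.mk N.str.ω.hom = _ from hN, show Arrow.mk M.str.ω.hom = _ from hM, whL_idc,
    whR_idc, idc_pcomp _ (by
      change 𝟙 _ ≫ f.r = T.unit _ ≫ M.str.a ≫ f.r
      rw [← Strict.assoc, e]), Option.some_inj] at h₁
  rw [h₁, Strict.comp_id]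

end

section
variable {M N : PseudoAlg pathMonad.{u}}

namespace LaxMor
variable (f : LaxMor M N)

/-- The comparison 2-cell. -/
abbrev cell : Arrow (pathGph M.carrier ⟶ N.carrier) := Arrow.mk f.φ

lemma ap_mult (P : Path (pathGph M.carrier)) :
    pcomp (some (ap N.str.kc (mapPath (pathMap f.f) P))) (some (ap f.cell (flattenPath P))) =
      pcomp (some (mapA N.str.c₁ (ap (pcell f.cell) P)))
        (pcomp (some (ap f.cell (mapPath M.str.c P))) (some (mapA f.f.F₁ (ap M.str.kc P)))) := by
  have := congrArg (fun α : Arrow (pathGph (pathGph M.carrier) ⟶ N.carrier) => some (ap α P)) f.mult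
  exact (ap_vcomp _ _ _ _).symm.trans (this.trans (ap_vcomp₃ _ _ _ _ _ _))

lemma whL_unit (hM : M.str.IsNormal) (hN : N.str.IsNormal) :
    whL (pathUnit M.carrier) f.cell = Arrow.mk (𝟙 f.f) := f.whL_unit_eq hM hN

lemma ap_one (hM : M.str.IsNormal) (hN : N.str.IsNormal) (u : M.carrier.A₁) :
    ap f.cell (onePath u) = Arrow.mk (𝟙 (f.f.F₁.obj u)) :=
  congrArg (fun α : Arrow (M.carrier ⟶ N.carrier) => ap α u) (f.whL_unit hM hN)

lemma flat (hM : M.str.IsNormal) (hN : N.str.IsNormal) : Flat f.cell :=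
  Flat.of_id (f := f.f.F₀.obj) fun u =>
    congrArg (fun α : Arrow (M.carrier ⟶ N.carrier) => ap₀ α u) (f.whL_unit hM hN)

lemma ap_pair (hN : N.str.IsNormal) (p q : Path M.carrier) (h : p.last = q.start) :
    pcomp (N.str.k₂ (mapPath f.f p) (mapPath f.f q) (map_tgt_src (pathMap f.f) h))
        (some (ap f.cell (catPath p q h))) =
      pcomp (hN.ops.cm (some (ap f.cell p)) (some (ap f.cell q)))
        (pcomp (some (ap f.cell (pairPath (M.str.c₁.obj p) (M.str.c₁.obj q) (map_tgt_src M.str.c h))))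
          (some (mapA f.f.F₁ (ap M.str.kc (pairPath (A := pathGph M.carrier) p q h))))) := by
  have c : Consec (ap f.cell p).hom (ap f.cell q).hom := .app f.φ h
  have e₁ := congrArg (fun P => some (ap N.str.kc P)) (mapPath_pair (pathMap f.f) p q h)
  have e₂ := congrArg (fun P => some (ap f.cell P)) (mapPath_pair M.str.c p q h)
  have e₃ := congrArg (fun α => some (mapA N.str.c₁ α)) (ap_pcell_pair f.cell p q h c)
  exact (congrArg₂ pcomp e₁ rfl).symm.trans ((f.ap_mult (pairPath (A := pathGph M.carrier) p q h)).trans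
    (congrArg₂ pcomp (e₃.trans (hN.ops.oa_cmap _ _ c)) (congrArg₂ pcomp e₂ rfl)))

/-- The comparison of a lax morphism on a path, with prescribed ends. -/
def app (p : Path M.carrier) {u : N.carrier.A₁} {v : M.carrier.A₁} (hu : N.str.c₁.obj (mapPath f.f p) = u)
    (hv : M.str.c₁.obj p = v) : u ⟶ f.f.F₁.obj v :=
  homOf (ap f.cell p) hu (congrArg f.f.F₁.obj hv)

lemma oa_app (p : Path M.carrier) {u : N.carrier.A₁} {v : M.carrier.A₁}
    (hu : N.str.c₁.obj (mapPath f.f p) = u) (hv : M.str.c₁.obj p = v) :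
    oa (f.app p hu hv) = some (ap f.cell p) := oa_homOf _ _ _

lemma app_special (hM : M.str.IsNormal) (hN : N.str.IsNormal) (p : Path M.carrier) {u : N.carrier.A₁}
    {v : M.carrier.A₁} (hu : N.str.c₁.obj (mapPath f.f p) = u) (hv : M.str.c₁.obj p = v) :
    Special (f.app p hu hv) :=
  ((f.flat hM hN).special p).of_mk (mk_homOf _ _ _)

lemma app_one (hM : M.str.IsNormal) (hN : N.str.IsNormal) (u : M.carrier.A₁) (h h') :
    f.app (onePath u) (u := f.f.F₁.obj u) (v := u) h h' = 𝟙 _ :=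
  oa_inj ((f.oa_app _ _ _).trans (congrArg some (f.ap_one hM hN u)))

lemma app_k₂ (hM : M.str.IsNormal) (hN : N.str.IsNormal) (p q : Path M.carrier) (h : p.last = q.start)
    {u v t : M.carrier.A₁} {u' v' t' : N.carrier.A₁} (hu : M.str.c₁.obj p = u)
    (hv : M.str.c₁.obj q = v) (ht : M.str.c₁.obj (catPath p q h) = t)
    (hu' : N.str.c₁.obj (mapPath f.f p) = u') (hv' : N.str.c₁.obj (mapPath f.f q) = v')
    (ht' : N.str.c₁.obj (mapPath f.f (catPath p q h)) = t') {p' q' : Path N.carrier}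
    (hp : mapPath f.f p = p') (hq : mapPath f.f q = q') (k h₁ h₂ h₃ k' c) (h₄) :
    (hN.k₂iso (u := u') (v := v') (t := t') p' q' h₁ h₂ h₃ h₄ k').hom ≫
        f.app (catPath p q h) ht' ht =
      hN.ops.cmap (f.app p hu' hu) (f.app q hv' hv) c ≫
        f.app (pairPath u v k) (u := hN.ops.comp (f.f.F₁.obj u) (f.f.F₁.obj v) (map_tgt_src f.f k))
          (congrArg N.str.c₁.obj (mapPath_pair _ _ _ _)) rfl ≫
        f.f.F₁.map (hM.k₂iso p q h hu hv ht k).hom := by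
  subst hu hv ht hp hq
  have e : oa (f.f.F₁.map (hM.k₂iso p q h rfl rfl rfl k).hom) =
      some (mapA f.f.F₁ (ap M.str.kc (pairPath (A := pathGph M.carrier) p q h))) :=
    congrArg some (mapA_congr' f.f.F₁ (mk_isoCast _ _ _))
  refine oa_inj ((oa_comp _ _).trans (Eq.trans ?_ (oa_comp _ _).symm))
  exact (congrArg₂ pcomp (hN.oa_k₂iso _ _ _ _ _ _ _) (f.oa_app _ _ _)).trans
    ((f.ap_pair hN p q h).trans (congrArg₂ pcomp ((VertOps.oa_cmap _ _ _ _).trans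
      (congrArg₂ _ (f.oa_app _ _ _) (f.oa_app _ _ _))) ((oa_comp _ _).trans (congrArg₂ pcomp
      (f.oa_app _ _ _) e))).symm)

lemma app_nat {p q : Path M.carrier} (a : p ⟶ q) {u u' : N.carrier.A₁} {v v' : M.carrier.A₁} (hu hv hu' hv')
    {b : u ⟶ u'} {d : v ⟶ v'} (hb : Arrow.mk (N.str.c₁.map ((pathFunctor f.f).map a)) = Arrow.mk b)
    (hd : Arrow.mk (M.str.c₁.map a) = Arrow.mk d) :
    b ≫ f.app q (u := u') (v := v') hu' hv' = f.app p (u := u) (v := v) hu hv ≫ f.f.F₁.map d := by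
  refine oa_inj ((oa_comp _ _).trans (Eq.trans ?_ (oa_comp _ _).symm))
  exact (congrArg₂ pcomp (congrArg some hb.symm) (f.oa_app _ _ _)).trans ((ap_nat f.cell a).trans
    (congrArg₂ pcomp (f.oa_app _ _ _) (congrArg some (mapA_congr' f.f.F₁ hd.symm))).symm)

/-- The lax double functor formed by the comparisons of a lax morphism on the paths of length zero
and two. -/
noncomputable def biased (hM : M.str.IsNormal) (hN : N.str.IsNormal) :
    LaxDbl ⟨M.carrier, hM.biased⟩ ⟨N.carrier, hN.biased⟩ where
  f := f.f
  unit x := f.app (nilPath x) rfl rfl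
  mult u v h := f.app (pairPath u v h) (congrArg N.str.c₁.obj (mapPath_pair _ _ _ _)) rfl
  unit_special _ := f.app_special hM hN _ _ _
  mult_special _ _ _ := f.app_special hM hN _ _ _
  unit_nat a := f.app_nat (nilHom a) _ _ _ _ rfl rfl
  mult_nat a b c := f.app_nat (pairHom a b c) _ _ _ _
    (mapA_congr' N.str.c₁ (mapCellPath_pairHom f.f a b c)) rfl
  lunit x u h := by
    have e := map_tgt_src f.f (VertOps.h_lunit (D := hM.ops) h)
    have h₁ := f.app_k₂ hM hN (nilPath x) (onePath u) h rfl (hM.c_one_obj u) (hM.kap_nil_one h) rfl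
      ((congrArg N.str.c₁.obj (mapPath_one f.f u)).trans (hN.c_one_obj _)) (t' := f.f.F₁.obj u)
      (by subst h; exact (congrArg N.str.c₁.obj (mapPath_one f.f u)).trans (hN.c_one_obj _))
      rfl (mapPath_one f.f u) (VertOps.h_lunit (D := hM.ops) h)
      ((congrArg f.f.F₀.obj h).trans (f.f.src_obj u).symm) rfl (hN.c_one_obj _)
      (VertOps.h_lunit (D := hN.ops) ((congrArg f.f.F₀.obj h).trans (f.f.src_obj u).symm))
      ((f.app_special hM hN _ _ _).consec (f.app_special hM hN _ _ _)
        (VertOps.h_lunit (D := hN.ops) ((congrArg f.f.F₀.obj h).trans (f.f.src_obj u).symm)))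
      (hN.kap_nil_one _)
    exact comp_of_id_right h₁ (by subst h; exact f.app_one hM hN u _ _)
      (hN.ops.cmap_congr rfl (f.app_one hM hN u _ _) _ _)
  runit u x h := by
    have e : N.carrier.tgt.obj (f.f.F₁.obj u) = f.f.F₀.obj x :=
      (f.f.tgt_obj u).trans (congrArg f.f.F₀.obj h)
    have h₁ := f.app_k₂ hM hN (onePath u) (nilPath x) h (hM.c_one_obj u) rfl (hM.c_one_obj u)
      ((congrArg N.str.c₁.obj (mapPath_one f.f u)).trans (hN.c_one_obj _)) rfl (t' := f.f.F₁.obj u)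
      ((congrArg N.str.c₁.obj (mapPath_one f.f u)).trans (hN.c_one_obj _))
      (mapPath_one f.f u) rfl (VertOps.h_runit (D := hM.ops) h) e (hN.c_one_obj _) rfl
      (VertOps.h_runit (D := hN.ops) e)
      ((f.app_special hM hN _ _ _).consec (f.app_special hM hN _ _ _)
        (VertOps.h_runit (D := hN.ops) e)) (hN.c_one_obj _)
    exact comp_of_id_right h₁ (f.app_one hM hN u _ _)
      (hN.ops.cmap_congr (f.app_one hM hN u _ _) rfl _ _)
  assoc u v w h h' := by
    have k := map_tgt_src f.f h
    have k' := map_tgt_src f.f h'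
    have h₁ := f.app_k₂ hM hN (onePath u) (pairPath v w h') h (hM.c_one_obj u) rfl
      (t := M.str.c₁.obj (triPath u v w h h')) rfl
      ((congrArg N.str.c₁.obj (mapPath_one f.f u)).trans (hN.c_one_obj _))
      (congrArg N.str.c₁.obj (mapPath_pair f.f v w h'))
      (t' := N.str.c₁.obj (triPath _ _ _ k k')) (congrArg N.str.c₁.obj (mapPath_tri f.f u v w h h'))
      (mapPath_one f.f u) (mapPath_pair f.f v w h') (VertOps.h_left (D := hM.ops) h h') k
      (hN.c_one_obj _) rfl (VertOps.h_left (D := hN.ops) k k')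
      ((f.app_special hM hN _ _ _).consec (f.app_special hM hN _ _ _)
        (VertOps.h_left (D := hN.ops) k k')) rfl
    have h₂ := f.app_k₂ hM hN (pairPath u v h) (onePath w) h' rfl (hM.c_one_obj w)
      (t := M.str.c₁.obj (triPath u v w h h')) rfl
      (congrArg N.str.c₁.obj (mapPath_pair f.f u v h))
      ((congrArg N.str.c₁.obj (mapPath_one f.f w)).trans (hN.c_one_obj _))
      (t' := N.str.c₁.obj (triPath _ _ _ k k')) (congrArg N.str.c₁.obj (mapPath_tri f.f u v w h h'))
      (mapPath_pair f.f u v h) (mapPath_one f.f w) (VertOps.h_right (D := hM.ops) h h') k'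
      rfl (hN.c_one_obj _) (VertOps.h_right (D := hN.ops) k k')
      ((f.app_special hM hN _ _ _).consec (f.app_special hM hN _ _ _)
        (VertOps.h_right (D := hN.ops) k k')) rfl
    exact lax_assoc_of h₁ h₂ (hN.ops.cmap_congr (f.app_one hM hN u _ _) rfl _ _)
      (hN.ops.cmap_congr rfl (f.app_one hM hN w _ _) _ _)

end LaxMor

namespace ColaxMor
variable (f : ColaxMor M N)

/-- The comparison 2-cell. -/
abbrev cell : Arrow (pathGph M.carrier ⟶ N.carrier) := Arrow.mk f.ρ

lemma ap_mult (P : Path (pathGph M.carrier)) :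
    pcomp (some (mapA f.r.F₁ (ap M.str.kc P))) (some (ap f.cell (flattenPath P))) =
      pcomp (some (ap f.cell (mapPath M.str.c P))) (pcomp (some (mapA N.str.c₁ (ap (pcell f.cell) P)))
        (some (ap N.str.kc (mapPath (pathMap f.r) P)))) := by
  have := congrArg (fun α : Arrow (pathGph (pathGph M.carrier) ⟶ N.carrier) => some (ap α P)) f.mult
  exact (ap_vcomp _ _ _ _).symm.trans (this.trans (ap_vcomp₃ _ _ _ _ _ _))

lemma whL_unit (hM : M.str.IsNormal) (hN : N.str.IsNormal) :
    whL (pathUnit M.carrier) f.cell = Arrow.mk (𝟙 f.r) := f.whL_unit_eq hM hN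

lemma ap_one (hM : M.str.IsNormal) (hN : N.str.IsNormal) (u : M.carrier.A₁) :
    ap f.cell (onePath u) = Arrow.mk (𝟙 (f.r.F₁.obj u)) :=
  congrArg (fun α : Arrow (M.carrier ⟶ N.carrier) => ap α u) (f.whL_unit hM hN)

lemma flat (hM : M.str.IsNormal) (hN : N.str.IsNormal) : Flat f.cell :=
  Flat.of_id (f := f.r.F₀.obj) fun u =>
    congrArg (fun α : Arrow (M.carrier ⟶ N.carrier) => ap₀ α u) (f.whL_unit hM hN)

lemma ap_pair (hN : N.str.IsNormal) (p q : Path M.carrier) (h : p.last = q.start) :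
    pcomp (some (mapA f.r.F₁ (ap M.str.kc (pairPath (A := pathGph M.carrier) p q h))))
        (some (ap f.cell (catPath p q h))) =
      pcomp (some (ap f.cell (pairPath (M.str.c₁.obj p) (M.str.c₁.obj q) (map_tgt_src M.str.c h))))
        (pcomp (hN.ops.cm (some (ap f.cell p)) (some (ap f.cell q)))
          (N.str.k₂ (mapPath f.r p) (mapPath f.r q) (map_tgt_src (pathMap f.r) h))) := by
  have c : Consec (ap f.cell p).hom (ap f.cell q).hom := .app f.ρ h
  have e₁ := congrArg (fun P => some (ap N.str.kc P)) (mapPath_pair (pathMap f.r) p q h)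
  have e₂ := congrArg (fun P => some (ap f.cell P)) (mapPath_pair M.str.c p q h)
  have e₃ := congrArg (fun α => some (mapA N.str.c₁ α)) (ap_pcell_pair f.cell p q h c)
  exact (f.ap_mult (pairPath (A := pathGph M.carrier) p q h)).trans
    (congrArg₂ pcomp e₂ (congrArg₂ pcomp (e₃.trans (hN.ops.oa_cmap _ _ c)) e₁))

/-- The comparison of a colax morphism on a path, with prescribed ends. -/
def app (p : Path M.carrier) {u : N.carrier.A₁} {v : M.carrier.A₁} (hu : N.str.c₁.obj (mapPath f.r p) = u)
    (hv : M.str.c₁.obj p = v) : f.r.F₁.obj v ⟶ u :=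
  homOf (ap f.cell p) (congrArg f.r.F₁.obj hv) hu

lemma oa_app (p : Path M.carrier) {u : N.carrier.A₁} {v : M.carrier.A₁}
    (hu : N.str.c₁.obj (mapPath f.r p) = u) (hv : M.str.c₁.obj p = v) :
    oa (f.app p hu hv) = some (ap f.cell p) := oa_homOf _ _ _

lemma app_special (hM : M.str.IsNormal) (hN : N.str.IsNormal) (p : Path M.carrier) {u : N.carrier.A₁}
    {v : M.carrier.A₁} (hu : N.str.c₁.obj (mapPath f.r p) = u) (hv : M.str.c₁.obj p = v) :
    Special (f.app p hu hv) :=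
  ((f.flat hM hN).special p).of_mk (mk_homOf _ _ _)

lemma app_one (hM : M.str.IsNormal) (hN : N.str.IsNormal) (u : M.carrier.A₁) (h h') :
    f.app (onePath u) (u := f.r.F₁.obj u) (v := u) h h' = 𝟙 _ :=
  oa_inj ((f.oa_app _ _ _).trans (congrArg some (f.ap_one hM hN u)))

lemma app_k₂ (hM : M.str.IsNormal) (hN : N.str.IsNormal) (p q : Path M.carrier) (h : p.last = q.start)
    {u v t : M.carrier.A₁} {u' v' t' : N.carrier.A₁} (hu : M.str.c₁.obj p = u)
    (hv : M.str.c₁.obj q = v) (ht : M.str.c₁.obj (catPath p q h) = t)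
    (hu' : N.str.c₁.obj (mapPath f.r p) = u') (hv' : N.str.c₁.obj (mapPath f.r q) = v')
    (ht' : N.str.c₁.obj (mapPath f.r (catPath p q h)) = t') {p' q' : Path N.carrier}
    (hp : mapPath f.r p = p') (hq : mapPath f.r q = q') (k h₁ h₂ h₃ k' c) (h₄) :
    f.r.F₁.map (hM.k₂iso p q h hu hv ht k).hom ≫ f.app (catPath p q h) ht' ht =
      f.app (pairPath u v k) (u := hN.ops.comp (f.r.F₁.obj u) (f.r.F₁.obj v) (map_tgt_src f.r k))
          (congrArg N.str.c₁.obj (mapPath_pair _ _ _ _)) rfl ≫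
        hN.ops.cmap (f.app p hu' hu) (f.app q hv' hv) c ≫
        (hN.k₂iso (u := u') (v := v') (t := t') p' q' h₁ h₂ h₃ h₄ k').hom := by
  subst hu hv ht hp hq
  have e : oa (f.r.F₁.map (hM.k₂iso p q h rfl rfl rfl k).hom) =
      some (mapA f.r.F₁ (ap M.str.kc (pairPath (A := pathGph M.carrier) p q h))) :=
    congrArg some (mapA_congr' f.r.F₁ (mk_isoCast _ _ _))
  refine oa_inj ((oa_comp _ _).trans (Eq.trans ?_ (oa_comp _ _).symm))
  exact (congrArg₂ pcomp e (f.oa_app _ _ _)).trans ((f.ap_pair hN p q h).trans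
    (congrArg₂ pcomp (f.oa_app _ _ _) ((oa_comp _ _).trans (congrArg₂ pcomp
      ((VertOps.oa_cmap _ _ _ _).trans (congrArg₂ _ (f.oa_app _ _ _) (f.oa_app _ _ _)))
      (hN.oa_k₂iso _ _ _ _ _ _ _)))).symm)

lemma app_nat {p q : Path M.carrier} (a : p ⟶ q) {u u' : N.carrier.A₁} {v v' : M.carrier.A₁} (hu hv hu' hv')
    {b : u ⟶ u'} {d : v ⟶ v'} (hb : Arrow.mk (N.str.c₁.map ((pathFunctor f.r).map a)) = Arrow.mk b)
    (hd : Arrow.mk (M.str.c₁.map a) = Arrow.mk d) :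
    f.r.F₁.map d ≫ f.app q (u := u') (v := v') hu' hv' = f.app p (u := u) (v := v) hu hv ≫ b := by
  refine oa_inj ((oa_comp _ _).trans (Eq.trans ?_ (oa_comp _ _).symm))
  exact (congrArg₂ pcomp (congrArg some (mapA_congr' f.r.F₁ hd.symm)) (f.oa_app _ _ _)).trans
    ((ap_nat f.cell a).trans (congrArg₂ pcomp (f.oa_app _ _ _) (congrArg some hb.symm)).symm)

/-- The colax double functor formed by the comparisons of a colax morphism on the paths of length
zero and two. -/
noncomputable def biased (hM : M.str.IsNormal) (hN : N.str.IsNormal) :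
    ColaxDbl ⟨M.carrier, hM.biased⟩ ⟨N.carrier, hN.biased⟩ where
  f := f.r
  unit x := f.app (nilPath x) rfl rfl
  mult u v h := f.app (pairPath u v h) (congrArg N.str.c₁.obj (mapPath_pair _ _ _ _)) rfl
  unit_special _ := f.app_special hM hN _ _ _
  mult_special _ _ _ := f.app_special hM hN _ _ _
  unit_nat a := f.app_nat (nilHom a) _ _ _ _ rfl rfl
  mult_nat a b c := f.app_nat (pairHom a b c) _ _ _ _
    (mapA_congr' N.str.c₁ (mapCellPath_pairHom f.r a b c)) rfl
  lunit x u h := by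
    have h₁ := f.app_k₂ hM hN (nilPath x) (onePath u) h rfl (hM.c_one_obj u) (hM.kap_nil_one h) rfl
      ((congrArg N.str.c₁.obj (mapPath_one f.r u)).trans (hN.c_one_obj _)) (t' := f.r.F₁.obj u)
      (by subst h; exact (congrArg N.str.c₁.obj (mapPath_one f.r u)).trans (hN.c_one_obj _))
      rfl (mapPath_one f.r u) (VertOps.h_lunit (D := hM.ops) h)
      ((congrArg f.r.F₀.obj h).trans (f.r.src_obj u).symm) rfl (hN.c_one_obj _)
      (VertOps.h_lunit (D := hN.ops) ((congrArg f.r.F₀.obj h).trans (f.r.src_obj u).symm))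
      ((f.app_special hM hN _ _ _).consec (f.app_special hM hN _ _ _)
        (map_tgt_src f.r (VertOps.h_lunit (D := hM.ops) h)))
      (hN.kap_nil_one _)
    exact comp_of_id_right' h₁ (by subst h; exact f.app_one hM hN u _ _)
      (hN.ops.cmap_congr rfl (f.app_one hM hN u _ _) _ _)
  runit u x h := by
    have e : N.carrier.tgt.obj (f.r.F₁.obj u) = f.r.F₀.obj x :=
      (f.r.tgt_obj u).trans (congrArg f.r.F₀.obj h)
    have h₁ := f.app_k₂ hM hN (onePath u) (nilPath x) h (hM.c_one_obj u) rfl (hM.c_one_obj u)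
      ((congrArg N.str.c₁.obj (mapPath_one f.r u)).trans (hN.c_one_obj _)) rfl (t' := f.r.F₁.obj u)
      ((congrArg N.str.c₁.obj (mapPath_one f.r u)).trans (hN.c_one_obj _))
      (mapPath_one f.r u) rfl (VertOps.h_runit (D := hM.ops) h) e (hN.c_one_obj _) rfl
      (VertOps.h_runit (D := hN.ops) e)
      ((f.app_special hM hN _ _ _).consec (f.app_special hM hN _ _ _)
        (map_tgt_src f.r (VertOps.h_runit (D := hM.ops) h))) (hN.c_one_obj _)
    exact comp_of_id_right' h₁ (f.app_one hM hN u _ _)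
      (hN.ops.cmap_congr (f.app_one hM hN u _ _) rfl _ _)
  assoc u v w h h' := by
    have k := map_tgt_src f.r h
    have k' := map_tgt_src f.r h'
    have h₁ := f.app_k₂ hM hN (onePath u) (pairPath v w h') h (hM.c_one_obj u) rfl
      (t := M.str.c₁.obj (triPath u v w h h')) rfl
      ((congrArg N.str.c₁.obj (mapPath_one f.r u)).trans (hN.c_one_obj _))
      (congrArg N.str.c₁.obj (mapPath_pair f.r v w h'))
      (t' := N.str.c₁.obj (triPath _ _ _ k k')) (congrArg N.str.c₁.obj (mapPath_tri f.r u v w h h'))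
      (mapPath_one f.r u) (mapPath_pair f.r v w h') (VertOps.h_left (D := hM.ops) h h') k
      (hN.c_one_obj _) rfl (VertOps.h_left (D := hN.ops) k k')
      ((f.app_special hM hN _ _ _).consec (f.app_special hM hN _ _ _)
        (map_tgt_src f.r (VertOps.h_left (D := hM.ops) h h'))) rfl
    have h₂ := f.app_k₂ hM hN (pairPath u v h) (onePath w) h' rfl (hM.c_one_obj w)
      (t := M.str.c₁.obj (triPath u v w h h')) rfl
      (congrArg N.str.c₁.obj (mapPath_pair f.r u v h))
      ((congrArg N.str.c₁.obj (mapPath_one f.r w)).trans (hN.c_one_obj _))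
      (t' := N.str.c₁.obj (triPath _ _ _ k k')) (congrArg N.str.c₁.obj (mapPath_tri f.r u v w h h'))
      (mapPath_pair f.r u v h) (mapPath_one f.r w) (VertOps.h_right (D := hM.ops) h h') k'
      rfl (hN.c_one_obj _) (VertOps.h_right (D := hN.ops) k k')
      ((f.app_special hM hN _ _ _).consec (f.app_special hM hN _ _ _)
        (map_tgt_src f.r (VertOps.h_right (D := hM.ops) h h'))) rfl
    exact colax_assoc_of h₁ h₂ (hN.ops.cmap_congr (f.app_one hM hN u _ _) rfl _ _)
      (hN.ops.cmap_congr rfl (f.app_one hM hN w _ _) _ _)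

end ColaxMor
end

lemma oa3 {K : Type*} [Category K] {X Y Z W : K} (f : X ⟶ Y) (g : Y ⟶ Z) (h : Z ⟶ W) :
    oa (f ≫ g ≫ h) = pcomp (oa f) (pcomp (oa g) (oa h)) := by
  rw [oa_comp, oa_comp]

section
variable {A B D E P : PseudoAlg pathMonad.{u}}

lemma LaxMor.ap_comp (x : LaxMor A B) (y : LaxMor B D) (p : Path A.carrier) :
    some (ap (x.comp y).cell p) =
      pcomp (some (ap y.cell (mapPath x.f p))) (some (mapA y.f.F₁ (ap x.cell p))) :=
  (congrArg (fun α : Arrow (pathGph A.carrier ⟶ D.carrier) => some (ap α p))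
    (LaxMor.mk_comp x y)).trans (ap_vcomp _ _ _ _)

lemma ColaxMor.ap_comp (x : ColaxMor A B) (y : ColaxMor B D) (p : Path A.carrier) :
    some (ap (x.comp y).cell p) =
      pcomp (some (mapA y.r.F₁ (ap x.cell p))) (some (ap y.cell (mapPath x.r p))) :=
  (congrArg (fun α : Arrow (pathGph A.carrier ⟶ D.carrier) => some (ap α p))
    (ColaxMor.mk_comp x y)).trans (ap_vcomp _ _ _ _)

lemma LaxMor.ap_id (A : PseudoAlg pathMonad.{u}) (p : Path A.carrier) :
    ap (LaxMor.id A).cell p = Arrow.mk (𝟙 (A.str.c₁.obj p)) :=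
  (congrArg (fun α : Arrow (pathGph A.carrier ⟶ A.carrier) => ap α p) (LaxMor.mk_id A)).trans
    (congrArg (fun q => Arrow.mk (𝟙 (A.str.c₁.obj q))) (GPath.ext rfl (List.map_id _)))

lemma ColaxMor.ap_id (A : PseudoAlg pathMonad.{u}) (p : Path A.carrier) :
    ap (ColaxMor.id A).cell p = Arrow.mk (𝟙 (A.str.c₁.obj p)) :=
  congrArg (fun α : Arrow (pathGph A.carrier ⟶ A.carrier) => ap α p) (ColaxMor.mk_id A)

lemma LaxMor.mk_biased_unit (hA : A.str.IsNormal) (hB : B.str.IsNormal) (f : LaxMor A B) (x) :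
    Arrow.mk ((f.biased hA hB).unit x) = ap f.cell (nilPath x) :=
  Option.some_injective _ (f.oa_app _ rfl rfl)

lemma LaxMor.mk_biased_mult (hA : A.str.IsNormal) (hB : B.str.IsNormal) (f : LaxMor A B) (u v h) :
    Arrow.mk ((f.biased hA hB).mult u v h) = ap f.cell (pairPath u v h) :=
  Option.some_injective _ (f.oa_app _ (congrArg B.str.c₁.obj (mapPath_pair f.f u v h)) rfl)

lemma ColaxMor.mk_biased_unit (hA : A.str.IsNormal) (hB : B.str.IsNormal) (f : ColaxMor A B) (x) :
    Arrow.mk ((f.biased hA hB).unit x) = ap f.cell (nilPath x) :=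
  Option.some_injective _ (f.oa_app _ rfl rfl)

lemma ColaxMor.mk_biased_mult (hA : A.str.IsNormal) (hB : B.str.IsNormal) (f : ColaxMor A B) (u v h) :
    Arrow.mk ((f.biased hA hB).mult u v h) = ap f.cell (pairPath u v h) :=
  Option.some_injective _ (f.oa_app _ (congrArg B.str.c₁.obj (mapPath_pair f.r u v h)) rfl)

lemma LaxMor.biased_id (hA : A.str.IsNormal) : (LaxMor.id A).biased hA hA = .id ⟨A.carrier, hA.biased⟩ :=
  LaxDbl.ext' rfl (fun x => (mk_biased_unit hA hA _ x).trans (ap_id A _))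
    (fun u v h => (mk_biased_mult hA hA _ u v h).trans (ap_id A _))

lemma ColaxMor.biased_id (hA : A.str.IsNormal) :
    (ColaxMor.id A).biased hA hA = .id ⟨A.carrier, hA.biased⟩ :=
  ColaxDbl.ext' rfl (fun x => (mk_biased_unit hA hA _ x).trans (ap_id A _))
    (fun u v h => (mk_biased_mult hA hA _ u v h).trans (ap_id A _))

lemma LaxMor.biased_comp (hA : A.str.IsNormal) (hB : B.str.IsNormal) (hD : D.str.IsNormal)
    (x : LaxMor A B) (y : LaxMor B D) :
    (x.comp y).biased hA hD = (x.biased hA hB).comp (y.biased hB hD) := by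
  refine LaxDbl.ext' rfl (fun a => Option.some_injective _ ?_)
    (fun u v h => Option.some_injective _ ?_)
  · exact (congrArg some (mk_biased_unit hA hD _ a)).trans ((x.ap_comp y _).trans
      ((oa_comp _ _).trans (congrArg₂ pcomp (congrArg some (mk_biased_unit hB hD y _))
        (congrArg some (mapA_congr' y.f.F₁ (mk_biased_unit hA hB x _))))).symm)
  · exact (congrArg some (mk_biased_mult hA hD _ u v h)).trans ((x.ap_comp y _).trans
      ((oa_comp _ _).trans (congrArg₂ pcomp (congrArg some ((mk_biased_mult hB hD y _ _ _).trans
        (congrArg (ap y.cell) (mapPath_pair _ _ _ _).symm)))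
        (congrArg some (mapA_congr' y.f.F₁ (mk_biased_mult hA hB x _ _ _))))).symm)

lemma ColaxMor.biased_comp (hA : A.str.IsNormal) (hB : B.str.IsNormal) (hD : D.str.IsNormal)
    (x : ColaxMor A B) (y : ColaxMor B D) :
    (x.comp y).biased hA hD = (x.biased hA hB).comp (y.biased hB hD) := by
  refine ColaxDbl.ext' rfl (fun a => Option.some_injective _ ?_)
    (fun u v h => Option.some_injective _ ?_)
  · exact (congrArg some (mk_biased_unit hA hD _ a)).trans ((x.ap_comp y _).trans
      ((oa_comp _ _).trans (congrArg₂ pcomp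
        (congrArg some (mapA_congr' y.r.F₁ (mk_biased_unit hA hB x _)))
        (congrArg some (mk_biased_unit hB hD y _)))).symm)
  · exact (congrArg some (mk_biased_mult hA hD _ u v h)).trans ((x.ap_comp y _).trans
      ((oa_comp _ _).trans (congrArg₂ pcomp
        (congrArg some (mapA_congr' y.r.F₁ (mk_biased_mult hA hB x _ _ _)))
        (congrArg some ((mk_biased_mult hB hD y _ _ _).trans
        (congrArg (ap y.cell) (mapPath_pair _ _ _ _).symm))))).symm)

instance (x : PseudoMor A B) (p : Path A.carrier) : IsIso (ap x.toLaxMor.cell p).hom := by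
  have := x.isIso
  exact ⟨(inv x.φ).φ₁.app p, congrArg (fun a => GphCat.Hom₂.φ₁ a |>.app p) (IsIso.hom_inv_id x.φ),
    congrArg (fun a => GphCat.Hom₂.φ₁ a |>.app p) (IsIso.inv_hom_id x.φ)⟩

/-- The pseudo double functor formed by the comparisons of a pseudo morphism on the paths of length
zero and two. -/
noncomputable def PseudoMor.biased (hA : A.str.IsNormal) (hB : B.str.IsNormal) (x : PseudoMor A B) :
    PseudoDbl ⟨A.carrier, hA.biased⟩ ⟨B.carrier, hB.biased⟩ where
  toLaxDbl := x.toLaxMor.biased hA hB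
  unit_iso a := isIso_of_mk (g := (ap x.toLaxMor.cell (nilPath a)).hom)
    (x.toLaxMor.mk_biased_unit hA hB a)
  mult_iso u v h := isIso_of_mk (g := (ap x.toLaxMor.cell (pairPath u v h)).hom)
    (x.toLaxMor.mk_biased_mult hA hB u v h)

lemma LaxCoh.ap {r : LaxMor A B} {s : LaxMor D E} {u : LaxMor A D} {v : LaxMor B E}
    {π : r.f ≫ v.f ⟶ u.f ≫ s.f} (c : LaxCoh r s u v π) (p : Path A.carrier) :
    pcomp (some (ap v.cell (mapPath r.f p))) (pcomp (some (mapA v.f.F₁ (TripleCat.ap r.cell p)))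
        (some (TripleCat.ap (Arrow.mk π) (A.str.c₁.obj p)))) =
      pcomp (some (mapA E.str.c₁ (TripleCat.ap (pcell (Arrow.mk π)) p)))
        (pcomp (some (TripleCat.ap s.cell (mapPath u.f p))) (some (mapA s.f.F₁ (TripleCat.ap u.cell p)))) := by
  have := congrArg (fun α : Arrow (pathGph A.carrier ⟶ E.carrier) => some (TripleCat.ap α p)) c
  exact (ap_vcomp₃ _ _ _ _ _ _).symm.trans (this.trans (ap_vcomp₃ _ _ _ _ _ _))

lemma LaxColaxCoh.ap {f : LaxMor A B} {g : LaxMor D E} {r : ColaxMor A D} {s : ColaxMor B E}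
    {π : f.f ≫ s.r ⟶ r.r ≫ g.f} (c : LaxColaxCoh f g r s π) (p : Path A.carrier) :
    pcomp (some (mapA s.r.F₁ (TripleCat.ap f.cell p))) (pcomp
        (some (TripleCat.ap (Arrow.mk π) (A.str.c₁.obj p))) (some (mapA g.f.F₁ (TripleCat.ap r.cell p)))) =
      pcomp (some (TripleCat.ap s.cell (mapPath f.f p))) (pcomp
        (some (mapA E.str.c₁ (TripleCat.ap (pcell (Arrow.mk π)) p)))
        (some (TripleCat.ap g.cell (mapPath r.r p)))) := by
  have := congrArg (fun α : Arrow (pathGph A.carrier ⟶ E.carrier) => some (TripleCat.ap α p)) c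
  exact (ap_vcomp₃ _ _ _ _ _ _).symm.trans (this.trans (ap_vcomp₃ _ _ _ _ _ _))

lemma LaxCoh.biased (hA : A.str.IsNormal) (hB : B.str.IsNormal) (hD : D.str.IsNormal)
    (hE : E.str.IsNormal) {r : LaxMor A B} {s : LaxMor D E} {u : LaxMor A D} {v : LaxMor B E}
    {π : r.f ≫ v.f ⟶ u.f ≫ s.f} (c : LaxCoh r s u v π) :
    DblLaxCoh (r.biased hA hB) (s.biased hD hE) (u.biased hA hD) (v.biased hB hE) π where
  unit x := by
    refine oa_inj ((oa3 _ _ _).trans (Eq.trans ?_ (oa3 _ _ _).symm))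
    exact (congrArg₂ pcomp (congrArg some (v.mk_biased_unit hB hE _)) (congrArg₂ pcomp
      (congrArg some (mapA_congr' v.f.F₁ (r.mk_biased_unit hA hB x))) rfl)).trans
      ((c.ap (nilPath x)).trans (congrArg₂ pcomp rfl (congrArg₂ pcomp
        (congrArg some (s.mk_biased_unit hD hE _))
        (congrArg some (mapA_congr' s.f.F₁ (u.mk_biased_unit hA hD x))))).symm)
  mult x y h := by
    refine oa_inj ((oa3 _ _ _).trans (Eq.trans ?_ (oa3 _ _ _).symm))
    exact (congrArg₂ pcomp (congrArg some ((v.mk_biased_mult hB hE _ _ _).trans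
      (congrArg (TripleCat.ap v.cell) (mapPath_pair r.f x y h).symm))) (congrArg₂ pcomp
      (congrArg some (mapA_congr' v.f.F₁ (r.mk_biased_mult hA hB x y h))) rfl)).trans
      ((c.ap (pairPath x y h)).trans (congrArg₂ pcomp
        (congrArg (fun a => some (mapA E.str.c₁ a)) (ap_pcell_pair (Arrow.mk π) x y h (.app π h)).symm)
        (congrArg₂ pcomp (congrArg some ((s.mk_biased_mult hD hE _ _ _).trans
          (congrArg (TripleCat.ap s.cell) (mapPath_pair u.f x y h).symm)))
        (congrArg some (mapA_congr' s.f.F₁ (u.mk_biased_mult hA hD x y h))))).symm)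

lemma LaxColaxCoh.biased (hA : A.str.IsNormal) (hB : B.str.IsNormal) (hD : D.str.IsNormal)
    (hE : E.str.IsNormal) {f : LaxMor A B} {g : LaxMor D E} {r : ColaxMor A D} {s : ColaxMor B E}
    {π : f.f ≫ s.r ⟶ r.r ≫ g.f} (c : LaxColaxCoh f g r s π) :
    DblLaxColaxCoh (f.biased hA hB) (g.biased hD hE) (r.biased hA hD) (s.biased hB hE) π where
  unit x := by
    refine oa_inj ((oa3 _ _ _).trans (Eq.trans ?_ (oa3 _ _ _).symm))
    exact (congrArg₂ pcomp (congrArg some (mapA_congr' s.r.F₁ (f.mk_biased_unit hA hB x)))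
      (congrArg₂ pcomp rfl
      (congrArg some (mapA_congr' g.f.F₁ (r.mk_biased_unit hA hD x))))).trans
      ((c.ap (nilPath x)).trans (congrArg₂ pcomp (congrArg some (s.mk_biased_unit hB hE _))
        (congrArg₂ pcomp rfl (congrArg some (g.mk_biased_unit hD hE _)))).symm)
  mult x y h := by
    refine oa_inj ((oa3 _ _ _).trans (Eq.trans ?_ (oa3 _ _ _).symm))
    exact (congrArg₂ pcomp (congrArg some (mapA_congr' s.r.F₁ (f.mk_biased_mult hA hB x y h)))
      (congrArg₂ pcomp rfl
      (congrArg some (mapA_congr' g.f.F₁ (r.mk_biased_mult hA hD x y h))))).trans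
      ((c.ap (pairPath x y h)).trans (congrArg₂ pcomp
        (congrArg some ((s.mk_biased_mult hB hE _ _ _).trans
          (congrArg (TripleCat.ap s.cell) (mapPath_pair f.f x y h).symm)))
        (congrArg₂ pcomp
        (congrArg (fun a => some (mapA E.str.c₁ a)) (ap_pcell_pair (Arrow.mk π) x y h (.app π h)).symm)
        (congrArg some ((g.mk_biased_mult hD hE _ _ _).trans
          (congrArg (TripleCat.ap g.cell) (mapPath_pair r.r x y h).symm))))).symm)

end

/-- The underlying weak double category of a normal pseudo algebra. -/
noncomputable abbrev NormalPseudoAlg.dbl (N : NormalPseudoAlg pathMonad.{u}) : WDbl.{u} :=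
  ⟨N.carrier, N.normal.biased⟩

/-- The extraction of the biased structure, on arrows and cells. -/
noncomputable def biasedMor :
    CellKinds.Mor (i := NormalPseudoAlg.dbl.{u}) (und' := WDbl.graph) (normalAlgKinds pathMonad.{u})
      dblKinds.{u} where
  m₀ :=
    { map := fun {x y} f => PseudoMor.biased x.normal y.normal f
      map_id := fun x => PseudoDbl.ext' (LaxMor.biased_id x.normal)
      map_comp := fun {x y z} f g => PseudoDbl.ext' (LaxMor.biased_comp x.normal y.normal z.normal _ _)
      forget := fun _ => rfl }
  m₁ :=
    { map := fun {x y} f => LaxMor.biased f x.normal y.normal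
      map_id := fun x => LaxMor.biased_id x.normal
      map_comp := fun {x y z} f g => LaxMor.biased_comp x.normal y.normal z.normal _ _
      forget := fun _ => rfl }
  m₂ :=
    { map := fun {x y} f => ColaxMor.biased f x.normal y.normal
      map_id := fun x => ColaxMor.biased_id x.normal
      map_comp := fun {x y z} f g => ColaxMor.biased_comp x.normal y.normal z.normal _ _
      forget := fun _ => rfl }
  p01 := ⟨fun {A B D E} r s l m π π' h c => by
    obtain rfl := Arrow.mk_injective _ _ h
    exact LaxCoh.biased A.normal B.normal D.normal E.normal c⟩
  p02 := ⟨fun {A B D E} r s l m π π' h c => by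
    obtain rfl := Arrow.mk_injective _ _ h
    exact LaxColaxCoh.biased A.normal B.normal D.normal E.normal c⟩
  p12 := ⟨fun {A B D E} r s l m π π' h c => by
    obtain rfl := Arrow.mk_injective _ _ h
    exact LaxColaxCoh.biased A.normal B.normal D.normal E.normal c⟩

/-- The extraction of the biased structure. -/
noncomputable def biasedFunctor : TripleFunctor PsNPsa.{u} PsDbl.{u} := biasedMor.functor

lemma isBiasedExtraction_biasedFunctor : IsBiasedExtraction biasedFunctor.{u} where
  forget := biasedMor.functor_forget
  ob N := ⟨_, rfl, N.normal.isBiasedReduct⟩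
  lax {M N} f := ⟨_, _, _, rfl, rfl, LaxMor.mk_biased_unit M.normal N.normal f,
    LaxMor.mk_biased_mult M.normal N.normal f⟩
  colax {M N} f := ⟨_, _, _, rfl, rfl, ColaxMor.mk_biased_unit M.normal N.normal f,
    ColaxMor.mk_biased_mult M.normal N.normal f⟩
  pseudo {M N} f := ⟨_, _, _, rfl, rfl, LaxMor.mk_biased_unit M.normal N.normal f.toLaxMor,
    LaxMor.mk_biased_mult M.normal N.normal f.toLaxMor⟩

/-- Lists of cells between two lists of vertical arrows. -/
inductive Cells (A : GphCat.{u}) : List A.A₁ → List A.A₁ → Type u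
  | nil : Cells A [] []
  | cons {u u' : A.A₁} {l l' : List A.A₁} (f : u ⟶ u') (cs : Cells A l l') :
    Cells A (u :: l) (u' :: l')

section
variable {A : GphCat.{u}}

/-- A list of consecutive vertical arrows, beginning at `x`. -/
abbrev Chn (A : GphCat.{u}) (x : A.A₀) (l : List A.A₁) : Prop := Chain A.src.obj A.tgt.obj x l

/-- A list of consecutive cells, beginning at the horizontal arrow `a`. -/
abbrev CChn (A : GphCat.{u}) (a : Arrow A.A₀) (l : List (Arrow A.A₁)) : Prop :=
  Chain (mapA A.src) (mapA A.tgt) a l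

lemma Chain.of_eq {O E : Type*} {s t : E → O} {x y : O} {l : List E} (h : Chain s t x l) (e : y = x) :
    Chain s t y l := e ▸ h

namespace Cells

/-- The underlying list. -/
def toList : {l l' : List A.A₁} → Cells A l l' → List (Arrow A.A₁)
  | _, _, nil => []
  | _, _, cons f cs => Arrow.mk f :: cs.toList

/-- The identity cells. -/
def id : (l : List A.A₁) → Cells A l l
  | [] => nil
  | u :: l => cons (𝟙 u) (id l)

/-- The termwise composition. -/
def comp : {l l' l'' : List A.A₁} → Cells A l l' → Cells A l' l'' → Cells A l l''
  | _, _, _, nil, nil => nil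
  | _, _, _, cons f cs, cons g ds => cons (f ≫ g) (cs.comp ds)

lemma id_comp {l l' : List A.A₁} (cs : Cells A l l') : (id l).comp cs = cs := by
  induction cs with
  | nil => rfl
  | cons f cs ih => exact congrArg₂ cons (Category.id_comp f) ih

lemma comp_id {l l' : List A.A₁} (cs : Cells A l l') : cs.comp (id l') = cs := by
  induction cs with
  | nil => rfl
  | cons f cs ih => exact congrArg₂ cons (Category.comp_id f) ih

lemma chain_id {l : List A.A₁} {x : A.A₀} {a : Arrow A.A₀} (h : Chn A x l)
    (ha : a = Arrow.mk (𝟙 x)) : CChn A a (id l).toList := by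
  induction l generalizing x a with
  | nil => trivial
  | cons v l ih => exact ⟨(mk_map_id _ _).trans ((mk_id_congr h.1).trans ha.symm), ih h.2 (mk_map_id _ _)⟩

lemma chain_comp {l l' l'' : List A.A₁} (cs : Cells A l l') (ds : Cells A l' l'') {x y z : A.A₀}
    {a : x ⟶ y} {b : y ⟶ z} (c : CChn A (Arrow.mk a) cs.toList) (d : CChn A (Arrow.mk b) ds.toList) :
    CChn A (Arrow.mk (a ≫ b)) (cs.comp ds).toList := by
  induction cs generalizing l'' x y z with
  | nil => cases ds; trivial
  | cons f cs ih =>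
    cases ds with
    | cons g ds =>
      exact ⟨(mk_map_comp A.src f g).trans (GphCat.mk_comp_congr c.1 d.1), (ih ds c.2 d.2).of_eq (mk_map_comp _ _ _)⟩

end Cells

lemma Special.chain {l : List A.A₁} {u u' : A.A₁} {f : u ⟶ u'} (s : Special f)
    (h : Chn A (A.tgt.obj u) l) : Chn A (A.tgt.obj u') l := h.of_eq s.tgt_eq

lemma Special.cchain {l : List A.A₁} {u u' : A.A₁} {f : u ⟶ u'} (s : Special f)
    (h : Chn A (A.tgt.obj u) l) : CChn A (Arrow.mk (A.tgt.map f)) (Cells.id l).toList :=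
  Cells.chain_id h s.2

namespace VertOps
variable (O : VertOps A)

lemma Chn_comp {u v : A.A₁} {l : List A.A₁} {x : A.A₀} (h : Chn A x (v :: l)) (e) :
    Chn A (A.tgt.obj (O.comp u v e)) l := Chain.of_eq h.2 (O.comp_tgt _ _ _)

/-- The left bracketed composite of a nonempty path. -/
def fold : (l : List A.A₁) → (u : A.A₁) → Chn A (A.tgt.obj u) l → A.A₁
  | [], u, _ => u
  | v :: l, u, h => fold l (O.comp u v h.1.symm) (O.Chn_comp h _)

lemma src_fold : ∀ (l : List A.A₁) (u : A.A₁) (h : Chn A (A.tgt.obj u) l),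
    A.src.obj (O.fold l u h) = A.src.obj u
  | [], _, _ => rfl
  | _ :: l, _, _ => (src_fold l _ _).trans (O.comp_src _ _ _)

lemma tgt_fold : ∀ (l : List A.A₁) (u : A.A₁) (h : Chn A (A.tgt.obj u) l),
    A.tgt.obj (O.fold l u h) = lastV A.tgt.obj (A.tgt.obj u) l
  | [], _, _ => rfl
  | _ :: l, _, _ => (tgt_fold l _ _).trans (congrArg (lastV A.tgt.obj · l) (O.comp_tgt _ _ _))

/-- The left bracketed composite of a nonempty path of cells. -/
def cfold : {l l' : List A.A₁} → (cs : Cells A l l') → {u u' : A.A₁} → (f : u ⟶ u') →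
    (c : CChn A (Arrow.mk (A.tgt.map f)) cs.toList) → (h : Chn A (A.tgt.obj u) l) →
    (h' : Chn A (A.tgt.obj u') l') → (O.fold l u h ⟶ O.fold l' u' h')
  | _, _, .nil, _, _, f, _, _, _ => f
  | _, _, .cons g cs, _, _, f, c, h, h' =>
    cfold cs (O.cmap f g c.1.symm) (Chain.of_eq c.2 (O.cmap_tgt _ _ _)) (O.Chn_comp h _) (O.Chn_comp h' _)

lemma cfold_congr {l l' : List A.A₁} {cs ds : Cells A l l'} {u u' : A.A₁} {f g : u ⟶ u'} (e : cs = ds)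
    (e' : f = g) (c c' h h') : O.cfold cs f c h h' = O.cfold ds g c' h h' := by
  subst e e'; rfl

lemma cfold_id (l : List A.A₁) (u : A.A₁) (c h) : O.cfold (.id l) (𝟙 u) c h h = 𝟙 _ := by
  induction l generalizing u with
  | nil => rfl
  | cons v l ih =>
    exact (O.cfold_congr rfl (O.cmap_id u v h.1.symm) _ ((Special.id _).cchain (O.Chn_comp h h.1.symm))
      (O.Chn_comp h h.1.symm) (O.Chn_comp h h.1.symm)).trans (ih _ _ _)

lemma cfold_comp {l l' l'' : List A.A₁} (cs : Cells A l l') (ds : Cells A l' l'') {u u' u'' : A.A₁}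
    (f : u ⟶ u') (g : u' ⟶ u'') (c d e h h' h'') :
    O.cfold (cs.comp ds) (f ≫ g) c h h'' = O.cfold cs f d h h' ≫ O.cfold ds g e h' h'' := by
  induction cs generalizing l'' u u' u'' with
  | nil => cases ds; rfl
  | cons a cs ih =>
    cases ds with
    | cons b ds =>
      have k := O.cmap_comp f a g b d.1.symm e.1.symm
      exact (O.cfold_congr rfl k _ (k ▸ Chain.of_eq c.2 (O.cmap_tgt _ _ _)) _ _).trans (ih ds _ _ _ _ _ _ _ _)

lemma src_cfold {l l' : List A.A₁} (cs : Cells A l l') {u u' : A.A₁} (f : u ⟶ u') (c h h') :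
    Arrow.mk (A.src.map (O.cfold cs f c h h')) = Arrow.mk (A.src.map f) := by
  induction cs generalizing u u' with
  | nil => rfl
  | cons a cs ih => exact (ih _ _ _ _).trans (O.cmap_src _ _ _)

lemma tgt_cfold {l l' : List A.A₁} (cs : Cells A l l') {u u' : A.A₁} (f : u ⟶ u') (c h h') :
    Arrow.mk (A.tgt.map (O.cfold cs f c h h')) =
      lastV (mapA A.tgt) (Arrow.mk (A.tgt.map f)) cs.toList := by
  induction cs generalizing u u' with
  | nil => rfl
  | cons a cs ih => exact (ih _ _ _ _).trans (congrArg (lastV (mapA A.tgt) · cs.toList) (O.cmap_tgt _ _ _))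

/-- The action of a special cell on a left bracketed composite. -/
def fmap (l : List A.A₁) {u u' : A.A₁} (f : u ⟶ u') (s : Special f) (h : Chn A (A.tgt.obj u) l) :
    O.fold l u h ⟶ O.fold l u' (s.chain h) :=
  O.cfold (.id l) f (s.cchain h) h (s.chain h)

lemma fmap_congr (l : List A.A₁) {u u' : A.A₁} {f g : u ⟶ u'} (e : f = g) (s s' h) :
    O.fmap l f s h = O.fmap l g s' h := by subst e; rfl

lemma fmap_id (l : List A.A₁) (u : A.A₁) (s h) : O.fmap l (𝟙 u) s h = 𝟙 _ := O.cfold_id _ _ _ _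

lemma fmap_cfold {l l' : List A.A₁} (cs : Cells A l l') {u u' u'' : A.A₁} (f : u ⟶ u') (g : u' ⟶ u'')
    (s c d h h' h'') : O.fmap l f s h ≫ O.cfold cs g c h' h'' = O.cfold cs (f ≫ g) d h h'' := by
  have e := cs.id_comp
  exact (O.cfold_comp (.id l) cs f g (e.symm ▸ d) _ c _ _ _).symm.trans (O.cfold_congr e rfl _ _ _ _)

lemma cfold_fmap {l l' : List A.A₁} (cs : Cells A l l') {u u' u'' : A.A₁} (f : u ⟶ u') (g : u' ⟶ u'')
    (s c d h h' h'') : O.cfold cs f c h h' ≫ O.fmap l' g s h' = O.cfold cs (f ≫ g) d h h'' := by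
  have e := cs.comp_id
  exact (O.cfold_comp cs (.id l') f g (e.symm ▸ d) c _ _ _ _).symm.trans (O.cfold_congr e rfl _ _ _ _)

lemma fmap_comp (l : List A.A₁) {u u' u'' : A.A₁} (f : u ⟶ u') (g : u' ⟶ u'') (s s' t h h') :
    O.fmap l (f ≫ g) t h = O.fmap l f s h ≫ O.fmap l g s' h' :=
  (O.fmap_cfold (.id l) f g s _ _ _ _ _).symm

lemma fmap_special (l : List A.A₁) {u u' : A.A₁} (f : u ⟶ u') (s : Special f) (h) :
    Special (O.fmap l f s h) := by
  induction l generalizing u u' with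
  | nil => exact s
  | cons v l ih =>
    have k : Special (O.cmap f (𝟙 v) (s.consec (.id v) h.1.symm)) :=
      ⟨(O.cmap_src _ _ _).trans (s.1.trans (mk_id_congr (O.comp_src _ _ _).symm)),
        (O.cmap_tgt _ _ _).trans ((mk_map_id _ _).trans (mk_id_congr (O.comp_tgt _ _ _).symm))⟩
    exact ih _ k _

lemma cmap_special {u u' v v' : A.A₁} {f : u ⟶ u'} {g : v ⟶ v'} (s : Special f) (t : Special g) (c) :
    Special (O.cmap f g c) :=
  ⟨(O.cmap_src _ _ _).trans (s.1.trans (mk_id_congr (O.comp_src _ _ _).symm)),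
    (O.cmap_tgt _ _ _).trans (t.2.trans (mk_id_congr (O.comp_tgt _ _ _).symm))⟩

/-- The left bracketed composite of a path. -/
def eval : (x : A.A₀) → (l : List A.A₁) → Chn A x l → A.A₁
  | x, [], _ => O.one.obj x
  | _, u :: l, h => O.fold l u h.2

/-- The left bracketed composite of a path of cells. -/
def ceval {x x' : A.A₀} (a : x ⟶ x') : {l l' : List A.A₁} → (cs : Cells A l l') →
    (c : CChn A (Arrow.mk a) cs.toList) → (h : Chn A x l) → (h' : Chn A x' l') →
    (O.eval x l h ⟶ O.eval x' l' h')
  | _, _, .nil, _, _, _ => O.one.map a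
  | _, _, .cons f cs, c, h, h' => O.cfold cs f c.2 h.2 h'.2

end VertOps
end

section
variable {K : Type*} [Category K]

lemma kelly_left_of {X₁ X₂ X₃ X₄ X₅ X₆ Y₁ : K} {a₁ : X₁ ⟶ X₂} {a₂ : X₂ ⟶ X₃} {b₁ : X₁ ⟶ X₄}
    {b₂ : X₄ ⟶ X₅} {b₃ : X₅ ⟶ X₃} (pent : a₁ ≫ a₂ = b₁ ≫ b₂ ≫ b₃) {r : X₂ ⟶ X₆} {r' : X₃ ⟶ Y₁}
    {a : X₆ ⟶ Y₁} [IsIso a] (nr : r ≫ a = a₂ ≫ r') {l : X₁ ⟶ X₆} (tri : a₁ ≫ r = l) {l' : X₅ ⟶ Y₁}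
    (tri' : b₃ ≫ r' = l') {m : X₄ ⟶ X₆} (nl : m ≫ a = b₂ ≫ l') : l = b₁ ≫ m := by
  rw [← cancel_mono a, ← tri, Category.assoc, nr, reassoc_of% pent, tri', Category.assoc, nl]

lemma kelly_right_of {X₁ X₂ X₃ X₄ X₅ Y₁ Y₂ : K} {a₁ : X₁ ⟶ X₂} {a₂ : X₂ ⟶ X₃} {b₁ : X₁ ⟶ X₄}
    {b₂ : X₄ ⟶ X₅} {b₃ : X₅ ⟶ X₃} [IsIso b₁] [IsIso b₂] (pent : a₁ ≫ a₂ = b₁ ≫ b₂ ≫ b₃)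
    {r : X₃ ⟶ Y₁} {l : X₂ ⟶ Y₁} (tri : a₂ ≫ r = l) {m : X₁ ⟶ Y₂} {a : Y₂ ⟶ Y₁}
    (nl : m ≫ a = a₁ ≫ l) {t : X₄ ⟶ Y₂} (tri' : b₁ ≫ t = m) {t' : X₅ ⟶ Y₁}
    (nt : t ≫ a = b₂ ≫ t') : b₃ ≫ r = t' := by
  rw [← cancel_epi b₂, ← cancel_epi b₁, ← nt, reassoc_of% tri', nl, ← tri, reassoc_of% pent]

end

namespace VertOps
variable {A : GphCat.{u}} (O : VertOps A)

/-- Left whiskering of a special cell by a vertical arrow. -/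
def wl (u : A.A₁) {v v' : A.A₁} (f : v ⟶ v') (s : Special f) (h : A.tgt.obj u = A.src.obj v) :
    O.comp u v h ⟶ O.comp u v' (h.trans s.src_eq.symm) :=
  O.cmap (𝟙 u) f ((Special.id u).consec s h)

/-- Right whiskering of a special cell by a vertical arrow. -/
def wr {u u' : A.A₁} (f : u ⟶ u') (s : Special f) (v : A.A₁) (h : A.tgt.obj u = A.src.obj v) :
    O.comp u v h ⟶ O.comp u' v (s.tgt_eq.trans h) :=
  O.cmap f (𝟙 v) (s.consec (Special.id v) h)

variable {u u' u'' v v' v'' w w' : A.A₁}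

lemma wl_special (f : v ⟶ v') (s : Special f) (h : A.tgt.obj u = A.src.obj v) :
    Special (O.wl u f s h) := O.cmap_special (.id u) s _

lemma wr_special (f : u ⟶ u') (s : Special f) (h : A.tgt.obj u = A.src.obj v) :
    Special (O.wr f s v h) := O.cmap_special s (.id v) _

lemma wl_congr {f g : v ⟶ v'} (e : f = g) (s s' h) : O.wl u f s h = O.wl u g s' h := by subst e; rfl

lemma wr_congr {f g : u ⟶ u'} (e : f = g) (s s' h) : O.wr f s v h = O.wr g s' v h := by subst e; rfl

lemma wl_id (s) (h : A.tgt.obj u = A.src.obj v) : O.wl u (𝟙 v) s h = 𝟙 _ := O.cmap_id _ _ _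

lemma wr_id (s) (h : A.tgt.obj u = A.src.obj v) : O.wr (𝟙 u) s v h = 𝟙 _ := O.cmap_id _ _ _

lemma wl_comp (f : v ⟶ v') (g : v' ⟶ v'') (s t r) (h : A.tgt.obj u = A.src.obj v) (h') :
    O.wl u (f ≫ g) r h = O.wl u f s h ≫ O.wl u g t h' := O.cmap_id_comp _ _ _ _ _

lemma wr_comp (f : u ⟶ u') (g : u' ⟶ u'') (s t r) (h : A.tgt.obj u = A.src.obj v) (h') :
    O.wr (f ≫ g) r v h = O.wr f s v h ≫ O.wr g t v h' := O.cmap_comp_id _ _ _ _ _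

instance (f : u ⟶ u') [IsIso f] (s : Special f) (h : A.tgt.obj u = A.src.obj v) :
    IsIso (O.wr f s v h) := O.isIso_cmap _ _ _

end VertOps

namespace WDblStr
variable {A : GphCat.{u}} (D : WDblStr A) {u u' v v' w w' z : A.A₁} {x y : A.A₀}

lemma wl_wl_assoc (f : w ⟶ w') (s : Special f) (h : A.tgt.obj u = A.src.obj v)
    (h' : A.tgt.obj v = A.src.obj w) (h₁ h₂ h₃ h₄ t) :
    D.ops.wl u (D.ops.wl v f s h') t h₁ ≫ (D.assoc u v w' h h₂).hom =
      (D.assoc u v w h h').hom ≫ D.ops.wl (D.ops.comp u v h) f h₃ h₄ :=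
  (D.assoc_nat (𝟙 u) (𝟙 v) f (.id h) ((Special.id v).consec s h')).trans
    (congrArg (_ ≫ ·) (D.ops.cmap_congr (D.ops.cmap_id u v h) rfl _ _))

lemma wl_wr_assoc (f : v ⟶ v') (s : Special f) (h : A.tgt.obj u = A.src.obj v)
    (h' : A.tgt.obj v = A.src.obj w) (h₁ h₂ h₃ h₄ h₅ t) :
    D.ops.wl u (D.ops.wr f s w h') t h₁ ≫ (D.assoc u v' w h₂ h₃).hom =
      (D.assoc u v w h h').hom ≫ D.ops.wr (D.ops.wl u f s h) h₄ w h₅ :=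
  D.assoc_nat (𝟙 u) f (𝟙 w) ((Special.id u).consec s h) (s.consec (.id w) h')

lemma wr_assoc (f : u ⟶ u') (s : Special f) (h : A.tgt.obj u = A.src.obj v)
    (h' : A.tgt.obj v = A.src.obj w) (h₁ h₂ h₃ h₄) :
    D.ops.wr f s (D.ops.comp v w h') h₁ ≫ (D.assoc u' v w h₂ h').hom =
      (D.assoc u v w h h').hom ≫ D.ops.wr (D.ops.wr f s v h) h₃ w h₄ :=
  Eq.trans (congrArg (· ≫ _) (D.ops.cmap_congr rfl (D.ops.cmap_id v w h').symm _
      ((Special.consec s (D.ops.cmap_special (.id v) (.id w) (.id h')) (VertOps.h_left h h')))))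
    (D.assoc_nat f (𝟙 v) (𝟙 w) (s.consec (.id v) h) (.id h'))

lemma wl_lunit (f : u ⟶ u') (s : Special f) (h : x = A.src.obj u) (h') :
    D.ops.wl (D.ops.one.obj x) f s (VertOps.h_lunit h) ≫ (D.lunit x u' h').hom =
      (D.lunit x u h).hom ≫ f :=
  (congrArg (· ≫ _) (D.ops.cmap_congr (D.ops.one.map_id x).symm rfl _ (VertOps.c_lunit
    ((mk_id_congr h).trans s.1.symm)))).trans (D.lunit_nat (𝟙 x) f ((mk_id_congr h).trans s.1.symm))

lemma wr_runit (f : u ⟶ u') (s : Special f) (h : A.tgt.obj u = x) (h') :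
    D.ops.wr f s (D.ops.one.obj x) (VertOps.h_runit h) ≫ (D.runit u' x h').hom =
      (D.runit u x h).hom ≫ f :=
  (congrArg (· ≫ _) (D.ops.cmap_congr rfl (D.ops.one.map_id x).symm _ (VertOps.c_runit
    (s.2.trans (mk_id_congr h))))).trans (D.runit_nat f (𝟙 x) (s.2.trans (mk_id_congr h)))

lemma wl_one_injective {f g : u ⟶ u'} {s : Special f} {t : Special g} (h : x = A.src.obj u)
    (e : D.ops.wl (D.ops.one.obj x) f s (VertOps.h_lunit h) =
      D.ops.wl (D.ops.one.obj x) g t (VertOps.h_lunit h)) : f = g := by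
  have h' : x = A.src.obj u' := h.trans s.src_eq.symm
  rw [← cancel_epi (D.lunit x u h).hom, ← D.wl_lunit f s h h', ← D.wl_lunit g t h h', e]

lemma wr_one_injective {f g : u ⟶ u'} {s : Special f} {t : Special g} (h : A.tgt.obj u = x)
    (e : D.ops.wr f s (D.ops.one.obj x) (VertOps.h_runit h) =
      D.ops.wr g t (D.ops.one.obj x) (VertOps.h_runit h)) : f = g := by
  have h' : A.tgt.obj u' = x := s.tgt_eq.trans h
  rw [← cancel_epi (D.runit u x h).hom, ← D.wr_runit f s h h', ← D.wr_runit g t h h', e]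

lemma assoc_lunit (h : x = A.src.obj u) (h' : A.tgt.obj u = A.src.obj v) (h₁ h₂ h₃) :
    (D.assoc (D.ops.one.obj x) u v h₁ h').hom ≫
        D.ops.wr (D.lunit x u h).hom (D.lunit_special x u h) v h₂ =
      (D.lunit x (D.ops.comp u v h') h₃).hom := by
  have a := D.assoc_special (D.ops.one.obj x) u v h₁ h'
  have l := D.ops.wr_special (D.lunit x u h).hom (D.lunit_special x u h) h₂
  have k : A.tgt.obj (D.ops.one.obj x) = x := D.ops.tgt_one x
  have kk := k.trans (D.ops.src_one x).symm
  have r := D.runit_special (D.ops.one.obj x) x k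
  have wl := D.ops.wl_special (D.lunit x u h).hom (D.lunit_special x u h) (VertOps.h_left kk h₁)
  refine (D.wl_one_injective (x := x) (s := D.lunit_special x _ h₃) (t := a.comp l)
    (h₃.trans (D.lunit_special x _ h₃).src_eq) ?_).symm
  refine (kelly_left_of (D.pentagon (D.ops.one.obj x) (D.ops.one.obj x) u v kk h₁ h')
    (D.wr_assoc (D.runit _ x k).hom r (VertOps.h_right kk h₁) h' (VertOps.h_right kk (VertOps.h_left h₁ h')) h₁
      (D.ops.wr_special _ r (VertOps.h_right kk h₁)) (VertOps.h_right (VertOps.h_right kk h₁) h'))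
    (D.triangle _ x _ k h₃) (l' := D.ops.wr (D.ops.wl _ (D.lunit x u h).hom (D.lunit_special x u h)
      (VertOps.h_left kk h₁)) wl v (VertOps.h_right (VertOps.h_left kk h₁) (VertOps.h_right h₁ h'))) ?_
    (D.wl_wr_assoc (D.lunit x u h).hom (D.lunit_special x u h) (VertOps.h_left kk h₁) h₂
      (VertOps.h_left (VertOps.h_left kk h₁) h₂) h₁ h' wl (VertOps.h_right (VertOps.h_left kk h₁) h₂) l)).trans
      (D.ops.wl_comp _ _ a l (a.comp l) (VertOps.h_left kk (VertOps.h_left h₁ h'))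
        (VertOps.h_left (VertOps.h_left kk h₁) h₂)).symm
  exact (D.ops.wr_comp _ _ (D.assoc_special _ _ _ kk h₁) (D.ops.wr_special _ r (VertOps.h_right kk h₁))
    ((D.assoc_special _ _ _ kk h₁).comp (D.ops.wr_special _ r (VertOps.h_right kk h₁)))
    (VertOps.h_right (VertOps.h_left kk h₁) h₂) (VertOps.h_right (VertOps.h_right kk h₁) h')).symm.trans
      (D.ops.wr_congr (D.triangle _ x u k h) _ _ _)

lemma assoc_runit (h : A.tgt.obj u = A.src.obj v) (h' : A.tgt.obj v = x) (h₁ h₂ h₃) :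
    (D.assoc u v (D.ops.one.obj x) h h₁).hom ≫ (D.runit (D.ops.comp u v h) x h₂).hom =
      D.ops.wl u (D.runit v x h').hom (D.runit_special v x h') h₃ := by
  have a := D.assoc_special u v (D.ops.one.obj x) h h₁
  have r := D.runit_special _ x h₂
  have rv := D.runit_special v x h'
  have t := D.ops.wl_special (u := u) (D.runit v x h').hom rv h₃
  have k : A.tgt.obj (D.ops.one.obj x) = x := D.ops.tgt_one x
  have k' : x = A.src.obj (D.ops.one.obj x) := (D.ops.src_one x).symm
  have kk := k.trans k'
  have l := D.lunit_special x _ k'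
  have wl := D.ops.wl_special _ l (VertOps.h_left h₁ kk)
  have wr := D.ops.wr_special _ rv (VertOps.h_right h₁ kk)
  refine D.wr_one_injective (x := x) (s := a.comp r) (t := t) (t.tgt_eq.symm.trans h₂) ?_
  have : IsIso (D.ops.cmap (𝟙 u) (D.assoc v _ _ h₁ kk).hom ((Special.id u).consec
    (D.assoc_special _ _ _ h₁ kk) (VertOps.h_left h (VertOps.h_left h₁ kk)))) := D.ops.isIso_cmap _ _ _
  refine (D.ops.wr_comp _ _ a r (a.comp r) (VertOps.h_right h₃ (VertOps.h_right h₁ kk))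
    (VertOps.h_right (VertOps.h_right h h₁) kk)).trans
    (kelly_right_of (D.pentagon u v _ _ h h₁ kk) (D.triangle _ x _ h₂ k')
    (D.wl_wl_assoc (D.lunit x _ k').hom l h (VertOps.h_left h₁ kk) (VertOps.h_left h (VertOps.h_left h₁ kk))
      h₁ l (VertOps.h_right h (VertOps.h_left h₁ kk)) wl)
    (t := D.ops.wl u (D.ops.wr (D.runit v x h').hom rv _ (VertOps.h_right h₁ kk)) wr
      (VertOps.h_left h₃ (VertOps.h_right h₁ kk))) ?_
    (D.wl_wr_assoc _ rv h₃ (VertOps.h_right h₁ kk) (VertOps.h_left h₃ (VertOps.h_right h₁ kk)) h h₁ t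
      (VertOps.h_right h₃ (VertOps.h_right h₁ kk)) wr))
  exact (D.ops.wl_comp _ _ (D.assoc_special _ _ _ h₁ kk) wr ((D.assoc_special _ _ _ h₁ kk).comp wr)
    (VertOps.h_left h (VertOps.h_left h₁ kk)) (VertOps.h_left h₃ (VertOps.h_right h₁ kk))).symm.trans
      (D.ops.wl_congr (D.triangle _ x _ h' k') _ _ _)

lemma lunit_one (h h') : (D.lunit x (D.ops.one.obj x) h).hom = (D.runit (D.ops.one.obj x) x h').hom := by
  have hh := h'.trans h
  refine D.wr_one_injective (x := x) (s := D.lunit_special _ _ _) (t := D.runit_special _ _ _)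
    ((D.ops.comp_tgt _ _ _).trans h') ?_
  rw [← cancel_epi (D.assoc _ _ _ hh hh).hom]
  refine (D.assoc_lunit h hh hh (VertOps.h_right hh hh) (h.trans (D.ops.comp_src _ _ _).symm)).trans
    (Eq.trans ?_ (D.triangle _ x _ h' h).symm)
  rw [← cancel_mono (D.lunit x _ h).hom]
  exact (D.wl_lunit _ (D.lunit_special _ _ h) (h.trans (D.ops.comp_src _ _ _).symm) h).symm

end WDblStr

namespace Cells
variable {A : GphCat.{u}}

/-- Concatenation. -/
def append : {l l' k k' : List A.A₁} → Cells A l l' → Cells A k k' → Cells A (l ++ k) (l' ++ k')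
  | _, _, _, _, nil, ds => ds
  | _, _, _, _, cons f cs, ds => cons f (cs.append ds)

lemma toList_append {l l' k k' : List A.A₁} (cs : Cells A l l') (ds : Cells A k k') :
    (cs.append ds).toList = cs.toList ++ ds.toList := by
  induction cs with
  | nil => rfl
  | cons f cs ih => exact congrArg (_ :: ·) ih

lemma id_append (l k : List A.A₁) : (id l).append (id k) = id (l ++ k) := by
  induction l with
  | nil => rfl
  | cons v l ih => exact congrArg (cons (𝟙 v)) ih

lemma chain_append {l l' k k' : List A.A₁} {cs : Cells A l l'} {ds : Cells A k k'} {a b : Arrow A.A₀}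
    (c : CChn A a cs.toList) (hb : lastV (mapA A.tgt) a cs.toList = b) (d : CChn A b ds.toList) :
    CChn A a (cs.append ds).toList := by
  subst hb
  rw [toList_append]
  exact TripleCat.chain_append.2 ⟨c, d⟩

end Cells

section
variable {A : GphCat.{u}}

lemma Chn.append {l l' : List A.A₁} {x y : A.A₀} (h : Chn A x l) (hy : lastV A.tgt.obj x l = y)
    (h' : Chn A y l') : Chn A x (l ++ l') := by
  subst hy
  exact TripleCat.chain_append.2 ⟨h, h'⟩

namespace VertOps
variable (O : VertOps A)

lemma h_fold {w u : A.A₁} {l : List A.A₁} (hw : A.tgt.obj w = A.src.obj u) (h : Chn A (A.tgt.obj u) l) :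
    A.tgt.obj w = A.src.obj (O.fold l u h) := hw.trans (O.src_fold _ _ _).symm

lemma src_eval {x : A.A₀} : ∀ {l : List A.A₁} (h : Chn A x l), A.src.obj (O.eval x l h) = x
  | [], _ => O.src_one x
  | _ :: l, h => (O.src_fold l _ h.2).trans h.1

lemma tgt_eval {x : A.A₀} : ∀ {l : List A.A₁} (h : Chn A x l),
    A.tgt.obj (O.eval x l h) = lastV A.tgt.obj x l
  | [], _ => O.tgt_one x
  | _ :: l, h => O.tgt_fold l _ h.2

lemma h_eval {w : A.A₁} {x : A.A₀} {l : List A.A₁} (hw : A.tgt.obj w = x) (h : Chn A x l) :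
    A.tgt.obj w = A.src.obj (O.eval x l h) := hw.trans (O.src_eval _).symm

lemma tgt_fold' {l : List A.A₁} {u : A.A₁} {h : Chn A (A.tgt.obj u) l} {y : A.A₀}
    (hy : lastV A.tgt.obj (A.tgt.obj u) l = y) : A.tgt.obj (O.fold l u h) = y :=
  (O.tgt_fold l u h).trans hy

lemma src_ceval {x x' : A.A₀} (a : x ⟶ x') {l l' : List A.A₁} (cs : Cells A l l') (c h h') :
    Arrow.mk (A.src.map (O.ceval a cs c h h')) = Arrow.mk a := by
  cases cs with
  | nil => exact O.src_map_one a
  | cons f cs => exact (O.src_cfold _ _ _ _ _).trans c.1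

lemma tgt_ceval {x x' : A.A₀} (a : x ⟶ x') {l l' : List A.A₁} (cs : Cells A l l') (c h h') :
    Arrow.mk (A.tgt.map (O.ceval a cs c h h')) = lastV (mapA A.tgt) (Arrow.mk a) cs.toList := by
  cases cs with
  | nil => exact O.tgt_map_one a
  | cons f cs => exact O.tgt_cfold _ _ _ _ _

lemma ceval_id {x : A.A₀} (l : List A.A₁) (c h) : O.ceval (𝟙 x) (.id l) c h h = 𝟙 _ := by
  cases l with
  | nil => exact O.one.map_id x
  | cons v l => exact O.cfold_id _ _ _ _

lemma ceval_comp {x x' x'' : A.A₀} (a : x ⟶ x') (b : x' ⟶ x'') {l l' l'' : List A.A₁}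
    (cs : Cells A l l') (ds : Cells A l' l'') (c d e h h' h'') :
    O.ceval (a ≫ b) (cs.comp ds) c h h'' = O.ceval a cs d h h' ≫ O.ceval b ds e h' h'' := by
  cases cs with
  | nil => cases ds; exact O.one.map_comp a b
  | cons f cs => cases ds; exact O.cfold_comp _ _ _ _ _ _ _ _ _ _

instance isIso_fmap (l : List A.A₁) {u u' : A.A₁} (f : u ⟶ u') [IsIso f] (s : Special f) (h) :
    IsIso (O.fmap l f s h) := by
  have t : Special (inv f) := Special.inv (asIso f) s
  refine ⟨O.fmap l (inv f) t (s.chain h), ?_, ?_⟩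
  · rw [← O.fmap_comp l f (inv f) s t (s.comp t) h _]
    exact (O.fmap_congr l (IsIso.hom_inv_id f) _ (.id _) _).trans (O.fmap_id _ _ _ _)
  · refine (O.fmap_comp l (inv f) f t s (t.comp s) (s.chain h) _).symm.trans ?_
    exact (O.fmap_congr l (IsIso.inv_hom_id f) _ (.id _) _).trans (O.fmap_id _ _ _ _)

end VertOps

namespace WDblStr
variable (D : WDblStr A)

lemma h_slide {w u : A.A₁} {l : List A.A₁} (hw : A.tgt.obj w = A.src.obj u) (h : Chn A (A.tgt.obj u) l) :
    Chn A (A.tgt.obj (D.ops.comp w u hw)) l := h.of_eq (D.ops.comp_tgt _ _ _)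

/-- The rebracketing of the composite of a vertical arrow with a left bracketed composite. -/
def slide : (l : List A.A₁) → (w u : A.A₁) → (hw : A.tgt.obj w = A.src.obj u) →
    (h : Chn A (A.tgt.obj u) l) →
    (D.ops.comp w (D.ops.fold l u h) (D.ops.h_fold hw h) ⟶ D.ops.fold l (D.ops.comp w u hw) (D.h_slide hw h))
  | [], _, _, _, _ => 𝟙 _
  | v :: l, w, u, hw, h =>
    slide l w (D.ops.comp u v h.1.symm) (VertOps.h_left hw _) (D.ops.Chn_comp h _) ≫
      D.ops.fmap l (D.assoc w u v hw h.1.symm).hom (D.assoc_special w u v hw h.1.symm) _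

lemma slide_special : ∀ (l : List A.A₁) (w u hw) (h : Chn A (A.tgt.obj u) l), Special (D.slide l w u hw h)
  | [], _, _, _, _ => .id _
  | _ :: l, _, _, _, _ => (slide_special l _ _ _ _).comp (D.ops.fmap_special _ _ _ _)

instance isIso_slide : ∀ (l : List A.A₁) (w u hw) (h : Chn A (A.tgt.obj u) l), IsIso (D.slide l w u hw h)
  | [], _, _, _, _ => inferInstanceAs (IsIso (𝟙 _))
  | v :: l, w, u, hw, h => by
    have := isIso_slide l w (D.ops.comp u v h.1.symm) (VertOps.h_left hw _) (D.ops.Chn_comp h _)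
    exact IsIso.comp_isIso' this (D.ops.isIso_fmap _ _ _ _)

lemma slide_nat {l l' : List A.A₁} (cs : Cells A l l') {w w' u u' : A.A₁} (f : w ⟶ w') (g : u ⟶ u')
    (c : Consec f g) (d h h') (e : Consec f (D.ops.cfold cs g d h h')) (k) :
    D.ops.cmap f (D.ops.cfold cs g d h h') e ≫ D.slide l' w' u' c.right h' =
      D.slide l w u c.left h ≫ D.ops.cfold cs (D.ops.cmap f g c) k _ _ := by
  induction cs generalizing u u' with
  | nil => exact (Category.comp_id _).trans (Category.id_comp _).symm
  | @cons v v' l l' a cs ih =>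
    have c' : Consec g a := d.1.symm
    have n := D.assoc_nat f g a c c'
    have k₁ : CChn A (Arrow.mk (A.tgt.map (D.ops.cmap f (D.ops.cmap g a c') (VertOps.c_left c c')))) cs.toList :=
      d.2.of_eq ((D.ops.cmap_tgt _ _ _).trans (D.ops.cmap_tgt _ _ _))
    have h₁ : Chn A (A.tgt.obj (D.ops.comp w u c.left)) (v :: l) := D.h_slide c.left h
    have h₂ : Chn A (A.tgt.obj (D.ops.comp w' u' c.right)) (v' :: l') := D.h_slide c.right h'
    have hl := D.h_slide (VertOps.h_left c.left c'.left) (D.ops.Chn_comp h c'.left)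
    have hr := D.h_slide (VertOps.h_left c.right c'.right) (D.ops.Chn_comp h' c'.right)
    have ih := ih (D.ops.cmap g a c') (VertOps.c_left c c') (d.2.of_eq (D.ops.cmap_tgt _ _ _))
      (D.ops.Chn_comp h c'.left) (D.ops.Chn_comp h' c'.right) e k₁
    have k₂ : CChn A (Arrow.mk (A.tgt.map (D.ops.cmap f (D.ops.cmap g a c') (VertOps.c_left c c') ≫
        (D.assoc w' u' v' c.right c'.right).hom))) cs.toList := by
      rw [n]
      refine Chain.of_eq (k.2.of_eq (D.ops.cmap_tgt (D.ops.cmap f g c) a (VertOps.c_right c c'))) ?_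
      refine (mk_map_comp _ _ _).trans (Option.some_injective _ ((oa_comp _ _).trans ?_))
      refine (congrArg₂ pcomp (congrArg some (D.assoc_special _ _ _ _ _).2) rfl).trans (idc_pcomp _ ?_)
      exact (D.assoc_special _ _ _ c.left c'.left).tgt_eq.symm
    have e₁ := D.ops.cfold_fmap cs _ (D.assoc w' u' v' c.right c'.right).hom (D.assoc_special _ _ _ _ _) k₁ k₂ hl hr
      (D.ops.Chn_comp h₂ _)
    have e₂ := D.ops.fmap_cfold cs (D.assoc w u v c.left c'.left).hom (D.ops.cmap (D.ops.cmap f g c) a (VertOps.c_right c c'))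
      (D.assoc_special _ _ _ _ _) (k.2.of_eq (D.ops.cmap_tgt _ _ _)) (n ▸ k₂) hl (D.ops.Chn_comp h₁ _) (D.ops.Chn_comp h₂ _)
    have e₃ := e₁.trans ((D.ops.cfold_congr rfl n _ _ _ _).trans e₂.symm)
    exact (Category.assoc _ _ _).symm.trans ((congrArg (· ≫ _) ih).trans ((Category.assoc _ _ _).trans
      ((congrArg (_ ≫ ·) e₃).trans (Category.assoc _ _ _).symm)))

end WDblStr
end

section
variable {A : GphCat.{u}}

namespace WDblStr
variable (D : WDblStr A)

lemma slide_fmap (l : List A.A₁) {w u u' : A.A₁} (f : u ⟶ u') (s : Special f) (hw : A.tgt.obj w = A.src.obj u)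
    (h : Chn A (A.tgt.obj u) l) (h₁ h₂ h₃) :
    D.ops.wl w (D.ops.fmap l f s h) (D.ops.fmap_special _ _ _ _) (D.ops.h_fold hw h) ≫
        D.slide l w u' h₁ h₂ =
      D.slide l w u hw h ≫ D.ops.fmap l (D.ops.wl w f s hw) (D.ops.wl_special _ _ _) h₃ :=
  D.slide_nat (.id l) (𝟙 w) f ((Special.id w).consec s hw) (s.cchain h) h h₂
    ((Special.id w).consec (D.ops.fmap_special l f s h) (D.ops.h_fold hw h))
    ((D.ops.wl_special f s hw).cchain h₃)

lemma slide_assoc_step {K : Type*} [Category K] {X₁ X₂ X₃ X₄ Y₁ Y₂ Y₃ Y₄ Y₅ : K}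
    {a : X₁ ⟶ X₂} {s : X₂ ⟶ X₃} {f : X₃ ⟶ X₄} {w : X₁ ⟶ Y₁} {t : Y₁ ⟶ Y₂} {g : Y₂ ⟶ X₃}
    (ih : a ≫ s = w ≫ t ≫ g) {w' : Y₁ ⟶ Y₃} {t' : Y₃ ⟶ Y₄} {g' : Y₂ ⟶ Y₄} (n : w' ≫ t' = t ≫ g')
    {b : Y₄ ⟶ Y₅} {c : Y₅ ⟶ X₄} (p : g ≫ f = g' ≫ b ≫ c) {v : X₁ ⟶ Y₃} (hv : v = w ≫ w') :
    a ≫ s ≫ f = v ≫ (t' ≫ b) ≫ c := by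
  rw [reassoc_of% ih, p, hv]
  simp only [Category.assoc]
  rw [reassoc_of% n]

lemma slide_assoc : ∀ (l : List A.A₁) (w z u : A.A₁) (hw : A.tgt.obj w = A.src.obj z)
    (hz : A.tgt.obj z = A.src.obj u) (h : Chn A (A.tgt.obj u) l) (h₁ h₂ h₃ h₄ h₅),
    (D.assoc w z (D.ops.fold l u h) hw (D.ops.h_fold hz h)).hom ≫
        D.slide l (D.ops.comp w z hw) u h₁ h =
      D.ops.wl w (D.slide l z u hz h) (D.slide_special _ _ _ _ _) h₂ ≫
        D.slide l w (D.ops.comp z u hz) h₃ h₄ ≫ D.ops.fmap l (D.assoc w z u hw hz).hom (D.assoc_special _ _ _ _ _) h₅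
  | [], w, z, u, hw, hz, h, h₁, h₂, h₃, h₄, h₅ => by
    refine (Category.comp_id _).trans (Eq.trans ?_ (congrArg₂ (· ≫ ·) (D.ops.wl_id (.id _) h₂).symm rfl))
    exact ((Category.id_comp _).trans (Category.id_comp _)).symm
  | v :: l, w, z, u, hw, hz, h, h₁, h₂, h₃, h₄, h₅ => by
    have hv := h.1.symm
    have hh := D.ops.Chn_comp h hv
    have hzu : A.tgt.obj z = A.src.obj (D.ops.comp u v hv) := VertOps.h_left hz hv
    have hzuv : Chn A (A.tgt.obj (D.ops.comp z (D.ops.comp u v hv) hzu)) l := D.h_slide _ hh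
    have hwzu : A.tgt.obj w = A.src.obj (D.ops.comp z (D.ops.comp u v hv) hzu) := VertOps.h_left hw hzu
    have s₁ := D.assoc_special z u v hz hv
    have h6 : Chn A (A.tgt.obj (D.ops.comp w (D.ops.comp z (D.ops.comp u v hv) hzu) hwzu)) l := D.h_slide hwzu hzuv
    have h7 : A.tgt.obj (D.ops.comp w z hw) = A.src.obj (D.ops.comp u v hv) := VertOps.h_right hw hzu
    have h8 := D.ops.h_fold hzu hh
    have h9 := D.ops.h_fold hwzu hzuv
    have ih := slide_assoc l w z (D.ops.comp u v hv) hw hzu hh h7 (VertOps.h_left hw h8) hwzu hzuv h6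
    have s₂ := D.assoc_special w z (D.ops.comp u v hv) hw hzu
    have s₃ := D.assoc_special (D.ops.comp w z hw) u v h₁ hv
    have s₄ := D.ops.wl_special (D.assoc z u v hz hv).hom s₁ hwzu
    have h10 : A.tgt.obj (D.ops.comp z u hz) = A.src.obj v := VertOps.h_right hz hv
    have s₅ := D.assoc_special w (D.ops.comp z u hz) v h₃ h10
    have h11 : A.tgt.obj (D.ops.comp w (D.ops.comp z u hz) h₃) = A.src.obj v := VertOps.h_right h₃ h10
    have s₆ := D.ops.wr_special (D.assoc w z u hw hz).hom (D.assoc_special _ _ _ hw hz) h11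
    refine slide_assoc_step ih (D.slide_fmap l (D.assoc z u v hz hv).hom s₁ hwzu hzuv (VertOps.h_left h₃ h10)
      (s₁.chain hzuv) h6) ?_
      (D.ops.wl_comp _ _ (D.slide_special l _ _ hzu hh) (D.ops.fmap_special l _ s₁ hzuv)
        ((D.slide_special l _ _ hzu hh).comp (D.ops.fmap_special l _ s₁ hzuv)) (VertOps.h_left hw h8) h9)
    exact (D.ops.fmap_comp l _ _ s₂ s₃ (s₂.comp s₃) h6 (s₂.chain h6)).symm.trans
      ((D.ops.fmap_congr l (D.pentagon w z u v hw hz hv) _ (s₄.comp (s₅.comp s₆)) h6).trans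
      ((D.ops.fmap_comp l _ _ s₄ (s₅.comp s₆) _ h6 (s₄.chain h6)).trans (congrArg (_ ≫ ·)
      (D.ops.fmap_comp l _ _ s₅ s₆ (s₅.comp s₆) (s₄.chain h6) (s₅.chain (s₄.chain h6))))))

/-- The rebracketing of the composite of a vertical arrow with a left bracketed path. -/
def slideEval : (l : List A.A₁) → (w : A.A₁) → (y : A.A₀) → (hw : A.tgt.obj w = y) → (h : Chn A y l) →
    (D.ops.comp w (D.ops.eval y l h) (D.ops.h_eval hw h) ⟶ D.ops.fold l w (h.of_eq hw))
  | [], w, y, hw, _ => (D.runit w y hw).hom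
  | v :: l, w, _, hw, h => D.slide l w v (hw.trans h.1.symm) h.2

lemma slideEval_special (l : List A.A₁) (w : A.A₁) (y : A.A₀) (hw : A.tgt.obj w = y) (h : Chn A y l) :
    Special (D.slideEval l w y hw h) := by
  cases l with
  | nil => exact D.runit_special _ _ _
  | cons v l => exact D.slide_special _ _ _ _ _

instance isIso_slideEval (l : List A.A₁) (w : A.A₁) (y : A.A₀) (hw : A.tgt.obj w = y) (h : Chn A y l) :
    IsIso (D.slideEval l w y hw h) := by
  cases l with
  | nil => exact Iso.isIso_hom _
  | cons v l => exact D.isIso_slide _ _ _ _ _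

lemma slideEval_nat {l l' : List A.A₁} (ds : Cells A l l') {w w' : A.A₁} {y y' : A.A₀} (f : w ⟶ w')
    (a : y ⟶ y') (c : Arrow.mk (A.tgt.map f) = Arrow.mk a) (d h h') (e : Consec f (D.ops.ceval a ds d h h'))
    (hw hw' k) :
    D.ops.cmap f (D.ops.ceval a ds d h h') e ≫ D.slideEval l' w' y' hw' h' =
      D.slideEval l w y hw h ≫ D.ops.cfold ds f k (h.of_eq hw) (h'.of_eq hw') := by
  cases ds with
  | nil => exact D.runit_nat f a c
  | cons b ds =>
    exact D.slide_nat ds f b (c.trans d.1.symm) d.2 h.2 h'.2 e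
      (k.2.of_eq (D.ops.cmap_tgt f b (c.trans d.1.symm)))

lemma slideEval_assoc (l : List A.A₁) (w z : A.A₁) (y : A.A₀) (hw : A.tgt.obj w = A.src.obj z)
    (hz : A.tgt.obj z = y) (h : Chn A y l) (h₁ h₂ h₃) :
    (D.assoc w z (D.ops.eval y l h) hw (D.ops.h_eval hz h)).hom ≫ D.slideEval l (D.ops.comp w z hw) y h₁ h =
      D.ops.wl w (D.slideEval l z y hz h) (D.slideEval_special _ _ _ _ _) h₂ ≫ D.slide l w z hw h₃ := by
  cases l with
  | nil => exact (D.assoc_runit hw hz _ _ _).trans (Category.comp_id _).symm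
  | cons v l =>
    have h4 := VertOps.h_left (D := D.ops) hw (hz.trans h.1.symm)
    have h5 := D.h_slide (hz.trans h.1.symm) h.2
    exact D.slide_assoc l w z v hw (hz.trans h.1.symm) h.2 (h₁.trans h.1.symm) (VertOps.h_left hw (D.ops.h_fold (hz.trans h.1.symm) h.2))
      h4 h5 (D.h_slide h4 h5)

lemma lastV_comp {u v : A.A₁} {l : List A.A₁} {x y : A.A₀} (hy : lastV A.tgt.obj x (v :: l) = y) (e) :
    lastV A.tgt.obj (A.tgt.obj (D.ops.comp u v e)) l = y :=
  (congrArg (lastV A.tgt.obj · l) (D.ops.comp_tgt _ _ _)).trans hy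

/-- The rebracketing of the composite of two left bracketed paths, the first one nonempty. -/
def merge : (k : List A.A₁) → (u : A.A₁) → (h : Chn A (A.tgt.obj u) k) → (l : List A.A₁) → (y : A.A₀) →
    (hy : lastV A.tgt.obj (A.tgt.obj u) k = y) → (hl : Chn A y l) →
    (D.ops.comp (D.ops.fold k u h) (D.ops.eval y l hl) (D.ops.h_eval (D.ops.tgt_fold' hy) hl) ⟶
      D.ops.fold (k ++ l) u (h.append hy hl))
  | [], u, _, l, y, hy, hl => D.slideEval l u y hy hl
  | v :: k, u, h, l, y, hy, hl => merge k (D.ops.comp u v h.1.symm) (D.ops.Chn_comp h _) l y (D.lastV_comp hy _) hl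

lemma merge_special : ∀ (k : List A.A₁) (u : A.A₁) (h : Chn A (A.tgt.obj u) k) (l : List A.A₁) (y : A.A₀)
    (hy : lastV A.tgt.obj (A.tgt.obj u) k = y) (hl : Chn A y l), Special (D.merge k u h l y hy hl)
  | [], _, _, _, _, _, _ => D.slideEval_special _ _ _ _ _
  | _ :: k, _, _, _, _, _, _ => merge_special k _ _ _ _ _ _

instance isIso_merge : ∀ (k : List A.A₁) (u : A.A₁) (h : Chn A (A.tgt.obj u) k) (l : List A.A₁) (y : A.A₀)
    (hy : lastV A.tgt.obj (A.tgt.obj u) k = y) (hl : Chn A y l), IsIso (D.merge k u h l y hy hl)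
  | [], _, _, _, _, _, _ => D.isIso_slideEval _ _ _ _ _
  | _ :: k, _, _, _, _, _, _ => isIso_merge k _ _ _ _ _ _

lemma merge_nat {k k' l l' : List A.A₁} (cs : Cells A k k') (ds : Cells A l l') {u u' : A.A₁} {y y' : A.A₀}
    (f : u ⟶ u') (a : y ⟶ y') (d h h')
    (c : lastV (mapA A.tgt) (Arrow.mk (A.tgt.map f)) cs.toList = Arrow.mk a) (d' hl hl')
    (e : Consec (D.ops.cfold cs f d h h') (D.ops.ceval a ds d' hl hl')) (hy hy') :
    D.ops.cmap (D.ops.cfold cs f d h h') (D.ops.ceval a ds d' hl hl') e ≫ D.merge k' u' h' l' y' hy' hl' =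
      D.merge k u h l y hy hl ≫ D.ops.cfold (cs.append ds) f (Cells.chain_append d c d')
        (h.append hy hl) (h'.append hy' hl') := by
  induction cs generalizing u u' with
  | nil => exact D.slideEval_nat ds f a c d' hl hl' e hy hy' _
  | cons b cs ih =>
    exact ih _ (d.2.of_eq (D.ops.cmap_tgt f b d.1.symm)) (D.ops.Chn_comp h _) (D.ops.Chn_comp h' _)
      ((congrArg (lastV (mapA A.tgt) · cs.toList) (D.ops.cmap_tgt f b d.1.symm)).trans c) e
      (D.lastV_comp hy _) (D.lastV_comp hy' _)

lemma merge_fmap (k l : List A.A₁) {u u' : A.A₁} {y : A.A₀} (f : u ⟶ u') (s : Special f) (h hl hy h' hy') (e) :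
    D.ops.wr (D.ops.fmap k f s h) (D.ops.fmap_special _ _ _ _) (D.ops.eval y l hl) e ≫ D.merge k u' h' l y hy' hl =
      D.merge k u h l y hy hl ≫ D.ops.fmap (k ++ l) f s (h.append hy hl) := by
  have c : lastV (mapA A.tgt) (Arrow.mk (A.tgt.map f)) (Cells.id k).toList = Arrow.mk (𝟙 y) := by
    refine (D.ops.tgt_cfold (.id k) f (s.cchain h) h h').symm.trans (((D.ops.fmap_special k f s h).2).trans
      (mk_id_congr (D.ops.tgt_fold' hy)))
  have i := D.ops.ceval_id (x := y) l (Cells.chain_id hl rfl) hl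
  have n := D.merge_nat (.id k) (.id l) f (𝟙 y) (s.cchain h) h h' c (Cells.chain_id hl rfl) hl hl
    (i ▸ (D.ops.fmap_special k f s h).consec (.id _) e) hy hy'
  refine (congrArg (· ≫ _) (D.ops.cmap_congr rfl i.symm _ _)).trans (n.trans (congrArg (_ ≫ ·)
    (D.ops.cfold_congr (Cells.id_append k l) rfl _ _ _ _)))

end WDblStr
end

section
variable {A : GphCat.{u}}

namespace WDblStr
variable (D : WDblStr A)

lemma merge_slide_step {K : Type*} [Category K] {X₁ X₂ X₃ X₄ Y₁ Y₂ Y₃ : K}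
    {a : X₁ ⟶ X₂} {s : X₂ ⟶ X₃} {m : X₃ ⟶ X₄} {w : X₁ ⟶ Y₁} {t : Y₁ ⟶ X₄}
    (ih : a ≫ s ≫ m = w ≫ t) {f : X₃ ⟶ Y₂} {m' : Y₂ ⟶ Y₃} {f' : X₄ ⟶ Y₃} (n : f ≫ m' = m ≫ f')
    {r : X₂ ⟶ Y₂} (hr : r = s ≫ f) : a ≫ r ≫ m' = w ≫ t ≫ f' := by
  rw [hr, Category.assoc, n, reassoc_of% ih]

lemma merge_slide (k : List A.A₁) (w u : A.A₁) (hw : A.tgt.obj w = A.src.obj u) (h : Chn A (A.tgt.obj u) k)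
    (l : List A.A₁) (y : A.A₀) (hy : lastV A.tgt.obj (A.tgt.obj u) k = y) (hl : Chn A y l)
    (h₁ h₂ h₃ h₄ h₅) :
    (D.assoc w (D.ops.fold k u h) (D.ops.eval y l hl) (D.ops.h_fold hw h)
          (D.ops.h_eval (D.ops.tgt_fold' hy) hl)).hom ≫
        D.ops.wr (D.slide k w u hw h) (D.slide_special _ _ _ _ _) (D.ops.eval y l hl) h₁ ≫
        D.merge k (D.ops.comp w u hw) h₂ l y h₃ hl =
      D.ops.wl w (D.merge k u h l y hy hl) (D.merge_special _ _ _ _ _ _ _) h₄ ≫ D.slide (k ++ l) w u hw h₅ := by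
  induction k generalizing u with
  | nil =>
    exact (congrArg (_ ≫ ·) ((congrArg (· ≫ _) (D.ops.wr_id (.id _) h₁)).trans (Category.id_comp _))).trans
      (D.slideEval_assoc l w u y hw hy hl h₃ h₄ h₅)
  | cons v k ih =>
    have hv := h.1.symm
    have hu : A.tgt.obj w = A.src.obj (D.ops.comp u v hv) := VertOps.h_left hw hv
    have hh := D.ops.Chn_comp h hv
    have hh' := D.h_slide hu hh
    have a := D.assoc_special w u v hw hv
    have s := D.slide_special k w _ hu hh
    have f := D.ops.fmap_special k _ a hh'
    have hy' := D.lastV_comp hy hv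
    have hy'' : lastV A.tgt.obj (A.tgt.obj (D.ops.comp w _ hu)) k = y :=
      (congrArg (lastV A.tgt.obj · k) (D.ops.comp_tgt _ _ _)).trans hy'
    have e₁ := D.ops.h_eval (D.ops.tgt_fold' (h := hh') hy'') hl
    have e₀ := s.tgt_eq.symm.trans e₁
    refine merge_slide_step (ih (D.ops.comp u v hv) hu hh hy' e₀ hh' hy'' h₄ (D.ops.Chn_comp h₅ hv))
      (D.merge_fmap k l (D.assoc w u v hw hv).hom a hh' hl hy'' (a.chain hh') (D.lastV_comp h₃ _) e₁)
      (D.ops.wr_comp _ _ s f (s.comp f) e₀ e₁)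

/-- The rebracketing of the composite of two left bracketed paths. -/
def mergeEval : (l : List A.A₁) → (x : A.A₀) → (h : Chn A x l) → (m : List A.A₁) → (y : A.A₀) →
    (hy : lastV A.tgt.obj x l = y) → (hm : Chn A y m) →
    (D.ops.comp (D.ops.eval x l h) (D.ops.eval y m hm) (D.ops.h_eval ((D.ops.tgt_eval h).trans hy) hm) ⟶
      D.ops.eval x (l ++ m) (h.append hy hm))
  | [], x, _, m, y, hy, hm => (D.lunit x (D.ops.eval y m hm)
      ((show x = y from hy).trans (D.ops.src_eval hm).symm)).hom ≫ eqToHom (by obtain rfl : x = y := hy; rfl)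
  | u :: k, _, h, m, y, hy, hm => D.merge k u h.2 m y hy hm

lemma mergeEval_nil (x : A.A₀) (h) (m : List A.A₁) (hy) (hm : Chn A x m) (h') :
    D.mergeEval [] x h m x hy hm = (D.lunit x (D.ops.eval x m hm) h').hom := Category.comp_id _

lemma mergeEval_special (l : List A.A₁) (x : A.A₀) (h : Chn A x l) (m : List A.A₁) (y : A.A₀) (hy) (hm : Chn A y m) :
    Special (D.mergeEval l x h m y hy hm) := by
  cases l with
  | nil =>
    obtain rfl : x = y := hy
    exact (D.lunit_special _ _ _).comp (.id _)
  | cons u k => exact D.merge_special _ _ _ _ _ _ _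

instance isIso_mergeEval (l : List A.A₁) (x : A.A₀) (h : Chn A x l) (m : List A.A₁) (y : A.A₀) (hy) (hm : Chn A y m) :
    IsIso (D.mergeEval l x h m y hy hm) := by
  cases l with
  | nil => exact IsIso.comp_isIso' (Iso.isIso_hom _) inferInstance
  | cons u k => exact D.isIso_merge _ _ _ _ _ _ _

lemma mergeEval_nat {l l' m m' : List A.A₁} (cs : Cells A l l') (ds : Cells A m m') {x x' : A.A₀} {y y' : A.A₀}
    (a : x ⟶ x') (b : y ⟶ y') (d h h') (c : lastV (mapA A.tgt) (Arrow.mk a) cs.toList = Arrow.mk b) (d' hm hm')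
    (e : Consec (D.ops.ceval a cs d h h') (D.ops.ceval b ds d' hm hm')) (hy hy') :
    D.ops.cmap (D.ops.ceval a cs d h h') (D.ops.ceval b ds d' hm hm') e ≫ D.mergeEval l' x' h' m' y' hy' hm' =
      D.mergeEval l x h m y hy hm ≫ D.ops.ceval a (cs.append ds) (Cells.chain_append d c d')
        (h.append hy hm) (h'.append hy' hm') := by
  cases cs with
  | nil =>
    obtain rfl : x = y := hy
    obtain rfl : x' = y' := hy'
    obtain rfl : a = b := Arrow.mk_injective _ _ c
    have k := (D.ops.src_ceval a ds d' hm hm').symm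
    exact (congrArg (_ ≫ ·) (D.mergeEval_nil _ _ _ _ _ (congrArg (·.right) k))).trans ((D.lunit_nat a _ k).trans
      (congrArg (· ≫ _) (D.mergeEval_nil _ _ _ _ _ _).symm))
  | cons f cs => exact D.merge_nat cs ds f b d.2 h.2 h'.2 c d' hm hm' e hy hy'

lemma merge_assoc (k : List A.A₁) (u : A.A₁) (h : Chn A (A.tgt.obj u) k) (l : List A.A₁) (x : A.A₀)
    (hx : lastV A.tgt.obj (A.tgt.obj u) k = x) (hl : Chn A x l) (m : List A.A₁) (y : A.A₀)
    (hy : lastV A.tgt.obj x l = y) (hm : Chn A y m) (h₁ h₂ h₃ h₄ h₅ h₆ h₇ h₈) :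
    Arrow.mk ((D.assoc (D.ops.fold k u h) (D.ops.eval x l hl) (D.ops.eval y m hm) h₁ h₂).hom ≫
        D.ops.wr (D.merge k u h l x hx hl) (D.merge_special _ _ _ _ _ _ _) (D.ops.eval y m hm) h₃ ≫
        D.merge (k ++ l) u h₄ m y h₅ hm) =
      Arrow.mk (D.ops.wl (D.ops.fold k u h) (D.mergeEval l x hl m y hy hm) (D.mergeEval_special _ _ _ _ _ _ _) h₆ ≫
        D.merge k u h (l ++ m) x h₇ h₈) := by
  induction k generalizing u with
  | nil =>
    refine congrArg Arrow.mk ?_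
    cases l with
    | nil =>
      obtain rfl : x = y := hy
      have e : x = A.src.obj (D.ops.eval x m hm) := (D.ops.src_eval hm).symm
      refine (Category.assoc _ _ _).symm.trans ((congrArg (· ≫ _) (D.triangle u x _ hx e)).trans ?_)
      exact congrArg (· ≫ _) (D.ops.wl_congr (D.mergeEval_nil _ _ _ _ _ e).symm (D.lunit_special _ _ _)
        (D.mergeEval_special _ _ _ _ _ _ _) h₆)
    | cons v l => exact D.merge_slide l u v (hx.trans hl.1.symm) hl.2 m y hy hm _ _ _ _ h₈.2
  | cons v k ih =>
    exact ih (D.ops.comp u v h.1.symm) (D.ops.Chn_comp h _) (D.lastV_comp hx _) h₁ h₃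
      (D.ops.Chn_comp h₄ _) (D.lastV_comp h₅ _) h₆ (D.lastV_comp h₇ _)

lemma mergeEval_assoc (k : List A.A₁) (z : A.A₀) (h : Chn A z k) (l : List A.A₁) (x : A.A₀)
    (hx : lastV A.tgt.obj z k = x) (hl : Chn A x l) (m : List A.A₁) (y : A.A₀)
    (hy : lastV A.tgt.obj x l = y) (hm : Chn A y m) (h₁ h₂ h₃ h₄ h₅ h₆ h₇ h₈) :
    Arrow.mk ((D.assoc (D.ops.eval z k h) (D.ops.eval x l hl) (D.ops.eval y m hm) h₁ h₂).hom ≫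
        D.ops.wr (D.mergeEval k z h l x hx hl) (D.mergeEval_special _ _ _ _ _ _ _) (D.ops.eval y m hm) h₃ ≫
        D.mergeEval (k ++ l) z h₄ m y h₅ hm) =
      Arrow.mk (D.ops.wl (D.ops.eval z k h) (D.mergeEval l x hl m y hy hm) (D.mergeEval_special _ _ _ _ _ _ _) h₆ ≫
        D.mergeEval k z h (l ++ m) x h₇ h₈) := by
  cases k with
  | nil =>
    obtain rfl : z = x := hx
    refine congrArg Arrow.mk ?_
    have e : z = A.src.obj (D.ops.eval z l hl) := (D.ops.src_eval hl).symm
    have e' : z = A.src.obj (D.ops.comp _ _ h₂) := e.trans (D.ops.comp_src _ _ _).symm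
    have e'' : z = A.src.obj (D.ops.eval z (l ++ m) h₈) := (D.ops.src_eval h₈).symm
    have s := D.mergeEval_special l z hl m y hy hm
    refine Eq.trans ?_ ((D.wl_lunit _ s e' e'').symm.trans (congrArg (_ ≫ ·) (D.mergeEval_nil _ _ _ _ _ e'').symm))
    refine (congrArg (_ ≫ ·) (congrArg (· ≫ _) (D.ops.wr_congr (D.mergeEval_nil _ _ _ _ _ e) _
      (D.lunit_special _ _ _) h₃))).trans ?_
    exact (Category.assoc _ _ _).symm.trans (congrArg (· ≫ _) (D.assoc_lunit e h₂ _ _ _))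
  | cons u k => exact D.merge_assoc k u h.2 l x hx hl m y hy hm _ _ _ _ _ _ _ _

lemma merge_nil (k : List A.A₁) (u : A.A₁) (h : Chn A (A.tgt.obj u) k) (y : A.A₀) (hy) (hm : Chn A y []) (h') :
    Arrow.mk (D.merge k u h [] y hy hm) = Arrow.mk (D.runit (D.ops.fold k u h) y h').hom := by
  induction k generalizing u with
  | nil => rfl
  | cons v k ih => exact ih _ _ _ _

lemma mergeEval_right_nil (k : List A.A₁) (x : A.A₀) (h : Chn A x k) (y : A.A₀) (hy) (hm : Chn A y []) (h') :
    Arrow.mk (D.mergeEval k x h [] y hy hm) = Arrow.mk (D.runit (D.ops.eval x k h) y h').hom := by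
  cases k with
  | nil =>
    obtain rfl : x = y := hy
    have e : x = A.src.obj (D.ops.eval x [] hm) := (D.ops.src_eval hm).symm
    exact congrArg Arrow.mk ((D.mergeEval_nil _ _ _ _ _ e).trans (D.lunit_one e h'))
  | cons u k => exact D.merge_nil k u h.2 y hy hm h'

lemma merge_one (k : List A.A₁) (u : A.A₁) (h : Chn A (A.tgt.obj u) k) (y : A.A₀) (hy) (v : A.A₁) (hm : Chn A y [v]) :
    Arrow.mk (D.merge k u h [v] y hy hm) = Arrow.mk (𝟙 (D.ops.fold (k ++ [v]) u (h.append hy hm))) := by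
  induction k generalizing u with
  | nil => rfl
  | cons w k ih => exact ih _ _ _

end WDblStr
end

/-- The identity arrows of a category. -/
def IsIdArrow {K : Type*} [Category K] (a : Arrow K) : Prop := ∃ x, a = Arrow.mk (𝟙 x)

namespace IsIdArrow
variable {K : Type*} [Category K] {a b c : Arrow K}

lemma mk_id (x : K) : IsIdArrow (Arrow.mk (𝟙 x)) := ⟨x, rfl⟩

lemma mk_eqToHom {x y : K} (h : x = y) : IsIdArrow (Arrow.mk (eqToHom h)) := ⟨x, TripleCat.mk_eqToHom h⟩

lemma ext (ha : IsIdArrow a) (hb : IsIdArrow b) (h : a.left = b.left) : a = b := by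
  obtain ⟨x, rfl⟩ := ha
  obtain ⟨y, rfl⟩ := hb
  obtain rfl : x = y := h
  rfl

lemma eq_id (ha : IsIdArrow a) {x : K} (h : a.left = x) : a = Arrow.mk (𝟙 x) := ha.ext (mk_id x) h

lemma vcomp (ha : IsIdArrow a) (hb : IsIdArrow b) (h) : IsIdArrow (TripleCat.vcomp a b h) := by
  obtain ⟨x, rfl⟩ := ha
  obtain ⟨y, rfl⟩ := hb
  exact ⟨x, vcomp_id _ h⟩

lemma vcomp₃ (ha : IsIdArrow a) (hb : IsIdArrow b) (hc : IsIdArrow c) (h h') :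
    IsIdArrow (TripleCat.vcomp₃ a b c h h') := ha.vcomp (hb.vcomp hc h') h

lemma mapA {L : Type*} [Category L] (F : K ⥤ L) (ha : IsIdArrow a) : IsIdArrow (GphCat.mapA F a) := by
  obtain ⟨x, rfl⟩ := ha
  exact ⟨F.obj x, mk_map_id F x⟩

lemma pcomp_right (hb : IsIdArrow b) (h : a.right = b.left) : pcomp (some a) (some b) = some a := by
  obtain ⟨x, rfl⟩ := hb
  exact pcomp_idc a h

lemma pcomp_left (hb : IsIdArrow b) (h : b.right = a.left) : pcomp (some b) (some a) = some a := by
  obtain ⟨x, rfl⟩ := hb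
  exact idc_pcomp a h

end IsIdArrow

section
variable {C : Type u} [Bicategory.{w, v} C] [Strict C] (M : TwoMonad C) {X Y Z : C}

lemma IsIdArrow.whL (f : X ⟶ Y) {a : Arrow (Y ⟶ Z)} (h : IsIdArrow a) : IsIdArrow (whL f a) := by
  obtain ⟨g, rfl⟩ := h
  exact ⟨_, whL_idc f g⟩

lemma IsIdArrow.whR {a : Arrow (X ⟶ Y)} (h : IsIdArrow a) (g : Y ⟶ Z) : IsIdArrow (whR a g) := by
  obtain ⟨f, rfl⟩ := h
  exact ⟨_, whR_idc f g⟩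

lemma IsIdArrow.mapCell {a : Arrow (X ⟶ Y)} (h : IsIdArrow a) : IsIdArrow (mapCell M.T a) := by
  obtain ⟨f, rfl⟩ := h
  exact ⟨_, mapCell_id M.T f⟩

/-- The free algebra. -/
def TwoMonad.freeStr (X : C) : PseudoAlgStr M (M.T.obj X) where
  a := M.mult X
  ω := eqToIso (M.unit_mult X).symm
  κ := eqToIso (M.mult_mult X)
  unit_left := (((IsIdArrow.mk_eqToHom (M.unit_mult X).symm).mapCell M |>.whR _).vcomp ((IsIdArrow.mk_eqToHom (M.mult_mult X)).whL _) _).eq_id (by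
    change M.T.map (𝟙 _) ≫ _ = _
    exact (congrArg (· ≫ _) (M.T.map_id _)).trans (Strict.id_comp _))
  unit_right := (((IsIdArrow.mk_eqToHom (M.unit_mult X).symm).whL _).vcomp ((IsIdArrow.mk_eqToHom (M.mult_mult X)).whL _) _).eq_id
    (Strict.comp_id _)
  assoc := (((IsIdArrow.mk_eqToHom (M.mult_mult X)).whL _).vcomp ((IsIdArrow.mk_eqToHom (M.mult_mult X)).whL _) _).ext
    (((IsIdArrow.mk_eqToHom (M.mult_mult X)).mapCell M |>.whR _).vcomp ((IsIdArrow.mk_eqToHom (M.mult_mult X)).whL _) _) (by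
      change M.T.map (M.T.map _) ≫ M.T.map _ ≫ _ = M.T.map (M.T.map _ ≫ _) ≫ _
      rw [StrictPseudofunctor.map_comp, Strict.assoc])

/-- The free algebra. -/
def TwoMonad.free (X : C) : PseudoAlg M := ⟨M.T.obj X, M.freeStr X⟩

lemma TwoMonad.free_isNormal (X : C) : (M.free X).str.IsNormal := TripleCat.mk_eqToHom (M.unit_mult X).symm

variable {M}

/-- A pseudo algebra whose normaliser and extended associator are identities. -/
structure PseudoAlg.IsStrict (A : PseudoAlg M) : Prop where
  ω : IsIdArrow (Arrow.mk A.str.ω.hom)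
  κ : IsIdArrow (Arrow.mk A.str.κ.hom)

lemma TwoMonad.free_isStrict (X : C) : (M.free X).IsStrict :=
  ⟨IsIdArrow.mk_eqToHom (M.unit_mult X).symm, IsIdArrow.mk_eqToHom (M.mult_mult X)⟩

/-- A strict morphism of strict algebras, as a lax morphism. -/
def LaxMor.ofStrict {A B : PseudoAlg M} (hA : A.IsStrict) (hB : B.IsStrict) (f : A.carrier ⟶ B.carrier)
    (h : M.T.map f ≫ B.str.a = A.str.a ≫ f) : LaxMor A B where
  f := f
  φ := eqToHom h
  unit := ((hB.ω.whL _).vcomp ((IsIdArrow.mk_eqToHom h).whL _) _).ext (hA.ω.whR _)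
    ((Strict.comp_id f).trans (Strict.id_comp f).symm)
  mult := ((hB.κ.whL _).vcomp ((IsIdArrow.mk_eqToHom h).whL _) _).ext
    (((IsIdArrow.mk_eqToHom h).mapCell M |>.whR _).vcomp₃ ((IsIdArrow.mk_eqToHom h).whL _) (hA.κ.whR _) _ _) (by
      change M.T.map (M.T.map _) ≫ M.T.map _ ≫ _ = M.T.map (M.T.map _ ≫ _) ≫ _
      rw [StrictPseudofunctor.map_comp, Strict.assoc])

/-- A strict morphism of strict algebras, as a colax morphism. -/
def ColaxMor.ofStrict {A B : PseudoAlg M} (hA : A.IsStrict) (hB : B.IsStrict) (f : A.carrier ⟶ B.carrier)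
    (h : M.T.map f ≫ B.str.a = A.str.a ≫ f) : ColaxMor A B where
  r := f
  ρ := eqToHom h.symm
  unit := ((hA.ω.whR _).vcomp ((IsIdArrow.mk_eqToHom h.symm).whL _) _).ext (hB.ω.whL _)
    ((Strict.id_comp f).trans (Strict.comp_id f).symm)
  mult := ((hA.κ.whR _).vcomp ((IsIdArrow.mk_eqToHom h.symm).whL _) _).ext
    (((IsIdArrow.mk_eqToHom h.symm).whL _).vcomp₃ ((IsIdArrow.mk_eqToHom h.symm).mapCell M |>.whR _) (hB.κ.whL _) _ _)
      (Strict.assoc _ _ _)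

/-- The structure of a normal pseudo algebra, as a pseudo morphism from the free algebra. -/
def PseudoAlg.strMor (A : PseudoAlg M) (hA : A.str.IsNormal) : PseudoMor (M.free A.carrier) A where
  f := A.str.a
  φ := A.str.κ.hom
  isIso := Iso.isIso_hom _
  unit := A.str.unit_right.trans ((IsIdArrow.mk_eqToHom (M.unit_mult A.carrier).symm).whR _ |>.eq_id (Strict.id_comp _)).symm
  mult := two_three (((some_vcomp _ _ _).symm.trans ((congrArg some A.str.assoc).trans
    (some_vcomp _ _ _))).trans (congrArg (pcomp _)
    (IsIdArrow.pcomp_right ((IsIdArrow.mk_eqToHom (M.mult_mult A.carrier)).whR _) (by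
      change M.T.map (M.mult _) ≫ M.mult _ ≫ _ = (M.T.map (M.mult _) ≫ M.mult _) ≫ _
      rw [Strict.assoc])).symm))

end

section
variable {A : GphCat.{u}}

namespace Cells

lemma left_toList {l l' : List A.A₁} (cs : Cells A l l') : cs.toList.map (·.left) = l := by
  induction cs with
  | nil => rfl
  | cons f cs ih => exact congrArg (_ :: ·) ih

lemma right_toList {l l' : List A.A₁} (cs : Cells A l l') : cs.toList.map (·.right) = l' := by
  induction cs with
  | nil => rfl
  | cons f cs ih => exact congrArg (_ :: ·) ih

lemma toList_injective {l l' : List A.A₁} {cs ds : Cells A l l'} (h : cs.toList = ds.toList) : cs = ds := by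
  induction cs with
  | nil => cases ds; rfl
  | cons f cs ih =>
    cases ds with
    | cons g ds =>
      obtain ⟨h₁, h₂⟩ := List.cons.inj h
      exact congrArg₂ cons (Arrow.mk_injective _ _ h₁) (ih h₂)

lemma toList_id (l : List A.A₁) : (id l).toList = l.map fun x => Arrow.mk (𝟙 x) := by
  induction l with
  | nil => rfl
  | cons v l ih => exact congrArg (_ :: ·) ih

lemma toList_comp {l l' l'' : List A.A₁} (cs : Cells A l l') (ds : Cells A l' l'') (h) :
    (cs.comp ds).toList = zipC cs.toList ds.toList h := by
  induction cs generalizing l'' with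
  | nil => cases ds; rfl
  | cons f cs ih =>
    cases ds with
    | cons g ds => exact congrArg₂ List.cons (vcomp_mk f g).symm (ih ds _)

/-- A list of arrows, as a list of cells with prescribed ends. -/
def of : (L : List (Arrow A.A₁)) → {l l' : List A.A₁} → L.map (·.left) = l → L.map (·.right) = l' → Cells A l l'
  | [], _, _, rfl, rfl => nil
  | a :: L, _, _, rfl, rfl => cons a.hom (of L rfl rfl)

lemma toList_of (L : List (Arrow A.A₁)) {l l' : List A.A₁} (h : L.map (·.left) = l) (h' : L.map (·.right) = l') :
    (of L h h').toList = L := by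
  induction L generalizing l l' with
  | nil => subst h h'; rfl
  | cons a L ih => subst h h'; exact congrArg (_ :: ·) (ih rfl rfl)

/-- The cells of an arrow between paths. -/
def ofHom {p q : Path A} (f : p ⟶ q) : Cells A p.edges q.edges :=
  of (toCell f).edges (congrArg GPath.edges (toCell_dom f)) (congrArg GPath.edges (toCell_cod f))

lemma toList_ofHom {p q : Path A} (f : p ⟶ q) : (ofHom f).toList = (toCell f).edges := toList_of _ _ _

lemma chain_ofHom {p q : Path A} (f : p ⟶ q) :
    CChn A (Arrow.mk ((Path.srcF A).map f)) (ofHom f).toList := by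
  rw [toList_ofHom, mapA_srcF]
  exact (toCell f).chain

lemma last_ofHom {p q : Path A} (f : p ⟶ q) :
    lastV (mapA A.tgt) (Arrow.mk ((Path.srcF A).map f)) (ofHom f).toList = Arrow.mk ((Path.tgtF A).map f) := by
  rw [toList_ofHom, mapA_srcF, mapA_tgtF]
  rfl

lemma ofHom_id (p : Path A) : ofHom (𝟙 p) = id p.edges :=
  toList_injective ((toList_ofHom _).trans (toList_id _).symm)

lemma ofHom_comp {p q r : Path A} (f : p ⟶ q) (g : q ⟶ r) : ofHom (f ≫ g) = (ofHom f).comp (ofHom g) :=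
  toList_injective ((toList_ofHom _).trans ((zipC_congr (toList_ofHom f).symm (toList_ofHom g).symm _).trans
    (toList_comp _ _ _).symm))

end Cells

namespace VertOps
variable (O : VertOps A)

lemma eval_congr {x y : A.A₀} {l m : List A.A₁} (e : x = y) (e' : l = m) (h h') :
    O.eval x l h = O.eval y m h' := by subst e e'; rfl

lemma ceval_mk_congr {x x' y y' : A.A₀} {a : x ⟶ x'} {b : y ⟶ y'} {l l' m m' : List A.A₁} {cs : Cells A l l'}
    {ds : Cells A m m'} (e : Arrow.mk a = Arrow.mk b) (e' : cs.toList = ds.toList) (c c' h h' k k') :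
    Arrow.mk (O.ceval a cs c h h') = Arrow.mk (O.ceval b ds c' k k') := by
  obtain rfl : x = y := congrArg (·.left) e
  obtain rfl : x' = y' := congrArg (·.right) e
  obtain rfl := Arrow.mk_injective _ _ e
  obtain rfl : l = m := cs.left_toList.symm.trans (e' ▸ ds.left_toList)
  obtain rfl : l' = m' := cs.right_toList.symm.trans (e' ▸ ds.right_toList)
  obtain rfl := Cells.toList_injective e'
  rfl

/-- Left bracketed composition, as a functor on paths. -/
def evalF : Path A ⥤ A.A₁ where
  obj p := O.eval p.start p.edges p.chain
  map {p q} f := O.ceval ((Path.srcF A).map f) (Cells.ofHom f) (Cells.chain_ofHom f) p.chain q.chain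
  map_id p := Arrow.mk_injective _ _ ((O.ceval_mk_congr (congrArg Arrow.mk ((Path.srcF A).map_id p))
    (congrArg Cells.toList (Cells.ofHom_id p)) _ (Cells.chain_id p.chain rfl) _ _ p.chain p.chain).trans
      (congrArg Arrow.mk (O.ceval_id _ _ _)))
  map_comp {p q r} f g := Arrow.mk_injective _ _ ((O.ceval_mk_congr (congrArg Arrow.mk ((Path.srcF A).map_comp f g))
    (congrArg Cells.toList (Cells.ofHom_comp f g)) _ (Cells.chain_comp _ _ (Cells.chain_ofHom f) (Cells.chain_ofHom g))
      _ _ p.chain r.chain).trans (congrArg Arrow.mk (O.ceval_comp _ _ _ _ _ _ _ _ q.chain _)))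

lemma mk_evalF_map {p q : Path A} (f : p ⟶ q) {x x' : A.A₀} {a : x ⟶ x'} {l l' : List A.A₁} {cs : Cells A l l'}
    (e : (toCell f).start = Arrow.mk a) (e' : (toCell f).edges = cs.toList) (c h h') :
    Arrow.mk (O.evalF.map f) = Arrow.mk (O.ceval a cs c h h') :=
  O.ceval_mk_congr ((mapA_srcF f).trans e) ((Cells.toList_ofHom f).trans e') _ _ _ _ _ _

/-- Left bracketed composition, as a morphism of graphs. -/
def evalG : pathGph A ⟶ A where
  F₀ := 𝟭 _
  F₁ := O.evalF
  src := functor_ext_mk (F := O.evalF ⋙ A.src) (G := Path.srcF A ⋙ 𝟭 _) fun _ _ _ => O.src_ceval _ _ _ _ _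
  tgt := functor_ext_mk (F := O.evalF ⋙ A.tgt) (G := Path.tgtF A ⋙ 𝟭 _) fun _ _ f =>
    (O.tgt_ceval _ _ _ _ _).trans (Cells.last_ofHom f)

end VertOps

lemma IsIdArrow.ap {X Y : GphCat.{u}} {α : Arrow (X ⟶ Y)} (h : IsIdArrow α) (p : X.A₁) : IsIdArrow (ap α p) := by
  obtain ⟨f, rfl⟩ := h
  exact ⟨_, rfl⟩

/-- The free double category. -/
noncomputable def freeDbl (A : GphCat.{u}) : WDbl.{u} := ⟨pathGph A, (pathMonad.free_isNormal A).biased⟩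

lemma freeDbl_lunit (x : A.A₀) (p : Path A) (h) : IsIdArrow (Arrow.mk ((freeDbl A).str.lunit x p h).hom) := by
  have e := (pathMonad.free_isNormal A).isBiasedReduct.lunit x p h
  have k := (pathMonad.free_isStrict A).κ.ap (X := pathGph (pathGph (pathGph A))) (Y := pathGph A)
    (pairPath (A := pathGph (pathGph A)) (nilPath (A := pathGph A) x) (onePath (A := pathGph A) p) h)
  exact e ▸ k

lemma freeDbl_runit (x : A.A₀) (p : Path A) (h) : IsIdArrow (Arrow.mk ((freeDbl A).str.runit p x h).hom) := by
  have e := (pathMonad.free_isNormal A).isBiasedReduct.runit p x h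
  have k := (pathMonad.free_isStrict A).κ.ap (X := pathGph (pathGph (pathGph A))) (Y := pathGph A)
    (pairPath (A := pathGph (pathGph A)) (onePath (A := pathGph A) p) (nilPath (A := pathGph A) x) h)
  exact e ▸ k

lemma freeDbl_assoc (p q r : Path A) (h h') : IsIdArrow (Arrow.mk ((freeDbl A).str.assoc p q r h h').hom) := by
  obtain ⟨e, k⟩ := (pathMonad.free_isNormal A).isBiasedReduct.assoc p q r h h'
  have hκ := (pathMonad.free_isStrict A).κ
  have k₁ := hκ.ap (X := pathGph (pathGph (pathGph A))) (Y := pathGph A)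
    (pairPath (A := pathGph (pathGph A)) (pairPath (A := pathGph A) p q h) (onePath (A := pathGph A) r) h')
  have k₂ := hκ.ap (X := pathGph (pathGph (pathGph A))) (Y := pathGph A)
    (pairPath (A := pathGph (pathGph A)) (onePath (A := pathGph A) p) (pairPath (A := pathGph A) q r h') h)
  refine Eq.mp (congrArg IsIdArrow ?_) k₂
  exact Option.some_injective _ ((of_two_one k).symm.trans (k₁.pcomp_right e))

lemma freeDbl_comp_edges (p q : Path A) (h) :
    GPath.edges ((freeDbl A).str.ops.comp p q h) = p.edges ++ q.edges :=
  congrArg (p.edges ++ ·) (List.append_nil _)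

lemma freeDbl_cmap_edges {p p' q q' : Path A} (f : p ⟶ p') (g : q ⟶ q') (c : Consec (A := pathGph A) f g) :
    (toCell ((freeDbl A).str.ops.cmap f g c)).edges = (toCell f).edges ++ (toCell g).edges :=
  (flattenCell_edges _).trans (congrArg ((toCell f).edges ++ ·) (List.append_nil _))

lemma freeDbl_cmap_start {p p' q q' : Path A} (f : p ⟶ p') (g : q ⟶ q') (c : Consec (A := pathGph A) f g) :
    (toCell ((freeDbl A).str.ops.cmap f g c)).start = (toCell f).start := mapA_srcF f

namespace WDblStr
variable (D : WDblStr A)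

/-- The comparison of left bracketed composition with the concatenation of two paths. -/
noncomputable def mergePath (p q : Path A) (h : p.last = q.start) :
    D.ops.comp (D.ops.evalF.obj p) (D.ops.evalF.obj q) (map_tgt_src (A := pathGph A) D.ops.evalG h) ⟶
      D.ops.evalF.obj ((freeDbl A).str.ops.comp p q h) :=
  homOf (Arrow.mk (D.mergeEval p.edges p.start p.chain q.edges q.start h q.chain)) rfl
    (D.ops.eval_congr rfl (freeDbl_comp_edges p q h).symm _ _)

lemma mk_mergePath (p q : Path A) (h : p.last = q.start) : Arrow.mk (D.mergePath p q h) =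
    Arrow.mk (D.mergeEval p.edges p.start p.chain q.edges q.start h q.chain) := mk_homOf _ _ _

lemma mergePath_special (p q : Path A) (h : p.last = q.start) : Special (D.mergePath p q h) :=
  Special.of_mk (D.mk_mergePath p q h) (D.mergeEval_special _ _ _ _ _ _ _)

lemma isIso_mergePath (p q : Path A) (h : p.last = q.start) : IsIso (D.mergePath p q h) :=
  have := D.isIso_mergeEval p.edges p.start p.chain q.edges q.start h q.chain
  isIso_of_mk (D.mk_mergePath p q h)

lemma mergeEval_mk_congr {l l' m m' : List A.A₁} {x x' y y' : A.A₀} (e : l = l') (e' : x = x') (k : m = m')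
    (k' : y = y') (h h' hm hm' hy hy') :
    Arrow.mk (D.mergeEval l x h m y hy hm) = Arrow.mk (D.mergeEval l' x' h' m' y' hy' hm') := by
  subst e e' k k'; rfl

/-- Left bracketed composition, as a pseudo double functor on the free double category. -/
noncomputable def evalDbl : PseudoDbl (freeDbl A) ⟨A, D⟩ where
  f := D.ops.evalG
  unit x := 𝟙 (D.ops.one.obj x)
  mult p q h := D.mergePath p q h
  unit_special _ := .id _
  mult_special p q h := D.mergePath_special p q h
  unit_iso _ := inferInstanceAs (IsIso (𝟙 _))
  mult_iso p q h := D.isIso_mergePath p q h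
  unit_nat {x y} a := by
    have e := D.ops.mk_evalF_map (p := nilPath x) (q := nilPath y) (nilHom a) (a := a) (cs := .nil) rfl rfl trivial trivial trivial
    refine (Category.comp_id _).trans (Eq.trans ?_ (Category.id_comp _).symm)
    refine Arrow.mk_injective _ _ (e.symm.trans ?_)
    refine mapA_congr' D.ops.evalF ?_
    exact arrow_ext rfl
  mult_nat {p p' q q'} f g c := by
    have n := D.mergeEval_nat (.ofHom f) (.ofHom g) _ _ (Cells.chain_ofHom f) p.chain p'.chain
      ((Cells.last_ofHom f).trans c) (Cells.chain_ofHom g) q.chain q'.chain (c.map (A := pathGph A) D.ops.evalG)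
      c.left c.right
    have k := D.ops.mk_evalF_map ((freeDbl A).str.ops.cmap f g c) ((freeDbl_cmap_start f g c).trans (mapA_srcF f).symm)
      ((freeDbl_cmap_edges f g c).trans
        ((congrArg₂ (· ++ ·) (Cells.toList_ofHom f) (Cells.toList_ofHom g)).symm.trans (Cells.toList_append _ _).symm))
      (Cells.chain_append (Cells.chain_ofHom f) ((Cells.last_ofHom f).trans c) (Cells.chain_ofHom g))
      (Chn.append p.chain c.left q.chain) (Chn.append p'.chain c.right q'.chain)
    refine oa_inj ((oa_comp _ _).trans (Eq.trans ?_ (oa_comp _ _).symm))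
    refine (congrArg (pcomp _) (congrArg some (D.mk_mergePath p' q' c.right))).trans ?_
    exact ((oa_comp _ _).symm.trans ((congrArg oa n).trans (oa_comp _ _))).trans
      (congrArg₂ pcomp (congrArg some (D.mk_mergePath p q c.left).symm) (congrArg some k.symm))
  lunit x p h := by
    refine (congrArg (· ≫ _) (D.ops.cmap_id _ _ _)).trans ((Category.id_comp _).trans (oa_inj ((oa_comp _ _).trans ?_)))
    refine (IsIdArrow.pcomp_right ((freeDbl_lunit (A := A) x p h).mapA D.ops.evalF) rfl).trans (congrArg some ?_)
    refine (D.mk_mergePath (nilPath x) p h).trans ?_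
    obtain ⟨y, l, ch⟩ := p
    obtain rfl : x = y := h
    exact congrArg Arrow.mk (D.mergeEval_nil x trivial l rfl ch (D.ops.src_eval ch).symm)
  runit p x h := by
    refine (congrArg (· ≫ _) (D.ops.cmap_id _ _ _)).trans ((Category.id_comp _).trans (oa_inj ((oa_comp _ _).trans ?_)))
    refine (IsIdArrow.pcomp_right ((freeDbl_runit (A := A) x p h).mapA D.ops.evalF) rfl).trans (congrArg some ?_)
    exact (D.mk_mergePath p (nilPath x) h).trans (D.mergeEval_right_nil p.edges p.start p.chain x h trivial ((D.ops.tgt_eval p.chain).trans h))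
  assoc p q r h h' := by
    have s₁ := D.mergeEval_special p.edges p.start p.chain q.edges q.start h q.chain
    have s₂ := D.mergeEval_special q.edges q.start q.chain r.edges r.start h' r.chain
    have t₁ := (D.ops.h_eval ((D.ops.tgt_eval p.chain).trans h) q.chain)
    have t₂ := (D.ops.h_eval ((D.ops.tgt_eval q.chain).trans h') r.chain)
    have t₃ := VertOps.h_right (D := D.ops) t₁ t₂
    have t₄ := VertOps.h_left (D := D.ops) t₁ t₂
    have l₁ : lastV A.tgt.obj p.start (p.edges ++ q.edges) = r.start := by
      rw [lastV_append]
      exact (congrArg (lastV A.tgt.obj · q.edges) h).trans h'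
    have e := D.mergeEval_assoc p.edges p.start p.chain q.edges q.start h q.chain r.edges r.start h' r.chain
      t₁ t₂ t₃ (Chn.append p.chain h q.chain) l₁ t₄ h (Chn.append q.chain h' r.chain)
    refine oa_inj ((oa_comp _ _).trans ?_)
    refine (congrArg (pcomp _) ((oa_comp _ _).trans (IsIdArrow.pcomp_right
      ((freeDbl_assoc (A := A) p q r h h').mapA D.ops.evalF) rfl))).trans ?_
    refine Eq.trans ?_ ((oa_comp _ _).trans (congrArg (pcomp _) (oa_comp _ _))).symm
    refine Eq.trans (congrArg₂ pcomp ?_ ?_) (((oa_comp _ _).symm.trans ((congrArg some e.symm).trans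
      ((oa_comp _ _).trans (congrArg (pcomp _) (oa_comp _ _))))).trans
      (congrArg (pcomp _) (congrArg₂ pcomp ?_ ?_)))
    · exact congrArg some (cmap_mk_congr D.ops rfl (D.mk_mergePath q r h') _ ((Special.id _).consec s₂ t₄))
    · exact congrArg some ((D.mk_mergePath p _ _).trans (D.mergeEval_mk_congr rfl rfl (freeDbl_comp_edges q r h') rfl
        _ _ _ _ _ _))
    · exact congrArg some (cmap_mk_congr D.ops (D.mk_mergePath p q h).symm rfl (s₁.consec (.id _) t₃) _)
    · exact congrArg some ((D.mk_mergePath _ r _).trans (D.mergeEval_mk_congr (freeDbl_comp_edges p q h) rfl rfl rfl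
        _ _ _ _ _ _)).symm

end WDblStr
end

namespace VertOps
variable {A : GphCat.{u}} (O : VertOps A)

lemma cmap_wr {u u' u'' v v' : A.A₁} (f : u ⟶ u') (g : v ⟶ v') (c : Consec f g) (s : u' ⟶ u'') (t : Special s) (h)
    (c' : Consec (f ≫ s) g) : O.cmap f g c ≫ O.wr s t v' h = O.cmap (f ≫ s) g c' :=
  (O.cmap_comp _ _ _ _ c (t.consec (.id v') h)).symm.trans (O.cmap_congr rfl (Category.comp_id _) _ _)

lemma wr_cmap {u u' u'' v v' : A.A₁} (f : u' ⟶ u'') (g : v ⟶ v') (c : Consec f g) (s : u ⟶ u') (t : Special s) (h)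
    (c' : Consec (s ≫ f) g) : O.wr s t v h ≫ O.cmap f g c = O.cmap (s ≫ f) g c' :=
  (O.cmap_comp _ _ _ _ (t.consec (.id v) h) c).symm.trans (O.cmap_congr rfl (Category.id_comp _) _ _)

end VertOps

lemma Consec.comp_special {A : GphCat.{u}} {u u' u'' v v' : A.A₁} {f : u ⟶ u'} {g : v ⟶ v'} (c : Consec f g) {s : u' ⟶ u''}
    (t : Special s) : Consec (f ≫ s) g := by
  have e := c.comp (t.consec (.id v') c.right)
  rwa [Category.comp_id] at e

lemma Special.comp_consec {A : GphCat.{u}} {u u' u'' v v' : A.A₁} {f : u' ⟶ u''} {g : v ⟶ v'} {s : u ⟶ u'}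
    (t : Special s) (c : Consec f g) : Consec (s ≫ f) g := by
  have e := Consec.comp (t.consec (.id v) (t.tgt_eq.symm.trans c.left)) c
  rwa [Category.id_comp] at e

section
variable {A B : GphCat.{u}}

lemma Chn.map (F : A ⟶ B) {x : A.A₀} {l : List A.A₁} (h : Chn A x l) : Chn B (F.F₀.obj x) (l.map F.F₁.obj) :=
  chain_map F.F₀.obj F.F₁.obj F.src_obj F.tgt_obj h

namespace Cells

/-- The action of a morphism of graphs. -/
def map (F : A ⟶ B) : {l l' : List A.A₁} → Cells A l l' → Cells B (l.map F.F₁.obj) (l'.map F.F₁.obj)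
  | _, _, nil => nil
  | _, _, cons f cs => cons (F.F₁.map f) (cs.map F)

lemma toList_map (F : A ⟶ B) {l l' : List A.A₁} (cs : Cells A l l') :
    (cs.map F).toList = cs.toList.map (mapA F.F₁) := by
  induction cs with
  | nil => rfl
  | cons f cs ih => exact congrArg (_ :: ·) ih

lemma chain_map (F : A ⟶ B) {l l' : List A.A₁} (cs : Cells A l l') {x y : A.A₀} {a : x ⟶ y}
    (c : CChn A (Arrow.mk a) cs.toList) : CChn B (Arrow.mk (F.F₀.map a)) (cs.map F).toList := by
  rw [toList_map]
  exact TripleCat.chain_map (mapA F.F₀) (mapA F.F₁) (fun b => F.src_map b.hom) (fun b => F.tgt_map b.hom) c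

/-- The components of a 2-cell. -/
def app {F G : A ⟶ B} (π : F ⟶ G) : (l : List A.A₁) → Cells B (l.map F.F₁.obj) (l.map G.F₁.obj)
  | [] => nil
  | u :: l => cons (GphCat.Hom₂.φ₁ π |>.app u) (app π l)

lemma toList_app {F G : A ⟶ B} (π : F ⟶ G) (l : List A.A₁) :
    (app π l).toList = l.map fun u => Arrow.mk (GphCat.Hom₂.φ₁ π |>.app u) := by
  induction l with
  | nil => rfl
  | cons u l ih => exact congrArg (_ :: ·) ih

end Cells
end

lemma isIso_cell {X Y : GphCat.{u}} {f g : X ⟶ Y} (α : f ⟶ g) (h₀ : ∀ x, IsIso (α.φ₀.app x)) (h₁ : ∀ x, IsIso (α.φ₁.app x)) :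
    IsIso α := by
  have i₀ := NatIso.isIso_of_isIso_app α.φ₀
  have i₁ := NatIso.isIso_of_isIso_app α.φ₁
  let β : g ⟶ f :=
    { φ₀ := inv α.φ₀
      φ₁ := inv α.φ₁
      src x := by
        rw [NatIso.isIso_inv_app, NatIso.isIso_inv_app, Functor.map_inv]
        exact mk_inv_congr (α.src x)
      tgt x := by
        rw [NatIso.isIso_inv_app, NatIso.isIso_inv_app, Functor.map_inv]
        exact mk_inv_congr (α.tgt x) }
  refine ⟨β, Arrow.mk_injective _ _ (cell_arrow_ext rfl rfl (fun x => ?_) fun x => ?_),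
    Arrow.mk_injective _ _ (cell_arrow_ext rfl rfl (fun x => ?_) fun x => ?_)⟩
  · exact congrArg (fun k : f.F₀ ⟶ f.F₀ => Arrow.mk (k.app x)) (IsIso.hom_inv_id α.φ₀)
  · exact congrArg (fun k : f.F₁ ⟶ f.F₁ => Arrow.mk (k.app x)) (IsIso.hom_inv_id α.φ₁)
  · exact congrArg (fun k : g.F₀ ⟶ g.F₀ => Arrow.mk (k.app x)) (IsIso.inv_hom_id α.φ₀)
  · exact congrArg (fun k : g.F₁ ⟶ g.F₁ => Arrow.mk (k.app x)) (IsIso.inv_hom_id α.φ₁)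

lemma isIdArrow_of_ap {X Y : GphCat.{u}} {α : Arrow (X ⟶ Y)} (h₀ : ∀ x, IsIdArrow (ap₀ α x)) (h₁ : ∀ x, IsIdArrow (ap α x)) :
    IsIdArrow α := by
  obtain ⟨f, g, α⟩ := α
  have e : f = g := hom_ext (functor_ext_mk fun x y a => ?_) (functor_ext_mk fun x y a => ?_)
  · exact ⟨f, cell_arrow_ext rfl e.symm (fun x => (h₀ x).eq_id rfl) fun x => (h₁ x).eq_id rfl⟩
  · refine Option.some_injective _ (((h₀ y).pcomp_right rfl).symm.trans (Eq.trans ?_ ((h₀ x).pcomp_left rfl)))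
    exact (oa_comp _ _).symm.trans ((congrArg oa (α.φ₀.naturality a)).trans (oa_comp _ _))
  · refine Option.some_injective _ (((h₁ y).pcomp_right rfl).symm.trans (Eq.trans ?_ ((h₁ x).pcomp_left rfl)))
    exact (oa_comp _ _).symm.trans ((congrArg oa (α.φ₁.naturality a)).trans (oa_comp _ _))

lemma IsIdArrow.mk_comp {K : Type*} [Category K] {X Y Z : K} {f : X ⟶ Y} {g : Y ⟶ Z} (hf : IsIdArrow (Arrow.mk f))
    (hg : IsIdArrow (Arrow.mk g)) : IsIdArrow (Arrow.mk (f ≫ g)) := vcomp_mk f g ▸ hf.vcomp hg rfl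

lemma VertOps.isIdArrow_cmap {A : GphCat.{u}} (O : VertOps A) {u u' v v' : A.A₁} {f : u ⟶ u'} {g : v ⟶ v'}
    (hf : IsIdArrow (Arrow.mk f)) (hg : IsIdArrow (Arrow.mk g)) (c) : IsIdArrow (Arrow.mk (O.cmap f g c)) :=
  ⟨_, (cmap_mk_congr O (hf.eq_id rfl) (hg.eq_id rfl) c (.id c.left)).trans (congrArg Arrow.mk (O.cmap_id _ _ c.left))⟩

namespace LaxDbl
variable {D E G : WDbl.{u}} (F : LaxDbl D E)

lemma step_special {w u : D.graph.A₁} (h : D.graph.tgt.obj w = D.graph.src.obj u) {W : E.graph.A₁}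
    {a : W ⟶ F.f.F₁.obj w} (s : Special a) (H : E.graph.tgt.obj W = E.graph.src.obj (F.f.F₁.obj u)) :
    Special (E.str.ops.wr a s (F.f.F₁.obj u) H ≫ F.mult w u h) :=
  (E.str.ops.wr_special _ _ _).comp (F.mult_special _ _ _)

/-- The comparison of a lax double functor with left bracketed composites. -/
def lx : (l : List D.graph.A₁) → (w : D.graph.A₁) → (h : Chn D.graph (D.graph.tgt.obj w) l) → (W : E.graph.A₁) →
    (a : W ⟶ F.f.F₁.obj w) → (s : Special a) → (H : Chn E.graph (E.graph.tgt.obj W) (l.map F.f.F₁.obj)) →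
    (E.str.ops.fold (l.map F.f.F₁.obj) W H ⟶ F.f.F₁.obj (D.str.ops.fold l w h))
  | [], _, _, _, a, _, _ => a
  | u :: l, w, h, _, _, s, H => lx l (D.str.ops.comp w u h.1.symm) (D.str.ops.Chn_comp h _) _ _
      (F.step_special h.1.symm s H.1.symm) (E.str.ops.Chn_comp H _)

lemma lx_special (l : List D.graph.A₁) (w : D.graph.A₁) (h) {W : E.graph.A₁} (a : W ⟶ F.f.F₁.obj w) (s H) :
    Special (F.lx l w h W a s H) := by
  induction l generalizing w W with
  | nil => exact s
  | cons u l ih => exact ih _ _ _ _ _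

lemma isIso_lx (i : ∀ u v h, IsIso (F.mult u v h)) (l : List D.graph.A₁) (w : D.graph.A₁) (h) {W : E.graph.A₁}
    (a : W ⟶ F.f.F₁.obj w) [IsIso a] (s H) : IsIso (F.lx l w h W a s H) := by
  induction l generalizing w W with
  | nil => exact inferInstanceAs (IsIso a)
  | cons u l ih =>
    have := i w u h.1.symm
    exact ih _ _ _ _ _

lemma lx_nat {l l' : List D.graph.A₁} (cs : Cells D.graph l l') {w w' : D.graph.A₁} (g : w ⟶ w') {W W' : E.graph.A₁}
    {a : W ⟶ F.f.F₁.obj w} {a' : W' ⟶ F.f.F₁.obj w'} (s s') {g' : W ⟶ W'} (e : g' ≫ a' = a ≫ F.f.F₁.map g) (c d h h' H H') :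
    E.str.ops.cfold (cs.map F.f) g' c H H' ≫ F.lx l' w' h' W' a' s' H' =
      F.lx l w h W a s H ≫ F.f.F₁.map (D.str.ops.cfold cs g d h h') := by
  induction cs generalizing w w' W W' with
  | nil => exact e
  | @cons u u' l l' f cs ih =>
    have k : Consec g' (F.f.F₁.map f) := c.1.symm
    have k' : Consec g f := d.1.symm
    refine ih (D.str.ops.cmap g f k') _ _ ?_ _ (d.2.of_eq (D.str.ops.cmap_tgt g f k')) _ _ _ _
    have e₁ := E.str.ops.cmap_wr g' (F.f.F₁.map f) k a' s' k.right (k.comp_special s')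
    have e₂ := E.str.ops.wr_cmap (F.f.F₁.map g) (F.f.F₁.map f) (k'.map F.f) a s k.left (s.comp_consec (k'.map F.f))
    have e₃ := F.mult_nat g f k'
    exact (Category.assoc _ _ _).symm.trans ((congrArg (· ≫ _) (e₁.trans ((E.str.ops.cmap_congr e rfl _ _).trans e₂.symm))).trans
      ((Category.assoc _ _ _).trans ((congrArg (_ ≫ ·) e₃).trans (Category.assoc _ _ _).symm)))

lemma lx_comp_step {K : Type*} [Category K] {X₁ X₂ X₃ X₄ X₅ Y : K} {p : X₁ ⟶ X₂} {q : X₂ ⟶ X₃} {m : X₃ ⟶ X₄} {t : X₄ ⟶ X₅}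
    {m' : X₂ ⟶ Y} {n : Y ⟶ X₄} (e : q ≫ m = m' ≫ n) {x : X₁ ⟶ X₃} (hx : x = p ≫ q) {k : Y ⟶ X₅} (hk : k = n ≫ t) :
    x ≫ m ≫ t = (p ≫ m') ≫ k := by
  rw [hx, hk, Category.assoc, reassoc_of% e, Category.assoc]

lemma lx_comp (y : LaxDbl E G) (l : List D.graph.A₁) (w : D.graph.A₁) {W' : E.graph.A₁} {W : G.graph.A₁}
    (β : W' ⟶ F.f.F₁.obj w) (α : W ⟶ y.f.F₁.obj W') {a : W ⟶ y.f.F₁.obj (F.f.F₁.obj w)} (e : a = α ≫ y.f.F₁.map β)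
    (sa sα sβ h H H' H'') :
    Arrow.mk ((F.comp y).lx l w h W a sa H) =
      Arrow.mk (y.lx (l.map F.f.F₁.obj) W' H' W α sα H'' ≫ y.f.F₁.map (F.lx l w h W' β sβ H')) := by
  induction l generalizing w W W' with
  | nil => exact congrArg Arrow.mk e
  | cons u l ih =>
    have k : Consec β (𝟙 (F.f.F₁.obj u)) := sβ.consec (.id _) H'.1.symm
    have k' := k.map y.f
    rw [CategoryTheory.Functor.map_id] at k'
    have e₁ := y.mult_nat_left β k k'
    have e₂ := G.str.ops.wr_comp α (y.f.F₁.map β) sα (sβ.map y.f) (e ▸ sa) H''.1.symm (sα.tgt_eq.trans H''.1.symm)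
    exact ih (D.str.ops.comp w u h.1.symm) (E.str.ops.wr β sβ _ H'.1.symm ≫ F.mult w u h.1.symm)
      (G.str.ops.wr α sα _ H''.1.symm ≫ y.mult W' _ H'.1.symm)
      (lx_comp_step e₁ ((G.str.ops.wr_congr e sa _ _).trans e₂) (y.f.F₁.map_comp _ _)) _ _ _ _ _ _ _

/-- Coherence of a 2-cell between two lax double functors. -/
structure Coh (x y : LaxDbl D E) (π : x.f ⟶ y.f) : Prop where
  unit : ∀ a, x.unit a ≫ π.φ₁.app (D.str.ops.one.obj a) = E.str.ops.one.map (π.φ₀.app a) ≫ y.unit a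
  mult : ∀ u v h, x.mult u v h ≫ π.φ₁.app (D.str.ops.comp u v h) =
    E.str.ops.cmap (π.φ₁.app u) (π.φ₁.app v) (Consec.app π h) ≫ y.mult u v h

lemma lx_cell {x y : LaxDbl D E} {π : x.f ⟶ y.f} (hπ : Coh x y π) (l : List D.graph.A₁) (w : D.graph.A₁) {W W' : E.graph.A₁}
    {a : W ⟶ x.f.F₁.obj w} {a' : W' ⟶ y.f.F₁.obj w} (s s') {g : W ⟶ W'} (e : a ≫ π.φ₁.app w = g ≫ a') (c h H H') :
    x.lx l w h W a s H ≫ π.φ₁.app (D.str.ops.fold l w h) =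
      E.str.ops.cfold (.app π l) g c H H' ≫ y.lx l w h W' a' s' H' := by
  induction l generalizing w W W' with
  | nil => exact e
  | cons u l ih =>
    have k : Consec g (π.φ₁.app u) := c.1.symm
    have k' : Consec (π.φ₁.app w) (π.φ₁.app u) := Consec.app π h.1.symm
    refine ih (D.str.ops.comp w u h.1.symm) _ _ ?_ _ _ _ _
    have e₁ := E.str.ops.cmap_wr g (π.φ₁.app u) k a' s' k.right (k.comp_special s')
    have e₂ := E.str.ops.wr_cmap (π.φ₁.app w) (π.φ₁.app u) k' a s k.left (s.comp_consec k')
    exact ((Category.assoc _ _ _).trans ((congrArg (_ ≫ ·) (hπ.mult w u h.1.symm)).trans ((Category.assoc _ _ _).symm.trans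
      (congrArg (· ≫ _) (e₂.trans ((E.str.ops.cmap_congr e rfl _ _).trans e₁.symm)))))).trans (Category.assoc _ _ _)

/-- The comparison of a lax double functor with the left bracketed composite of a path. -/
def lxEval : (l : List D.graph.A₁) → (x : D.graph.A₀) → (h : Chn D.graph x l) →
    (H : Chn E.graph (F.f.F₀.obj x) (l.map F.f.F₁.obj)) →
    (E.str.ops.eval (F.f.F₀.obj x) (l.map F.f.F₁.obj) H ⟶ F.f.F₁.obj (D.str.ops.eval x l h))
  | [], x, _, _ => F.unit x
  | u :: l, _, h, H => F.lx l u h.2 _ (𝟙 _) (.id _) H.2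

lemma lxEval_special (l : List D.graph.A₁) (x : D.graph.A₀) (h) (H) : Special (F.lxEval l x h H) := by
  cases l with
  | nil => exact F.unit_special x
  | cons u l => exact F.lx_special _ _ _ _ _ _

lemma isIso_lxEval (i : ∀ x, IsIso (F.unit x)) (j : ∀ u v h, IsIso (F.mult u v h)) (l : List D.graph.A₁)
    (x : D.graph.A₀) (h) (H) : IsIso (F.lxEval l x h H) := by
  cases l with
  | nil => exact i x
  | cons u l => exact F.isIso_lx j _ _ _ _ _ _

lemma lxEval_nat {l l' : List D.graph.A₁} (cs : Cells D.graph l l') {x x' : D.graph.A₀} (a : x ⟶ x') (c d h h' H H') :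
    E.str.ops.ceval (F.f.F₀.map a) (cs.map F.f) c H H' ≫ F.lxEval l' x' h' H' =
      F.lxEval l x h H ≫ F.f.F₁.map (D.str.ops.ceval a cs d h h') := by
  cases cs with
  | nil => exact F.unit_nat a
  | cons f cs =>
    exact F.lx_nat cs f (.id _) (.id _) ((Category.comp_id _).trans (Category.id_comp _).symm) _ _ _ _ _ _

/-- The comparison of a lax double functor with left bracketed composition. -/
def ext : (pathMap F.f ≫ E.str.ops.evalG : pathGph D.graph ⟶ E.graph) ⟶ D.str.ops.evalG ≫ F.f where
  φ₀ := 𝟙 F.f.F₀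
  φ₁ :=
    { app p := F.lxEval p.edges p.start p.chain (mapPath F.f p).chain
      naturality p q f := by
        have e := E.str.ops.mk_evalF_map ((pathFunctor F.f).map f) (a := F.f.F₀.map ((Path.srcF _).map f))
          (cs := (Cells.ofHom f).map F.f) (congrArg (mapA F.f.F₀) (mapA_srcF f).symm)
          ((congrArg (List.map (mapA F.f.F₁)) (Cells.toList_ofHom f).symm).trans (Cells.toList_map _ _).symm)
          ((Cells.ofHom f).chain_map F.f (Cells.chain_ofHom f)) (mapPath F.f p).chain (mapPath F.f q).chain
        exact (congrArg (· ≫ _) (Arrow.mk_injective _ _ e)).trans (F.lxEval_nat _ _ _ _ _ _ _ _) }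
  src p := (F.lxEval_special _ _ _ _).1.trans (mk_id_congr (E.str.ops.src_eval _))
  tgt p := (F.lxEval_special _ _ _ _).2.trans (mk_id_congr ((E.str.ops.tgt_eval _).trans
    (GPath.last_map F.f.F₀.obj F.f.F₁.obj F.f.src_obj F.f.tgt_obj p)))

/-- The comparison of a lax double functor with left bracketed composition, as an arrow. -/
abbrev ec : Arrow (pathGph D.graph ⟶ E.graph) := Arrow.mk F.ext

lemma isIso_ext (i : ∀ x, IsIso (F.unit x)) (j : ∀ u v h, IsIso (F.mult u v h)) : IsIso F.ext :=
  isIso_cell F.ext (fun _ => inferInstanceAs (IsIso (𝟙 _))) fun _ => F.isIso_lxEval i j _ _ _ _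

lemma isIdArrow_lx (P Q : D.graph.A₁ → Prop) (hP : ∀ w u h, P w → Q u → P (D.str.ops.comp w u h))
    (hF : ∀ w u h, P w → Q u → IsIdArrow (Arrow.mk (F.mult w u h))) (l : List D.graph.A₁) (w : D.graph.A₁) (h)
    {W : E.graph.A₁} (a : W ⟶ F.f.F₁.obj w) (s H) (ha : IsIdArrow (Arrow.mk a)) (hw : P w) (hl : ∀ u ∈ l, Q u) :
    IsIdArrow (Arrow.mk (F.lx l w h W a s H)) := by
  induction l generalizing w W with
  | nil => exact ha
  | cons u l ih =>
    have hu := hl u List.mem_cons_self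
    exact ih _ _ _ _ _ (IsIdArrow.mk_comp (E.str.ops.isIdArrow_cmap ha (.mk_id _) _) (hF _ _ _ hw hu)) (hP _ _ _ hw hu)
      fun v hv => hl v (List.mem_cons_of_mem _ hv)

lemma isIdArrow_ext (h₀ : ∀ x, IsIdArrow (Arrow.mk (F.unit x))) (h₁ : ∀ u v h, IsIdArrow (Arrow.mk (F.mult u v h))) :
    IsIdArrow F.ec := by
  refine isIdArrow_of_ap (fun x => .mk_id _) fun p => ?_
  obtain ⟨x, l, ch⟩ := p
  cases l with
  | nil => exact h₀ x
  | cons u l =>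
    exact F.isIdArrow_lx (fun _ => True) (fun _ => True) (fun _ _ _ _ _ => trivial) (fun _ _ _ _ _ => h₁ _ _ _) l u _ _ _ _
      (.mk_id _) trivial fun _ _ => trivial

lemma ext_comp (y : LaxDbl E G) : some (F.comp y).ec = pcomp (some (whL (pathMap F.f) y.ec)) (some (whR F.ec y.f)) := by
  have h : (whL (pathMap F.f) y.ec).right = (whR F.ec y.f).left := rfl
  refine (congrArg some ?_).trans (some_vcomp _ _ h)
  refine cell_arrow_ext (congrArg (fun k => k ≫ G.str.ops.evalG) (pathMap_comp F.f y.f)) rfl (fun x => ?_) fun p => ?_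
  · refine Option.some_injective _ (Eq.symm ((ap₀_vcomp _ _ h x).trans ?_))
    exact (((IsIdArrow.mk_id _).mapA y.f.F₀).pcomp_right rfl).trans (congrArg some ((IsIdArrow.mk_id _).ext (IsIdArrow.mk_id _) rfl))
  · refine Option.some_injective _ (Eq.symm ((ap_vcomp _ _ h p).trans ((oa_comp _ _).symm.trans (congrArg some ?_))))
    obtain ⟨x, l, ch⟩ := p
    cases l with
    | nil => rfl
    | cons u l =>
      exact (F.lx_comp y l u (𝟙 _) (𝟙 _) ((Category.id_comp _).trans (y.f.F₁.map_id _)).symm (.id _) (.id _) (.id _) _ _ _ _).symm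

lemma Coh.ext {x y : LaxDbl D E} {π : x.f ⟶ y.f} (hπ : Coh x y π) :
    pcomp (some x.ec) (some (whL D.str.ops.evalG (Arrow.mk π))) =
      pcomp (some (whR (pcell (Arrow.mk π)) E.str.ops.evalG)) (some y.ec) := by
  have h₁ : x.ec.right = (whL D.str.ops.evalG (Arrow.mk π)).left := rfl
  have h₂ : (whR (pcell (Arrow.mk π)) E.str.ops.evalG).right = y.ec.left := rfl
  refine (some_vcomp _ _ h₁).symm.trans ((congrArg some ?_).trans (some_vcomp _ _ h₂))
  refine cell_arrow_ext rfl rfl (fun a => ?_) fun p => ?_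
  · refine Option.some_injective _ ((ap₀_vcomp _ _ h₁ a).trans (Eq.trans ?_ (ap₀_vcomp _ _ h₂ a).symm))
    have k₁ : IsIdArrow (ap₀ x.ec a) := .mk_id _
    have k₂ : IsIdArrow (ap₀ y.ec a) := .mk_id _
    exact (k₁.pcomp_left rfl).trans (k₂.pcomp_right rfl).symm
  · refine Option.some_injective _ ((ap_vcomp _ _ h₁ p).trans (Eq.trans ?_ (ap_vcomp _ _ h₂ p).symm))
    refine (oa_comp _ _).symm.trans (Eq.trans ?_ (oa_comp _ _))
    have e := fun (H) => E.str.ops.mk_evalF_map (ap (pcell (Arrow.mk π)) p).hom (a := π.φ₀.app p.start)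
      (cs := Cells.app π p.edges) rfl (Cells.toList_app π p.edges).symm H (mapPath x.f p).chain (mapPath y.f p).chain
    refine Eq.trans ?_ (congrArg (fun k => oa (k ≫ y.lxEval _ _ _ _)) (Arrow.mk_injective _ _ (e ?_)).symm)
    swap
    · rw [Cells.toList_app]
      exact (compPath π p).chain
    refine congrArg oa ?_
    obtain ⟨x', l, ch⟩ := p
    cases l with
    | nil => exact hπ.unit x'
    | cons u l =>
      exact lx_cell hπ l u (.id _) (.id _) ((Category.id_comp _).trans (Category.comp_id _).symm) _ _ _ _

end LaxDbl

lemma Cells.map_id {A B : GphCat.{u}} (F : A ⟶ B) (l : List A.A₁) : (Cells.id l).map F = Cells.id (l.map F.F₁.obj) := by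
  induction l with
  | nil => rfl
  | cons v l ih => exact congrArg₂ Cells.cons (F.F₁.map_id v) ih

namespace VertOps
variable {A : GphCat.{u}} (O : VertOps A)

lemma cmap_eq_wl_wr {u u' v v' : A.A₁} (f : u ⟶ u') (g : v ⟶ v') (s : Special f) (t : Special g) (c : Consec f g) (h) :
    O.cmap f g c = O.wl u g t c.left ≫ O.wr f s v' h :=
  (O.cmap_congr (Category.id_comp f).symm (Category.comp_id g).symm _ _).trans
    (O.cmap_comp _ _ _ _ ((Special.id u).consec t c.left) (s.consec (.id v') h))

lemma cmap_eq_wr_wl {u u' v v' : A.A₁} (f : u ⟶ u') (g : v ⟶ v') (s : Special f) (t : Special g) (c : Consec f g) (h) :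
    O.cmap f g c = O.wr f s v c.left ≫ O.wl u' g t h :=
  (O.cmap_congr (Category.comp_id f).symm (Category.id_comp g).symm _ _).trans
    (O.cmap_comp _ _ _ _ (s.consec (.id v) c.left) ((Special.id u').consec t h))

end VertOps

namespace LaxDbl
variable {D E : WDbl.{u}} (F : LaxDbl D E)

lemma map_id_toList (l : List D.graph.A₁) : ((Cells.id l).map F.f).toList = (Cells.id (l.map F.f.F₁.obj)).toList :=
  congrArg Cells.toList (Cells.map_id F.f l)

lemma assoc_cmap_step {K : Type*} [Category K] {X₁ X₂ X₃ X₄ X₅ Y₁ Y₂ Y₃ : K}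
    {a : X₁ ⟶ X₂} {x : X₂ ⟶ X₃} {m : X₃ ⟶ X₄} {t : X₄ ⟶ X₅} {c : X₁ ⟶ Y₁} {a' : Y₁ ⟶ X₃} (n : a ≫ x = c ≫ a')
    {p : Y₁ ⟶ Y₂} {q : Y₂ ⟶ Y₃} {r : Y₃ ⟶ X₅} (e : p ≫ q ≫ r = a' ≫ m ≫ t)
    {z : X₁ ⟶ Y₂} (hz : z = c ≫ p) {v : X₂ ⟶ X₄} (hv : v = x ≫ m) : a ≫ v ≫ t = (z ≫ q) ≫ r := by
  rw [hv, hz, Category.assoc, reassoc_of% n, ← e]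
  simp only [Category.assoc]

lemma assoc_cmap {w u v : D.graph.A₁} (h : D.graph.tgt.obj w = D.graph.src.obj u) (h' : D.graph.tgt.obj u = D.graph.src.obj v)
    {W U : E.graph.A₁} {b : W ⟶ F.f.F₁.obj w} {a : U ⟶ F.f.F₁.obj u} (s : Special b) (t : Special a)
    (c : Consec b a) (k) (c₁ c₂ h₁ h₂ h₃) :
    (E.str.assoc W U (F.f.F₁.obj v) c.left k).hom ≫
      E.str.ops.wr (E.str.ops.cmap b a c ≫ F.mult w u h) c₁ (F.f.F₁.obj v) h₁ ≫ F.mult (D.str.ops.comp w u h) v h₂ =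
    (E.str.ops.cmap b (E.str.ops.wr a t (F.f.F₁.obj v) k ≫ F.mult u v h') c₂ ≫ F.mult w (D.str.ops.comp u v h') h₃) ≫
      F.f.F₁.map (D.str.assoc w u v h h').hom := by
  have k' : Consec a (𝟙 (F.f.F₁.obj v)) := t.consec (.id _) k
  have n := E.str.assoc_nat b a (𝟙 (F.f.F₁.obj v)) c k'
  exact assoc_cmap_step n.symm (F.assoc w u v h h')
    ((E.str.ops.cmap_congr (Category.comp_id b).symm rfl c₂ _).trans
      (E.str.ops.cmap_comp _ _ _ _ (VertOps.c_left c k') ((Special.id _).consec (F.mult_special u v h')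
      (VertOps.h_left (map_tgt_src F.f h) (map_tgt_src F.f h')))))
    (E.str.ops.cmap_comp_id _ _ _ _ _)

lemma slide_lx : ∀ (l : List D.graph.A₁) (w u : D.graph.A₁) (h : D.graph.tgt.obj w = D.graph.src.obj u)
    (hl : Chn D.graph (D.graph.tgt.obj u) l) {W U : E.graph.A₁} {b : W ⟶ F.f.F₁.obj w} {a : U ⟶ F.f.F₁.obj u}
    (s : Special b) (t : Special a) (c : Consec b a) (H : Chn E.graph (E.graph.tgt.obj U) (l.map F.f.F₁.obj))
    (c' : Consec b (F.lx l u hl U a t H)) (s' H' h₁ h₂),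
    E.str.slide (l.map F.f.F₁.obj) W U c.left H ≫
        F.lx l (D.str.ops.comp w u h) h₁ _ (E.str.ops.cmap b a c ≫ F.mult w u h) s' H' =
      E.str.ops.cmap b (F.lx l u hl U a t H) c' ≫ F.mult w (D.str.ops.fold l u hl) h₂ ≫
        F.f.F₁.map (D.str.slide l w u h hl)
  | [], w, u, h, hl, W, U, b, a, s, t, c, H, c', s', H', h₁, h₂ => by
    exact (Category.id_comp _).trans (congrArg (_ ≫ ·) ((congrArg (_ ≫ ·) (F.f.F₁.map_id _)).trans (Category.comp_id _)).symm)
  | v :: l, w, u, h, hl, W, U, b, a, s, t, c, H, c', s', H', h₁, h₂ => by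
    have hv := hl.1.symm
    have k := H.1.symm
    have c₂ : Consec b (E.str.ops.wr a t (F.f.F₁.obj v) k ≫ F.mult u v hv) :=
      c'.trans ((F.lx_special l _ (D.str.ops.Chn_comp hl hv) _ (F.step_special hv t k) (E.str.ops.Chn_comp H k)).1.trans
        ((mk_id_congr (E.str.ops.src_fold _ _ _)).trans (F.step_special hv t k).1.symm))
    have h₃ : D.graph.tgt.obj w = D.graph.src.obj (D.str.ops.comp u v hv) := VertOps.h_left h hv
    have sa := D.str.assoc_special w u v h hv
    have sA := E.str.assoc_special W U (F.f.F₁.obj v) c.left k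
    have sη : Special (E.str.ops.cmap b (E.str.ops.wr a t (F.f.F₁.obj v) k ≫ F.mult u v hv) c₂ ≫ F.mult w _ h₃) :=
      (E.str.ops.cmap_special s (F.step_special hv t k) c₂).comp (F.mult_special _ _ _)
    have hh := D.str.ops.Chn_comp hl hv
    have HH := E.str.ops.Chn_comp H k
    have ih := slide_lx l w (D.str.ops.comp u v hv) h₃ hh s (F.step_special hv t k) c₂ HH c' sη
      (E.str.h_slide c₂.left HH) (D.str.h_slide h₃ hh) h₂
    have e := F.assoc_cmap h hv s t c k s' c₂ H'.1.symm h₁.1.symm h₃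
    have n := F.lx_nat (.id l) (D.str.assoc w u v h hv).hom sη (F.step_special h₁.1.symm s' H'.1.symm) e
      ((F.map_id_toList l).symm ▸ sA.cchain (E.str.h_slide c₂.left HH)) (sa.cchain (D.str.h_slide h₃ hh)) (D.str.h_slide h₃ hh)
      (D.str.ops.Chn_comp h₁ _) (E.str.h_slide c₂.left HH) (E.str.ops.Chn_comp H' _)
    refine (Category.assoc _ _ _).trans ((congrArg (_ ≫ ·) ((congrArg (· ≫ _) (E.str.ops.cfold_congr (Cells.map_id F.f l).symm
      rfl _ _ _ _)).trans n)).trans ?_)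
    exact (Category.assoc _ _ _).symm.trans ((congrArg (· ≫ _) ih).trans ((Category.assoc _ _ _).trans
      (congrArg (_ ≫ ·) ((Category.assoc _ _ _).trans (congrArg (_ ≫ ·) (F.f.F₁.map_comp _ _).symm)))))

lemma slideEval_lx (l : List D.graph.A₁) (w : D.graph.A₁) (y : D.graph.A₀) (hw : D.graph.tgt.obj w = y) (hl : Chn D.graph y l)
    {W : E.graph.A₁} {b : W ⟶ F.f.F₁.obj w} (s : Special b) (hW : E.graph.tgt.obj W = F.f.F₀.obj y)
    (H : Chn E.graph (F.f.F₀.obj y) (l.map F.f.F₁.obj)) (c : Consec b (F.lxEval l y hl H)) (h₁ h₂) :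
    E.str.slideEval (l.map F.f.F₁.obj) W (F.f.F₀.obj y) hW H ≫ F.lx l w h₁ W b s (H.of_eq hW) =
      E.str.ops.cmap b (F.lxEval l y hl H) c ≫ F.mult w (D.str.ops.eval y l hl) h₂ ≫
        F.f.F₁.map (D.str.slideEval l w y hw hl) := by
  cases l with
  | nil =>
    have e := F.runit w y hw
    have k : E.graph.tgt.obj (F.f.F₁.obj w) = F.f.F₀.obj y := s.tgt_eq.trans hW
    have n := E.str.wr_runit b s hW k
    have h := E.str.ops.cmap_eq_wr_wl b (F.unit y) s (F.unit_special y) c (VertOps.h_runit k)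
    exact n.symm.trans ((congrArg (_ ≫ ·) e.symm).trans ((Category.assoc _ _ _).symm.trans (congrArg (· ≫ _) h.symm)))
  | cons v l =>
    exact F.slide_lx l w v (hw.trans hl.1.symm) hl.2 s (.id _) (hW.trans H.1.symm |> s.consec (.id _)) H.2 c _ _ _ _

lemma merge_lx (k : List D.graph.A₁) (u : D.graph.A₁) (h : Chn D.graph (D.graph.tgt.obj u) k) (l : List D.graph.A₁) (y : D.graph.A₀)
    (hy : lastV D.graph.tgt.obj (D.graph.tgt.obj u) k = y) (hl : Chn D.graph y l)
    {U : E.graph.A₁} {b : U ⟶ F.f.F₁.obj u} (s : Special b) (H : Chn E.graph (E.graph.tgt.obj U) (k.map F.f.F₁.obj)) (hY)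
    (HL : Chn E.graph (F.f.F₀.obj y) (l.map F.f.F₁.obj)) (c : Consec (F.lx k u h U b s H) (F.lxEval l y hl HL)) (h₁ H₁ h₂) :
    pcomp (oa (E.str.merge (k.map F.f.F₁.obj) U H (l.map F.f.F₁.obj) (F.f.F₀.obj y) hY HL)) (oa (F.lx (k ++ l) u h₁ U b s H₁)) =
      oa (E.str.ops.cmap (F.lx k u h U b s H) (F.lxEval l y hl HL) c ≫ F.mult (D.str.ops.fold k u h) (D.str.ops.eval y l hl) h₂ ≫
        F.f.F₁.map (D.str.merge k u h l y hy hl)) := by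
  induction k generalizing u U with
  | nil => exact (oa_comp _ _).symm.trans (congrArg oa (F.slideEval_lx l u y hy hl s hY HL c _ _))
  | cons v k ih =>
    exact ih (D.str.ops.comp u v h.1.symm) (D.str.ops.Chn_comp h _) (D.str.lastV_comp hy _) _
      (E.str.ops.Chn_comp H _) (E.str.lastV_comp hY _) c _ _ _

lemma mergeEval_lx (k : List D.graph.A₁) (x : D.graph.A₀) (h : Chn D.graph x k) (l : List D.graph.A₁) (y : D.graph.A₀)
    (hy : lastV D.graph.tgt.obj x k = y) (hl : Chn D.graph y l) (H : Chn E.graph (F.f.F₀.obj x) (k.map F.f.F₁.obj)) (hY)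
    (HL : Chn E.graph (F.f.F₀.obj y) (l.map F.f.F₁.obj)) (c : Consec (F.lxEval k x h H) (F.lxEval l y hl HL)) (h₁ H₁ h₂) :
    pcomp (oa (E.str.mergeEval (k.map F.f.F₁.obj) (F.f.F₀.obj x) H (l.map F.f.F₁.obj) (F.f.F₀.obj y) hY HL))
        (oa (F.lxEval (k ++ l) x h₁ H₁)) =
      oa (E.str.ops.cmap (F.lxEval k x h H) (F.lxEval l y hl HL) c ≫ F.mult (D.str.ops.eval x k h) (D.str.ops.eval y l hl) h₂ ≫
        F.f.F₁.map (D.str.mergeEval k x h l y hy hl)) := by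
  cases k with
  | nil =>
    obtain rfl : x = y := hy
    have s := F.lxEval_special l x hl HL
    have k₀ : x = D.graph.src.obj (D.str.ops.eval x l hl) := (D.str.ops.src_eval hl).symm
    have k₁ : F.f.F₀.obj x = E.graph.src.obj (F.f.F₁.obj (D.str.ops.eval x l hl)) :=
      (congrArg F.f.F₀.obj k₀).trans (F.f.src_obj _).symm
    have k₂ : F.f.F₀.obj x = E.graph.src.obj (E.str.ops.eval (F.f.F₀.obj x) (l.map F.f.F₁.obj) HL) := (E.str.ops.src_eval HL).symm
    have e := F.lunit x _ k₀
    have n := E.str.wl_lunit (F.lxEval l x hl HL) s k₂ k₁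
    have w := E.str.ops.cmap_eq_wl_wr (F.unit x) (F.lxEval l x hl HL) (F.unit_special x) s c (VertOps.h_lunit k₁)
    refine (congrArg₂ pcomp (congrArg oa (E.str.mergeEval_nil _ _ _ hY HL k₂)) rfl).trans ((oa_comp _ _).symm.trans (congrArg oa ?_))
    refine n.symm.trans ((congrArg (_ ≫ ·) e.symm).trans ((Category.assoc _ _ _).symm.trans (congrArg₂ (· ≫ ·) w.symm ?_)))
    exact congrArg (_ ≫ ·) (congrArg F.f.F₁.map (D.str.mergeEval_nil _ _ _ rfl hl k₀).symm)
  | cons v k => exact F.merge_lx k v h.2 l y hy hl (.id _) H.2 hY HL c _ _ _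

end LaxDbl

lemma free_map_mult {A B : GphCat.{u}} (f : A ⟶ B) :
    pathMonad.T.map (pathMap f) ≫ (pathMonad.free B).str.a = (pathMonad.free A).str.a ≫ pathMap f := pathMult_nat f

/-- The free lax double functor on a morphism of graphs. -/
noncomputable def freeMap {A B : GphCat.{u}} (f : A ⟶ B) : LaxDbl (freeDbl A) (freeDbl B) :=
  (LaxMor.ofStrict (pathMonad.free_isStrict A) (pathMonad.free_isStrict B) (pathMap f) (free_map_mult f)).biased
    (pathMonad.free_isNormal A) (pathMonad.free_isNormal B)

lemma freeMap_unit {A B : GphCat.{u}} (f : A ⟶ B) (x : A.A₀) : IsIdArrow (Arrow.mk ((freeMap f).unit x)) := by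
  have e := LaxMor.mk_biased_unit (pathMonad.free_isNormal A) (pathMonad.free_isNormal B)
    (LaxMor.ofStrict (pathMonad.free_isStrict A) (pathMonad.free_isStrict B) (pathMap f) (free_map_mult f)) x
  have k := (IsIdArrow.mk_eqToHom (free_map_mult f)).ap (X := pathGph (pathGph A)) (nilPath (A := pathGph A) x)
  exact e ▸ k

lemma freeMap_mult {A B : GphCat.{u}} (f : A ⟶ B) (p q : Path A) (h) : IsIdArrow (Arrow.mk ((freeMap f).mult p q h)) := by
  have e := LaxMor.mk_biased_mult (pathMonad.free_isNormal A) (pathMonad.free_isNormal B)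
    (LaxMor.ofStrict (pathMonad.free_isStrict A) (pathMonad.free_isStrict B) (pathMap f) (free_map_mult f)) p q h
  have k := (IsIdArrow.mk_eqToHom (free_map_mult f)).ap (X := pathGph (pathGph A)) (pairPath (A := pathGph A) p q h)
  exact e ▸ k

namespace LaxDbl
variable {D E : WDbl.{u}} (F : LaxDbl D E)

lemma lxEval_mk_congr {l l' : List D.graph.A₁} {x x' : D.graph.A₀} (e : l = l') (e' : x = x') (h h' H H') :
    Arrow.mk (F.lxEval l x h H) = Arrow.mk (F.lxEval l' x' h' H') := by subst e e'; rfl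

/-- Left bracketed composition, as a pseudo double functor. -/
noncomputable abbrev _root_.TripleCat.WDbl.ev (D : WDbl.{u}) : PseudoDbl (freeDbl D.graph) D := D.str.evalDbl

lemma ext_coh : Coh ((freeMap F.f).comp E.ev.toLaxDbl) (D.ev.toLaxDbl.comp F) F.ext where
  unit x := by
    refine oa_inj ((oa_comp _ _).trans (Eq.trans ?_ (oa_comp _ _).symm))
    refine Eq.trans (b := oa (F.unit x)) ?_ ?_
    · refine (congrArg₂ pcomp (oa_comp _ _) rfl).trans ((congrArg₂ pcomp (IsIdArrow.pcomp_right
        ((freeMap_unit F.f x).mapA E.str.ops.evalF) rfl) rfl).trans (idc_pcomp _ rfl))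
    · refine Eq.symm ((congrArg (pcomp _) ((oa_comp _ _).trans (IsIdArrow.pcomp_right
        ((IsIdArrow.mk_id (D.str.ops.one.obj x)).mapA F.f.F₁) rfl))).trans ?_)
      exact IsIdArrow.pcomp_left ((IsIdArrow.mk_id (F.f.F₀.obj x)).mapA E.str.ops.one) rfl
  mult p q h := by
    have hh := Chn.append p.chain h q.chain
    have e := F.mergeEval_lx p.edges p.start p.chain q.edges q.start h q.chain (mapPath F.f p).chain
      (map_tgt_src (pathMap F.f) h) (mapPath F.f q).chain (Consec.app F.ext h) hh (Chn.map F.f hh)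
      (map_tgt_src (A := pathGph D.graph) D.str.ops.evalG h)
    have m₁ := E.str.mk_mergePath (mapPath F.f p) (mapPath F.f q) (map_tgt_src (pathMap F.f) h)
    have m₂ := D.str.mk_mergePath p q h
    refine oa_inj ((oa_comp _ _).trans ?_)
    refine (congrArg₂ pcomp ((oa_comp _ _).trans (IsIdArrow.pcomp_right
        ((freeMap_mult F.f p q h).mapA E.str.ops.evalF) rfl)) rfl).trans ?_
    refine (congrArg₂ pcomp (congrArg some m₁) (congrArg some (F.lxEval_mk_congr (freeDbl_comp_edges p q h) rfl _ _ _ _))).trans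
      (e.trans ?_)
    refine (oa_comp _ _).trans (Eq.trans (congrArg (pcomp _) ?_) (oa_comp _ _).symm)
    exact (oa_comp _ _).trans ((congrArg (pcomp _) (congrArg some (mapA_congr' F.f.F₁ m₂.symm))).trans (oa_comp _ _).symm)

end LaxDbl

namespace ColaxDbl
variable {D E : WDbl.{u}} (F : ColaxDbl D E)

lemma step_special {w u : D.graph.A₁} (h : D.graph.tgt.obj w = D.graph.src.obj u) {W : E.graph.A₁}
    {a : F.f.F₁.obj w ⟶ W} (s : Special a) :
    Special (F.mult w u h ≫ E.str.ops.wr a s (F.f.F₁.obj u) (map_tgt_src F.f h)) :=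
  (F.mult_special _ _ _).comp (E.str.ops.wr_special _ _ _)

/-- The comparison of a colax double functor with left bracketed composites. -/
def cx : (l : List D.graph.A₁) → (w : D.graph.A₁) → (h : Chn D.graph (D.graph.tgt.obj w) l) → (W : E.graph.A₁) →
    (a : F.f.F₁.obj w ⟶ W) → (s : Special a) → (H : Chn E.graph (E.graph.tgt.obj W) (l.map F.f.F₁.obj)) →
    (F.f.F₁.obj (D.str.ops.fold l w h) ⟶ E.str.ops.fold (l.map F.f.F₁.obj) W H)
  | [], _, _, _, a, _, _ => a
  | u :: l, w, h, _, _, s, H => cx l (D.str.ops.comp w u h.1.symm) (D.str.ops.Chn_comp h _) _ _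
      (F.step_special h.1.symm s) (E.str.ops.Chn_comp H _)

lemma cx_special (l : List D.graph.A₁) (w : D.graph.A₁) (h) {W : E.graph.A₁} (a : F.f.F₁.obj w ⟶ W) (s H) :
    Special (F.cx l w h W a s H) := by
  induction l generalizing w W with
  | nil => exact s
  | cons u l ih => exact ih _ _ _ _ _

lemma cx_nat {l l' : List D.graph.A₁} (cs : Cells D.graph l l') {w w' : D.graph.A₁} (g : w ⟶ w') {W W' : E.graph.A₁}
    {a : F.f.F₁.obj w ⟶ W} {a' : F.f.F₁.obj w' ⟶ W'} (s s') {g' : W ⟶ W'} (e : F.f.F₁.map g ≫ a' = a ≫ g') (c d h h' H H') :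
    F.f.F₁.map (D.str.ops.cfold cs g d h h') ≫ F.cx l' w' h' W' a' s' H' =
      F.cx l w h W a s H ≫ E.str.ops.cfold (cs.map F.f) g' c H H' := by
  induction cs generalizing w w' W W' with
  | nil => exact e
  | @cons u u' l l' f cs ih =>
    have k : Consec g' (F.f.F₁.map f) := c.1.symm
    have k' : Consec g f := d.1.symm
    refine ih (D.str.ops.cmap g f k') _ _ ?_ (c.2.of_eq (E.str.ops.cmap_tgt g' _ k)) _ _ _ _ _
    have e₁ := E.str.ops.cmap_wr (F.f.F₁.map g) (F.f.F₁.map f) (k'.map F.f) a' s' (k'.map F.f).right ((k'.map F.f).comp_special s')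
    have e₂ := E.str.ops.wr_cmap g' (F.f.F₁.map f) k a s (k'.map F.f).left (s.comp_consec k)
    have e₃ := F.mult_nat g f k'
    exact ((Category.assoc _ _ _).symm.trans ((congrArg (· ≫ _) e₃).trans (Category.assoc _ _ _))).trans
      ((congrArg (_ ≫ ·) (e₁.trans ((E.str.ops.cmap_congr e rfl _ _).trans e₂.symm))).trans (Category.assoc _ _ _).symm)

/-- The comparison of a colax double functor with the left bracketed composite of a path. -/
def cxEval : (l : List D.graph.A₁) → (x : D.graph.A₀) → (h : Chn D.graph x l) →
    (H : Chn E.graph (F.f.F₀.obj x) (l.map F.f.F₁.obj)) →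
    (F.f.F₁.obj (D.str.ops.eval x l h) ⟶ E.str.ops.eval (F.f.F₀.obj x) (l.map F.f.F₁.obj) H)
  | [], x, _, _ => F.unit x
  | u :: l, _, h, H => F.cx l u h.2 _ (𝟙 _) (.id _) H.2

lemma cxEval_special (l : List D.graph.A₁) (x : D.graph.A₀) (h) (H) : Special (F.cxEval l x h H) := by
  cases l with
  | nil => exact F.unit_special x
  | cons u l => exact F.cx_special _ _ _ _ _ _

lemma cxEval_nat {l l' : List D.graph.A₁} (cs : Cells D.graph l l') {x x' : D.graph.A₀} (a : x ⟶ x') (c d h h' H H') :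
    F.f.F₁.map (D.str.ops.ceval a cs d h h') ≫ F.cxEval l' x' h' H' =
      F.cxEval l x h H ≫ E.str.ops.ceval (F.f.F₀.map a) (cs.map F.f) c H H' := by
  cases cs with
  | nil => exact F.unit_nat a
  | cons f cs =>
    exact F.cx_nat cs f (.id _) (.id _) ((Category.comp_id _).trans (Category.id_comp _).symm) _ _ _ _ _ _

/-- The comparison of a colax double functor with left bracketed composition. -/
def ext : (D.str.ops.evalG ≫ F.f : pathGph D.graph ⟶ E.graph) ⟶ pathMap F.f ≫ E.str.ops.evalG where
  φ₀ := 𝟙 F.f.F₀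
  φ₁ :=
    { app p := F.cxEval p.edges p.start p.chain (mapPath F.f p).chain
      naturality p q f := by
        have e := E.str.ops.mk_evalF_map ((pathFunctor F.f).map f) (a := F.f.F₀.map ((Path.srcF _).map f))
          (cs := (Cells.ofHom f).map F.f) (congrArg (mapA F.f.F₀) (mapA_srcF f).symm)
          ((congrArg (List.map (mapA F.f.F₁)) (Cells.toList_ofHom f).symm).trans (Cells.toList_map _ _).symm)
          ((Cells.ofHom f).chain_map F.f (Cells.chain_ofHom f)) (mapPath F.f p).chain (mapPath F.f q).chain
        exact (F.cxEval_nat _ _ _ _ _ _ _ _).trans (congrArg (_ ≫ ·) (Arrow.mk_injective _ _ e).symm) }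
  src p := (F.cxEval_special _ _ _ _).1.trans (mk_id_congr ((F.f.src_obj _).trans (congrArg F.f.F₀.obj (D.str.ops.src_eval _))))
  tgt p := (F.cxEval_special _ _ _ _).2.trans (mk_id_congr ((F.f.tgt_obj _).trans (congrArg F.f.F₀.obj (D.str.ops.tgt_eval _))))

/-- The comparison of a colax double functor with left bracketed composition, as an arrow. -/
abbrev ec : Arrow (pathGph D.graph ⟶ E.graph) := Arrow.mk F.ext

lemma isIdArrow_cx (hF : ∀ w u h, IsIdArrow (Arrow.mk (F.mult w u h))) (l : List D.graph.A₁) (w : D.graph.A₁) (h)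
    {W : E.graph.A₁} (a : F.f.F₁.obj w ⟶ W) (s H) (ha : IsIdArrow (Arrow.mk a)) :
    IsIdArrow (Arrow.mk (F.cx l w h W a s H)) := by
  induction l generalizing w W with
  | nil => exact ha
  | cons u l ih => exact ih _ _ _ _ _ (IsIdArrow.mk_comp (hF _ _ _) (E.str.ops.isIdArrow_cmap ha (.mk_id _) _))

lemma isIdArrow_ext (h₀ : ∀ x, IsIdArrow (Arrow.mk (F.unit x))) (h₁ : ∀ u v h, IsIdArrow (Arrow.mk (F.mult u v h))) :
    IsIdArrow F.ec := by
  refine isIdArrow_of_ap (fun x => .mk_id _) fun p => ?_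
  obtain ⟨x, l, ch⟩ := p
  cases l with
  | nil => exact h₀ x
  | cons u l => exact F.isIdArrow_cx h₁ l u _ _ _ _ (.mk_id _)

variable {G : WDbl.{u}}

lemma cx_comp (y : ColaxDbl E G) (l : List D.graph.A₁) (w : D.graph.A₁) {W' : E.graph.A₁} {W : G.graph.A₁}
    (β : F.f.F₁.obj w ⟶ W') (α : y.f.F₁.obj W' ⟶ W) {a : y.f.F₁.obj (F.f.F₁.obj w) ⟶ W} (e : a = y.f.F₁.map β ≫ α)
    (sa sα sβ h H H' H'') :
    Arrow.mk ((F.comp y).cx l w h W a sa H) =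
      Arrow.mk (y.f.F₁.map (F.cx l w h W' β sβ H') ≫ y.cx (l.map F.f.F₁.obj) W' H' W α sα H'') := by
  induction l generalizing w W W' with
  | nil => exact congrArg Arrow.mk e
  | cons u l ih =>
    have k : Consec β (𝟙 (F.f.F₁.obj u)) := sβ.consec (.id _) (map_tgt_src F.f h.1.symm)
    have k' := k.map y.f
    rw [CategoryTheory.Functor.map_id] at k'
    have e₁ := y.mult_nat_left β k k'
    have e₂ := G.str.ops.wr_comp (y.f.F₁.map β) α (sβ.map y.f) sα (e ▸ sa) (map_tgt_src y.f k.left) (map_tgt_src y.f k.right)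
    refine ih (D.str.ops.comp w u h.1.symm) (F.mult w u h.1.symm ≫ E.str.ops.wr β sβ _ k.left)
      (y.mult W' _ k.right ≫ G.str.ops.wr α sα _ (map_tgt_src y.f k.right)) ?_ _ _ _ _ _ _ _
    refine (Category.assoc _ _ _).trans (Eq.trans ?_ ((congrArg (· ≫ _) (y.f.F₁.map_comp _ _)).trans (Category.assoc _ _ _)).symm)
    refine congrArg (_ ≫ ·) ?_
    refine (congrArg (_ ≫ ·) ((G.str.ops.wr_congr e sa _ _).trans e₂)).trans ?_
    exact (Category.assoc _ _ _).symm.trans ((congrArg (· ≫ _) e₁.symm).trans (Category.assoc _ _ _))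

lemma ext_comp (y : ColaxDbl E G) : some (F.comp y).ec = pcomp (some (whR F.ec y.f)) (some (whL (pathMap F.f) y.ec)) := by
  have h : (whR F.ec y.f).right = (whL (pathMap F.f) y.ec).left := rfl
  refine (congrArg some ?_).trans (some_vcomp _ _ h)
  refine cell_arrow_ext rfl (congrArg (fun k => k ≫ G.str.ops.evalG) (pathMap_comp F.f y.f)) (fun x => ?_) fun p => ?_
  · refine Option.some_injective _ (Eq.symm ((ap₀_vcomp _ _ h x).trans ?_))
    have k : IsIdArrow (ap₀ (whR F.ec y.f) x) := (IsIdArrow.mk_id _).mapA y.f.F₀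
    exact (k.pcomp_left rfl).trans rfl
  · refine Option.some_injective _ (Eq.symm ((ap_vcomp _ _ h p).trans ((oa_comp _ _).symm.trans (congrArg some ?_))))
    obtain ⟨x, l, ch⟩ := p
    cases l with
    | nil => rfl
    | cons u l =>
      exact (F.cx_comp y l u (𝟙 _) (𝟙 _) ((Category.comp_id _).trans (y.f.F₁.map_id _)).symm (.id _) (.id _) (.id _) _ _ _ _).symm

end ColaxDbl

namespace ColaxDbl
variable {D E : WDbl.{u}} (F : ColaxDbl D E)

lemma map_id_toList (l : List D.graph.A₁) : ((Cells.id l).map F.f).toList = (Cells.id (l.map F.f.F₁.obj)).toList :=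
  congrArg Cells.toList (Cells.map_id F.f l)

lemma assoc_cmap_step {K : Type*} [Category K] {X₁ X₂ X₃ X₄ X₅ Y₁ Y₂ Y₃ : K}
    {f : X₁ ⟶ X₂} {m : X₂ ⟶ X₃} {p : X₃ ⟶ X₄} {q : X₄ ⟶ X₅} {v : X₃ ⟶ X₅} (hv : v = p ≫ q)
    {n : X₁ ⟶ Y₁} {c : Y₁ ⟶ Y₂} {d : Y₂ ⟶ Y₃} {z : Y₁ ⟶ Y₃} (hz : z = c ≫ d) {a : Y₂ ⟶ X₄} {a' : Y₃ ⟶ X₅}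
    (e : n ≫ c ≫ a = f ≫ m ≫ p) (k : d ≫ a' = a ≫ q) : f ≫ m ≫ v = (n ≫ z) ≫ a' := by
  rw [hv, hz, Category.assoc, Category.assoc, k]
  simp only [← Category.assoc] at e ⊢
  rw [e]

lemma assoc_cmap {w u v : D.graph.A₁} (h : D.graph.tgt.obj w = D.graph.src.obj u) (h' : D.graph.tgt.obj u = D.graph.src.obj v)
    {W U : E.graph.A₁} {b : F.f.F₁.obj w ⟶ W} {a : F.f.F₁.obj u ⟶ U} (s : Special b) (t : Special a)
    (c : Consec b a) (k) (c₁ c₂ h₁ h₂ h₃ h₄) :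
    F.f.F₁.map (D.str.assoc w u v h h').hom ≫ F.mult (D.str.ops.comp w u h) v h₂ ≫
      E.str.ops.wr (F.mult w u h ≫ E.str.ops.cmap b a c) c₁ (F.f.F₁.obj v) h₁ =
    (F.mult w (D.str.ops.comp u v h') h₃ ≫
      E.str.ops.cmap b (F.mult u v h' ≫ E.str.ops.wr a t (F.f.F₁.obj v) k) c₂) ≫
      (E.str.assoc W U (F.f.F₁.obj v) c.right h₄).hom := by
  have k' : Consec a (𝟙 (F.f.F₁.obj v)) := t.consec (.id _) k
  exact assoc_cmap_step (E.str.ops.cmap_comp_id _ _ _ ((F.mult_special w u h).consec (.id _) h₁) (VertOps.c_right c k'))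
    ((E.str.ops.cmap_congr (Category.id_comp b).symm rfl c₂ _).trans
      (E.str.ops.cmap_comp _ _ _ _ ((Special.id _).consec (F.mult_special u v h') (map_tgt_src F.f h₃)) (VertOps.c_left c k')))
    (F.assoc w u v h h') (E.str.assoc_nat b a (𝟙 (F.f.F₁.obj v)) c k')

lemma slide_cx : ∀ (l : List D.graph.A₁) (w u : D.graph.A₁) (h : D.graph.tgt.obj w = D.graph.src.obj u)
    (hl : Chn D.graph (D.graph.tgt.obj u) l) {W U : E.graph.A₁} {b : F.f.F₁.obj w ⟶ W} {a : F.f.F₁.obj u ⟶ U}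
    (s : Special b) (t : Special a) (c : Consec b a) (H : Chn E.graph (E.graph.tgt.obj U) (l.map F.f.F₁.obj))
    (c' : Consec b (F.cx l u hl U a t H)) (s' H' h₁ h₂),
    F.f.F₁.map (D.str.slide l w u h hl) ≫
        F.cx l (D.str.ops.comp w u h) h₁ _ (F.mult w u h ≫ E.str.ops.cmap b a c) s' H' =
      F.mult w (D.str.ops.fold l u hl) h₂ ≫ E.str.ops.cmap b (F.cx l u hl U a t H) c' ≫
        E.str.slide (l.map F.f.F₁.obj) W U c.right H
  | [], w, u, h, hl, W, U, b, a, s, t, c, H, c', s', H', h₁, h₂ => by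
    exact ((congrArg (· ≫ _) (F.f.F₁.map_id _)).trans (Category.id_comp _)).trans
      (congrArg (_ ≫ ·) (Category.comp_id _)).symm
  | v :: l, w, u, h, hl, W, U, b, a, s, t, c, H, c', s', H', h₁, h₂ => by
    have hv := hl.1.symm
    have k := map_tgt_src F.f hv
    have c₂ : Consec b (F.mult u v hv ≫ E.str.ops.wr a t (F.f.F₁.obj v) k) :=
      c'.trans ((F.cx_special l _ (D.str.ops.Chn_comp hl hv) _ (F.step_special hv t) (E.str.ops.Chn_comp H _)).1.trans
        ((mk_id_congr ((F.f.src_obj _).trans ((congrArg F.f.F₀.obj (D.str.ops.src_fold _ _ _)).trans (F.f.src_obj _).symm))).trans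
          (F.step_special hv t).1.symm))
    have h₃ : D.graph.tgt.obj w = D.graph.src.obj (D.str.ops.comp u v hv) := VertOps.h_left h hv
    have sa := D.str.assoc_special w u v h hv
    have sA := E.str.assoc_special W U (F.f.F₁.obj v) c.right H.1.symm
    have sη : Special (F.mult w _ h₃ ≫ E.str.ops.cmap b (F.mult u v hv ≫ E.str.ops.wr a t (F.f.F₁.obj v) k) c₂) :=
      (F.mult_special _ _ _).comp (E.str.ops.cmap_special s (F.step_special hv t) c₂)
    have hh := D.str.ops.Chn_comp hl hv
    have HH := E.str.ops.Chn_comp H H.1.symm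
    have ih := slide_cx l w (D.str.ops.comp u v hv) h₃ hh s (F.step_special hv t) c₂ HH c' sη
      (E.str.h_slide c₂.right HH) (D.str.h_slide h₃ hh) h₂
    have e := F.assoc_cmap h hv s t c k s' c₂ (map_tgt_src F.f h₁.1.symm) h₁.1.symm h₃ H.1.symm
    have n := F.cx_nat (.id l) (D.str.assoc w u v h hv).hom sη (F.step_special h₁.1.symm s') e
      ((F.map_id_toList l).symm ▸ sA.cchain (E.str.h_slide c₂.right HH)) (sa.cchain (D.str.h_slide h₃ hh)) (D.str.h_slide h₃ hh)
      (D.str.ops.Chn_comp h₁ _) (E.str.h_slide c₂.right HH) (E.str.ops.Chn_comp H' _)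
    refine (congrArg (· ≫ _) (F.f.F₁.map_comp _ _)).trans ((Category.assoc _ _ _).trans ((congrArg (_ ≫ ·) n).trans ?_))
    refine (Category.assoc _ _ _).symm.trans ((congrArg (· ≫ _) ih).trans ((Category.assoc _ _ _).trans
      (congrArg (_ ≫ ·) ((Category.assoc _ _ _).trans (congrArg (_ ≫ ·) (congrArg (_ ≫ ·) ?_))))))
    exact E.str.ops.cfold_congr (Cells.map_id F.f l) rfl _ _ _ _

lemma slideEval_cx (l : List D.graph.A₁) (w : D.graph.A₁) (y : D.graph.A₀) (hw : D.graph.tgt.obj w = y) (hl : Chn D.graph y l)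
    {W : E.graph.A₁} {b : F.f.F₁.obj w ⟶ W} (s : Special b) (hW : E.graph.tgt.obj W = F.f.F₀.obj y)
    (H : Chn E.graph (F.f.F₀.obj y) (l.map F.f.F₁.obj)) (c : Consec b (F.cxEval l y hl H)) (h₁ h₂) :
    F.f.F₁.map (D.str.slideEval l w y hw hl) ≫ F.cx l w h₁ W b s (H.of_eq hW) =
      F.mult w (D.str.ops.eval y l hl) h₂ ≫ E.str.ops.cmap b (F.cxEval l y hl H) c ≫
        E.str.slideEval (l.map F.f.F₁.obj) W (F.f.F₀.obj y) hW H := by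
  cases l with
  | nil =>
    have e := F.runit w y hw
    have k : E.graph.tgt.obj (F.f.F₁.obj w) = F.f.F₀.obj y := s.tgt_eq.symm.trans hW
    have n := E.str.wr_runit b s k hW
    have h := E.str.ops.cmap_eq_wl_wr b (F.unit y) s (F.unit_special y) c (VertOps.h_runit k)
    refine (congrArg (· ≫ _) e.symm).trans ((Category.assoc _ _ _).trans (congrArg (_ ≫ ·) ((Category.assoc _ _ _).trans ?_)))
    exact (congrArg (_ ≫ ·) n.symm).trans ((Category.assoc _ _ _).symm.trans (congrArg (· ≫ _) h.symm))
  | cons v l =>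
    exact F.slide_cx l w v (hw.trans hl.1.symm) hl.2 s (.id _) (s.consec (.id _) (map_tgt_src F.f (hw.trans hl.1.symm))) H.2 c _ _ _ _

lemma merge_cx (k : List D.graph.A₁) (u : D.graph.A₁) (h : Chn D.graph (D.graph.tgt.obj u) k) (l : List D.graph.A₁) (y : D.graph.A₀)
    (hy : lastV D.graph.tgt.obj (D.graph.tgt.obj u) k = y) (hl : Chn D.graph y l)
    {U : E.graph.A₁} {b : F.f.F₁.obj u ⟶ U} (s : Special b) (H : Chn E.graph (E.graph.tgt.obj U) (k.map F.f.F₁.obj)) (hY)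
    (HL : Chn E.graph (F.f.F₀.obj y) (l.map F.f.F₁.obj)) (c : Consec (F.cx k u h U b s H) (F.cxEval l y hl HL)) (h₁ H₁ h₂) :
    pcomp (oa (F.f.F₁.map (D.str.merge k u h l y hy hl))) (oa (F.cx (k ++ l) u h₁ U b s H₁)) =
      pcomp (oa (F.mult (D.str.ops.fold k u h) (D.str.ops.eval y l hl) h₂ ≫
        E.str.ops.cmap (F.cx k u h U b s H) (F.cxEval l y hl HL) c))
        (oa (E.str.merge (k.map F.f.F₁.obj) U H (l.map F.f.F₁.obj) (F.f.F₀.obj y) hY HL)) := by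
  induction k generalizing u U with
  | nil => exact (oa_comp _ _).symm.trans ((congrArg oa ((F.slideEval_cx l u y hy hl s hY HL c _ _).trans (Category.assoc _ _ _).symm)).trans (oa_comp _ _))
  | cons v k ih =>
    exact ih (D.str.ops.comp u v h.1.symm) (D.str.ops.Chn_comp h _) (D.str.lastV_comp hy _) _
      (E.str.ops.Chn_comp H _) (E.str.lastV_comp hY _) c _ _ _

lemma mergeEval_cx (k : List D.graph.A₁) (x : D.graph.A₀) (h : Chn D.graph x k) (l : List D.graph.A₁) (y : D.graph.A₀)
    (hy : lastV D.graph.tgt.obj x k = y) (hl : Chn D.graph y l) (H : Chn E.graph (F.f.F₀.obj x) (k.map F.f.F₁.obj)) (hY)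
    (HL : Chn E.graph (F.f.F₀.obj y) (l.map F.f.F₁.obj)) (c : Consec (F.cxEval k x h H) (F.cxEval l y hl HL)) (h₁ H₁ h₂) :
    pcomp (oa (F.f.F₁.map (D.str.mergeEval k x h l y hy hl))) (oa (F.cxEval (k ++ l) x h₁ H₁)) =
      pcomp (oa (F.mult (D.str.ops.eval x k h) (D.str.ops.eval y l hl) h₂ ≫
        E.str.ops.cmap (F.cxEval k x h H) (F.cxEval l y hl HL) c))
        (oa (E.str.mergeEval (k.map F.f.F₁.obj) (F.f.F₀.obj x) H (l.map F.f.F₁.obj) (F.f.F₀.obj y) hY HL)) := by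
  cases k with
  | nil =>
    obtain rfl : x = y := hy
    have s := F.cxEval_special l x hl HL
    have k₀ : x = D.graph.src.obj (D.str.ops.eval x l hl) := (D.str.ops.src_eval hl).symm
    have k₁ : F.f.F₀.obj x = E.graph.src.obj (F.f.F₁.obj (D.str.ops.eval x l hl)) :=
      (congrArg F.f.F₀.obj k₀).trans (F.f.src_obj _).symm
    have k₂ : F.f.F₀.obj x = E.graph.src.obj (E.str.ops.eval (F.f.F₀.obj x) (l.map F.f.F₁.obj) HL) := (E.str.ops.src_eval HL).symm
    have e := F.lunit x _ k₀
    have n := E.str.wl_lunit (F.cxEval l x hl HL) s k₁ k₂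
    have w := E.str.ops.cmap_eq_wr_wl (F.unit x) (F.cxEval l x hl HL) (F.unit_special x) s c (VertOps.h_lunit k₁)
    refine Eq.trans ?_ (congrArg (pcomp _) (congrArg oa (E.str.mergeEval_nil _ _ _ hY HL k₂))).symm
    refine (congrArg₂ pcomp (congrArg (fun k => oa (F.f.F₁.map k)) (D.str.mergeEval_nil _ _ _ rfl hl k₀)) rfl).trans ?_
    refine (oa_comp _ _).symm.trans ((congrArg oa ?_).trans (oa_comp _ _))
    refine (congrArg (· ≫ _) e.symm).trans ((Category.assoc _ _ _).trans (Eq.trans ?_ (Category.assoc _ _ _).symm))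
    refine congrArg (_ ≫ ·) ((Category.assoc _ _ _).trans ?_)
    exact (congrArg (_ ≫ ·) n.symm).trans ((Category.assoc _ _ _).symm.trans (congrArg (· ≫ _) w.symm))
  | cons v k => exact F.merge_cx k v h.2 l y hy hl (.id _) H.2 hY HL c _ _ _

lemma cxEval_mk_congr {l l' : List D.graph.A₁} {x x' : D.graph.A₀} (e : l = l') (e' : x = x') (h h' H H') :
    Arrow.mk (F.cxEval l x h H) = Arrow.mk (F.cxEval l' x' h' H') := by subst e e'; rfl

/-- The free colax double functor on a morphism of graphs. -/
noncomputable def _root_.TripleCat.freeMapC {A B : GphCat.{u}} (f : A ⟶ B) : ColaxDbl (freeDbl A) (freeDbl B) :=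
  (ColaxMor.ofStrict (pathMonad.free_isStrict A) (pathMonad.free_isStrict B) (pathMap f) (free_map_mult f)).biased
    (pathMonad.free_isNormal A) (pathMonad.free_isNormal B)

lemma _root_.TripleCat.freeMapC_unit {A B : GphCat.{u}} (f : A ⟶ B) (x : A.A₀) : IsIdArrow (Arrow.mk ((freeMapC f).unit x)) := by
  have e := ColaxMor.mk_biased_unit (pathMonad.free_isNormal A) (pathMonad.free_isNormal B)
    (ColaxMor.ofStrict (pathMonad.free_isStrict A) (pathMonad.free_isStrict B) (pathMap f) (free_map_mult f)) x
  have k := (IsIdArrow.mk_eqToHom (free_map_mult f).symm).ap (X := pathGph (pathGph A)) (nilPath (A := pathGph A) x)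
  exact e ▸ k

lemma _root_.TripleCat.freeMapC_mult {A B : GphCat.{u}} (f : A ⟶ B) (p q : Path A) (h) :
    IsIdArrow (Arrow.mk ((freeMapC f).mult p q h)) := by
  have e := ColaxMor.mk_biased_mult (pathMonad.free_isNormal A) (pathMonad.free_isNormal B)
    (ColaxMor.ofStrict (pathMonad.free_isStrict A) (pathMonad.free_isStrict B) (pathMap f) (free_map_mult f)) p q h
  have k := (IsIdArrow.mk_eqToHom (free_map_mult f).symm).ap (X := pathGph (pathGph A)) (pairPath (A := pathGph A) p q h)
  exact e ▸ k

lemma ext_coh : DblLaxColaxCoh D.ev.toLaxDbl E.ev.toLaxDbl (freeMapC F.f) F F.ext where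
  unit x := by
    refine oa_inj ((oa_comp _ _).trans (Eq.trans ?_ (oa_comp _ _).symm))
    refine Eq.trans (b := oa (F.unit x)) ?_ ?_
    · refine (congrArg (pcomp _) ((oa_comp _ _).trans (IsIdArrow.pcomp_right
        ((freeMapC_unit F.f x).mapA E.str.ops.evalF) rfl))).trans ?_
      exact IsIdArrow.pcomp_left ((IsIdArrow.mk_id (D.str.ops.one.obj x)).mapA F.f.F₁) rfl
    · refine Eq.symm ((congrArg (pcomp _) ((oa_comp _ _).trans (IsIdArrow.pcomp_left
        ((IsIdArrow.mk_id (F.f.F₀.obj x)).mapA E.str.ops.one) rfl))).trans ?_)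
      exact IsIdArrow.pcomp_right (.mk_id _) rfl
  mult p q h := by
    have hh := Chn.append p.chain h q.chain
    have e := F.mergeEval_cx p.edges p.start p.chain q.edges q.start h q.chain (mapPath F.f p).chain
      (map_tgt_src (pathMap F.f) h) (mapPath F.f q).chain (Consec.app F.ext h) hh (Chn.map F.f hh)
      (map_tgt_src (A := pathGph D.graph) D.str.ops.evalG h)
    have m₁ := E.str.mk_mergePath (mapPath F.f p) (mapPath F.f q) (map_tgt_src (pathMap F.f) h)
    have m₂ := D.str.mk_mergePath p q h
    refine oa_inj ((oa_comp _ _).trans ?_)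
    refine (congrArg (pcomp _) ((oa_comp _ _).trans (IsIdArrow.pcomp_right
        ((freeMapC_mult F.f p q h).mapA E.str.ops.evalF) rfl))).trans ?_
    refine (congrArg₂ pcomp (congrArg some (mapA_congr' F.f.F₁ m₂))
      (congrArg some (F.cxEval_mk_congr (freeDbl_comp_edges p q h) rfl _ _ _ _))).trans (e.trans ?_)
    refine (congrArg₂ pcomp (oa_comp _ _) (congrArg some m₁.symm)).trans ((pcomp_assoc _ _ _).trans ?_)
    exact (congrArg (pcomp _) (oa_comp _ _).symm).trans (oa_comp _ _).symm

end ColaxDbl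

namespace DblLaxColaxCoh
variable {A B D E : WDbl.{u}} {f : LaxDbl A B} {g : LaxDbl D E} {r : ColaxDbl A D} {s : ColaxDbl B E}
  {π : f.f ≫ s.f ⟶ r.f ≫ g.f}

/-- The components of a quintet. -/
def _root_.TripleCat.Cells.quintet {A B D E : GphCat.{u}} {f : A ⟶ B} {g : D ⟶ E} {r : A ⟶ D} {s : B ⟶ E} (π : f ≫ s ⟶ r ≫ g) :
    (l : List A.A₁) → Cells E ((l.map f.F₁.obj).map s.F₁.obj) ((l.map r.F₁.obj).map g.F₁.obj)
  | [] => .nil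
  | u :: l => .cons (GphCat.Hom₂.φ₁ π |>.app u) (quintet π l)

lemma _root_.TripleCat.Cells.toList_quintet {A B D E : GphCat.{u}} {f : A ⟶ B} {g : D ⟶ E} {r : A ⟶ D} {s : B ⟶ E}
    (π : f ≫ s ⟶ r ≫ g) (l : List A.A₁) :
    (Cells.quintet π l).toList = l.map fun u => Arrow.mk (GphCat.Hom₂.φ₁ π |>.app u) := by
  induction l with
  | nil => rfl
  | cons u l ih => exact congrArg (_ :: ·) ih

lemma step {K L M : Type*} [Category K] [Category L] [Category M] (S : K ⥤ M) (G : L ⥤ M) {X₁ X₂ X₃ : K} {Y₁ Y₂ Y₃ : L}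
    {wa : X₁ ⟶ X₂} {fm : X₂ ⟶ X₃} {p : S.obj X₃ ⟶ G.obj Y₁} {rm : Y₁ ⟶ Y₂} {wb : Y₂ ⟶ Y₃}
    {Z₁ Z₂ Z₃ Z₄ Z₅ Z₆ : M} {sm : S.obj X₁ ⟶ Z₁} {sm' : S.obj X₂ ⟶ Z₂} {Swa : Z₁ ⟶ Z₂} {c : Z₂ ⟶ Z₃} {gm : Z₃ ⟶ G.obj Y₂}
    {Gwb : Z₃ ⟶ Z₄} {gm' : Z₄ ⟶ G.obj Y₃} {wv : Z₁ ⟶ Z₅} {γ : Z₅ ⟶ Z₆} {wd : Z₆ ⟶ Z₄}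
    (e : S.map fm ≫ p ≫ G.map rm = sm' ≫ c ≫ gm) (n : S.map wa ≫ sm' = sm ≫ Swa) (n' : Gwb ≫ gm' = gm ≫ G.map wb)
    (k : Swa ≫ c ≫ Gwb = wv ≫ γ ≫ wd) :
    S.map (wa ≫ fm) ≫ p ≫ G.map (rm ≫ wb) = (sm ≫ wv) ≫ γ ≫ wd ≫ gm' := by
  have e' := e =≫ G.map wb
  have k' := k =≫ gm'
  simp only [Category.assoc] at e' k'
  simp only [Functor.map_comp, Category.assoc]
  rw [e', reassoc_of% n, ← n', k']

lemma lx_cx (hπ : DblLaxColaxCoh f g r s π) (l : List A.graph.A₁) (w : A.graph.A₁) {W : B.graph.A₁} {Z : D.graph.A₁}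
    {V Y : E.graph.A₁} {a : W ⟶ f.f.F₁.obj w} {b : r.f.F₁.obj w ⟶ Z} {v : s.f.F₁.obj W ⟶ V} {γ : V ⟶ Y} {d : Y ⟶ g.f.F₁.obj Z}
    (sa sb sv sd) (e : s.f.F₁.map a ≫ π.φ₁.app w ≫ g.f.F₁.map b = v ≫ γ ≫ d) (h HW HZ HV HY c) :
    s.f.F₁.map (f.lx l w h W a sa HW) ≫ π.φ₁.app (A.str.ops.fold l w h) ≫ g.f.F₁.map (r.cx l w h Z b sb HZ) =
      s.cx (l.map f.f.F₁.obj) W HW V v sv HV ≫ E.str.ops.cfold (.quintet π l) γ c HV HY ≫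
        g.lx (l.map r.f.F₁.obj) Z HZ Y d sd HY := by
  induction l generalizing w W Z V Y with
  | nil => exact e
  | cons u l ih =>
    have hw := h.1.symm
    have k : Consec γ (π.φ₁.app u) := c.1.symm
    have k' : Consec (π.φ₁.app w) (π.φ₁.app u) := Consec.app π hw
    have hW : B.graph.tgt.obj W = B.graph.src.obj (f.f.F₁.obj u) := HW.1.symm
    have hZ : D.graph.tgt.obj Z = D.graph.src.obj (r.f.F₁.obj u) := HZ.1.symm
    have c₁ : Consec a (𝟙 (f.f.F₁.obj u)) := sa.consec (.id _) hW
    have c₂ : Consec b (𝟙 (r.f.F₁.obj u)) := sb.consec (.id _) (map_tgt_src r.f hw)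
    have c₁' : Consec (s.f.F₁.map a) (𝟙 (s.f.F₁.obj (f.f.F₁.obj u))) := (sa.map s.f).consec (.id _) (map_tgt_src s.f hW)
    have c₂' : Consec (g.f.F₁.map b) (𝟙 (g.f.F₁.obj (r.f.F₁.obj u))) :=
      (sb.map g.f).consec (.id _) (map_tgt_src g.f (map_tgt_src r.f hw))
    have n := s.mult_nat_left a c₁ c₁'
    have n' := g.mult_nat_left b c₂ c₂'
    have cd : Consec d (𝟙 (g.f.F₁.obj (r.f.F₁.obj u))) := sd.consec (.id _) k.right
    have cv : Consec v (𝟙 (s.f.F₁.obj (f.f.F₁.obj u))) := sv.consec (.id _) (map_tgt_src s.f hW)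
    have m₁ := E.str.ops.cmap_comp (π.φ₁.app w) (π.φ₁.app u) (g.f.F₁.map b) (𝟙 _) k' c₂'
    have m₂ := E.str.ops.cmap_comp (s.f.F₁.map a) (𝟙 _) (π.φ₁.app w ≫ g.f.F₁.map b) (π.φ₁.app u ≫ 𝟙 _) c₁' (k'.comp c₂')
    have m₃ := E.str.ops.cmap_comp γ (π.φ₁.app u) d (𝟙 _) k cd
    have m₄ := E.str.ops.cmap_comp v (𝟙 _) (γ ≫ d) (π.φ₁.app u ≫ 𝟙 _) cv (k.comp cd)
    refine ih (A.str.ops.comp w u hw) _ _ _ _ (step s.f.F₁ g.f.F₁ (hπ.mult w u hw) n n' ?_) _ _ _ _ _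
      (c.2.of_eq (E.str.ops.cmap_tgt γ (π.φ₁.app u) k))
    refine (congrArg (_ ≫ ·) m₁.symm).trans (m₂.symm.trans ?_)
    exact (E.str.ops.cmap_congr e rfl _ _).trans (m₄.trans (congrArg (_ ≫ ·) m₃))

lemma ext_ext (hπ : DblLaxColaxCoh f g r s π) :
    pcomp (some (whR f.ec s.f)) (pcomp (some (whL A.str.ops.evalG (Arrow.mk π))) (some (whR r.ec g.f))) =
      pcomp (some (whL (pathMap f.f) s.ec)) (pcomp (some (whR (pcell (Arrow.mk π)) E.str.ops.evalG))
        (some (whL (pathMap r.f) g.ec))) := by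
  have h₁ : (whR f.ec s.f).right = (whL A.str.ops.evalG (Arrow.mk π)).left := rfl
  have h₂ : (whL A.str.ops.evalG (Arrow.mk π)).right = (whR r.ec g.f).left := rfl
  have h₃ : (whL (pathMap f.f) s.ec).right = (whR (pcell (Arrow.mk π)) E.str.ops.evalG).left :=
    congrArg (· ≫ E.str.ops.evalG) (pathMap_comp f.f s.f).symm
  have h₄ : (whR (pcell (Arrow.mk π)) E.str.ops.evalG).right = (whL (pathMap r.f) g.ec).left :=
    congrArg (· ≫ E.str.ops.evalG) (pathMap_comp r.f g.f)
  refine (some_vcomp₃ _ _ _ h₁ h₂).symm.trans ((congrArg some ?_).trans (some_vcomp₃ _ _ _ h₃ h₄))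
  refine cell_arrow_ext rfl rfl (fun a => ?_) fun p => ?_
  · refine Option.some_injective _ ((ap₀_vcomp₃ _ _ _ h₁ h₂ a).trans (Eq.trans ?_ (ap₀_vcomp₃ _ _ _ h₃ h₄ a).symm))
    have k₁ : IsIdArrow (ap₀ (whR f.ec s.f) a) := (IsIdArrow.mk_id _).mapA s.f.F₀
    have k₂ : IsIdArrow (ap₀ (whR r.ec g.f) a) := (IsIdArrow.mk_id _).mapA g.f.F₀
    have k₃ : IsIdArrow (ap₀ (whL (pathMap f.f) s.ec) a) := .mk_id _
    have k₄ : IsIdArrow (ap₀ (whL (pathMap r.f) g.ec) a) := .mk_id _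
    exact ((congrArg (pcomp _) (k₂.pcomp_right rfl)).trans (k₁.pcomp_left rfl)).trans
      ((congrArg (pcomp _) (k₄.pcomp_right rfl)).trans (k₃.pcomp_left rfl)).symm
  · refine Option.some_injective _ ((ap_vcomp₃ _ _ _ h₁ h₂ p).trans (Eq.trans ?_ (ap_vcomp₃ _ _ _ h₃ h₄ p).symm))
    have e := fun H H₁ H₂ => E.str.ops.mk_evalF_map (ap (pcell (Arrow.mk π)) p).hom (a := π.φ₀.app p.start)
      (cs := Cells.quintet π p.edges) rfl (Cells.toList_quintet π p.edges).symm H H₁ H₂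
    refine Eq.trans ?_ (congrArg (pcomp _) (congrArg (fun k => pcomp (some k) _)
      (e ?_ (Chn.map s.f (mapPath f.f p).chain) (Chn.map g.f (mapPath r.f p).chain)).symm))
    swap
    · rw [Cells.toList_quintet]
      exact (compPath π p).chain
    refine ((congrArg (pcomp _) (oa_comp _ _).symm).trans (oa_comp _ _).symm).trans (Eq.trans (congrArg oa ?_)
      ((oa_comp _ _).trans (congrArg (pcomp _) (oa_comp _ _))))
    obtain ⟨x', l, ch⟩ := p
    cases l with
    | nil => exact hπ.unit x'
    | cons u l =>
      refine lx_cx hπ l u (.id _) (.id _) (.id _) (.id _) ?_ _ _ _ _ _ _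
      exact ((congrArg₂ (· ≫ ·) (s.f.F₁.map_id _) (congrArg (_ ≫ ·) (g.f.F₁.map_id _))))

end DblLaxColaxCoh

section
variable {A : GphCat.{u}}

lemma Cells.ne_nil {l l' : List A.A₁} (cs : Cells A l l') (h : l ≠ []) : l' ≠ [] := by
  cases cs with
  | nil => exact h
  | cons f cs => exact List.cons_ne_nil _ _

lemma VertOps.isIdArrow_cfold (O : VertOps A) (l : List A.A₁) {u u' : A.A₁} {f : u ⟶ u'} (hf : IsIdArrow (Arrow.mk f))
    (c h h') : IsIdArrow (Arrow.mk (O.cfold (.id l) f c h h')) := by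
  induction l generalizing u u' with
  | nil => exact hf
  | cons v l ih => exact ih (O.isIdArrow_cmap hf (.mk_id v) _) _ _ _

/-- A weak double category whose comparisons are identities. -/
structure WDblStr.IsStrict (D : WDblStr A) : Prop where
  lunit : ∀ x u h, IsIdArrow (Arrow.mk (D.lunit x u h).hom)
  runit : ∀ u x h, IsIdArrow (Arrow.mk (D.runit u x h).hom)
  assoc : ∀ u v w h h', IsIdArrow (Arrow.mk (D.assoc u v w h h').hom)

lemma freeDbl_isStrict (A : GphCat.{u}) : (freeDbl A).str.IsStrict where
  lunit x p h := freeDbl_lunit (A := A) x p h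
  runit p x h := freeDbl_runit (A := A) x p h
  assoc p q r h h' := freeDbl_assoc (A := A) p q r h h'

namespace WDblStr.IsStrict
variable {D : WDblStr A}

lemma slide (hD : D.IsStrict) : ∀ (l : List A.A₁) (w u : A.A₁) (hw) (h : Chn A (A.tgt.obj u) l), IsIdArrow (Arrow.mk (D.slide l w u hw h))
  | [], _, _, _, _ => .mk_id _
  | _ :: l, _, _, _, _ => (slide hD l _ _ _ _).mk_comp (D.ops.isIdArrow_cfold l (hD.assoc _ _ _ _ _) _ _ _)

lemma slideEval (hD : D.IsStrict) (l : List A.A₁) (w : A.A₁) (y : A.A₀) (hw) (h : Chn A y l) : IsIdArrow (Arrow.mk (D.slideEval l w y hw h)) := by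
  cases l with
  | nil => exact hD.runit _ _ _
  | cons v l => exact hD.slide _ _ _ _ _

lemma merge (hD : D.IsStrict) : ∀ (k : List A.A₁) (u : A.A₁) (h : Chn A (A.tgt.obj u) k) (l : List A.A₁) (y : A.A₀) (hy) (hl : Chn A y l),
    IsIdArrow (Arrow.mk (D.merge k u h l y hy hl))
  | [], _, _, _, _, _, _ => hD.slideEval _ _ _ _ _
  | _ :: k, _, _, _, _, _, _ => merge hD k _ _ _ _ _ _

lemma mergePath (hD : D.IsStrict) (p q : Path A) (h : p.last = q.start) : IsIdArrow (Arrow.mk (D.mergePath p q h)) := by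
  rw [D.mk_mergePath]
  obtain ⟨x, k, ch⟩ := p
  obtain ⟨y, l, ch'⟩ := q
  cases k with
  | nil =>
    obtain rfl : x = y := h
    have e := congrArg Arrow.mk (D.mergeEval_nil x ch l rfl ch' (D.ops.src_eval ch').symm)
    exact e ▸ hD.lunit _ _ _
  | cons u k => exact hD.merge _ _ _ _ _ _ _

lemma ec (hD : D.IsStrict) : IsIdArrow (WDbl.ev ⟨A, D⟩).ec :=
  (WDbl.ev ⟨A, D⟩).isIdArrow_ext (fun x => .mk_id _) fun p q h => hD.mergePath p q h

end WDblStr.IsStrict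

lemma free_cfold_edges {l l' : List (pathGph A).A₁} (cs : Cells (pathGph A) l l') {p p' : Path A} (f : p ⟶ p') (c h h') :
    (toCell ((freeDbl A).str.ops.cfold cs f c h h')).edges =
      (toCell f).edges ++ (cs.toList.map fun a => GPath.edges (toCell a.hom)).flatten := by
  induction cs generalizing p p' with
  | nil => exact (List.append_nil _).symm
  | cons g cs ih => exact (ih _ _ _ _).trans ((congrArg (· ++ _) (freeDbl_cmap_edges f g _)).trans (List.append_assoc _ _ _))

lemma free_evalG (A : GphCat.{u}) : (freeDbl A).str.ops.evalG = pathMult A :=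
  hom_ext rfl (functor_ext_mk (F := (freeDbl A).str.ops.evalF) (G := flattenFunctor A) fun P Q f => by
    refine arrow_ext (GPath.ext ?_ ?_)
    · exact (mapA_srcF _).symm.trans (((freeDbl A).str.ops.src_ceval _ _ _ _ _).trans (mapA_srcF f))
    · refine Eq.trans ?_ (flattenCell_edges _).symm
      refine Eq.trans ?_ (congrArg (fun l : List (Arrow (Path A)) => (l.map fun a => GPath.edges (toCell a.hom)).flatten)
        (Cells.toList_ofHom f))
      change GPath.edges (toCell ((freeDbl A).str.ops.ceval _ (Cells.ofHom f) _ _ _)) = _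
      obtain ⟨x, l, ch⟩ := P
      obtain ⟨x', l', ch'⟩ := Q
      generalize Cells.chain_ofHom f = k
      generalize Cells.ofHom f = cs at k ⊢
      cases cs with
      | nil => rfl
      | cons g cs => exact free_cfold_edges cs g _ _ _)

lemma unit_evalG (O : VertOps A) : (pathUnit A ≫ O.evalG : A ⟶ A) = 𝟙 A :=
  hom_ext rfl (functor_ext_mk (F := (pathUnit A).F₁ ⋙ O.evalF) (G := 𝟭 _) fun u v f =>
    O.mk_evalF_map (p := onePath u) (q := onePath v) (oneHom f) (a := A.src.map f) (cs := .cons f .nil) rfl rfl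
      ⟨rfl, trivial⟩ ⟨rfl, trivial⟩ ⟨rfl, trivial⟩)

lemma mk_evalF_one (O : VertOps A) {u v : A.A₁} (f : u ⟶ v) : Arrow.mk (O.evalF.map (oneHom f)) = Arrow.mk f :=
  O.mk_evalF_map (p := onePath u) (q := onePath v) (oneHom f) (a := A.src.map f) (cs := .cons f .nil) rfl rfl
      ⟨rfl, trivial⟩ ⟨rfl, trivial⟩ ⟨rfl, trivial⟩

end

lemma LaxDbl.ext_mult {D E : WDbl.{u}} (F : LaxDbl D E) :
    pcomp (some (whL (pathMap (pathMap F.f)) E.ev.ec)) (some (whL (pathMult D.graph) F.ec)) =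
      pcomp (some (whR (pcell F.ec) E.str.ops.evalG)) (pcomp (some (whL (pathMap D.str.ops.evalG) F.ec))
        (some (whR D.ev.ec F.f))) := by
  have e := F.ext_coh.ext
  have k := (freeMap F.f).isIdArrow_ext (freeMap_unit F.f) (freeMap_mult F.f)
  have e₁ := ((freeMap F.f).ext_comp E.ev.toLaxDbl).trans ((k.whR E.str.ops.evalG).pcomp_right rfl)
  have e₂ := D.ev.ext_comp F
  exact (congrArg₂ pcomp e₁.symm (congrArg (fun k => some (whL k F.ec)) (free_evalG D.graph).symm)).trans
    (e.trans (congrArg (pcomp _) e₂))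

lemma ColaxDbl.ext_mult {D E : WDbl.{u}} (F : ColaxDbl D E) :
    pcomp (some (whR D.ev.ec F.f)) (some (whL (pathMult D.graph) F.ec)) =
      pcomp (some (whL (pathMap D.str.ops.evalG) F.ec)) (pcomp (some (whR (pcell F.ec) E.str.ops.evalG))
        (some (whL (pathMap (pathMap F.f)) E.ev.ec))) := by
  have e := F.ext_coh.ext_ext
  have k := (freeMapC F.f).isIdArrow_ext (freeMapC_unit F.f) (freeMapC_mult F.f)
  refine Eq.trans (congrArg (pcomp _) ?_) e
  exact (congrArg (fun k => some (whL k F.ec)) (free_evalG D.graph).symm).trans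
    ((k.whR E.str.ops.evalG).pcomp_right rfl).symm

lemma IsIdArrow.eq_id_right {K : Type*} [Category K] {a : Arrow K} (ha : IsIdArrow a) {x : K} (h : a.right = x) :
    a = Arrow.mk (𝟙 x) := by
  obtain ⟨y, rfl⟩ := ha
  obtain rfl : y = x := h
  rfl

section
variable {C : Type u} [Bicategory.{w, v} C] [Strict C] (M : TwoMonad C) {X : C}

/-- A pseudo algebra structure with identity normaliser. -/
def PseudoAlgStr.ofNormal (a : M.T.obj X ⟶ X) (h : M.unit X ≫ a = 𝟙 X) (κ : M.T.map a ≫ a ≅ M.mult X ≫ a)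
    (l : IsIdArrow (whL (M.T.map (M.unit X)) (Arrow.mk κ.hom))) (r : IsIdArrow (whL (M.unit (M.T.obj X)) (Arrow.mk κ.hom)))
    (e : pcomp (some (whL (M.T.map (M.T.map a)) (Arrow.mk κ.hom))) (some (whL (M.mult (M.T.obj X)) (Arrow.mk κ.hom))) =
      pcomp (some (whR (mapCell M.T (Arrow.mk κ.hom)) a)) (some (whL (M.T.map (M.mult X)) (Arrow.mk κ.hom)))) :
    PseudoAlgStr M X where
  a := a
  ω := eqToIso h.symm
  κ := κ
  unit_left := (((IsIdArrow.mk_eqToHom h.symm).mapCell M |>.whR a).vcomp l _).eq_id (by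
    change M.T.map (𝟙 _) ≫ _ = _
    exact (congrArg (· ≫ _) (M.T.map_id _)).trans (Strict.id_comp _))
  unit_right := (((IsIdArrow.mk_eqToHom h.symm).whL a).vcomp r _).eq_id (Strict.comp_id a)
  assoc := Option.some_injective _ ((some_vcomp _ _ _).trans (e.trans (some_vcomp _ _ _).symm))

variable {M} {A B : PseudoAlg M}

/-- A lax morphism of normal pseudo algebras. -/
def LaxMor.ofNormal (hA : A.str.IsNormal) (hB : B.str.IsNormal) (f : A.carrier ⟶ B.carrier)
    (φ : M.T.map f ≫ B.str.a ⟶ A.str.a ≫ f) (h : IsIdArrow (whL (M.unit A.carrier) (Arrow.mk φ)))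
    (e : pcomp (some (whL (M.T.map (M.T.map f)) (Arrow.mk B.str.κ.hom))) (some (whL (M.mult A.carrier) (Arrow.mk φ))) =
      pcomp (some (whR (mapCell M.T (Arrow.mk φ)) B.str.a)) (pcomp (some (whL (M.T.map A.str.a) (Arrow.mk φ)))
        (some (whR (Arrow.mk A.str.κ.hom) f)))) : LaxMor A B where
  f := f
  φ := φ
  unit := ((IsIdArrow.whL f ⟨_, hB⟩).vcomp h _).ext (IsIdArrow.whR ⟨_, hA⟩ f) ((Strict.comp_id f).trans (Strict.id_comp f).symm)
  mult := two_three e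

/-- A colax morphism of normal pseudo algebras. -/
def ColaxMor.ofNormal (hA : A.str.IsNormal) (hB : B.str.IsNormal) (r : A.carrier ⟶ B.carrier)
    (ρ : A.str.a ≫ r ⟶ M.T.map r ≫ B.str.a) (h : IsIdArrow (whL (M.unit A.carrier) (Arrow.mk ρ)))
    (e : pcomp (some (whR (Arrow.mk A.str.κ.hom) r)) (some (whL (M.mult A.carrier) (Arrow.mk ρ))) =
      pcomp (some (whL (M.T.map A.str.a) (Arrow.mk ρ))) (pcomp (some (whR (mapCell M.T (Arrow.mk ρ)) B.str.a))
        (some (whL (M.T.map (M.T.map r)) (Arrow.mk B.str.κ.hom))))) : ColaxMor A B where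
  r := r
  ρ := ρ
  unit := ((IsIdArrow.whR ⟨_, hA⟩ r).vcomp h _).ext (IsIdArrow.whL r ⟨_, hB⟩) ((Strict.id_comp r).trans (Strict.comp_id r).symm)
  mult := two_three e

end

lemma isIdArrow_mergePath_one {A : GphCat.{u}} (D : WDblStr A) (p : Path A) (v : A.A₁) (h : p.last = (onePath v).start)
    (hp : p.edges ≠ []) : IsIdArrow (Arrow.mk (D.mergePath p (onePath v) h)) := by
  rw [D.mk_mergePath]
  obtain ⟨x, k, ch⟩ := p
  cases k with
  | nil => exact absurd rfl hp
  | cons u k => exact ⟨_, D.merge_one k u ch.2 (A.src.obj v) h v (onePath v).chain⟩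

lemma isIdArrow_evalDbl_unit (D : WDbl.{u}) : IsIdArrow (whL (pathMap (pathUnit D.graph)) D.ev.ec) := by
  refine isIdArrow_of_ap (fun x => .mk_id _) fun p => ?_
  obtain ⟨x, l, ch⟩ := p
  cases l with
  | nil => exact .mk_id _
  | cons u l =>
    refine D.ev.isIdArrow_lx (fun p => GPath.edges p ≠ []) (fun p => ∃ v, p = onePath v) (fun p q h hp _ => ?_)
      (fun p q h hp hq => ?_) _ _ _ _ _ _ (.mk_id _) (List.cons_ne_nil _ _) fun q hq => ?_
    · exact fun e => hp (List.append_eq_nil_iff.1 ((freeDbl_comp_edges p q h).symm.trans e)).1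
    · obtain ⟨v, rfl⟩ := hq
      exact isIdArrow_mergePath_one D.str p v h hp
    · obtain ⟨v, -, rfl⟩ := List.mem_map.1 hq
      exact ⟨v, rfl⟩

lemma LaxDbl.isIdArrow_ext_one {D E : WDbl.{u}} (F : LaxDbl D E) : IsIdArrow (whL (pathUnit D.graph) F.ec) :=
  isIdArrow_of_ap (fun _ => .mk_id _) fun _ => .mk_id _

lemma ColaxDbl.isIdArrow_ext_one {D E : WDbl.{u}} (F : ColaxDbl D E) : IsIdArrow (whL (pathUnit D.graph) F.ec) :=
  isIdArrow_of_ap (fun _ => .mk_id _) fun _ => .mk_id _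

namespace WDbl
variable (D : WDbl.{u})

/-- The extended associator of left bracketed composition. -/
noncomputable def extAssoc : (pathMap D.str.ops.evalG ≫ D.str.ops.evalG : pathGph (pathGph D.graph) ⟶ D.graph) ≅
    pathMult D.graph ≫ D.str.ops.evalG :=
  isoCast (@asIso _ _ _ _ D.ev.ext (D.ev.isIso_ext D.ev.unit_iso D.ev.mult_iso)) rfl
    (congrArg (· ≫ D.str.ops.evalG) (free_evalG D.graph))

lemma mk_extAssoc : Arrow.mk D.extAssoc.hom = D.ev.ec :=
  mk_isoCast (@asIso _ _ _ _ D.ev.ext (D.ev.isIso_ext D.ev.unit_iso D.ev.mult_iso)) rfl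
    (congrArg (· ≫ D.str.ops.evalG) (free_evalG D.graph))

/-- The pseudo algebra of left bracketed compositions. -/
noncomputable def algStr : PseudoAlgStr pathMonad D.graph :=
  .ofNormal pathMonad D.str.ops.evalG (unit_evalG D.str.ops) D.extAssoc
    ((congrArg (fun k => IsIdArrow (whL (pathMap (pathUnit D.graph)) k)) D.mk_extAssoc).mpr (isIdArrow_evalDbl_unit D))
    ((congrArg (fun k => IsIdArrow (whL (pathUnit (pathGph D.graph)) k)) D.mk_extAssoc).mpr D.ev.isIdArrow_ext_one) (by
      have e := D.ev.ext_mult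
      have k := (freeDbl_isStrict D.graph).ec.whR D.str.ops.evalG
      have e' := e.trans (congrArg (pcomp _) (k.pcomp_right rfl))
      refine Eq.trans (congrArg (fun k => pcomp (some (whL (pathMap (pathMap D.str.ops.evalG)) k)) (some (whL (pathMult _) k)))
        D.mk_extAssoc) (e'.trans ?_)
      exact ((congrArg (fun k => pcomp (some (whR (pcell k) D.str.ops.evalG)) (some (whL (pathMap (pathMult _)) k)))
        D.mk_extAssoc).trans (congrArg (fun k => pcomp _ (some (whL (pathMap k) D.ev.ec))) (free_evalG D.graph).symm)).symm)

/-- The normal pseudo algebra of left bracketed compositions. -/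
noncomputable def alg : NormalPseudoAlg pathMonad.{u} :=
  ⟨⟨D.graph, D.algStr⟩, TripleCat.mk_eqToHom (unit_evalG D.str.ops).symm⟩

end WDbl

namespace LaxDbl
variable {D E G : WDbl.{u}}

/-- The extension of a lax double functor to the pseudo algebras of left bracketed compositions. -/
noncomputable def alg (F : LaxDbl D E) : LaxMor D.alg.toPseudoAlg E.alg.toPseudoAlg :=
  .ofNormal (A := D.alg.toPseudoAlg) (B := E.alg.toPseudoAlg) D.alg.normal E.alg.normal F.f F.ext F.isIdArrow_ext_one (by
    have e := F.ext_mult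
    rw [← D.mk_extAssoc, ← E.mk_extAssoc] at e
    exact e)

lemma alg_id (D : WDbl.{u}) : (LaxDbl.id D).alg = LaxMor.id D.alg.toPseudoAlg :=
  LaxMor.ext' rfl (((LaxDbl.id D).isIdArrow_ext (fun _ => .mk_id _) fun _ _ _ => .mk_id _).ext ⟨_, LaxMor.mk_id _⟩ rfl)

lemma alg_comp (x : LaxDbl D E) (y : LaxDbl E G) : (x.comp y).alg = x.alg.comp y.alg :=
  LaxMor.ext' rfl (Option.some_injective _ ((ext_comp x y).trans
    ((congrArg some (LaxMor.mk_comp x.alg y.alg)).trans (Quintet.some_pasteH _ _)).symm))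

end LaxDbl

namespace ColaxDbl
variable {D E G : WDbl.{u}}

/-- The extension of a colax double functor to the pseudo algebras of left bracketed compositions. -/
noncomputable def alg (F : ColaxDbl D E) : ColaxMor D.alg.toPseudoAlg E.alg.toPseudoAlg :=
  .ofNormal (A := D.alg.toPseudoAlg) (B := E.alg.toPseudoAlg) D.alg.normal E.alg.normal F.f F.ext F.isIdArrow_ext_one (by
    have e := F.ext_mult
    rw [← D.mk_extAssoc, ← E.mk_extAssoc] at e
    exact e)

lemma alg_id (D : WDbl.{u}) : (ColaxDbl.id D).alg = ColaxMor.id D.alg.toPseudoAlg :=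
  ColaxMor.ext' rfl (((ColaxDbl.id D).isIdArrow_ext (fun _ => .mk_id _) fun _ _ _ => .mk_id _).ext ⟨_, ColaxMor.mk_id _⟩ rfl)

lemma alg_comp (x : ColaxDbl D E) (y : ColaxDbl E G) : (x.comp y).alg = x.alg.comp y.alg :=
  ColaxMor.ext' rfl (Option.some_injective _ ((ext_comp x y).trans
    ((congrArg some (ColaxMor.mk_comp x.alg y.alg)).trans (Quintet.some_pasteV _ _)).symm))

end ColaxDbl

/-- The extension of a pseudo double functor to the pseudo algebras of left bracketed compositions. -/
noncomputable def PseudoDbl.alg {D E : WDbl.{u}} (F : PseudoDbl D E) : PseudoMor D.alg.toPseudoAlg E.alg.toPseudoAlg :=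
  ⟨F.toLaxDbl.alg, F.isIso_ext F.unit_iso F.mult_iso⟩

section
variable {A B D E : WDbl.{u}}

lemma DblLaxCoh.coh {r : LaxDbl A B} {s : LaxDbl D E} {u : LaxDbl A D} {v : LaxDbl B E} {π : r.f ≫ v.f ⟶ u.f ≫ s.f}
    (h : DblLaxCoh r s u v π) : LaxDbl.Coh (r.comp v) (u.comp s) π where
  unit a := (Category.assoc _ _ _).trans (h.unit a)
  mult x y k := (Category.assoc _ _ _).trans (h.mult x y k)

lemma DblLaxCoh.alg {r : LaxDbl A B} {s : LaxDbl D E} {u : LaxDbl A D} {v : LaxDbl B E} {π : r.f ≫ v.f ⟶ u.f ≫ s.f}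
    (h : DblLaxCoh r s u v π) : LaxCoh r.alg s.alg u.alg v.alg π := by
  have e := h.coh.ext
  have e' := (congrArg₂ pcomp (r.ext_comp v).symm rfl).trans (e.trans (congrArg (pcomp _) (u.ext_comp s)))
  exact Option.some_injective _ ((some_vcomp₃ _ _ _ _ _).trans (((pcomp_assoc _ _ _).symm.trans e').trans
    (some_vcomp₃ _ _ _ _ _).symm))

lemma DblLaxColaxCoh.alg {f : LaxDbl A B} {g : LaxDbl D E} {r : ColaxDbl A D} {s : ColaxDbl B E} {π : f.f ≫ s.f ⟶ r.f ≫ g.f}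
    (h : DblLaxColaxCoh f g r s π) : LaxColaxCoh f.alg g.alg r.alg s.alg π :=
  Option.some_injective _ ((some_vcomp₃ _ _ _ _ _).trans (h.ext_ext.trans (some_vcomp₃ _ _ _ _ _).symm))

end

/-- The extension of the biased structure by left bracketing, on arrows and cells. -/
noncomputable def leftBracketMor :
    CellKinds.Mor (i := WDbl.alg.{u}) (und' := fun N : NormalPseudoAlg pathMonad.{u} => N.toPseudoAlg.carrier) dblKinds.{u}
      (normalAlgKinds pathMonad.{u}) where
  m₀ :=
    { map := fun {x y} f => PseudoDbl.alg f
      map_id := fun x => PseudoMor.ext' (LaxDbl.alg_id x)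
      map_comp := fun {x y z} f g => PseudoMor.ext' (LaxDbl.alg_comp _ _)
      forget := fun _ => rfl }
  m₁ :=
    { map := fun {x y} f => LaxDbl.alg f
      map_id := fun x => LaxDbl.alg_id x
      map_comp := fun {x y z} f g => LaxDbl.alg_comp f g
      forget := fun _ => rfl }
  m₂ :=
    { map := fun {x y} f => ColaxDbl.alg f
      map_id := fun x => ColaxDbl.alg_id x
      map_comp := fun {x y z} f g => ColaxDbl.alg_comp f g
      forget := fun _ => rfl }
  p01 := ⟨fun {A B D E} r s l m π π' h c => by
    obtain rfl := Arrow.mk_injective _ _ h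
    exact DblLaxCoh.alg c⟩
  p02 := ⟨fun {A B D E} r s l m π π' h c => by
    obtain rfl := Arrow.mk_injective _ _ h
    exact DblLaxColaxCoh.alg c⟩
  p12 := ⟨fun {A B D E} r s l m π π' h c => by
    obtain rfl := Arrow.mk_injective _ _ h
    exact DblLaxColaxCoh.alg c⟩

/-- The extension of the biased structure by left bracketing. -/
noncomputable def leftBracketFunctor : TripleFunctor PsDbl.{u} PsNPsa.{u} := leftBracketMor.functor

lemma WDbl.kap_snoc (D : WDbl.{u}) (p : Path D.graph) (v : D.graph.A₁) (h : p.last = (onePath v).start) (hp : p.edges ≠ []) :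
    IsIdArrow (D.algStr.kap (pairPath (A := pathGph D.graph) p (onePath v) h)) := by
  have e : IsIdArrow (ap D.ev.ec (pairPath (A := pathGph D.graph) p (onePath v) h)) :=
    D.ev.isIdArrow_lx (fun p => GPath.edges p ≠ []) (fun p => ∃ v, p = onePath v)
      (fun p q h hp _ e => hp (List.append_eq_nil_iff.1 ((freeDbl_comp_edges p q h).symm.trans e)).1)
      (fun p q h hp hq => by
        obtain ⟨v, rfl⟩ := hq
        exact isIdArrow_mergePath_one D.str p v h hp) _ _ _ _ _ _ (.mk_id _) hp
      fun q hq => ⟨v, (List.mem_singleton (a := q) (b := onePath v)).1 hq⟩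
  rw [← D.mk_extAssoc] at e
  exact e

lemma WDbl.isLeftBracketing (D : WDbl.{u}) : IsLeftBracketing D.str D.algStr where
  nil {x y} f := D.str.ops.mk_evalF_map (p := nilPath x) (q := nilPath y) (nilHom f) (a := f) (cs := .nil) rfl rfl trivial trivial trivial
  one f := mk_evalF_one D.str.ops f
  snoc {p q} f {u v} g c hp := by
    have n := D.ev.mult_nat f (oneHom g) c
    have hq := (Cells.ofHom f).ne_nil hp
    have k₁ := isIdArrow_mergePath_one D.str p u c.left hp
    have k₂ := isIdArrow_mergePath_one D.str q v c.right hq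
    have c' := c.map (A := pathGph D.graph) D.str.ops.evalG
    have e := cmap_mk_congr D.str.ops rfl (mk_evalF_one D.str.ops g) c' (Eq.trans c' (mapA_congr' D.graph.src (mk_evalF_one D.str.ops g)))
    refine ⟨_, Eq.trans (Option.some_injective _ ?_) e⟩
    exact (k₁.pcomp_left rfl).symm.trans ((oa_comp _ _).symm.trans ((congrArg oa n).symm.trans ((oa_comp _ _).trans (k₂.pcomp_right rfl))))
  kap_snoc p v h hp := (D.kap_snoc p v h hp).eq_id_right rfl

lemma isLeftBracketExtension_leftBracketFunctor : IsLeftBracketExtension leftBracketFunctor.{u} where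
  forget := leftBracketMor.functor_forget
  ob D := ⟨_, _, rfl, D.isLeftBracketing⟩

lemma pcomp_swap {K : Type*} [Category K] {p p' q q' : Option (Arrow K)} {x y : Arrow K} (E : pcomp p (some x) = pcomp (some y) q)
    (hp : pcomp p' p = some (Arrow.mk (𝟙 x.left))) (hq : pcomp q q' = some (Arrow.mk (𝟙 y.right))) :
    pcomp (some x) q' = pcomp p' (some y) := by
  have e := pcomp_assoc p' p (some x)
  rw [hp, idc_pcomp _ rfl, E] at e
  rw [e, pcomp_assoc, pcomp_assoc, hq, pcomp_idc _ rfl]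

section
variable {C : Type u} [Bicategory.{w, v} C] [Strict C] {M : TwoMonad C} {X Y : C}

lemma map_unit_struct {a : M.T.obj X ⟶ X} (h : M.unit X ≫ a = 𝟙 X) : M.T.map (M.unit X) ≫ M.T.map a = 𝟙 (M.T.obj X) := by
  rw [← M.T.map_comp, h, M.T.map_id]

lemma map_unit_nat (f : X ⟶ Y) : M.T.map (M.unit X) ≫ M.T.map (M.T.map f) = M.T.map f ≫ M.T.map (M.unit Y) := by
  rw [← M.T.map_comp, ← M.unit_nat, M.T.map_comp]

/-- The restriction of a lax coherence to paths of length one. -/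
lemma restrict_lax {a : M.T.obj X ⟶ X} (ha : M.unit X ≫ a = 𝟙 X) {f : X ⟶ Y} {e : M.T.obj Y ⟶ Y} {ΦA : Arrow (M.T.obj (M.T.obj X) ⟶ X)}
    {ΦB : Arrow (M.T.obj (M.T.obj Y) ⟶ Y)} {φ F : Arrow (M.T.obj X ⟶ Y)} {h p q}
    (E : vcomp (whL (M.T.map (M.T.map f)) ΦB) (whL (M.mult X) φ) h =
      vcomp₃ (whR (mapCell M.T φ) e) (whL (M.T.map a) F) (whR ΦA f) p q) (hφ : IsIdArrow (whL (M.unit X) φ)) :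
    pcomp (some (whL (M.T.map f) (whL (M.T.map (M.unit Y)) ΦB))) (some φ) =
      pcomp (some F) (some (whR (whL (M.T.map (M.unit X)) ΦA) f)) := by
  have k := two_three_whL (M.T.map (M.unit X)) E
  have hk := (hφ.mapCell M).whR e
  have e₁ : whL (M.T.map (M.unit X)) (whL (M.T.map a) F) = F := by rw [← whL_comp, map_unit_struct ha, whL_id]
  rw [mapCell_whL, whR_whL] at hk
  rw [e₁, ← pcomp_assoc (some (whL (M.T.map (M.unit X)) (whR (mapCell M.T φ) e))), hk.pcomp_left ?_, ← whL_comp, ← whL_comp, map_unit_nat, M.map_unit_mult, whL_id, ← whR_whL, whL_comp] at k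
  · exact k
  · exact (congrArg (fun z => M.T.map (M.unit X) ≫ z) p).trans (congrArg (·.left) e₁)

/-- The restriction of a colax coherence to paths of length one. -/
lemma restrict_colax {a : M.T.obj X ⟶ X} (ha : M.unit X ≫ a = 𝟙 X) {r : X ⟶ Y} {e : M.T.obj Y ⟶ Y} {ΦA : Arrow (M.T.obj (M.T.obj X) ⟶ X)}
    {ΦB : Arrow (M.T.obj (M.T.obj Y) ⟶ Y)} {ρ R : Arrow (M.T.obj X ⟶ Y)} {h p q}
    (E : vcomp (whR ΦA r) (whL (M.mult X) ρ) h =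
      vcomp₃ (whL (M.T.map a) R) (whR (mapCell M.T ρ) e) (whL (M.T.map (M.T.map r)) ΦB) p q) (hρ : IsIdArrow (whL (M.unit X) ρ)) :
    pcomp (some (whR (whL (M.T.map (M.unit X)) ΦA) r)) (some ρ) =
      pcomp (some R) (some (whL (M.T.map r) (whL (M.T.map (M.unit Y)) ΦB))) := by
  have k := two_three_whL (M.T.map (M.unit X)) E
  have hk := (hρ.mapCell M).whR e
  have e₁ : whL (M.T.map (M.unit X)) (whL (M.T.map a) R) = R := by rw [← whL_comp, map_unit_struct ha, whL_id]
  rw [mapCell_whL, whR_whL] at hk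
  rw [e₁, hk.pcomp_left ?_, ← whL_comp, ← whL_comp, map_unit_nat,
    M.map_unit_mult, whL_id, ← whR_whL, whL_comp] at k
  · exact k
  · exact congrArg (fun z => M.T.map (M.unit X) ≫ z) q

variable {A B : PseudoAlg M}

lemma LaxMor.strMor_coh (hA : A.str.IsNormal) (hB : B.str.IsNormal) (f : LaxMor A B) :
    LaxCoh (LaxMor.ofStrict (M.free_isStrict A.carrier) (M.free_isStrict B.carrier) (M.T.map f.f) (M.mult_nat f.f)) f
      (A.strMor hA).toLaxMor (B.strMor hB).toLaxMor f.φ := by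
  have k : IsIdArrow (whR (Arrow.mk (eqToHom (M.mult_nat f.f))) B.str.a) := (IsIdArrow.mk_eqToHom _).whR _
  have e : (whL (M.T.map (M.T.map f.f)) (Arrow.mk B.str.κ.hom)).right = (whR (Arrow.mk (eqToHom (M.mult_nat f.f))) B.str.a).left :=
    (Strict.assoc _ _ _).symm
  refine Option.some_injective _ ((some_vcomp₃ _ _ _ _ _).trans (Eq.trans ?_ ((of_two_three f.mult).trans (some_vcomp₃ _ _ _ _ _).symm)))
  exact (pcomp_assoc _ _ _).symm.trans (congrArg (fun z => pcomp z _) (k.pcomp_right e))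

lemma ColaxMor.strMor_coh (hA : A.str.IsNormal) (hB : B.str.IsNormal) (r : ColaxMor A B) :
    LaxColaxCoh (A.strMor hA).toLaxMor (B.strMor hB).toLaxMor
      (ColaxMor.ofStrict (M.free_isStrict A.carrier) (M.free_isStrict B.carrier) (M.T.map r.r) (M.mult_nat r.r)) r r.ρ := by
  have k : IsIdArrow (whR (Arrow.mk (eqToHom (M.mult_nat r.r).symm)) B.str.a) := (IsIdArrow.mk_eqToHom _).whR _
  have e : (whL (M.mult A.carrier) (Arrow.mk r.ρ)).right = (whR (Arrow.mk (eqToHom (M.mult_nat r.r).symm)) B.str.a).left :=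
    (Strict.assoc _ _ _).symm
  refine Option.some_injective _ ((some_vcomp₃ _ _ _ _ _).trans (Eq.trans ?_ ((of_two_three r.mult).trans (some_vcomp₃ _ _ _ _ _).symm)))
  exact congrArg (pcomp _) (k.pcomp_right e)

lemma PseudoAlgStr.unit_a {S : PseudoAlgStr M X} (h : S.IsNormal) : M.unit X ≫ S.a = 𝟙 X :=
  (congrArg (·.right) h)

lemma LaxMor.isIdArrow_unit (hA : A.str.IsNormal) (hB : B.str.IsNormal) (f : LaxMor A B) : IsIdArrow (whL (M.unit A.carrier) (Arrow.mk f.φ)) := by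
  have e := of_two_one f.unit
  rw [(IsIdArrow.whL f.f ⟨_, hB⟩).pcomp_left ?_] at e
  · exact Option.some_injective _ e ▸ IsIdArrow.whR ⟨_, hA⟩ f.f
  · change f.f ≫ M.unit _ ≫ _ = M.unit _ ≫ M.T.map f.f ≫ _
    rw [← Strict.assoc, M.unit_nat, Strict.assoc]

lemma ColaxMor.isIdArrow_unit (hA : A.str.IsNormal) (hB : B.str.IsNormal) (r : ColaxMor A B) : IsIdArrow (whL (M.unit A.carrier) (Arrow.mk r.ρ)) := by
  have e := of_two_one r.unit
  rw [(IsIdArrow.whR ⟨_, hA⟩ r.r).pcomp_left (Strict.assoc _ _ _)] at e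
  exact Option.some_injective _ e ▸ IsIdArrow.whL r.r ⟨_, hB⟩

end

namespace NormalPseudoAlg
variable (N : NormalPseudoAlg pathMonad.{u})

/-- The structure of a normal pseudo algebra, as a pseudo double functor. -/
noncomputable def strDbl : PseudoDbl (freeDbl N.carrier) N.dbl :=
  (N.toPseudoAlg.strMor N.normal).biased (pathMonad.free_isNormal _) N.normal

/-- The comparison of left bracketed composition with the structure of a normal pseudo algebra, as an arrow. -/
noncomputable def brk : Arrow (pathGph N.carrier ⟶ N.carrier) :=
  whL (pathMap (pathUnit N.carrier)) N.strDbl.ec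

end NormalPseudoAlg

section
variable {A B : NormalPseudoAlg pathMonad.{u}}

lemma brk_lax (f : LaxMor A.toPseudoAlg B.toPseudoAlg) :
    pcomp (some (whL (pathMap f.f) B.brk)) (some (Arrow.mk f.φ)) =
      pcomp (some (f.biased A.normal B.normal).ec) (some (whR A.brk f.f)) := by
  have c := (LaxCoh.biased (pathMonad.free_isNormal _) (pathMonad.free_isNormal _) A.normal B.normal
    (f.strMor_coh A.normal B.normal)).coh.ext
  have k := (freeMap f.f).isIdArrow_ext (freeMap_unit f.f) (freeMap_mult f.f)
  have e₁ := ((freeMap f.f).ext_comp B.strDbl.toLaxDbl).trans ((k.whR B.str.a).pcomp_right rfl)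
  have e₂ := A.strDbl.ext_comp (f.biased A.normal B.normal)
  have c' := (congrArg (fun z => pcomp z _) e₁).symm.trans (c.trans (congrArg (pcomp _) e₂))
  have c'' := (congrArg (fun z => pcomp (some (whL (pathMap (pathMap f.f)) B.strDbl.ec)) (some (whL z (Arrow.mk f.φ))))
    (free_evalG A.carrier).symm).trans c'
  exact restrict_lax (M := pathMonad) (PseudoAlgStr.unit_a A.normal) (two_three
    (h := (congrArg (fun z => pathMap (pathMap f.f) ≫ z ≫ B.str.a) (free_evalG B.carrier)).trans
      (congrArg (· ≫ B.str.a) (free_map_mult f.f))) (p := congrArg (· ≫ B.dbl.str.ops.evalG) (pathMap_comp A.str.a f.f)) (q := rfl) c'')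
    (f.isIdArrow_unit A.normal B.normal)

lemma brk_colax (r : ColaxMor A.toPseudoAlg B.toPseudoAlg) :
    pcomp (some (whR A.brk r.r)) (some (Arrow.mk r.ρ)) =
      pcomp (some (r.biased A.normal B.normal).ec) (some (whL (pathMap r.r) B.brk)) := by
  have c := (LaxColaxCoh.biased (pathMonad.free_isNormal _) A.normal (pathMonad.free_isNormal _) B.normal
    (r.strMor_coh A.normal B.normal)).ext_ext
  have k := (freeMapC r.r).isIdArrow_ext (freeMapC_unit r.r) (freeMapC_mult r.r)
  have c' := (congrArg (fun z => pcomp (some (whR A.strDbl.ec r.r)) z) ((congrArg (fun z => some (whL z (Arrow.mk r.ρ)))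
    (free_evalG A.carrier).symm).trans ((k.whR B.str.a).pcomp_right rfl).symm)).trans c
  exact restrict_colax (M := pathMonad) (PseudoAlgStr.unit_a A.normal) (two_three (h := congrArg (· ≫ A.str.a ≫ r.r) (free_evalG A.carrier))
    (p := congrArg (· ≫ B.dbl.str.ops.evalG) (pathMap_comp A.str.a r.r).symm)
    (q := congrArg (· ≫ B.dbl.str.ops.evalG) (pathMap_comp (pathMap r.r) B.str.a)) c')
    (r.isIdArrow_unit A.normal B.normal)

end

section
variable {C : Type u} [Bicategory.{w, v} C] [Strict C] {M : TwoMonad C} {X Y : C}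

/-- The comparison of composition with the structure is compatible with the associators. -/
lemma restrict_mult {a e : M.T.obj X ⟶ X} (ha : M.unit X ≫ a = 𝟙 X) {Φ : Arrow (M.T.obj (M.T.obj X) ⟶ X)}
    {κ κ' : Arrow (M.T.obj (M.T.obj X) ⟶ X)}
    (hΦ : some Φ = pcomp (some (whL (M.T.map a) (whL (M.T.map (M.unit X)) Φ))) (some κ)) {h h'}
    (E : vcomp (whL (M.T.map (M.T.map a)) κ') (whL (M.mult (M.T.obj X)) Φ) h =
      vcomp (whR (mapCell M.T Φ) e) (whL (M.T.map (M.mult X)) Φ) h') :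
    pcomp (some κ') (some (whL (M.mult X) (whL (M.T.map (M.unit X)) Φ))) =
      pcomp (some (whR (mapCell M.T (whL (M.T.map (M.unit X)) Φ)) e))
        (pcomp (some (whL (M.T.map a) (whL (M.T.map (M.unit X)) Φ))) (some κ)) := by
  have k := (some_whL_vcomp (M.T.map (M.T.map (M.unit X))) h).symm.trans
    ((congrArg (fun z => some (whL (M.T.map (M.T.map (M.unit X))) z)) E).trans (some_whL_vcomp _ h'))
  have e₁ : whL (M.T.map (M.T.map (M.unit X))) (whL (M.T.map (M.T.map a)) κ') = κ' := by
    rw [← whL_comp, ← M.T.map_comp, map_unit_struct ha, M.T.map_id, whL_id]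
  have e₂ : whL (M.T.map (M.T.map (M.unit X))) (whL (M.mult (M.T.obj X)) Φ) = whL (M.mult X) (whL (M.T.map (M.unit X)) Φ) := by
    rw [← whL_comp, M.mult_nat, whL_comp]
  have e₃ : whL (M.T.map (M.T.map (M.unit X))) (whL (M.T.map (M.mult X)) Φ) = Φ := by
    rw [← whL_comp, ← M.T.map_comp, M.map_unit_mult, M.T.map_id, whL_id]
  rw [e₁, e₂, e₃, hΦ, ← whR_whL, ← mapCell_whL] at k
  exact k

lemma isIdArrow_restrict_unit {Φ : Arrow (M.T.obj (M.T.obj X) ⟶ X)} (h : IsIdArrow (whL (M.unit (M.T.obj X)) Φ)) :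
    IsIdArrow (whL (M.unit X) (whL (M.T.map (M.unit X)) Φ)) := by
  rw [← whL_comp, ← M.unit_nat, whL_comp]
  exact h.whL _

/-- The compatibility of an isomorphism of structures with the associators. -/
def StrIsoCoh (S S' : PseudoAlgStr M X) (i : S'.a ≅ S.a) : Prop :=
  pcomp (some (Arrow.mk S'.κ.hom)) (some (whL (M.mult X) (Arrow.mk i.hom))) =
    pcomp (some (whR (mapCell M.T (Arrow.mk i.hom)) S'.a)) (pcomp (some (whL (M.T.map S.a) (Arrow.mk i.hom)))
      (some (Arrow.mk S.κ.hom)))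

lemma vcomp_hom_inv {K : Type*} [Category K] {a b : K} (i : a ≅ b) : vcomp (Arrow.mk i.hom) (Arrow.mk i.inv) rfl = Arrow.mk (𝟙 a) :=
  congrArg Arrow.mk (by simp)

lemma vcomp_inv_hom {K : Type*} [Category K] {a b : K} (i : a ≅ b) : vcomp (Arrow.mk i.inv) (Arrow.mk i.hom) rfl = Arrow.mk (𝟙 b) :=
  vcomp_hom_inv i.symm

lemma StrIsoCoh.symm {S S' : PseudoAlgStr M X} {i : S'.a ≅ S.a} (h : StrIsoCoh S S' i) : StrIsoCoh S' S i.symm := by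
  have e : pcomp (some (whL (M.T.map S.a) (Arrow.mk i.inv))) (some (whR (mapCell M.T (Arrow.mk i.inv)) S'.a)) =
      pcomp (some (whR (mapCell M.T (Arrow.mk i.inv)) S.a)) (some (whL (M.T.map S'.a) (Arrow.mk i.inv))) :=
    exchange' _ _ rfl rfl rfl rfl
  refine (pcomp_swap ((pcomp_assoc _ _ _).trans (Eq.symm h)) (p' := pcomp (some (whR (mapCell M.T (Arrow.mk i.inv)) S.a))
    (some (whL (M.T.map S'.a) (Arrow.mk i.inv)))) ?_ ?_).trans (pcomp_assoc _ _ _)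
  · have k₁ := two_one_whL (M.T.map S.a) (vcomp_inv_hom i)
    have k₂ := two_one_whR S'.a ((mapCell_vcomp M.T (Arrow.mk i.inv) (Arrow.mk i.hom) rfl).symm.trans
      ((congrArg (mapCell M.T) (vcomp_inv_hom i)).trans (mapCell_id M.T _)))
    rw [← e, pcomp_assoc, pcomp_reassoc2_1 k₂, IsIdArrow.pcomp_left (.whR (.mk_id _) _) rfl, k₁]
    exact congrArg some (whL_idc _ _)
  · exact (two_one_whL (M.mult X) (vcomp_hom_inv i)).trans (congrArg some (whL_idc _ _))

/-- An isomorphism of structures, as an invertible lax morphism on the identity. -/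
def PseudoMor.ofIso {S S' : PseudoAlgStr M X} (hS : S.IsNormal) (hS' : S'.IsNormal) (i : S'.a ≅ S.a)
    (h : IsIdArrow (whL (M.unit X) (Arrow.mk i.hom))) (c : StrIsoCoh S S' i) : PseudoMor ⟨X, S⟩ ⟨X, S'⟩ :=
  { LaxMor.ofNormal (A := ⟨X, S⟩) (B := ⟨X, S'⟩) hS hS' (𝟙 X)
      (isoCast i (by rw [M.T.map_id, Strict.id_comp]) (Strict.comp_id _).symm).hom (by rw [mk_isoCast]; exact h) (by
        rw [mk_isoCast, M.T.map_id, M.T.map_id, whL_id, whR_id]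
        exact c) with
    isIso := Iso.isIso_hom _ }

lemma PseudoMor.mk_ofIso {S S' : PseudoAlgStr M X} (hS : S.IsNormal) (hS' : S'.IsNormal) (i : S'.a ≅ S.a) (h) (c : StrIsoCoh S S' i) :
    Arrow.mk (PseudoMor.ofIso hS hS' i h c).φ = Arrow.mk i.hom := mk_isoCast _ _ _

lemma LaxCoh.of_one {S S' : PseudoAlgStr M X} {Q Q' : PseudoAlgStr M Y} {r : LaxMor ⟨X, S⟩ ⟨X, S'⟩} {s : LaxMor ⟨Y, Q⟩ ⟨Y, Q'⟩}
    {u : LaxMor ⟨X, S⟩ ⟨Y, Q⟩} {v : LaxMor ⟨X, S'⟩ ⟨Y, Q'⟩} (hr : r.f = 𝟙 X) (hs : s.f = 𝟙 Y) {π : r.f ≫ v.f ⟶ u.f ≫ s.f}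
    (hπ : IsIdArrow (Arrow.mk π))
    (E : pcomp (some (Arrow.mk v.φ)) (some (whR (Arrow.mk r.φ) v.f)) = pcomp (some (whL (M.T.map u.f) (Arrow.mk s.φ))) (some (Arrow.mk u.φ))) :
    LaxCoh r s u v π := by
  refine Option.some_injective _ ((some_vcomp₃ _ _ _ _ _).trans (Eq.trans ?_ (some_vcomp₃ _ _ _ _ _).symm))
  have e₁ : whL (M.T.map r.f) (Arrow.mk v.φ) = Arrow.mk v.φ := by rw [hr, M.T.map_id]; exact whL_id _
  have e₂ : whR (Arrow.mk u.φ) s.f = Arrow.mk u.φ := by rw [hs]; exact whR_id _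
  refine (congrArg₂ pcomp (congrArg some e₁) ((hπ.whL S.a).pcomp_right (Strict.assoc _ _ _))).trans (E.trans ?_)
  refine Eq.trans (congrArg (fun z => pcomp _ (some z)) e₂.symm) (Eq.trans ?_ (pcomp_assoc _ _ _))
  refine congrArg (fun z => pcomp z _) (((hπ.mapCell M).whR Q'.a).pcomp_left ?_).symm
  change M.T.map (u.f ≫ s.f) ≫ Q'.a = M.T.map u.f ≫ M.T.map s.f ≫ Q'.a
  rw [M.T.map_comp, Strict.assoc]

lemma LaxColaxCoh.of_one {S S' : PseudoAlgStr M X} {Q Q' : PseudoAlgStr M Y} {f : LaxMor ⟨X, S⟩ ⟨X, S'⟩} {g : LaxMor ⟨Y, Q⟩ ⟨Y, Q'⟩}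
    {r : ColaxMor ⟨X, S⟩ ⟨Y, Q⟩} {s : ColaxMor ⟨X, S'⟩ ⟨Y, Q'⟩} (hf : f.f = 𝟙 X) (hg : g.f = 𝟙 Y) {π : f.f ≫ s.r ⟶ r.r ≫ g.f}
    (hπ : IsIdArrow (Arrow.mk π))
    (E : pcomp (some (whR (Arrow.mk f.φ) s.r)) (some (Arrow.mk r.ρ)) = pcomp (some (Arrow.mk s.ρ)) (some (whL (M.T.map r.r) (Arrow.mk g.φ)))) :
    LaxColaxCoh f g r s π := by
  refine Option.some_injective _ ((some_vcomp₃ _ _ _ _ _).trans (Eq.trans ?_ (some_vcomp₃ _ _ _ _ _).symm))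
  have e₁ : whL (M.T.map f.f) (Arrow.mk s.ρ) = Arrow.mk s.ρ := by rw [hf, M.T.map_id]; exact whL_id _
  have e₂ : whR (Arrow.mk r.ρ) g.f = Arrow.mk r.ρ := by rw [hg]; exact whR_id _
  refine Eq.trans ?_ (E.trans ?_)
  · refine (pcomp_assoc _ _ _).symm.trans (congrArg₂ pcomp ((hπ.whL S.a).pcomp_right (Strict.assoc _ _ _)) (congrArg some e₂))
  · refine congrArg₂ pcomp (congrArg some e₁.symm) (((hπ.mapCell M).whR Q'.a).pcomp_left ?_).symm
    change M.T.map (r.r ≫ g.f) ≫ Q'.a = M.T.map r.r ≫ M.T.map g.f ≫ Q'.a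
    rw [M.T.map_comp, Strict.assoc]

end

namespace NormalPseudoAlg
variable (N : NormalPseudoAlg pathMonad.{u})

lemma isIdArrow_brk_one : IsIdArrow (whL (pathUnit N.carrier) N.brk) :=
  isIdArrow_restrict_unit (M := pathMonad) N.strDbl.isIdArrow_ext_one

/-- The comparison of left bracketed composition with the structure of a normal pseudo algebra. -/
noncomputable def brkIso : N.dbl.alg.str.a ≅ N.str.a :=
  isoCast (whiskerLeftIso (pathMap (pathUnit N.carrier)) (@asIso _ _ _ _ N.strDbl.ext (N.strDbl.isIso_ext N.strDbl.unit_iso N.strDbl.mult_iso)))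
    (congrArg (· ≫ N.dbl.str.ops.evalG) (map_unit_struct (M := pathMonad) (PseudoAlgStr.unit_a N.normal)))
    ((congrArg (fun z => pathMap (pathUnit N.carrier) ≫ z ≫ N.str.a) (free_evalG N.carrier)).trans
      (congrArg (· ≫ N.str.a) (pathMonad.map_unit_mult N.carrier)))

lemma mk_brkIso : Arrow.mk N.brkIso.hom = N.brk := mk_isoCast _ _ _

/-- The free normal pseudo algebra. -/
def free (X : GphCat.{u}) : NormalPseudoAlg pathMonad.{u} := ⟨pathMonad.free X, pathMonad.free_isNormal X⟩

lemma isIdArrow_brk_free (X : GphCat.{u}) : IsIdArrow (free X).brk := by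
  refine IsIdArrow.whL _ ((free X).strDbl.isIdArrow_ext (fun x => ?_) fun u v h => ?_)
  · exact (LaxMor.mk_biased_unit (pathMonad.free_isNormal _) (free X).normal ((free X).toPseudoAlg.strMor (free X).normal).toLaxMor x) ▸
      ((pathMonad.free_isStrict X).κ.ap _)
  · exact (LaxMor.mk_biased_mult (pathMonad.free_isNormal _) (free X).normal ((free X).toPseudoAlg.strMor (free X).normal).toLaxMor u v h) ▸
      ((pathMonad.free_isStrict X).κ.ap _)

lemma strDbl_ec : some N.strDbl.ec = pcomp (some (whL (pathMap N.str.a) N.brk)) (some (Arrow.mk N.str.κ.hom)) := by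
  refine Eq.symm ((brk_lax (A := free N.carrier) (B := N) (N.toPseudoAlg.strMor N.normal).toLaxMor).trans ?_)
  exact ((isIdArrow_brk_free N.carrier).whR N.str.a).pcomp_right
    (congrArg (fun z => (z ≫ (freeDbl N.carrier).str.ops.evalG) ≫ N.str.a)
      (map_unit_struct (M := pathMonad) (PseudoAlgStr.unit_a (free N.carrier).normal))).symm

lemma brkIso_coh : StrIsoCoh N.str N.dbl.alg.str N.brkIso := by
  have e := N.strDbl.ext_mult
  have k := (freeDbl_isStrict N.carrier).ec.whR N.str.a
  have e' := e.trans (congrArg (pcomp _) (k.pcomp_right rfl))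
  have e'' := e'.trans (congrArg (fun z => pcomp (some (whR (pcell N.strDbl.ec) N.dbl.str.ops.evalG)) (some (whL (pathMap z) N.strDbl.ec)))
    (free_evalG N.carrier))
  have h : (whL (pathMap (pathMap N.str.a)) N.dbl.ev.ec).right = (whL (pathMult (pathGph N.carrier)) N.strDbl.ec).left := by
    change pathMap (pathMap N.str.a) ≫ (freeDbl N.dbl.graph).str.ops.evalG ≫ N.dbl.str.ops.evalG =
      pathMult (pathGph N.carrier) ≫ pathMap N.str.a ≫ N.dbl.str.ops.evalG
    rw [free_evalG]
    exact congrArg (· ≫ N.dbl.str.ops.evalG) (free_map_mult N.str.a)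
  have h' : (whR (pcell N.strDbl.ec) N.dbl.str.ops.evalG).right = (whL (pathMap (pathMult N.carrier)) N.strDbl.ec).left := by
    change pathMap ((freeDbl N.carrier).str.ops.evalG ≫ N.str.a) ≫ N.dbl.str.ops.evalG =
      pathMap (pathMult N.carrier) ≫ pathMap N.str.a ≫ N.dbl.str.ops.evalG
    rw [free_evalG]
    exact congrArg (· ≫ N.dbl.str.ops.evalG) (pathMap_comp (pathMult N.carrier) N.str.a)
  have r := restrict_mult (M := pathMonad) (PseudoAlgStr.unit_a N.normal) N.strDbl_ec
    (κ' := N.dbl.ev.ec) (e := N.dbl.str.ops.evalG) (h := h)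
    (h' := h')
    (Option.some_injective _ ((some_vcomp _ _ _).trans (e''.trans (some_vcomp _ _ _).symm)))
  exact (congrArg₂ (fun y z => pcomp (some y) (some (whL (pathMult N.carrier) z))) N.dbl.mk_extAssoc N.mk_brkIso).trans
    (r.trans (congrArg (fun z => pcomp (some (whR (pcell z) N.dbl.str.ops.evalG)) (pcomp (some (whL (pathMap N.str.a) z))
      (some (Arrow.mk N.str.κ.hom)))) N.mk_brkIso.symm))

end NormalPseudoAlg

lemma CatStr.comp_eq_comp {O M : Type*} (c : CatStr O M) {f f' g g' : M} (hf : f = f') (hg : g = g') (h : c.cod f = c.dom g)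
    (h' : c.cod f' = c.dom g') : c.comp f g h = c.comp f' g' h' := by
  subst hf hg
  rfl

section
variable {C : Type (u + 1)} [Bicategory.{u, u} C] [Strict C] {Ob : Type (u + 1)} {und : Ob → C}
open CellKinds (forgetArr forgetQuintet)

/-- Quintets with prescribed ends and an identity as underlying quintet. -/
structure UnitFamily {K L : ArrowKind und} (Q : QuintetKind K L) (ob : Ob → KArr K) (F G : KArr L → KArr L) where
  q : KArr L → Quintet Q
  top : ∀ f, (q f).topArr = ob f.src
  bot : ∀ f, (q f).botArr = ob f.tgt
  left : ∀ f, (q f).leftArr = F f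
  right : ∀ f, (q f).rightArr = G f
  forget : ∀ f, forgetQuintet (q f) = (Quintet.catH _).ide (forgetArr f)

namespace UnitFamily
variable {K L : ArrowKind und} {Q : QuintetKind K L} {ob ob' : Ob → KArr K} {F G : KArr L → KArr L} (t : UnitFamily Q ob F G)
  (t' : UnitFamily Q ob' G F) {Fo Go : Ob → Ob}

lemma isFun (hob : ∀ x, forgetArr (ob x) = (KArr.cat (.all C)).ide (und x)) (hs : ∀ x, (ob x).src = Fo x) (ht : ∀ x, (ob x).tgt = Go x)
    (hF : IsFun (KArr.cat L) (KArr.cat L) Fo F) (hG : IsFun (KArr.cat L) (KArr.cat L) Go G) :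
    IsFun (KArr.cat L) (Quintet.catV Q) ob t.q where
  dom := t.top
  cod := t.bot
  ide x := Quintet.eq_of_forget (t.top _) (t.bot _) ((t.left _).trans ((hF.ide x).trans (congrArg (KArr.cat L).ide (hs x).symm)))
    ((t.right _).trans ((hG.ide x).trans (congrArg (KArr.cat L).ide (ht x).symm)))
    ((t.forget _).trans ((congrArg _ ((CellKinds.isFun_forgetArr L).ide x)).trans (((Quintet.isDouble (.all (.all C) (.all C))).ide_h.ide (und x)).trans
      (Eq.symm (((CellKinds.isFun_forgetV Q).ide (ob x)).trans (congrArg _ (hob x)))))))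
  comp f g h := by
    have h' : (Quintet.catV Q).cod (t.q f) = (Quintet.catV Q).dom (t.q g) := (t.bot f).trans ((congrArg ob h).trans (t.top g).symm)
    refine Quintet.eq_of_forget ?_ ?_ ?_ ?_ ?_
    · exact (t.top _).trans ((t.top f).symm.trans ((Quintet.catV Q).dom_comp _ _ h').symm)
    · exact (t.bot _).trans ((t.bot g).symm.trans ((Quintet.catV Q).cod_comp _ _ h').symm)
    · refine (t.left _).trans ((hF.comp f g h).trans (Eq.trans ?_ ((Quintet.isDouble Q).dom_h.comp _ _ h').symm))
      exact CatStr.comp_eq_comp _ (t.left f).symm (t.left g).symm _ _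
    · refine (t.right _).trans ((hG.comp f g h).trans (Eq.trans ?_ ((Quintet.isDouble Q).cod_h.comp _ _ h').symm))
      exact CatStr.comp_eq_comp _ (t.right f).symm (t.right g).symm _ _
    · refine (t.forget _).trans ((congrArg _ ((CellKinds.isFun_forgetArr L).comp f g h)).trans
        (((Quintet.isDouble (.all (.all C) (.all C))).ide_h.comp _ _ _).trans
        (Eq.symm (((CellKinds.isFun_forgetV Q).comp _ _ h').trans ?_))))
      exact CatStr.comp_eq_comp _ (t.forget f) (t.forget g) _ _

lemma nat {x y z : Quintet Q} (hy : forgetQuintet y = forgetQuintet x) (hz : forgetQuintet z = forgetQuintet x)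
    (yl : y.leftArr = F x.leftArr) (yr : y.rightArr = F x.rightArr) (zl : z.leftArr = G x.leftArr) (zr : z.rightArr = G x.rightArr)
    (e : ∀ p p', (KArr.cat K).comp (ob x.topArr.src) z.topArr p = (KArr.cat K).comp y.topArr (ob x.topArr.tgt) p')
    (e' : ∀ q q', (KArr.cat K).comp (ob x.botArr.src) z.botArr q = (KArr.cat K).comp y.botArr (ob x.botArr.tgt) q') (h h') :
    (Quintet.catH Q).comp (t.q x.leftArr) z h = (Quintet.catH Q).comp y (t.q x.rightArr) h' := by
  refine Quintet.eq_of_forget ?_ ?_ ?_ ?_ ?_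
  · refine ((Quintet.isDouble Q).dom_v.comp _ _ h).trans (Eq.trans ?_ ((Quintet.isDouble Q).dom_v.comp _ _ h').symm)
    exact (CatStr.comp_eq_comp _ (t.top _) rfl _ _).trans ((e ((congrArg KArr.tgt (t.top x.leftArr)).symm.trans (congrArg KArr.src h))
      ((congrArg KArr.src h').trans (congrArg KArr.src (t.top x.rightArr)))).trans (CatStr.comp_eq_comp _ rfl (t.top x.rightArr).symm _ _))
  · refine ((Quintet.isDouble Q).cod_v.comp _ _ h).trans (Eq.trans ?_ ((Quintet.isDouble Q).cod_v.comp _ _ h').symm)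
    exact (CatStr.comp_eq_comp _ (t.bot _) rfl _ _).trans ((e' ((congrArg KArr.tgt (t.bot x.leftArr)).symm.trans (congrArg KArr.tgt h))
      ((congrArg KArr.tgt h').trans (congrArg KArr.src (t.bot x.rightArr)))).trans (CatStr.comp_eq_comp _ rfl (t.bot x.rightArr).symm _ _))
  · exact ((Quintet.catH Q).dom_comp _ _ h).trans ((t.left _).trans (yl.symm.trans ((Quintet.catH Q).dom_comp _ _ h').symm))
  · exact ((Quintet.catH Q).cod_comp _ _ h).trans (zr.trans ((t.right _).symm.trans ((Quintet.catH Q).cod_comp _ _ h').symm))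
  · refine ((CellKinds.isFun_forgetH Q).comp _ _ h).trans (Eq.trans ?_ ((CellKinds.isFun_forgetH Q).comp _ _ h').symm)
    refine (CatStr.comp_eq_comp _ (t.forget _) hz _ rfl).trans (((Quintet.catH _).ide_comp (forgetQuintet x)).trans ?_)
    exact ((Quintet.catH _).comp_ide (forgetQuintet x)).symm.trans (CatStr.comp_eq_comp _ hy.symm (t.forget x.rightArr).symm _ _)

lemma eq_ide (hs : ∀ f, (F f).src = Fo f.src) (ht : ∀ f, (F f).tgt = Fo f.tgt) (hF : ∀ f, forgetArr (F f) = forgetArr f)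
    (f : KArr L) (ho : ob f.src = (KArr.cat K).ide (Fo f.src)) (ho' : ob f.tgt = (KArr.cat K).ide (Fo f.tgt)) (hFG : G f = F f) : t.q f = (Quintet.catH Q).ide (F f) :=
  Quintet.eq_of_forget ((t.top f).trans (ho.trans (congrArg _ (hs f).symm))) ((t.bot f).trans (ho'.trans (congrArg _ (ht f).symm)))
    (t.left f) ((t.right f).trans hFG) ((t.forget f).trans (((congrArg _ (hF f)).symm).trans ((CellKinds.isFun_forgetH Q).ide (F f)).symm))

lemma comp_eq_ide (hs : ∀ f, (F f).src = Fo f.src) (ht : ∀ f, (F f).tgt = Fo f.tgt) (hF : ∀ f, forgetArr (F f) = forgetArr f)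
    (p : ∀ x, (ob x).tgt = (ob' x).src) (ho : ∀ x, (KArr.cat K).comp (ob x) (ob' x) (p x) = (KArr.cat K).ide (Fo x)) (f : KArr L) (h) :
    (Quintet.catH Q).comp (t.q f) (t'.q f) h = (Quintet.catH Q).ide (F f) := by
  refine Quintet.eq_of_forget ?_ ?_ ?_ ?_ ?_
  · exact ((Quintet.isDouble Q).dom_v.comp _ _ h).trans ((CatStr.comp_eq_comp _ (t.top f) (t'.top f) _ _).trans
      ((ho _).trans (congrArg _ (hs f).symm)))
  · exact ((Quintet.isDouble Q).cod_v.comp _ _ h).trans ((CatStr.comp_eq_comp _ (t.bot f) (t'.bot f) _ _).trans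
      ((ho _).trans (congrArg _ (ht f).symm)))
  · exact ((Quintet.catH Q).dom_comp _ _ h).trans (t.left f)
  · exact ((Quintet.catH Q).cod_comp _ _ h).trans (t'.right f)
  · refine ((CellKinds.isFun_forgetH Q).comp _ _ h).trans (Eq.trans ?_ (((CellKinds.isFun_forgetH Q).ide _).trans (congrArg _ (hF f))).symm)
    exact (CatStr.comp_eq_comp _ (t.forget f) (t'.forget f) _ rfl).trans ((Quintet.catH _).ide_comp ((Quintet.catH _).ide (forgetArr f)))

end UnitFamily

/-- Transversal components over the identity of the forgetful functor. -/
structure OverUnit {K : CellKinds und} (F G : TripleFunctor K.triple K.triple) where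
  ob : Ob → KArr K.K₀
  src : ∀ x, (ob x).src = F.ob x
  tgt : ∀ x, (ob x).tgt = G.ob x
  forget_ob : ∀ x, forgetArr (ob x) = (KArr.cat (.all C)).ide (und x)
  a1 : UnitFamily K.Q01 ob F.a1 G.a1
  a2 : UnitFamily K.Q02 ob F.a2 G.a2
  nat : ∀ f, (KArr.cat K.K₀).comp (ob f.src) (G.a0 f) ((tgt _).trans (G.f0.dom f).symm) =
    (KArr.cat K.K₀).comp (F.a0 f) (ob f.tgt) ((F.f0.cod f).trans (src _).symm)

namespace OverUnit
variable {K : CellKinds und} {F G : TripleFunctor K.triple K.triple} (t : OverUnit F G) (t' : OverUnit G F)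
  (hF : F.comp K.forget = K.forget) (hG : G.comp K.forget = K.forget)

/-- The transversal component on a quintet in the directions 1, 2. -/
def cube (ω : Quintet K.Q12) : QCube K.Q01 K.Q02 K.Q12 where
  φ := t.a1.q ω.topArr
  ψ := t.a1.q ω.botArr
  π := t.a2.q ω.leftArr
  ρ := t.a2.q ω.rightArr
  ω := F.s12 ω
  ζ := G.s12 ω
  comm := .of_forget ((t.a1.top _).trans (t.a2.top ω.leftArr).symm) ((t.a1.bot _).trans (t.a2.top ω.rightArr).symm)
    ((t.a1.top _).trans (t.a2.bot ω.leftArr).symm) ((t.a1.bot _).trans (t.a2.bot ω.rightArr).symm)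
    ((t.a1.left _).trans (F.f12_2.dom ω).symm) ((t.a1.right _).trans (G.f12_2.dom ω).symm)
    ((t.a1.left _).trans (F.f12_2.cod ω).symm) ((t.a1.right _).trans (G.f12_2.cod ω).symm)
    ((t.a2.left _).trans (F.f12_1.dom ω).symm) ((t.a2.right _).trans (G.f12_1.dom ω).symm)
    ((t.a2.left _).trans (F.f12_1.cod ω).symm) ((t.a2.right _).trans (G.f12_1.cod ω).symm) (by
      have h₁ : forgetQuintet (F.s12 ω) = forgetQuintet ω := congrFun (congrArg TripleFunctor.s12 hF) ω
      have h₂ : forgetQuintet (G.s12 ω) = forgetQuintet ω := congrFun (congrArg TripleFunctor.s12 hG) ω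
      rw [t.a1.forget, t.a1.forget, t.a2.forget, t.a2.forget, h₁, h₂]
      exact (QCube.id0 _ _ (forgetQuintet ω)).comm)

lemma isFun_a1 : IsFun (KArr.cat K.K₁) (Quintet.catV K.Q01) t.ob t.a1.q := t.a1.isFun t.forget_ob t.src t.tgt F.f1 G.f1

lemma isFun_a2 : IsFun (KArr.cat K.K₂) (Quintet.catV K.Q02) t.ob t.a2.q := t.a2.isFun t.forget_ob t.src t.tgt F.f2 G.f2

lemma nat_s01 (hF : F.comp K.forget = K.forget) (hG : G.comp K.forget = K.forget) (x : Quintet K.Q01) (h h') :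
    (Quintet.catH K.Q01).comp (t.a1.q x.leftArr) (G.s01 x) h = (Quintet.catH K.Q01).comp (F.s01 x) (t.a1.q x.rightArr) h' :=
  t.a1.nat (congrFun (congrArg TripleFunctor.s01 hF) x) (congrFun (congrArg TripleFunctor.s01 hG) x)
    (F.f01_0.dom x) (F.f01_0.cod x) (G.f01_0.dom x) (G.f01_0.cod x)
    (fun _ _ => ((CatStr.comp_eq_comp _ rfl (G.f01_1.dom x) _ _).trans (t.nat x.topArr)).trans (CatStr.comp_eq_comp _ (F.f01_1.dom x).symm rfl _ _))
    (fun _ _ => ((CatStr.comp_eq_comp _ rfl (G.f01_1.cod x) _ _).trans (t.nat x.botArr)).trans (CatStr.comp_eq_comp _ (F.f01_1.cod x).symm rfl _ _)) _ _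

lemma nat_s02 (hF : F.comp K.forget = K.forget) (hG : G.comp K.forget = K.forget) (x : Quintet K.Q02) (h h') :
    (Quintet.catH K.Q02).comp (t.a2.q x.leftArr) (G.s02 x) h = (Quintet.catH K.Q02).comp (F.s02 x) (t.a2.q x.rightArr) h' :=
  t.a2.nat (congrFun (congrArg TripleFunctor.s02 hF) x) (congrFun (congrArg TripleFunctor.s02 hG) x)
    (F.f02_0.dom x) (F.f02_0.cod x) (G.f02_0.dom x) (G.f02_0.cod x)
    (fun _ _ => ((CatStr.comp_eq_comp _ rfl (G.f02_2.dom x) _ _).trans (t.nat x.topArr)).trans (CatStr.comp_eq_comp _ (F.f02_2.dom x).symm rfl _ _))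
    (fun _ _ => ((CatStr.comp_eq_comp _ rfl (G.f02_2.cod x) _ _).trans (t.nat x.botArr)).trans (CatStr.comp_eq_comp _ (F.f02_2.cod x).symm rfl _ _)) _ _

/-- The transversal transformation with the given components. -/
def transformation : TransversalTransformation F G where
  ob := t.ob
  a1 := t.a1.q
  a2 := t.a2.q
  s12 := t.cube hF hG
  dom_ob := t.src
  cod_ob := t.tgt
  dom_a1 := t.a1.left
  cod_a1 := t.a1.right
  dom_a2 := t.a2.left
  cod_a2 := t.a2.right
  dom_s12 _ := rfl
  cod_s12 _ := rfl
  f1 := t.isFun_a1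
  f2 := t.isFun_a2
  f12_1 :=
    { dom := fun _ => rfl
      cod := fun _ => rfl
      ide := fun x => QCube.ext ((t.isFun_a1.ide _).trans (congrArg _ (t.a2.top x).symm))
        ((t.isFun_a1.ide _).trans (congrArg _ (t.a2.bot x).symm)) rfl rfl
        ((F.f12_1.ide x).trans (congrArg _ (t.a2.left x).symm)) ((G.f12_1.ide x).trans (congrArg _ (t.a2.right x).symm))
      comp := fun x y h => QCube.ext
        ((congrArg t.a1.q ((Quintet.isDouble K.Q12).dom_v.comp x y h)).trans (t.isFun_a1.comp _ _ _))
        ((congrArg t.a1.q ((Quintet.isDouble K.Q12).cod_v.comp x y h)).trans (t.isFun_a1.comp _ _ _))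
        (congrArg t.a2.q ((Quintet.catH K.Q12).dom_comp x y h)) (congrArg t.a2.q ((Quintet.catH K.Q12).cod_comp x y h))
        (F.f12_1.comp x y h) (G.f12_1.comp x y h) }
  f12_2 :=
    { dom := fun _ => rfl
      cod := fun _ => rfl
      ide := fun x => QCube.ext rfl rfl ((t.isFun_a2.ide _).trans (congrArg _ (t.a1.top x).symm))
        ((t.isFun_a2.ide _).trans (congrArg _ (t.a1.bot x).symm))
        ((F.f12_2.ide x).trans (congrArg _ (t.a1.left x).symm)) ((G.f12_2.ide x).trans (congrArg _ (t.a1.right x).symm))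
      comp := fun x y h => QCube.ext
        (congrArg t.a1.q ((Quintet.catV K.Q12).dom_comp x y h)) (congrArg t.a1.q ((Quintet.catV K.Q12).cod_comp x y h))
        ((congrArg t.a2.q ((Quintet.isDouble K.Q12).dom_h.comp x y h)).trans (t.isFun_a2.comp _ _ _))
        ((congrArg t.a2.q ((Quintet.isDouble K.Q12).cod_h.comp x y h)).trans (t.isFun_a2.comp _ _ _))
        (F.f12_2.comp x y h) (G.f12_2.comp x y h) }
  nat_a0 := t.nat
  nat_s01 x := t.nat_s01 hF hG x _ _
  nat_s02 x := t.nat_s02 hF hG x _ _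
  nat_cube x := QCube.ext
    ((CatStr.comp_eq_comp _ (congrArg t.a1.q x.e5.symm) (G.fq2.dom x) _ ((t.a1.right _).trans (G.f01_0.dom _).symm)).trans
      ((t.nat_s01 hF hG x.φ _ ((F.f01_0.cod _).trans (t.a1.left _).symm)).trans
        (CatStr.comp_eq_comp _ (F.fq2.dom x).symm (congrArg t.a1.q x.e6) _ _)))
    ((CatStr.comp_eq_comp _ (congrArg t.a1.q x.e7.symm) (G.fq2.cod x) _ ((t.a1.right _).trans (G.f01_0.dom _).symm)).trans
      ((t.nat_s01 hF hG x.ψ _ ((F.f01_0.cod _).trans (t.a1.left _).symm)).trans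
        (CatStr.comp_eq_comp _ (F.fq2.cod x).symm (congrArg t.a1.q x.e8) _ _)))
    ((CatStr.comp_eq_comp _ (congrArg t.a2.q x.e9.symm) (G.fq1.dom x) _ ((t.a2.right _).trans (G.f02_0.dom _).symm)).trans
      ((t.nat_s02 hF hG x.π _ ((F.f02_0.cod _).trans (t.a2.left _).symm)).trans
        (CatStr.comp_eq_comp _ (F.fq1.dom x).symm (congrArg t.a2.q x.e10) _ _)))
    ((CatStr.comp_eq_comp _ (congrArg t.a2.q x.e11.symm) (G.fq1.cod x) _ ((t.a2.right _).trans (G.f02_0.dom _).symm)).trans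
      ((t.nat_s02 hF hG x.ρ _ ((F.f02_0.cod _).trans (t.a2.left _).symm)).trans
        (CatStr.comp_eq_comp _ (F.fq1.cod x).symm (congrArg t.a2.q x.e12) _ _)))
    (F.fq0.dom x).symm (G.fq0.cod x)

lemma isInvertible (h : ∀ x, (KArr.cat K.K₀).comp (t.ob x) (t'.ob x) ((t.tgt x).trans (t'.src x).symm) = (KArr.cat K.K₀).ide (F.ob x))
    (h' : ∀ x, (KArr.cat K.K₀).comp (t'.ob x) (t.ob x) ((t'.tgt x).trans (t.src x).symm) = (KArr.cat K.K₀).ide (G.ob x)) :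
    (t.transformation hF hG).IsInvertible := by
  have k₁ := fun f l => t.a1.comp_eq_ide t'.a1 F.f1.dom F.f1.cod (congrFun (congrArg TripleFunctor.a1 hF)) (fun x => (t.tgt x).trans (t'.src x).symm) h f l
  have k₁' := fun f l => t'.a1.comp_eq_ide t.a1 G.f1.dom G.f1.cod (congrFun (congrArg TripleFunctor.a1 hG)) (fun x => (t'.tgt x).trans (t.src x).symm) h' f l
  have k₂ := fun f l => t.a2.comp_eq_ide t'.a2 F.f2.dom F.f2.cod (congrFun (congrArg TripleFunctor.a2 hF)) (fun x => (t.tgt x).trans (t'.src x).symm) h f l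
  have k₂' := fun f l => t'.a2.comp_eq_ide t.a2 G.f2.dom G.f2.cod (congrFun (congrArg TripleFunctor.a2 hG)) (fun x => (t'.tgt x).trans (t.src x).symm) h' f l
  refine ⟨fun x => ⟨t'.ob x, _, (t'.tgt x).trans (t.src x).symm, (h x).trans (congrArg _ (t.src x).symm), (h' x).trans (congrArg _ (t.tgt x).symm)⟩,
    fun f => ⟨t'.a1.q f, (t.a1.right f).trans (t'.a1.left f).symm, (t'.a1.right f).trans (t.a1.left f).symm,
      (k₁ f _).trans (congrArg _ (t.a1.left f).symm), (k₁' f _).trans (congrArg _ (t.a1.right f).symm)⟩,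
    fun f => ⟨t'.a2.q f, (t.a2.right f).trans (t'.a2.left f).symm, (t'.a2.right f).trans (t.a2.left f).symm,
      (k₂ f _).trans (congrArg _ (t.a2.left f).symm), (k₂' f _).trans (congrArg _ (t.a2.right f).symm)⟩,
    fun ω => ⟨t'.cube hG hF ω, rfl, rfl, ?_, ?_⟩⟩
  · exact QCube.ext ((k₁ _ _).trans (congrArg _ (F.f12_2.dom ω).symm)) ((k₁ _ _).trans (congrArg _ (F.f12_2.cod ω).symm))
      ((k₂ _ _).trans (congrArg _ (F.f12_1.dom ω).symm)) ((k₂ _ _).trans (congrArg _ (F.f12_1.cod ω).symm)) rfl rfl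
  · exact QCube.ext ((k₁' _ _).trans (congrArg _ (G.f12_2.dom ω).symm)) ((k₁' _ _).trans (congrArg _ (G.f12_2.cod ω).symm))
      ((k₂' _ _).trans (congrArg _ (G.f12_1.dom ω).symm)) ((k₂' _ _).trans (congrArg _ (G.f12_1.cod ω).symm)) rfl rfl

end OverUnit

end

lemma VertOps.ext_of {A : GphCat.{u}} {O O' : VertOps A}
    (one : ∀ {x y : A.A₀} (f : x ⟶ y), Arrow.mk (O.one.map f) = Arrow.mk (O'.one.map f)) (comp : ∀ u v h, O.comp u v h = O'.comp u v h)
    (cmap : ∀ {u u' v v' : A.A₁} (f : u ⟶ u') (g : v ⟶ v') (c : Consec f g), Arrow.mk (O.cmap f g c) = Arrow.mk (O'.cmap f g c)) :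
    O = O' := by
  obtain ⟨e, _, _, c, _, _, m, _, _, _, _⟩ := O
  obtain ⟨e', _, _, c', _, _, m', _, _, _, _⟩ := O'
  obtain rfl : e = e' := functor_ext_mk fun _ _ f => one f
  obtain rfl : c = c' := funext fun u => funext fun v => funext fun h => comp u v h
  obtain rfl : @m = @m' := by
    funext u u' v v' f g c
    exact Arrow.mk_injective _ _ (cmap f g c)
  rfl

lemma isIso_kap {A : GphCat.{u}} (s : PseudoAlgStr pathMonad A) (P : Path (pathGph A)) : IsIso (s.kap P).hom :=
  ⟨s.κ.inv.φ₁.app P, congrArg (fun α => GphCat.Hom₂.φ₁ α |>.app P) s.κ.hom_inv_id, congrArg (fun α => GphCat.Hom₂.φ₁ α |>.app P) s.κ.inv_hom_id⟩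

lemma vcomp_right_cancel {K : Type*} [Category K] {a a' b : Arrow K} (i : IsIso b.hom) {h h'} (e : vcomp a b h = vcomp a' b h') :
    a = a' := by
  have k : pcomp (some b) (some (Arrow.mk (inv b.hom))) = some (Arrow.mk (𝟙 b.left)) :=
    (some_vcomp _ _ rfl).symm.trans (congrArg (fun z => some (Arrow.mk z)) (by simp))
  have := congrArg (fun z => pcomp (some z) (some (Arrow.mk (inv b.hom)))) e
  rw [some_vcomp, some_vcomp, pcomp_assoc, pcomp_assoc, k, pcomp_idc _ h, pcomp_idc _ h'] at this
  exact Option.some_injective _ this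

lemma IsBiasedReduct.unique {A : GphCat.{u}} {s : PseudoAlgStr pathMonad A} {D D' : WDblStr A} (h : IsBiasedReduct s D) (h' : IsBiasedReduct s D') :
    D = D' := by
  have ho : D.ops = D'.ops := VertOps.ext_of (fun f => (h.one f).trans (h'.one f).symm) (fun _ _ _ => (h.comp _ _ _).trans (h'.comp _ _ _).symm)
    fun _ _ _ => (h.cmap _ _ _).trans (h'.cmap _ _ _).symm
  have h₁ := fun x u k => (h.lunit x u k).trans (h'.lunit x u k).symm
  have h₂ := fun x u k => (h.runit x u k).trans (h'.runit x u k).symm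
  have h₃ : ∀ u v w k k', Arrow.mk (D.assoc u v w k k').hom = Arrow.mk (D'.assoc u v w k k').hom := fun u v w k k' => by
    obtain ⟨_, e⟩ := h.assoc u v w k k'
    obtain ⟨_, e'⟩ := h'.assoc u v w k k'
    exact vcomp_right_cancel (isIso_kap s _) (e.trans e'.symm)
  clear h h'
  obtain ⟨O, l, r, a, _, _, _, _, _, _, _, _⟩ := D
  obtain ⟨O', l', r', a', _, _, _, _, _, _, _, _⟩ := D'
  obtain rfl : O = O' := ho
  obtain rfl : l = l' := funext fun x => funext fun u => funext fun k => Iso.ext (Arrow.mk_injective _ _ (h₁ x u k))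
  obtain rfl : r = r' := funext fun x => funext fun u => funext fun k => Iso.ext (Arrow.mk_injective _ _ (h₂ x u k))
  obtain rfl : a = a' := funext fun u => funext fun v => funext fun w => funext fun k => funext fun k' =>
    Iso.ext (Arrow.mk_injective _ _ (h₃ u v w k k'))
  rfl

lemma LaxDbl.ap_ec_pair {D E : WDbl.{u}} (F : LaxDbl D E) (p q : D.graph.A₁) (h) : ap F.ec (pairPath p q h) = Arrow.mk (F.mult p q h) :=
  congrArg Arrow.mk ((congrArg (· ≫ F.mult p q h) (E.str.ops.cmap_id _ _ _)).trans (Category.id_comp _))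

lemma ColaxDbl.ap_ec_pair {D E : WDbl.{u}} (F : ColaxDbl D E) (p q : D.graph.A₁) (h) : ap F.ec (pairPath p q h) = Arrow.mk (F.mult p q h) := by
  exact congrArg Arrow.mk ((congrArg (F.mult p q h ≫ ·) (E.str.ops.cmap_id _ _ _)).trans (Category.comp_id _))

namespace WDbl
variable (D : WDbl.{u})

lemma kap_pair (p q : Path D.graph) (h) : D.algStr.kap (pairPath (A := pathGph D.graph) p q h) = Arrow.mk (D.str.mergePath p q h) := by
  have e := D.ev.ap_ec_pair p q h
  rw [← D.mk_extAssoc] at e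
  exact e

lemma isBiasedReduct_algStr : IsBiasedReduct D.algStr D.str where
  one f := (D.isLeftBracketing.nil f).symm
  comp _ _ _ := rfl
  cmap {u u' v v'} f g c := (D.str.ops.mk_evalF_map (p := pairPath u v c.left) (q := pairPath u' v' c.right) (pairHom f g c)
    (a := D.graph.src.map f) (cs := .cons f (.cons g .nil)) rfl rfl ⟨rfl, c.symm, trivial⟩ ⟨rfl, c.left.symm, trivial⟩ ⟨rfl, c.right.symm, trivial⟩).symm
  lunit x u h := by
    refine Eq.symm ((D.kap_pair _ _ _).trans ((D.str.mk_mergePath _ _ _).trans ?_))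
    subst h
    exact congrArg Arrow.mk (D.str.mergeEval_nil _ trivial [u] rfl (onePath u).chain rfl)
  runit u x h := ((D.kap_pair (onePath u) (nilPath x) h).trans (D.str.mk_mergePath _ _ _)).symm
  assoc u v w h h' := by
    have e₁ := (D.kap_pair (pairPath u v h) (onePath w) (pair_one u v w h h'))
    have e₂ := (D.kap_pair (onePath u) (pairPath v w h') (one_pair u v w h h')).trans (D.str.mk_mergePath _ _ _)
    have k := isIdArrow_mergePath_one D.str (pairPath u v h) w (pair_one u v w h h') (List.cons_ne_nil _ _)
    refine ⟨rfl, Option.some_injective _ ((some_vcomp _ _ _).trans ?_)⟩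
    refine ((congrArg (pcomp _) (congrArg some e₁)).trans (k.pcomp_right rfl)).trans (congrArg some (Eq.trans ?_ e₂.symm))
    exact congrArg Arrow.mk (Category.id_comp _).symm

lemma alg_dbl : D.alg.dbl = D := congrArg (WDbl.mk D.graph) (D.alg.normal.isBiasedReduct.unique D.isBiasedReduct_algStr)

end WDbl

section
variable {A B : GphCat.{u}} {S S' : WDblStr A} {R R' : WDblStr B}

lemma LaxDbl.arr_eq (hS : S = S') (hR : R = R') {x : LaxDbl ⟨A, S⟩ ⟨B, R⟩} {y : LaxDbl ⟨A, S'⟩ ⟨B, R'⟩} (h : x.f = y.f)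
    (h₁ : ∀ a, Arrow.mk (x.unit a) = Arrow.mk (y.unit a)) (h₂ : ∀ u v h, Arrow.mk (x.mult u v h) = Arrow.mk (y.mult u v h)) :
    (KArr.mk (K := dblKinds.{u}.K₁) x) = KArr.mk (K := dblKinds.{u}.K₁) y := by
  subst hS hR
  exact congrArg KArr.mk (LaxDbl.ext' h h₁ h₂)

lemma ColaxDbl.arr_eq (hS : S = S') (hR : R = R') {x : ColaxDbl ⟨A, S⟩ ⟨B, R⟩} {y : ColaxDbl ⟨A, S'⟩ ⟨B, R'⟩} (h : x.f = y.f)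
    (h₁ : ∀ a, Arrow.mk (x.unit a) = Arrow.mk (y.unit a)) (h₂ : ∀ u v h, Arrow.mk (x.mult u v h) = Arrow.mk (y.mult u v h)) :
    (KArr.mk (K := dblKinds.{u}.K₂) x) = KArr.mk (K := dblKinds.{u}.K₂) y := by
  subst hS hR
  exact congrArg KArr.mk (ColaxDbl.ext' h h₁ h₂)

lemma PseudoDbl.arr_eq (hS : S = S') (hR : R = R') {x : PseudoDbl ⟨A, S⟩ ⟨B, R⟩} {y : PseudoDbl ⟨A, S'⟩ ⟨B, R'⟩} (h : x.f = y.f)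
    (h₁ : ∀ a, Arrow.mk (x.unit a) = Arrow.mk (y.unit a)) (h₂ : ∀ u v h, Arrow.mk (x.mult u v h) = Arrow.mk (y.mult u v h)) :
    (KArr.mk (K := dblKinds.{u}.K₀) x) = KArr.mk (K := dblKinds.{u}.K₀) y := by
  subst hS hR
  exact congrArg KArr.mk (PseudoDbl.ext' (LaxDbl.ext' h h₁ h₂))

end

lemma WDbl.alg_dbl_str (D : WDbl.{u}) : D.alg.normal.biased = D.str := D.alg.normal.isBiasedReduct.unique D.isBiasedReduct_algStr

lemma leftBracketFunctor_comp_biasedFunctor : leftBracketFunctor.{u}.comp biasedFunctor.{u} = TripleFunctor.id PsDbl.{u} := by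
  have k₁ : ∀ {D E : WDbl.{u}} (f : LaxDbl D E) a, Arrow.mk ((f.alg.biased D.alg.normal E.alg.normal).unit a) = Arrow.mk (f.unit a) :=
    fun f a => f.alg.mk_biased_unit _ _ a
  have k₂ : ∀ {D E : WDbl.{u}} (f : LaxDbl D E) u v h, Arrow.mk ((f.alg.biased D.alg.normal E.alg.normal).mult u v h) = Arrow.mk (f.mult u v h) :=
    fun f u v h => (f.alg.mk_biased_mult _ _ u v h).trans (f.ap_ec_pair u v h)
  refine TripleFunctor.eq_id_of_forget _ ?_ ?_ ?_ ?_ fun D => D.alg_dbl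
  · exact (congrArg (TripleFunctor.comp leftBracketFunctor) biasedMor.functor_forget).trans leftBracketMor.functor_forget
  · rintro ⟨f⟩
    exact PseudoDbl.arr_eq (WDbl.alg_dbl_str _) (WDbl.alg_dbl_str _) rfl (k₁ f.toLaxDbl) (k₂ f.toLaxDbl)
  · rintro ⟨f⟩
    exact LaxDbl.arr_eq (WDbl.alg_dbl_str _) (WDbl.alg_dbl_str _) rfl (k₁ f) (k₂ f)
  · rintro ⟨f⟩
    exact ColaxDbl.arr_eq (WDbl.alg_dbl_str _) (WDbl.alg_dbl_str _) rfl (fun a => f.alg.mk_biased_unit _ _ a)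
      fun u v h => (f.alg.mk_biased_mult _ _ u v h).trans (f.ap_ec_pair u v h)

section
variable {C : Type u} [Bicategory.{w, v} C] [Strict C] {M : TwoMonad C} {X Y : C}

lemma isIdArrow_whL_inv {f : X ⟶ Y} {Z : C} {a b : Y ⟶ Z} {i : a ≅ b} (h : IsIdArrow (whL f (Arrow.mk i.hom))) :
    IsIdArrow (whL f (Arrow.mk i.inv)) := by
  have k := two_one_whL f (vcomp_hom_inv i)
  rw [h.pcomp_left rfl] at k
  exact Option.some_injective _ k ▸ (IsIdArrow.mk_id a).whL f

lemma PseudoMor.ofIso_comp_symm {S S' : PseudoAlgStr M X} (hS : S.IsNormal) (hS' : S'.IsNormal) (i : S'.a ≅ S.a) (h h') (c : StrIsoCoh S S' i)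
    (c' : StrIsoCoh S' S i.symm) :
    (PseudoMor.ofIso hS hS' i h c).toLaxMor.comp (PseudoMor.ofIso hS' hS i.symm h' c').toLaxMor = LaxMor.id ⟨X, S⟩ := by
  refine LaxMor.ext' (Strict.comp_id _) (Option.some_injective _ ?_)
  refine ((congrArg some (LaxMor.mk_comp _ _)).trans (Quintet.some_pasteH _ _)).trans ?_
  have e₁ : whL (M.T.map (𝟙 X)) (Arrow.mk i.inv) = Arrow.mk i.inv := by rw [M.T.map_id, whL_id]
  have e₂ : whR (Arrow.mk i.hom) (𝟙 X) = Arrow.mk i.hom := whR_id _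
  have k₁ := PseudoMor.mk_ofIso hS hS' i h c
  have k₂ := PseudoMor.mk_ofIso hS' hS i.symm h' c'
  refine (congrArg₂ (fun y z => pcomp (some (whL (M.T.map (𝟙 X)) y)) (some (whR z (𝟙 X)))) k₂ k₁).trans ?_
  refine (congrArg₂ (fun y z => pcomp (some y) (some z)) e₁ e₂).trans ((of_two_one (vcomp_inv_hom i)).trans ?_)
  refine congrArg some ((IsIdArrow.mk_id S.a).ext ⟨_, LaxMor.mk_id ⟨X, S⟩⟩ ?_)
  change S.a = M.T.map (𝟙 X) ≫ S.a
  rw [M.T.map_id, Strict.id_comp]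

lemma LaxMor.comp_eq_of_one {S S' : PseudoAlgStr M X} {Q Q' : PseudoAlgStr M Y} {r : LaxMor ⟨X, S⟩ ⟨X, S'⟩} {s : LaxMor ⟨Y, Q⟩ ⟨Y, Q'⟩}
    {u : LaxMor ⟨X, S⟩ ⟨Y, Q⟩} {v : LaxMor ⟨X, S'⟩ ⟨Y, Q'⟩} (hr : r.f = 𝟙 X) (hs : s.f = 𝟙 Y) (huv : u.f = v.f)
    (E : pcomp (some (Arrow.mk v.φ)) (some (whR (Arrow.mk r.φ) v.f)) = pcomp (some (whL (M.T.map u.f) (Arrow.mk s.φ))) (some (Arrow.mk u.φ))) :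
    r.comp v = u.comp s := by
  refine LaxMor.ext' ?_ (Option.some_injective _ ?_)
  · change r.f ≫ v.f = u.f ≫ s.f
    rw [hr, hs, huv, Strict.id_comp, Strict.comp_id]
  · refine ((congrArg some (LaxMor.mk_comp _ _)).trans (Quintet.some_pasteH _ _)).trans (Eq.trans ?_
      ((congrArg some (LaxMor.mk_comp _ _)).trans (Quintet.some_pasteH _ _)).symm)
    have e₁ : whL (M.T.map r.f) (Arrow.mk v.φ) = Arrow.mk v.φ := by rw [hr, M.T.map_id]; exact whL_id _
    have e₂ : whR (Arrow.mk u.φ) s.f = Arrow.mk u.φ := by rw [hs]; exact whR_id _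
    exact (congrArg (fun z => pcomp (some z) _) e₁).trans (E.trans (congrArg (fun z => pcomp _ (some z)) e₂.symm))

end

lemma PseudoMor.arr_ofIso {X : GphCat.{u}} {S S' : PseudoAlgStr pathMonad X} (e : S = S') (hS : S.IsNormal) (hS' : S'.IsNormal)
    (i : S'.a ≅ S.a) (h) (c : StrIsoCoh S S' i) (k : IsIdArrow (Arrow.mk i.hom)) :
    KArr.mk (K := (normalAlgKinds pathMonad.{u}).K₀) (src := ⟨⟨X, S⟩, hS⟩) (tgt := ⟨⟨X, S'⟩, hS'⟩) (PseudoMor.ofIso hS hS' i h c) =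
      ⟨(normalAlgKinds pathMonad.{u}).K₀.id ⟨⟨X, S⟩, hS⟩⟩ := by
  subst e
  refine congrArg KArr.mk (PseudoMor.ext' (LaxMor.ext' rfl ?_))
  exact (PseudoMor.mk_ofIso hS hS' i h c).trans (k.ext ⟨_, LaxMor.mk_id ⟨X, S⟩⟩ (congrArg (· ≫ S.a) (pathMonad.T.map_id X)).symm)

namespace NormalPseudoAlg
variable (N : NormalPseudoAlg pathMonad.{u})

lemma isIdArrow_brkIso_one : IsIdArrow (whL (pathUnit N.carrier) (Arrow.mk N.brkIso.hom)) :=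
  (congrArg (fun k => IsIdArrow (whL (pathUnit N.carrier) k)) N.mk_brkIso).mpr N.isIdArrow_brk_one

/-- The comparison of a normal pseudo algebra with left bracketed composition. -/
noncomputable def toBracket : PseudoMor N.toPseudoAlg N.dbl.alg.toPseudoAlg :=
  PseudoMor.ofIso (S := N.str) (S' := N.dbl.alg.str) N.normal N.dbl.alg.normal N.brkIso N.isIdArrow_brkIso_one N.brkIso_coh

/-- The comparison of left bracketed composition with a normal pseudo algebra. -/
noncomputable def ofBracket : PseudoMor N.dbl.alg.toPseudoAlg N.toPseudoAlg :=
  PseudoMor.ofIso (S := N.dbl.alg.str) (S' := N.str) N.dbl.alg.normal N.normal N.brkIso.symm (isIdArrow_whL_inv N.isIdArrow_brkIso_one)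
    N.brkIso_coh.symm

lemma mk_toBracket : Arrow.mk N.toBracket.φ = N.brk := (PseudoMor.mk_ofIso _ _ _ _ _).trans N.mk_brkIso

lemma mk_ofBracket : Arrow.mk N.ofBracket.φ = Arrow.mk N.brkIso.inv := PseudoMor.mk_ofIso _ _ _ _ _

end NormalPseudoAlg

section
variable {A B : NormalPseudoAlg pathMonad.{u}}

/-- The extension of the biased part of a lax morphism. -/
noncomputable abbrev LaxMor.rebracket (f : LaxMor A.toPseudoAlg B.toPseudoAlg) : LaxMor A.dbl.alg.toPseudoAlg B.dbl.alg.toPseudoAlg :=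
  LaxDbl.alg (f.biased A.normal B.normal)

/-- The extension of the biased part of a colax morphism. -/
noncomputable abbrev ColaxMor.rebracket (f : ColaxMor A.toPseudoAlg B.toPseudoAlg) : ColaxMor A.dbl.alg.toPseudoAlg B.dbl.alg.toPseudoAlg :=
  ColaxDbl.alg (f.biased A.normal B.normal)

lemma ofBracket_lax (f : LaxMor A.toPseudoAlg B.toPseudoAlg) :
    pcomp (some (Arrow.mk f.φ)) (some (whR (Arrow.mk A.ofBracket.φ) f.f)) =
      pcomp (some (whL (pathMap f.f) (Arrow.mk B.ofBracket.φ))) (some (Arrow.mk f.rebracket.φ)) := by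
  have e := brk_lax f
  rw [← A.mk_brkIso, ← B.mk_brkIso] at e
  have k₁ := two_one_whL (pathMap f.f) (vcomp_inv_hom B.brkIso)
  have k₂ := two_one_whR f.f (vcomp_hom_inv A.brkIso)
  refine (congrArg (fun z => pcomp (some (Arrow.mk f.φ)) (some (whR z f.f))) A.mk_ofBracket).trans
    ((pcomp_swap e (k₁.trans (congrArg some (whL_idc _ _))) (k₂.trans (congrArg some (whR_idc _ _)))).trans ?_)
  exact congrArg (fun z => pcomp (some (whL (pathMap f.f) z)) (some (Arrow.mk f.rebracket.φ))) B.mk_ofBracket.symm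

lemma ofBracket_colax (r : ColaxMor A.toPseudoAlg B.toPseudoAlg) :
    pcomp (some (whR (Arrow.mk A.ofBracket.φ) r.r)) (some (Arrow.mk r.rebracket.ρ)) =
      pcomp (some (Arrow.mk r.ρ)) (some (whL (pathMap r.r) (Arrow.mk B.ofBracket.φ))) := by
  have e := brk_colax r
  rw [← A.mk_brkIso, ← B.mk_brkIso] at e
  have k₁ := two_one_whL (pathMap r.r) (vcomp_hom_inv B.brkIso)
  have k₂ := two_one_whR r.r (vcomp_inv_hom A.brkIso)
  refine Eq.trans ?_ ((pcomp_swap e (k₂.trans (congrArg some (whR_idc _ _))) (k₁.trans (congrArg some (whL_idc _ _)))).symm.trans ?_)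
  · exact congrArg (fun z => pcomp (some (whR z r.r)) (some (Arrow.mk r.rebracket.ρ))) A.mk_ofBracket
  · exact congrArg (fun z => pcomp (some (Arrow.mk r.ρ)) (some (whL (pathMap r.r) z))) B.mk_ofBracket.symm

lemma toBracket_lax (f : LaxMor A.toPseudoAlg B.toPseudoAlg) :
    pcomp (some (Arrow.mk f.rebracket.φ)) (some (whR (Arrow.mk A.toBracket.φ) f.f)) =
      pcomp (some (whL (pathMap f.f) (Arrow.mk B.toBracket.φ))) (some (Arrow.mk f.φ)) :=
  (congrArg (fun z => pcomp (some (Arrow.mk f.rebracket.φ)) (some (whR z f.f))) A.mk_toBracket).trans ((brk_lax f).symm.trans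
    (congrArg (fun z => pcomp (some (whL (pathMap f.f) z)) (some (Arrow.mk f.φ))) B.mk_toBracket.symm))

lemma toBracket_colax (r : ColaxMor A.toPseudoAlg B.toPseudoAlg) :
    pcomp (some (whR (Arrow.mk A.toBracket.φ) r.r)) (some (Arrow.mk r.ρ)) =
      pcomp (some (Arrow.mk r.rebracket.ρ)) (some (whL (pathMap r.r) (Arrow.mk B.toBracket.φ))) :=
  (congrArg (fun z => pcomp (some (whR z r.r)) (some (Arrow.mk r.ρ))) A.mk_toBracket).trans ((brk_colax r).trans
    (congrArg (fun z => pcomp (some (Arrow.mk r.rebracket.ρ)) (some (whL (pathMap r.r) z))) B.mk_toBracket.symm))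

end

/-- The component of the counit on a lax morphism. -/
noncomputable def LaxMor.ofBracket {A B : NormalPseudoAlg pathMonad.{u}} (f : LaxMor A.toPseudoAlg B.toPseudoAlg) :
    Quintet (normalAlgKinds pathMonad.{u}).Q01 where
  A := A.dbl.alg
  B := A
  A' := B.dbl.alg
  B' := B
  top := A.ofBracket
  bot := B.ofBracket
  left := f.rebracket
  right := f
  cell := (eqToHom rfl : (𝟙 A.carrier ≫ f.f : A.carrier ⟶ B.carrier) ⟶ f.f ≫ 𝟙 B.carrier)
  coh := LaxCoh.of_one (S := A.dbl.alg.str) (S' := A.str) (Q := B.dbl.alg.str) (Q' := B.str) (r := A.ofBracket.toLaxMor)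
    (s := B.ofBracket.toLaxMor) (u := f.rebracket) (v := f) rfl rfl (.mk_eqToHom _) (ofBracket_lax f)

/-- The component of the counit on a colax morphism. -/
noncomputable def ColaxMor.ofBracket {A B : NormalPseudoAlg pathMonad.{u}} (f : ColaxMor A.toPseudoAlg B.toPseudoAlg) :
    Quintet (normalAlgKinds pathMonad.{u}).Q02 where
  A := A.dbl.alg
  B := A
  A' := B.dbl.alg
  B' := B
  top := A.ofBracket
  bot := B.ofBracket
  left := f.rebracket
  right := f
  cell := (eqToHom rfl : (𝟙 A.carrier ≫ f.r : A.carrier ⟶ B.carrier) ⟶ f.r ≫ 𝟙 B.carrier)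
  coh := LaxColaxCoh.of_one (S := A.dbl.alg.str) (S' := A.str) (Q := B.dbl.alg.str) (Q' := B.str) (f := A.ofBracket.toLaxMor)
    (g := B.ofBracket.toLaxMor) (r := f.rebracket) (s := f) rfl rfl (.mk_eqToHom _) (ofBracket_colax f)

/-- The inverse of the component of the counit on a lax morphism. -/
noncomputable def LaxMor.toBracket {A B : NormalPseudoAlg pathMonad.{u}} (f : LaxMor A.toPseudoAlg B.toPseudoAlg) :
    Quintet (normalAlgKinds pathMonad.{u}).Q01 where
  A := A
  B := A.dbl.alg
  A' := B
  B' := B.dbl.alg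
  top := A.toBracket
  bot := B.toBracket
  left := f
  right := f.rebracket
  cell := (eqToHom rfl : (𝟙 A.carrier ≫ f.f : A.carrier ⟶ B.carrier) ⟶ f.f ≫ 𝟙 B.carrier)
  coh := LaxCoh.of_one (S := A.str) (S' := A.dbl.alg.str) (Q := B.str) (Q' := B.dbl.alg.str) (r := A.toBracket.toLaxMor)
    (s := B.toBracket.toLaxMor) (u := f) (v := f.rebracket) rfl rfl (.mk_eqToHom _) (toBracket_lax f)

/-- The inverse of the component of the counit on a colax morphism. -/
noncomputable def ColaxMor.toBracket {A B : NormalPseudoAlg pathMonad.{u}} (f : ColaxMor A.toPseudoAlg B.toPseudoAlg) :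
    Quintet (normalAlgKinds pathMonad.{u}).Q02 where
  A := A
  B := A.dbl.alg
  A' := B
  B' := B.dbl.alg
  top := A.toBracket
  bot := B.toBracket
  left := f
  right := f.rebracket
  cell := (eqToHom rfl : (𝟙 A.carrier ≫ f.r : A.carrier ⟶ B.carrier) ⟶ f.r ≫ 𝟙 B.carrier)
  coh := LaxColaxCoh.of_one (S := A.str) (S' := A.dbl.alg.str) (Q := B.str) (Q' := B.dbl.alg.str) (f := A.toBracket.toLaxMor)
    (g := B.toBracket.toLaxMor) (r := f) (s := f.rebracket) rfl rfl (.mk_eqToHom _) (toBracket_colax f)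

/-- The extraction of the biased structure, extended by left bracketing. -/
noncomputable abbrev rebracketFunctor : TripleFunctor PsNPsa.{u} PsNPsa.{u} := biasedFunctor.comp leftBracketFunctor

lemma rebracketFunctor_forget : rebracketFunctor.{u}.comp (normalAlgKinds pathMonad.{u}).forget = (normalAlgKinds pathMonad.{u}).forget :=
  (congrArg (TripleFunctor.comp biasedFunctor) leftBracketMor.functor_forget).trans biasedMor.functor_forget

lemma ofBracket_comp {A B : NormalPseudoAlg pathMonad.{u}} (f : LaxMor A.toPseudoAlg B.toPseudoAlg) :
    A.ofBracket.toLaxMor.comp f = f.rebracket.comp B.ofBracket.toLaxMor :=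
  LaxMor.comp_eq_of_one (S := A.dbl.alg.str) (S' := A.str) (Q := B.dbl.alg.str) (Q' := B.str) rfl rfl rfl (ofBracket_lax f)

lemma toBracket_comp {A B : NormalPseudoAlg pathMonad.{u}} (f : LaxMor A.toPseudoAlg B.toPseudoAlg) :
    A.toBracket.toLaxMor.comp f.rebracket = f.comp B.toBracket.toLaxMor :=
  LaxMor.comp_eq_of_one (S := A.str) (S' := A.dbl.alg.str) (Q := B.str) (Q' := B.dbl.alg.str) rfl rfl rfl (toBracket_lax f)

/-- The components of the counit. -/
noncomputable def ofBracketUnit : OverUnit (K := normalAlgKinds pathMonad.{u}) rebracketFunctor.{u} (TripleFunctor.id PsNPsa.{u}) where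
  ob N := ⟨N.ofBracket⟩
  src _ := rfl
  tgt _ := rfl
  forget_ob _ := rfl
  a1 :=
    { q := fun f => LaxMor.ofBracket f.hom
      top := fun _ => rfl
      bot := fun _ => rfl
      left := fun _ => rfl
      right := fun _ => rfl
      forget := fun _ => Quintet.mk_congr rfl rfl rfl rfl ((IsIdArrow.mk_eqToHom _).ext (.mk_eqToHom _) rfl) }
  a2 :=
    { q := fun f => ColaxMor.ofBracket f.hom
      top := fun _ => rfl
      bot := fun _ => rfl
      left := fun _ => rfl
      right := fun _ => rfl
      forget := fun _ => Quintet.mk_congr rfl rfl rfl rfl ((IsIdArrow.mk_eqToHom _).ext (.mk_eqToHom _) rfl) }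
  nat f := congrArg KArr.mk (PseudoMor.ext' (ofBracket_comp (PseudoMor.toLaxMor f.hom)))

/-- The inverses of the components of the counit. -/
noncomputable def toBracketUnit : OverUnit (K := normalAlgKinds pathMonad.{u}) (TripleFunctor.id PsNPsa.{u}) rebracketFunctor.{u} where
  ob N := ⟨N.toBracket⟩
  src _ := rfl
  tgt _ := rfl
  forget_ob _ := rfl
  a1 :=
    { q := fun f => LaxMor.toBracket f.hom
      top := fun _ => rfl
      bot := fun _ => rfl
      left := fun _ => rfl
      right := fun _ => rfl
      forget := fun _ => Quintet.mk_congr rfl rfl rfl rfl ((IsIdArrow.mk_eqToHom _).ext (.mk_eqToHom _) rfl) }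
  a2 :=
    { q := fun f => ColaxMor.toBracket f.hom
      top := fun _ => rfl
      bot := fun _ => rfl
      left := fun _ => rfl
      right := fun _ => rfl
      forget := fun _ => Quintet.mk_congr rfl rfl rfl rfl ((IsIdArrow.mk_eqToHom _).ext (.mk_eqToHom _) rfl) }
  nat f := congrArg KArr.mk (PseudoMor.ext' (toBracket_comp (PseudoMor.toLaxMor f.hom)))

namespace OverUnit
variable {C : Type (u + 1)} [Bicategory.{u, u} C] [Strict C] {Ob Ob' : Type (u + 1)} {und : Ob → C} {und' : Ob' → C}
  {K : CellKinds und} {K' : CellKinds und'} {F G : TripleFunctor K.triple K.triple} (t : OverUnit F G)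
  (hF : F.comp K.forget = K.forget) (hG : G.comp K.forget = K.forget)
open CellKinds (forgetArr forgetQuintet)

lemma whiskerLeft_isIdentity {Z : TripleCategory.{u + 1}} (H : TripleFunctor Z K.triple) (h : H.comp F = H.comp G)
    (k : ∀ x, t.ob (H.ob x) = (KArr.cat K.K₀).ide (F.ob (H.ob x))) : ((t.transformation hF hG).whiskerLeft H).IsIdentity := by
  have k₁ : ∀ f, t.a1.q (H.a1 f) = (Quintet.catH K.Q01).ide (F.a1 (H.a1 f)) := fun f =>
    t.a1.eq_ide F.f1.dom F.f1.cod (congrFun (congrArg TripleFunctor.a1 hF)) (H.a1 f)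
      ((congrArg t.ob (H.f1.dom f)).trans ((k _).trans (congrArg (fun z => (KArr.cat K.K₀).ide (F.ob z)) (H.f1.dom f).symm)))
      ((congrArg t.ob (H.f1.cod f)).trans ((k _).trans (congrArg (fun z => (KArr.cat K.K₀).ide (F.ob z)) (H.f1.cod f).symm)))
      (congrFun (congrArg TripleFunctor.a1 h) f).symm
  have k₂ : ∀ f, t.a2.q (H.a2 f) = (Quintet.catH K.Q02).ide (F.a2 (H.a2 f)) := fun f =>
    t.a2.eq_ide F.f2.dom F.f2.cod (congrFun (congrArg TripleFunctor.a2 hF)) (H.a2 f)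
      ((congrArg t.ob (H.f2.dom f)).trans ((k _).trans (congrArg (fun z => (KArr.cat K.K₀).ide (F.ob z)) (H.f2.dom f).symm)))
      ((congrArg t.ob (H.f2.cod f)).trans ((k _).trans (congrArg (fun z => (KArr.cat K.K₀).ide (F.ob z)) (H.f2.cod f).symm)))
      (congrFun (congrArg TripleFunctor.a2 h) f).symm
  refine ⟨k, k₁, k₂, fun ω => QCube.ext ?_ ?_ ?_ ?_ rfl (congrFun (congrArg TripleFunctor.s12 h) ω).symm⟩
  · exact (congrArg t.a1.q (H.f12_2.dom ω)).trans ((k₁ _).trans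
      (congrArg (Quintet.catH K.Q01).ide ((congrArg F.a1 (H.f12_2.dom ω).symm).trans (F.f12_2.dom _).symm)))
  · exact (congrArg t.a1.q (H.f12_2.cod ω)).trans ((k₁ _).trans
      (congrArg (Quintet.catH K.Q01).ide ((congrArg F.a1 (H.f12_2.cod ω).symm).trans (F.f12_2.cod _).symm)))
  · exact (congrArg t.a2.q (H.f12_1.dom ω)).trans ((k₂ _).trans
      (congrArg (Quintet.catH K.Q02).ide ((congrArg F.a2 (H.f12_1.dom ω).symm).trans (F.f12_1.dom _).symm)))
  · exact (congrArg t.a2.q (H.f12_1.cod ω)).trans ((k₂ _).trans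
      (congrArg (Quintet.catH K.Q02).ide ((congrArg F.a2 (H.f12_1.cod ω).symm).trans (F.f12_1.cod _).symm)))

lemma whiskerRight_isIdentity (H : TripleFunctor K.triple K'.triple) (hH : H.comp K'.forget = K.forget) (h : F.comp H = G.comp H)
    (k : ∀ x, H.a0 (t.ob x) = (KArr.cat K'.K₀).ide (H.ob (F.ob x))) : ((t.transformation hF hG).whiskerRight H).IsIdentity := by
  have k₁ : ∀ f, H.s01 (t.a1.q f) = (Quintet.catH K'.Q01).ide (H.a1 (F.a1 f)) := fun f =>
    Quintet.eq_of_forget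
      ((H.f01_1.dom _).trans ((congrArg H.a0 (t.a1.top f)).trans ((k _).trans (congrArg (KArr.cat K'.K₀).ide
        ((congrArg H.ob (F.f1.dom f).symm).trans (H.f1.dom _).symm)))))
      ((H.f01_1.cod _).trans ((congrArg H.a0 (t.a1.bot f)).trans ((k _).trans (congrArg (KArr.cat K'.K₀).ide
        ((congrArg H.ob (F.f1.cod f).symm).trans (H.f1.cod _).symm)))))
      ((H.f01_0.dom _).trans (congrArg H.a1 (t.a1.left f)))
      ((H.f01_0.cod _).trans ((congrArg H.a1 (t.a1.right f)).trans (congrFun (congrArg TripleFunctor.a1 h) f).symm))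
      ((congrFun (congrArg TripleFunctor.s01 hH) _).trans ((t.a1.forget f).trans
        ((congrArg (Quintet.catH _).ide ((congrFun (congrArg TripleFunctor.a1 hH) (F.a1 f)).trans
          (congrFun (congrArg TripleFunctor.a1 hF) f)).symm).trans ((CellKinds.isFun_forgetH K'.Q01).ide _).symm)))
  have k₂ : ∀ f, H.s02 (t.a2.q f) = (Quintet.catH K'.Q02).ide (H.a2 (F.a2 f)) := fun f =>
    Quintet.eq_of_forget
      ((H.f02_2.dom _).trans ((congrArg H.a0 (t.a2.top f)).trans ((k _).trans (congrArg (KArr.cat K'.K₀).ide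
        ((congrArg H.ob (F.f2.dom f).symm).trans (H.f2.dom _).symm)))))
      ((H.f02_2.cod _).trans ((congrArg H.a0 (t.a2.bot f)).trans ((k _).trans (congrArg (KArr.cat K'.K₀).ide
        ((congrArg H.ob (F.f2.cod f).symm).trans (H.f2.cod _).symm)))))
      ((H.f02_0.dom _).trans (congrArg H.a2 (t.a2.left f)))
      ((H.f02_0.cod _).trans ((congrArg H.a2 (t.a2.right f)).trans (congrFun (congrArg TripleFunctor.a2 h) f).symm))
      ((congrFun (congrArg TripleFunctor.s02 hH) _).trans ((t.a2.forget f).trans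
        ((congrArg (Quintet.catH _).ide ((congrFun (congrArg TripleFunctor.a2 hH) (F.a2 f)).trans
          (congrFun (congrArg TripleFunctor.a2 hF) f)).symm).trans ((CellKinds.isFun_forgetH K'.Q02).ide _).symm)))
  refine ⟨k, k₁, k₂, fun ω => QCube.ext ?_ ?_ ?_ ?_ (H.fq0.dom _) ((H.fq0.cod _).trans (congrFun (congrArg TripleFunctor.s12 h) ω).symm)⟩
  · exact (H.fq2.dom _).trans ((k₁ _).trans (congrArg (Quintet.catH K'.Q01).ide
      ((congrArg H.a1 (F.f12_2.dom ω).symm).trans (H.f12_2.dom _).symm)))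
  · exact (H.fq2.cod _).trans ((k₁ _).trans (congrArg (Quintet.catH K'.Q01).ide
      ((congrArg H.a1 (F.f12_2.cod ω).symm).trans (H.f12_2.cod _).symm)))
  · exact (H.fq1.dom _).trans ((k₂ _).trans (congrArg (Quintet.catH K'.Q02).ide
      ((congrArg H.a2 (F.f12_1.dom ω).symm).trans (H.f12_1.dom _).symm)))
  · exact (H.fq1.cod _).trans ((k₂ _).trans (congrArg (Quintet.catH K'.Q02).ide
      ((congrArg H.a2 (F.f12_1.cod ω).symm).trans (H.f12_1.cod _).symm)))

end OverUnit

lemma IsIdArrow.of_iso_hom {K : Type*} [Category K] {a b : K} {i : a ≅ b} (h : IsIdArrow (Arrow.mk i.hom)) : IsIdArrow (Arrow.mk i.inv) := by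
  have k := of_two_one (vcomp_hom_inv i)
  rw [h.pcomp_left rfl] at k
  exact Option.some_injective _ k ▸ IsIdArrow.mk_id a

namespace NormalPseudoAlg
variable (N : NormalPseudoAlg pathMonad.{u})

lemma isIdArrow_kap_map_one (p : Path N.carrier) : IsIdArrow (N.str.kap ((pathMap (pathUnit N.carrier)).F₁.obj p)) :=
  ⟨_, N.normal.kap_units p⟩

lemma isIdArrow_strDbl_unit (x : N.carrier.A₀) : IsIdArrow (Arrow.mk (N.strDbl.unit x)) :=
  (LaxMor.mk_biased_unit (pathMonad.free_isNormal _) N.normal (N.toPseudoAlg.strMor N.normal).toLaxMor x) ▸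
    N.isIdArrow_kap_map_one (nilPath x)

lemma mk_strDbl_mult (p q : Path N.carrier) (h) : Arrow.mk (N.strDbl.mult p q h) = N.str.kap (pairPath (A := pathGph N.carrier) p q h) :=
  LaxMor.mk_biased_mult (pathMonad.free_isNormal _) N.normal (N.toPseudoAlg.strMor N.normal).toLaxMor p q h

lemma isIdArrow_ap_brk_nil (x : N.carrier.A₀) : IsIdArrow (ap N.brk (nilPath x)) := N.isIdArrow_strDbl_unit x

lemma isIdArrow_ap_brk_pair (u v : N.carrier.A₁) (h) : IsIdArrow (ap N.brk (pairPath u v h)) := by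
  have e := (N.strDbl.ap_ec_pair (onePath u) (onePath v) h).trans (N.mk_strDbl_mult _ _ _)
  have k := N.isIdArrow_kap_map_one (pairPath u v h)
  exact e ▸ k

lemma isIdArrow_ap_ofBracket {p : Path N.carrier} (h : IsIdArrow (ap N.brk p)) : IsIdArrow (ap (Arrow.mk N.ofBracket.φ) p) := by
  rw [← N.mk_brkIso] at h
  rw [N.mk_ofBracket]
  exact IsIdArrow.of_iso_hom (i := (⟨N.brkIso.hom.φ₁.app p, N.brkIso.inv.φ₁.app p,
    congrArg (fun α => (GphCat.Hom₂.φ₁ α).app p) N.brkIso.hom_inv_id,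
    congrArg (fun α => (GphCat.Hom₂.φ₁ α).app p) N.brkIso.inv_hom_id⟩ : N.dbl.alg.str.a.F₁.obj p ≅ N.str.a.F₁.obj p)) h

end NormalPseudoAlg

lemma WDbl.isIdArrow_brk_alg (D : WDbl.{u}) : IsIdArrow D.alg.brk := by
  refine isIdArrow_of_ap (fun x => .mk_id _) fun p => ?_
  obtain ⟨x, l, ch⟩ := p
  cases l with
  | nil => exact D.alg.isIdArrow_ap_brk_nil x
  | cons u l =>
    refine D.alg.strDbl.isIdArrow_lx (fun p => GPath.edges p ≠ []) (fun p => ∃ v, p = onePath v) (fun p q h hp _ => ?_)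
      (fun p q h hp hq => ?_) _ _ _ _ _ _ (.mk_id _) (List.cons_ne_nil _ _) fun q hq => ?_
    · exact fun e => hp (List.append_eq_nil_iff.1 ((freeDbl_comp_edges p q h).symm.trans e)).1
    · obtain ⟨v, rfl⟩ := hq
      exact (D.alg.mk_strDbl_mult p (onePath v) h) ▸ D.kap_snoc p v h hp
    · obtain ⟨v, -, rfl⟩ := List.mem_map.1 hq
      exact ⟨v, rfl⟩

/-- The counit of the adjoint equivalence. -/
noncomputable def bracketCounit : TransversalTransformation rebracketFunctor.{u} (TripleFunctor.id PsNPsa.{u}) :=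
  ofBracketUnit.transformation rebracketFunctor_forget rfl

lemma isInvertible_bracketCounit : bracketCounit.{u}.IsInvertible :=
  ofBracketUnit.isInvertible toBracketUnit rebracketFunctor_forget rfl
    (fun N => congrArg KArr.mk (PseudoMor.ext' (PseudoMor.ofIso_comp_symm (S := N.dbl.alg.str) (S' := N.str) N.dbl.alg.normal N.normal N.brkIso.symm
      (isIdArrow_whL_inv N.isIdArrow_brkIso_one) N.isIdArrow_brkIso_one N.brkIso_coh.symm N.brkIso_coh)))
    (fun N => congrArg KArr.mk (PseudoMor.ext' (PseudoMor.ofIso_comp_symm (S := N.str) (S' := N.dbl.alg.str) N.normal N.dbl.alg.normal N.brkIso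
      N.isIdArrow_brkIso_one (isIdArrow_whL_inv N.isIdArrow_brkIso_one) N.brkIso_coh N.brkIso_coh.symm)))

lemma WDbl.alg_str_congr {A : GphCat.{u}} {S S' : WDblStr A} (h : S = S') :
    @Eq (PseudoAlgStr pathMonad A) (WDbl.alg ⟨A, S⟩).str (WDbl.alg ⟨A, S'⟩).str := by
  subst h
  rfl

lemma WDbl.alg_dbl_alg_str (D : WDbl.{u}) : @Eq (PseudoAlgStr pathMonad D.graph) D.alg.dbl.alg.str D.alg.str :=
  alg_str_congr D.alg_dbl_str

lemma whiskerLeft_bracketCounit : (bracketCounit.{u}.whiskerLeft leftBracketFunctor).IsIdentity := by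
  refine ofBracketUnit.whiskerLeft_isIdentity _ _ _ ?_ fun D => ?_
  · exact congrArg (fun H => TripleFunctor.comp H leftBracketFunctor) leftBracketFunctor_comp_biasedFunctor
  · refine PseudoMor.arr_ofIso (X := D.graph) (S := D.alg.dbl.alg.str) (S' := D.alg.str) D.alg_dbl_alg_str _ _ _ _ _ ?_
    exact IsIdArrow.of_iso_hom (i := D.alg.brkIso) (D.alg.mk_brkIso ▸ D.isIdArrow_brk_alg)

lemma whiskerRight_bracketCounit : (bracketCounit.{u}.whiskerRight biasedFunctor).IsIdentity := by
  refine ofBracketUnit.whiskerRight_isIdentity _ _ _ biasedMor.functor_forget ?_ fun N => ?_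
  · exact congrArg (TripleFunctor.comp biasedFunctor) leftBracketFunctor_comp_biasedFunctor
  · have e := fun a => N.ofBracket.toLaxMor.mk_biased_unit N.dbl.alg.normal N.normal a
    have k := fun u v h => N.ofBracket.toLaxMor.mk_biased_mult N.dbl.alg.normal N.normal u v h
    exact PseudoDbl.arr_eq rfl N.dbl.alg_dbl_str.symm (x := N.ofBracket.biased N.dbl.alg.normal N.normal) (y := PseudoDbl.id N.dbl.alg.dbl) rfl
      (fun a => ((e a).symm ▸ N.isIdArrow_ap_ofBracket (N.isIdArrow_ap_brk_nil a) : IsIdArrow _).ext (.mk_id _) rfl)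
      (fun u v h => ((k u v h).symm ▸ N.isIdArrow_ap_ofBracket (N.isIdArrow_ap_brk_pair u v h) : IsIdArrow _).ext (.mk_id _) rfl)

end TripleCat

theorem theorem5p8 :
    ∃ (V : TripleFunctor TripleCat.PsNPsa.{u} TripleCat.PsDbl.{u})
      (J : TripleFunctor TripleCat.PsDbl.{u} TripleCat.PsNPsa.{u})
      (ε : TransversalTransformation (V.comp J) (TripleFunctor.id TripleCat.PsNPsa.{u})),
      TripleCat.IsBiasedExtraction V ∧ TripleCat.IsLeftBracketExtension J ∧
      J.comp V = TripleFunctor.id TripleCat.PsDbl.{u} ∧ ε.IsInvertible ∧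
      (ε.whiskerRight V).IsIdentity ∧ (ε.whiskerLeft J).IsIdentity := ⟨TripleCat.biasedFunctor, TripleCat.leftBracketFunctor, TripleCat.bracketCounit, TripleCat.isBiasedExtraction_biasedFunctor,
    TripleCat.isLeftBracketExtension_leftBracketFunctor, TripleCat.leftBracketFunctor_comp_biasedFunctor,
    TripleCat.isInvertible_bracketCounit, TripleCat.whiskerRight_bracketCounit, TripleCat.whiskerLeft_bracketCounit⟩
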